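/- **Theories.** Let $S$ be a dependent type theory: a calculus with the judgement forms $\Gamma\vdash A\ \mathsf{type}$, $\Gamma\vdash A=B\ \mathsf{type}$, $\Gamma\vdash a:A$ and $\Gamma\vdash a=b:A$ over a raw syntax generated by variables, the identity-type constructors $\mathsf{Id}_A(a,b)$, $r(a)$, $J$ and arbitrary further type and term formers with variable binding. Suppose that its derivable judgements are closed under * the structural rules: variables, substitution along context morphisms (including weakening, exchange and contraction), equality being an equivalence relation respected by substitution, conversion, and the presuppositions of judgements; * the identity-type rules: formation, introduction, the elimination rule with postcontext (from $x,y:A,\ p:\mathsf{Id}_A(x,y),\ \Delta(x,y,p)\vdash C(x,y,p)\ \mathsf{type}$ and $x:A,\ \Delta(x,x,r(x))\vdash d(x):C(x,x,r(x))$ infer $x,y:A,\ p:\mathsf{Id}_A(x,y),\ \Delta\vdash J_d(x,y,p):C(x,y,p)$), the computation rule $J_d(x,x,r(x))=d(x)$, and compatibility of these constructors with equality; * the discrete identity rule: if $p,q:\mathsf{Id}_A(a,b)$ and $s:\mathsf{Id}_{\mathsf{Id}_A(a,b)}(p,q)$ then $p=q:\mathsf{Id}_A(a,b)$. All syntax is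 taken modulo $\alpha$-equivalence and derivable equality. **Identity contexts.** For a context $\Phi$, the identity contexts $\mathsf{Id}_\Phi(\vec a,\vec b)$, with $r(\vec a)=(r(a_i))_i$ and an elimination rule, are defined by induction: $\mathsf{Id}_{()}=()$ and $\mathsf{Id}_{(\Lambda,D)}((\vec a,a'),(\vec b,b'))=(\vec p:\mathsf{Id}_\Lambda(\vec a,\vec b),\ q:\mathsf{Id}_{D(\vec a)}(a',\vec p^{\,*}b'))$, where $\vec p^{\,*}:D(\vec b)\to D(\vec a)$ is defined by elimination with $r(\vec x)^*z=z$. Elimination for $\mathsf{Id}_{(\Lambda,D)}$ is elimination for $\mathsf{Id}_\Lambda$ applied to a family obtained by elimination for $\mathsf{Id}_{D(\vec x)}$. Elimination also defines a composition $q\circ p$ with $r(\vec y)\circ p=p$ and, for $f:\Gamma\to\Delta$, an action $f^\bullet:\mathsf{Id}_\Gamma(\vec a,\vec b)\to\mathsf{Id}_\Delta(f\vec a,f\vec b)$ with $f^\bullet(r(\vec x))=r(f\vec x)$. **The 2-category $\mathfrak C_S$.** Objects are contexts; 1-cells $f:\Gamma\to\Delta$ are judgements $\vec x:\Gamma\vdash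 f(\vec x):\Delta$; 2-cells $f\Rightarrow g$ are judgements $\vec x:\Gamma\vdash\alpha(\vec x):\mathsf{Id}_\Delta(f\vec x,g\vec x)$. The 1-cells compose by substitution. Identity 2-cells are $r(f\vec x)$, the vertical composite of $\alpha$ and $\beta$ is $\beta(\vec x)\circ\alpha(\vec x)$, and whiskering is given by $\alpha(f\vec x)$ on the source side and $h^\bullet(\alpha(\vec x))$ on the target side. **The 2-category $\mathfrak T_S$.** Objects are pairs $(\Gamma,A)$ with $\vec x:\Gamma\vdash A(\vec x)\ \mathsf{type}$; 1-cells $(\Gamma,A)\to(\Delta,B)$ are pairs $(f,g)$ with $f:\Gamma\to\Delta$ and $\vec x:\Gamma,y:A(\vec x)\vdash g(\vec x,y):B(f\vec x)$; 2-cells $(f,g)\Rightarrow(f',g')$ are pairs $(\alpha,\beta)$ with $\vec x:\Gamma\vdash\alpha(\vec x):\mathsf{Id}_\Delta(f\vec x,f'\vec x)$ and $\vec x:\Gamma,y:A(\vec x)\vdash\beta(\vec x,y):\mathsf{Id}_{B(f\vec x)}(g(\vec x,y),\alpha(\vec x)^*g'(\vec x,y))$. The 2-cells compose as the corresponding pairs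 of 2-cells $f\Rightarrow f'$ and $(f,g)\Rightarrow(f',g'):\Gamma.A\to\Delta.B$ of $\mathfrak C_S$. **Proposition.** These are (strict) 2-categories, and $(\Gamma,A)\mapsto\Gamma$, $(f,g)\mapsto f$, $(\alpha,\beta)\mapsto\alpha$ defines a 2-functor $p:\mathfrak T_S\to\mathfrak C_S$ which is a globally split 2-fibration; that is: 1. The underlying functor of $p$ is a split fibration. The chosen cartesian lifting of $f:\Gamma\to\Delta$ at $(\Delta,B)$ is $(\Gamma,f^*B)\to(\Delta,B)$, given by $f$ and $\vec x:\Gamma,y:B(f\vec x)\vdash y:B(f\vec x)$, where $f^*B$ is $\vec x:\Gamma\vdash B(f\vec x)\ \mathsf{type}$. 2. Every cartesian 1-cell $f:y\to z$ of $\mathfrak T_S$ has the two-dimensional universal property: for each 2-cell $\alpha:g\Rightarrow h:x\to z$ and each $\gamma:k\Rightarrow l:p(x)\to p(y)$ with $p(\alpha)=p(f)\gamma$, there are unique $k',l':x\to y$ and $\gamma':k'\Rightarrow l'$ with $f\gamma'=\alpha$ and $p(\gamma')=\gamma$. 3. For all $x,y$ the functor $p_{x,y}:\mathfrak T_S(x,y)\to\mathfrak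 C_S(px,py)$ is a fibration. 4. For each $f:x\to y$ and each $z$, the functor $(-)\cdot f:\mathfrak T_S(y,z)\to\mathfrak T_S(x,z)$ preserves cartesian 2-cells. -/

import Mathlib

open CategoryTheory

universe u

namespace DTT

/-! ## Raw syntax

Expressions of a dependently typed calculus, up to `α`-equivalence: well-scoped expressions over
`n` variables.  Variables are numbered from left to right, so that the variable declared last is
`Fin.last`. -/

/-- The two syntactic kinds: types and terms. -/
inductive Kind
  | ty
  | tm

/-- A binding signature: the type formers and term formers which a calculus may possess in addition
to its identity types.  The argument `i` of the operator `o` binds `bind o i` variables. -/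
structure Signature where
  Op : Type u
  kind : Op → Kind
  arity : Op → ℕ
  argKind : ∀ o, Fin (arity o) → Kind
  bind : ∀ o, Fin (arity o) → ℕ

/-- Raw expressions.  `id A a b` is `Id_A(a, b)`; `refl a` is `r(a)`; and `J m C d a b p e` is the
eliminator `J_d(a, b, p)` for the motive `C` over `x, y, p` followed by a postcontext of length `m`,
which is instantiated by `e`. -/
inductive Expr (σ : Signature.{u}) : Kind → ℕ → Type u
  | var {n : ℕ} (i : Fin n) : Expr σ .tm n
  | op {n : ℕ} (o : σ.Op) (args : ∀ i : Fin (σ.arity o), Expr σ (σ.argKind o i) (n + σ.bind o i)) :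
      Expr σ (σ.kind o) n
  | id {n : ℕ} (A : Expr σ .ty n) (a b : Expr σ .tm n) : Expr σ .ty n
  | refl {n : ℕ} (a : Expr σ .tm n) : Expr σ .tm n
  | J {n : ℕ} (m : ℕ) (C : Expr σ .ty (n + 3 + m)) (d : Expr σ .tm (n + 1 + m))
      (a b p : Expr σ .tm n) (e : Fin m → Expr σ .tm n) : Expr σ .tm n

abbrev Ty (σ : Signature.{u}) (n : ℕ) := Expr σ .ty n
abbrev Tm (σ : Signature.{u}) (n : ℕ) := Expr σ .tm n

/-- `(f, a)`: a vector extended by one last entry. -/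
abbrev ext {α : Type*} {k : ℕ} (f : Fin k → α) (a : α) : Fin (k + 1) → α :=
  Fin.snoc (α := fun _ => α) f a

/-- A vector without its last entry. -/
abbrev pre {α : Type*} {k : ℕ} (f : Fin (k + 1) → α) : Fin k → α := fun i => f i.castSucc

/-- A vector's last entry. -/
abbrev lst {α : Type*} {k : ℕ} (f : Fin (k + 1) → α) : α := f (Fin.last k)

namespace Expr

variable {σ : Signature.{u}}

/-- A renaming pushed under `k` binders. -/
def liftRen {n m : ℕ} (k : ℕ) (ρ : Fin n → Fin m) : Fin (n + k) → Fin (m + k) :=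
  Fin.append (fun i => Fin.castAdd k (ρ i)) (Fin.natAdd m)

def rename : {K : Kind} → {n m : ℕ} → Expr σ K n → (Fin n → Fin m) → Expr σ K m
  | _, _, _, var i, ρ => var (ρ i)
  | _, _, _, op o args, ρ => op o fun i => (args i).rename (liftRen _ ρ)
  | _, _, _, id A a b, ρ => id (A.rename ρ) (a.rename ρ) (b.rename ρ)
  | _, _, _, refl a, ρ => refl (a.rename ρ)
  | _, _, _, J m C d a b p e, ρ =>
      J m (C.rename (liftRen m (liftRen 3 ρ))) (d.rename (liftRen m (liftRen 1 ρ)))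
        (a.rename ρ) (b.rename ρ) (p.rename ρ) fun i => (e i).rename ρ

/-- A substitution pushed under `k` binders. -/
def liftSub {n m : ℕ} (k : ℕ) (s : Fin n → Tm σ m) : Fin (n + k) → Tm σ (m + k) :=
  Fin.append (fun i => (s i).rename (Fin.castAdd k)) fun j => var (Fin.natAdd m j)

/-- Simultaneous (capture-avoiding) substitution. -/
def subst : {K : Kind} → {n m : ℕ} → Expr σ K n → (Fin n → Tm σ m) → Expr σ K m
  | _, _, _, var i, s => s i
  | _, _, _, op o args, s => op o fun i => (args i).subst (liftSub _ s)
  | _, _, _, id A a b, s => id (A.subst s) (a.subst s) (b.subst s)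
  | _, _, _, refl a, s => refl (a.subst s)
  | _, _, _, J m C d a b p e, s =>
      J m (C.subst (liftSub m (liftSub 3 s))) (d.subst (liftSub m (liftSub 1 s)))
        (a.subst s) (b.subst s) (p.subst s) fun i => (e i).subst s

/-- Weakening by `k` fresh variables, declared last. -/
abbrev wk {K : Kind} {n : ℕ} (k : ℕ) (t : Expr σ K n) : Expr σ K (n + k) :=
  t.rename (Fin.castAdd k)

end Expr

open DTT.Expr

/-- Raw contexts of length `n`. -/
inductive Ctx (σ : Signature.{u}) : ℕ → Type u
  | nil : Ctx σ 0
  | snoc {n : ℕ} (Γ : Ctx σ n) (A : Ty σ n) : Ctx σ (n + 1)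

/-- Raw dependent contexts (telescopes) of length `k` over `n` variables. -/
inductive Tel (σ : Signature.{u}) (n : ℕ) : ℕ → Type u
  | nil : Tel σ n 0
  | snoc {k : ℕ} (Θ : Tel σ n k) (A : Ty σ (n + k)) : Tel σ n (k + 1)

variable {σ : Signature.{u}}

/-- The type of the variable `i`, as a type over the whole context. -/
def Ctx.get : {n : ℕ} → Ctx σ n → Fin n → Ty σ n
  | _, .nil => fun i => i.elim0
  | _, .snoc Γ A => ext (fun i => (Γ.get i).wk 1) (A.wk 1)

/-- The context `Γ, Θ`. -/
def Ctx.append {n : ℕ} (Γ : Ctx σ n) : {k : ℕ} → Tel σ n k → Ctx σ (n + k)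
  | _, .nil => Γ
  | _, .snoc Θ A => (Γ.append Θ).snoc A

def Tel.subst {n m : ℕ} (s : Fin n → Tm σ m) : {k : ℕ} → Tel σ n k → Tel σ m k
  | _, .nil => .nil
  | k + 1, .snoc Θ A => .snoc (Θ.subst s) (A.subst (liftSub k s))

/-- The context `Γ, x : A, y : A, p : Id_A(x, y)`. -/
def Ctx.idCtx {n : ℕ} (Γ : Ctx σ n) (A : Ty σ n) : Ctx σ (n + 3) :=
  ((Γ.snoc A).snoc (A.wk 1)).snoc
    (.id (A.wk 2) (.var (Fin.natAdd n (0 : Fin 2))) (.var (Fin.natAdd n (1 : Fin 2))))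

/-- The substitution `[x, x, r(x) / x, y, p]`. -/
def diag (n : ℕ) : Fin (n + 3) → Tm σ (n + 1) :=
  Fin.append (fun i => .var (Fin.castAdd 1 i))
    ![.var (Fin.last n), .var (Fin.last n), .refl (.var (Fin.last n))]

/-! ## Calculi and their rules -/

/-- A dependently typed calculus over the raw syntax: its derivable judgements, of the forms
`Γ ⊢ A type`, `Γ ⊢ A = B type`, `Γ ⊢ a : A` and `Γ ⊢ a = b : A`. -/
structure Calculus (σ : Signature.{u}) where
  IsType : {n : ℕ} → Ctx σ n → Ty σ n → Prop
  TyEq : {n : ℕ} → Ctx σ n → Ty σ n → Ty σ n → Prop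
  IsTerm : {n : ℕ} → Ctx σ n → Tm σ n → Ty σ n → Prop
  TmEq : {n : ℕ} → Ctx σ n → Tm σ n → Tm σ n → Ty σ n → Prop

namespace Calculus

variable (S : Calculus σ)

/-- `Γ ctxt` -/
def IsCtx : {n : ℕ} → Ctx σ n → Prop
  | _, .nil => True
  | _, .snoc Γ A => IsCtx Γ ∧ S.IsType Γ A

/-- `Γ = Δ ctxt` -/
def CtxEq : {n : ℕ} → Ctx σ n → Ctx σ n → Prop
  | _, .nil, .nil => True
  | _, .snoc Γ A, .snoc Δ B => CtxEq Γ Δ ∧ S.TyEq Γ A B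

/-- `Γ ⊢ f : Δ`, for a closed context `Δ` -/
def IsMor {n : ℕ} (Γ : Ctx σ n) : {m : ℕ} → Ctx σ m → (Fin m → Tm σ n) → Prop
  | _, .nil, _ => True
  | _, .snoc Δ A, f => IsMor Γ Δ (pre f) ∧ S.IsTerm Γ (lst f) (A.subst (pre f))

/-- `Γ ⊢ f = g : Δ`, for a closed context `Δ` -/
def MorEq {n : ℕ} (Γ : Ctx σ n) : {m : ℕ} → Ctx σ m → (f g : Fin m → Tm σ n) → Prop
  | _, .nil, _, _ => True
  | _, .snoc Δ A, f, g =>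
      MorEq Γ Δ (pre f) (pre g) ∧ S.TmEq Γ (lst f) (lst g) (A.subst (pre f))

/-- `Γ ⊢ a : Θ`, for a context `Θ` dependent on `Γ` -/
def IsEl {n : ℕ} (Γ : Ctx σ n) : {k : ℕ} → Tel σ n k → (Fin k → Tm σ n) → Prop
  | _, .nil, _ => True
  | _, .snoc Θ A, a =>
      IsEl Γ Θ (pre a) ∧ S.IsTerm Γ (lst a) (A.subst (Fin.append .var (pre a)))

/-- `Γ ⊢ a = b : Θ`, for a context `Θ` dependent on `Γ` -/
def ElEq {n : ℕ} (Γ : Ctx σ n) : {k : ℕ} → Tel σ n k → (a b : Fin k → Tm σ n) → Prop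
  | _, .nil, _, _ => True
  | _, .snoc Θ A, a, b =>
      ElEq Γ Θ (pre a) (pre b) ∧ S.TmEq Γ (lst a) (lst b) (A.subst (Fin.append .var (pre a)))

/-- The structural rules, including the presuppositions of the judgements.  Substitution is along
arbitrary context morphisms, so that it comprises weakening, exchange and contraction. -/
structure StructuralRules : Prop where
  isType_ctx {n : ℕ} {Γ : Ctx σ n} {A} : S.IsType Γ A → S.IsCtx Γ
  tyEq_left {n : ℕ} {Γ : Ctx σ n} {A B} : S.TyEq Γ A B → S.IsType Γ A
  tyEq_right {n : ℕ} {Γ : Ctx σ n} {A B} : S.TyEq Γ A B → S.IsType Γ B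
  isTerm_type {n : ℕ} {Γ : Ctx σ n} {a A} : S.IsTerm Γ a A → S.IsType Γ A
  tmEq_left {n : ℕ} {Γ : Ctx σ n} {a b A} : S.TmEq Γ a b A → S.IsTerm Γ a A
  tmEq_right {n : ℕ} {Γ : Ctx σ n} {a b A} : S.TmEq Γ a b A → S.IsTerm Γ b A
  var {n : ℕ} {Γ : Ctx σ n} (i : Fin n) : S.IsCtx Γ → S.IsTerm Γ (.var i) (Γ.get i)
  tyEq_refl {n : ℕ} {Γ : Ctx σ n} {A} : S.IsType Γ A → S.TyEq Γ A A
  tyEq_symm {n : ℕ} {Γ : Ctx σ n} {A B} : S.TyEq Γ A B → S.TyEq Γ B A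
  tyEq_trans {n : ℕ} {Γ : Ctx σ n} {A B C} : S.TyEq Γ A B → S.TyEq Γ B C → S.TyEq Γ A C
  tmEq_refl {n : ℕ} {Γ : Ctx σ n} {a A} : S.IsTerm Γ a A → S.TmEq Γ a a A
  tmEq_symm {n : ℕ} {Γ : Ctx σ n} {a b A} : S.TmEq Γ a b A → S.TmEq Γ b a A
  tmEq_trans {n : ℕ} {Γ : Ctx σ n} {a b c A} :
    S.TmEq Γ a b A → S.TmEq Γ b c A → S.TmEq Γ a c A
  isTerm_conv {n : ℕ} {Γ : Ctx σ n} {a A B} : S.IsTerm Γ a A → S.TyEq Γ A B → S.IsTerm Γ a B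
  tmEq_conv {n : ℕ} {Γ : Ctx σ n} {a b A B} : S.TmEq Γ a b A → S.TyEq Γ A B → S.TmEq Γ a b B
  isType_subst {n m : ℕ} {Γ : Ctx σ n} {Δ : Ctx σ m} {f A} :
    S.IsCtx Γ → S.IsMor Γ Δ f → S.IsType Δ A → S.IsType Γ (A.subst f)
  tyEq_subst {n m : ℕ} {Γ : Ctx σ n} {Δ : Ctx σ m} {f A B} :
    S.IsCtx Γ → S.IsMor Γ Δ f → S.TyEq Δ A B → S.TyEq Γ (A.subst f) (B.subst f)
  isTerm_subst {n m : ℕ} {Γ : Ctx σ n} {Δ : Ctx σ m} {f a A} :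
    S.IsCtx Γ → S.IsMor Γ Δ f → S.IsTerm Δ a A → S.IsTerm Γ (a.subst f) (A.subst f)
  tmEq_subst {n m : ℕ} {Γ : Ctx σ n} {Δ : Ctx σ m} {f a b A} :
    S.IsCtx Γ → S.IsMor Γ Δ f → S.TmEq Δ a b A → S.TmEq Γ (a.subst f) (b.subst f) (A.subst f)
  isType_substEq {n m : ℕ} {Γ : Ctx σ n} {Δ : Ctx σ m} {f g A} :
    S.IsCtx Γ → S.MorEq Γ Δ f g → S.IsType Δ A → S.TyEq Γ (A.subst f) (A.subst g)
  isTerm_substEq {n m : ℕ} {Γ : Ctx σ n} {Δ : Ctx σ m} {f g a A} :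
    S.IsCtx Γ → S.MorEq Γ Δ f g → S.IsTerm Δ a A →
      S.TmEq Γ (a.subst f) (a.subst g) (A.subst f)

/-- The rules for identity types: formation, introduction, elimination (with a postcontext `Δ`) and
computation; and the compatibility of the three constructors with definitional equality. -/
structure IdentityRules : Prop where
  form {n : ℕ} {Γ : Ctx σ n} {A a b} :
    S.IsTerm Γ a A → S.IsTerm Γ b A → S.IsType Γ (.id A a b)
  intro {n : ℕ} {Γ : Ctx σ n} {A a} : S.IsTerm Γ a A → S.IsTerm Γ (.refl a) (.id A a a)
  elim {n m : ℕ} {Γ : Ctx σ n} {A} {Δ : Tel σ (n + 3) m} {C d a b p e} :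
    S.IsType ((Γ.idCtx A).append Δ) C →
    S.IsTerm ((Γ.snoc A).append (Δ.subst (diag n))) d (C.subst (liftSub m (diag n))) →
    S.IsTerm Γ a A → S.IsTerm Γ b A → S.IsTerm Γ p (.id A a b) →
    S.IsEl Γ (Δ.subst (Fin.append .var ![a, b, p])) e →
    S.IsTerm Γ (.J m C d a b p e) (C.subst (Fin.append (Fin.append .var ![a, b, p]) e))
  comp {n m : ℕ} {Γ : Ctx σ n} {A} {Δ : Tel σ (n + 3) m} {C d a e} :
    S.IsType ((Γ.idCtx A).append Δ) C →
    S.IsTerm ((Γ.snoc A).append (Δ.subst (diag n))) d (C.subst (liftSub m (diag n))) →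
    S.IsTerm Γ a A →
    S.IsEl Γ (Δ.subst (Fin.append .var ![a, a, .refl a])) e →
    S.TmEq Γ (.J m C d a a (.refl a) e) (d.subst (Fin.append (Fin.append .var ![a]) e))
      (C.subst (Fin.append (Fin.append .var ![a, a, .refl a]) e))
  form_eq {n : ℕ} {Γ : Ctx σ n} {A A' a a' b b'} :
    S.TyEq Γ A A' → S.TmEq Γ a a' A → S.TmEq Γ b b' A → S.TyEq Γ (.id A a b) (.id A' a' b')
  intro_eq {n : ℕ} {Γ : Ctx σ n} {A a a'} :
    S.TmEq Γ a a' A → S.TmEq Γ (.refl a) (.refl a') (.id A a a)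
  elim_eq {n m : ℕ} {Γ : Ctx σ n} {A} {Δ : Tel σ (n + 3) m} {C C' d d' a a' b b' p p' e e'} :
    S.TyEq ((Γ.idCtx A).append Δ) C C' →
    S.TmEq ((Γ.snoc A).append (Δ.subst (diag n))) d d' (C.subst (liftSub m (diag n))) →
    S.TmEq Γ a a' A → S.TmEq Γ b b' A → S.TmEq Γ p p' (.id A a b) →
    S.ElEq Γ (Δ.subst (Fin.append .var ![a, b, p])) e e' →
    S.TmEq Γ (.J m C d a b p e) (.J m C' d' a' b' p' e')
      (C.subst (Fin.append (Fin.append .var ![a, b, p]) e))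

/-- Discrete identity types: propositionally equal elements of an identity type are definitionally
equal.  (Using `Id`-elimination, it follows that any such propositional equality is itself `r`.) -/
structure DiscreteIdentityRules : Prop where
  reflection {n : ℕ} {Γ : Ctx σ n} {A a b p q s} :
    S.IsTerm Γ p (.id A a b) → S.IsTerm Γ q (.id A a b) →
      S.IsTerm Γ s (.id (.id A a b) p q) → S.TmEq Γ p q (.id A a b)

end Calculus

/-! ## Identity contexts -/

/-- A vector over `n + k + k + k + m`, given blockwise.  This is the shape of the contexts
`Γ, x : Φ, y : Φ, p : Id_Φ(x, y), Δ`. -/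
def glue {α : Type*} {n k m : ℕ} (b : Fin n → α) (x y p : Fin k → α) (e : Fin m → α) :
    Fin (n + k + k + k + m) → α :=
  Fin.append (Fin.append (Fin.append (Fin.append b x) y) p) e

section blocks

variable {n k m : ℕ}

/-- The variables of `Γ` in `Γ, x : Φ, y : Φ, p : Id_Φ(x, y), Δ`; similarly `vX`, `vY`, `vP`, `vE`
for those of `x`, `y`, `p` and `Δ`. -/
def vB (i : Fin n) : Fin (n + k + k + k + m) :=
  Fin.castAdd m (Fin.castAdd k (Fin.castAdd k (Fin.castAdd k i)))
def vX (i : Fin k) : Fin (n + k + k + k + m) :=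
  Fin.castAdd m (Fin.castAdd k (Fin.castAdd k (Fin.natAdd n i)))
def vY (i : Fin k) : Fin (n + k + k + k + m) :=
  Fin.castAdd m (Fin.castAdd k (Fin.natAdd (n + k) i))
def vP (i : Fin k) : Fin (n + k + k + k + m) :=
  Fin.castAdd m (Fin.natAdd (n + k + k) i)
def vE (i : Fin m) : Fin (n + k + k + k + m) :=
  Fin.natAdd (n + k + k + k) i

end blocks

/-- The eliminator as a term in context: `Γ, x, y : A, p : Id_A(x, y), Δ ⊢ J_d(x, y, p) : C`. -/
def elimOne {n m : ℕ} (C : Ty σ (n + 3 + m)) (d : Tm σ (n + 1 + m)) : Tm σ (n + 3 + m) :=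
  let b : Fin n → Fin (n + 3 + m) := fun i => Fin.castAdd m (Fin.castAdd 3 i)
  let v : Fin 3 → Tm σ (n + 3 + m) := fun i => .var (Fin.castAdd m (Fin.natAdd n i))
  .J m (C.rename (liftRen m (liftRen 3 b))) (d.rename (liftRen m (liftRen 1 b)))
    (v 0) (v 1) (v 2) fun i => .var (Fin.natAdd (n + 3) i)

/-- Elimination for the identity context of a context `Φ` of length `k`, into a single type `C`:
from `Γ, x, y : Φ, p : Id_Φ(x, y), Δ ⊢ C type` and `Γ, x : Φ, Δ[x, x, r(x)] ⊢ d : C[x, x, r(x)]`,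
it gives `Γ, x, y : Φ, p : Id_Φ(x, y), Δ ⊢ J_d(x, y, p) : C`.

For `Φ = (Λ, D)` one eliminates over `Λ`, with the postcontext
`y₁ : D(x₁), y₂ : D(x₂), q : Id(y₁, p^* y₂), Δ`; the generating family required for this is in turn
obtained by elimination over `D(x)`. -/
def elimTy : (k : ℕ) → {n m : ℕ} → Ty σ (n + k + k + k + m) → Tm σ (n + k + m) →
    Tm σ (n + k + k + k + m)
  | 0, _, _, _, d => d
  | k + 1, n, m, C, d =>
    -- `C` and the result of the elimination over `Λ`, in the reordered context
    let C₁ : Ty σ (n + k + k + k + (3 + m)) :=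
      C.rename (glue vB
        (ext vX (vE (Fin.castAdd m 0))) (ext vY (vE (Fin.castAdd m 1)))
        (ext vP (vE (Fin.castAdd m 2))) fun i => vE (Fin.natAdd 3 i))
    -- `C(x, y₁, x, y₂, r(x), q)` over `x : Λ, y₁, y₂ : D(x), q : Id(y₁, y₂), Δ`
    let b : Fin (n + k) → Fin (n + k + 3 + m) := fun i => Fin.castAdd m (Fin.castAdd 3 i)
    let v : Fin 3 → Tm σ (n + k + 3 + m) := fun i => .var (Fin.castAdd m (Fin.natAdd (n + k) i))
    let x : Fin k → Tm σ (n + k + 3 + m) := fun i => .var (b (Fin.natAdd n i))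
    let C₂ : Ty σ (n + k + 3 + m) :=
      C.subst (glue (fun i => .var (b (Fin.castAdd k i))) (ext x (v 0)) (ext x (v 1))
        (ext (fun i => .refl (x i)) (v 2)) fun i => .var (Fin.natAdd (n + k + 3) i))
    let d₁ : Tm σ (n + k + (3 + m)) :=
      (elimOne (n := n + k) C₂ d).rename (Fin.cast (Nat.add_assoc (n + k) 3 m))
    (elimTy k C₁ d₁).rename
      (glue vB (pre vX) (pre vY) (pre vP) (Fin.append ![lst vX, lst vY, lst vP] vE))

/-- Elimination for the identity context of a context of length `k`, into a dependent context. -/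
def elimTel (k : ℕ) {n m : ℕ} : {l : ℕ} → Tel σ (n + k + k + k + m) l →
    (Fin l → Tm σ (n + k + m)) → Fin l → Tm σ (n + k + k + k + m)
  | _, .nil, _ => fun i => i.elim0
  | _, .snoc Θ D, d =>
    let j := elimTel k Θ (pre d)
    ext j (elimTy k (D.subst (Fin.append .var j)) (lst d))

/-- The Leibnitz rule `p^*(z) : D(a)` for `x : Λ ⊢ D(x) type`, `p : Id_Λ(a, b)` and `z : D(b)`. -/
def transport {k n : ℕ} (D : Ty σ k) (a b p : Fin k → Tm σ n) (z : Tm σ n) : Tm σ n :=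
  (elimTy k (n := 0) (m := 1) (D.rename vX) (.var (Fin.last (0 + k)))).subst
    (glue Fin.elim0 a b p ![z])

/-- The identity context `Id_Φ(a, b)`:
`Id_{Λ, D}((a₁, a₂), (b₁, b₂)) = (p : Id_Λ(a₁, b₁), q : Id_{D(a₁)}(a₂, p^*(b₂)))`. -/
def idTel : {k : ℕ} → Ctx σ k → {n : ℕ} → (a b : Fin k → Tm σ n) → Tel σ n k
  | _, .nil, _, _, _ => .nil
  | k + 1, .snoc Λ D, n, a, b =>
    let a' := fun i => (a i).wk k
    let b' := fun i => (b i).wk k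
    .snoc (idTel Λ (pre a) (pre b))
      (.id (D.subst (pre a')) (lst a')
        (transport D (pre a') (pre b') (fun i => .var (Fin.natAdd n i)) (lst b')))

/-- `q ∘ p : Id_Φ(x, z)` for `p : Id_Φ(x, y)` and `q : Id_Φ(y, z)`, defined by elimination on `q`
with `r(y) ∘ p = p`. -/
def compId {k n : ℕ} (Φ : Ctx σ k) (x y z p q : Fin k → Tm σ n) : Fin k → Tm σ n := fun i =>
  (elimTel k (n := k) (m := k)
    (idTel Φ (fun j => .var (vB j)) (fun j => .var (vY j)))
    (fun j => .var (Fin.natAdd (k + k) j)) i).subst (glue x y z q p)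

/-- `f^•(p) : Id_Δ(f a, f b)` for `x : Γ ⊢ f(x) : Δ` and `p : Id_Γ(a, b)`, defined by elimination
on `p` with `f^•(r(x)) = r(f x)`. -/
def liftId {k m n : ℕ} (Δ : Ctx σ m) (f : Fin m → Tm σ k) (a b p : Fin k → Tm σ n) :
    Fin m → Tm σ n := fun i =>
  (elimTel k (n := 0) (m := 0)
    (idTel Δ (fun j => (f j).rename vX) (fun j => (f j).rename vY))
    (fun j => .refl ((f j).rename (Fin.natAdd 0))) i).subst (glue Fin.elim0 a b p Fin.elim0)

/-! ## Contexts, types in context, and the cells between them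

Everything is taken modulo definitional equality. -/

namespace Calculus

variable (S : Calculus σ)

/-- Contexts modulo definitional equality. -/
structure CtxOb where
  len : ℕ
  cls : Quot fun Γ Δ : { Γ : Ctx σ len // S.IsCtx Γ } => S.CtxEq Γ.1 Δ.1

/-- Types in context `(Γ, A)` modulo definitional equality. -/
structure TypOb where
  len : ℕ
  cls : Quot fun X Y : { X : Ctx σ len × Ty σ len // S.IsCtx X.1 ∧ S.IsType X.1 X.2 } =>
    S.CtxEq X.1.1 Y.1.1 ∧ S.TyEq X.1.1 X.1.2 Y.1.2

variable {S}

/-- `X` is the class of `Γ`. -/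
def CtxOb.Rep (X : S.CtxOb) (Γ : Ctx σ X.len) : Prop :=
  ∃ h : S.IsCtx Γ, X.cls = Quot.mk _ ⟨Γ, h⟩

/-- `X` is the class of `(Γ, A)`. -/
def TypOb.Rep (X : S.TypOb) (Γ : Ctx σ X.len) (A : Ty σ X.len) : Prop :=
  ∃ h : S.IsCtx Γ ∧ S.IsType Γ A, X.cls = Quot.mk _ ⟨(Γ, A), h⟩

/-- 1-cells `Γ → Δ`: judgements `x : Γ ⊢ f(x) : Δ`. -/
def CtxHom (X Y : S.CtxOb) : Type u :=
  Quot fun f g : { f : Fin Y.len → Tm σ X.len // ∃ Γ Δ, X.Rep Γ ∧ Y.Rep Δ ∧ S.IsMor Γ Δ f } =>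
    ∃ Γ Δ, X.Rep Γ ∧ Y.Rep Δ ∧ S.MorEq Γ Δ f.1 g.1

/-- `u` is the class of `f`. -/
def CtxHom.Rep {X Y : S.CtxOb} (u : CtxHom X Y) (f : Fin Y.len → Tm σ X.len) : Prop :=
  ∃ h, u = Quot.mk _ ⟨f, h⟩

/-- 2-cells `f ⇒ g : Γ → Δ`: judgements `x : Γ ⊢ α(x) : Id_Δ(f x, g x)`. -/
def CtxCell {X Y : S.CtxOb} (u v : CtxHom X Y) : Type u :=
  Quot fun α β : { α : Fin Y.len → Tm σ X.len // ∃ Γ Δ f g, X.Rep Γ ∧ Y.Rep Δ ∧ u.Rep f ∧ v.Rep g ∧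
      S.IsEl Γ (idTel Δ f g) α } =>
    ∃ Γ Δ f g, X.Rep Γ ∧ Y.Rep Δ ∧ u.Rep f ∧ v.Rep g ∧ S.ElEq Γ (idTel Δ f g) α.1 β.1

/-- `η` is the class of `α`. -/
def CtxCell.Rep {X Y : S.CtxOb} {u v : CtxHom X Y} (η : CtxCell u v)
    (α : Fin Y.len → Tm σ X.len) : Prop :=
  ∃ h, η = Quot.mk _ ⟨α, h⟩

/-- A raw 1-cell `(f, g) : (Γ, A) → (Δ, B)` of types, over contexts of lengths `n` and `m`. -/
abbrev RawPair (σ : Signature.{u}) (n m : ℕ) := (Fin m → Tm σ n) × Tm σ (n + 1)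

/-- The type `x : Γ, y : A ⊢ B(f x) type`. -/
abbrev tyAt {n m : ℕ} (B : Ty σ m) (f : Fin m → Tm σ n) : Ty σ (n + 1) :=
  B.subst fun i => (f i).wk 1

/-- The vector `f.g = (f, g)` over the context `Γ.A`. -/
abbrev total {n m : ℕ} (F : RawPair σ n m) : Fin (m + 1) → Tm σ (n + 1) :=
  ext (fun i => (F.1 i).wk 1) F.2

/-- The type `x : Γ, y : A ⊢ Id_{B(f x)}(g(x, y), α(x)^*(g'(x, y))) type`. -/
def cellTy {n m : ℕ} (B : Ty σ m) (F F' : RawPair σ n m) (α : Fin m → Tm σ n) : Ty σ (n + 1) :=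
  .id (tyAt B F.1) F.2
    (transport B (fun i => (F.1 i).wk 1) (fun i => (F'.1 i).wk 1) (fun i => (α i).wk 1) F'.2)

/-- 1-cells `(Γ, A) → (Δ, B)`: pairs of judgements `x : Γ ⊢ f(x) : Δ` and
`x : Γ, y : A(x) ⊢ g(x, y) : B(f x)`. -/
def TypHom (X Y : S.TypOb) : Type u :=
  Quot fun F G : { F : RawPair σ X.len Y.len // ∃ Γ A Δ B, X.Rep Γ A ∧ Y.Rep Δ B ∧
      S.IsMor Γ Δ F.1 ∧ S.IsTerm (Γ.snoc A) F.2 (tyAt B F.1) } =>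
    ∃ Γ A Δ B, X.Rep Γ A ∧ Y.Rep Δ B ∧
      S.MorEq Γ Δ F.1.1 G.1.1 ∧ S.TmEq (Γ.snoc A) F.1.2 G.1.2 (tyAt B F.1.1)

/-- `u` is the class of `F`. -/
def TypHom.Rep {X Y : S.TypOb} (u : TypHom X Y) (F : RawPair σ X.len Y.len) : Prop :=
  ∃ h, u = Quot.mk _ ⟨F, h⟩

/-- 2-cells `(f, g) ⇒ (f', g') : (Γ, A) → (Δ, B)`: pairs of judgements
`x : Γ ⊢ α(x) : Id_Δ(f x, f' x)` and
`x : Γ, y : A(x) ⊢ β(x, y) : Id_{B(f x)}(g(x, y), α(x)^*(g'(x, y)))`. -/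
def TypCell {X Y : S.TypOb} (u v : TypHom X Y) : Type u :=
  Quot fun a b : { a : RawPair σ X.len Y.len // ∃ Γ A Δ B F F', X.Rep Γ A ∧ Y.Rep Δ B ∧ u.Rep F ∧
      v.Rep F' ∧ S.IsEl Γ (idTel Δ F.1 F'.1) a.1 ∧
      S.IsTerm (Γ.snoc A) a.2 (cellTy B F F' a.1) } =>
    ∃ Γ A Δ B F F', X.Rep Γ A ∧ Y.Rep Δ B ∧ u.Rep F ∧ v.Rep F' ∧
      S.ElEq Γ (idTel Δ F.1 F'.1) a.1.1 b.1.1 ∧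
      S.TmEq (Γ.snoc A) a.1.2 b.1.2 (cellTy B F F' a.1.1)

/-- `η` is the class of `a`. -/
def TypCell.Rep {X Y : S.TypOb} {u v : TypHom X Y} (η : TypCell u v)
    (a : RawPair σ X.len Y.len) : Prop :=
  ∃ h, η = Quot.mk _ ⟨a, h⟩

/-! ### The projection `(Γ, A) ↦ Γ`, `(f, g) ↦ f`, `(α, β) ↦ α` -/

def TypOb.base (X : S.TypOb) : S.CtxOb where
  len := X.len
  cls := Quot.map (fun X => ⟨X.1.1, X.2.1⟩) (fun _ _ h => h.1) X.cls

theorem TypOb.Rep.base {X : S.TypOb} {Γ A} (h : X.Rep Γ A) : X.base.Rep Γ := by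
  obtain ⟨h, e⟩ := h
  exact ⟨h.1, by simp only [TypOb.base, e]; rfl⟩

def TypHom.base {X Y : S.TypOb} : TypHom X Y → CtxHom X.base Y.base :=
  Quot.map (fun F => ⟨F.1.1, by
      obtain ⟨_, Γ, A, Δ, B, hX, hY, h, _⟩ := F
      exact ⟨Γ, Δ, hX.base, hY.base, h⟩⟩)
    (by
      rintro _ _ ⟨Γ, A, Δ, B, hX, hY, h, _⟩
      exact ⟨Γ, Δ, hX.base, hY.base, h⟩)

theorem TypHom.Rep.base {X Y : S.TypOb} {u : TypHom X Y} {F} (h : u.Rep F) : u.base.Rep F.1 := by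
  obtain ⟨h, rfl⟩ := h
  exact ⟨_, rfl⟩

def TypCell.base {X Y : S.TypOb} {u v : TypHom X Y} : TypCell u v → CtxCell u.base v.base :=
  Quot.map (fun a => ⟨a.1.1, by
      obtain ⟨_, Γ, A, Δ, B, F, F', hX, hY, hu, hv, h, _⟩ := a
      exact ⟨Γ, Δ, F.1, F'.1, hX.base, hY.base, hu.base, hv.base, h⟩⟩)
    (by
      rintro _ _ ⟨Γ, A, Δ, B, F, F', hX, hY, hu, hv, h, _⟩
      exact ⟨Γ, Δ, F.1, F'.1, hX.base, hY.base, hu.base, hv.base, h⟩)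

variable (S)

/-! ### The 2-categories of contexts and of types -/

/-- An identification of the 1-cells, the 2-cells and all the operations of a given 2-category on
the contexts of `S` with the syntactic ones; that is, a witness that the given 2-category is the
2-category of contexts.  (As every 1-cell and 2-cell is the class of a raw one, the conditions below
determine all of the operations.) -/
structure IsContextTwoCategory [Bicategory.{u, u} S.CtxOb] where
  hom (X Y : S.CtxOb) : (X ⟶ Y) ≃ CtxHom X Y
  cell {X Y : S.CtxOb} (u v : X ⟶ Y) : (u ⟶ v) ≃ CtxCell (hom X Y u) (hom X Y v)
  /-- the identity `x : Γ ⊢ x : Γ` -/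
  id_rep (X : S.CtxOb) : (hom X X (𝟙 X)).Rep .var
  /-- composition is substitution -/
  comp_rep {X Y Z : S.CtxOb} (u : X ⟶ Y) (v : Y ⟶ Z) {f g} :
    (hom X Y u).Rep f → (hom Y Z v).Rep g → (hom X Z (u ≫ v)).Rep fun i => (g i).subst f
  /-- the identity 2-cell `x : Γ ⊢ r(f x) : Id_Δ(f x, f x)` -/
  idCell_rep {X Y : S.CtxOb} (u : X ⟶ Y) {f} :
    (hom X Y u).Rep f → (cell u u (𝟙 u)).Rep fun i => .refl (f i)
  /-- the vertical composite `x : Γ ⊢ β(x) ∘ α(x) : Id_Δ(f x, h x)` -/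
  vcomp_rep {X Y : S.CtxOb} {u v w : X ⟶ Y} (η : u ⟶ v) (θ : v ⟶ w) {Δ f g h α β} :
    Y.Rep Δ → (hom X Y u).Rep f → (hom X Y v).Rep g → (hom X Y w).Rep h →
    (cell u v η).Rep α → (cell v w θ).Rep β →
    (cell u w (η ≫ θ)).Rep (compId Δ f g h α β)
  /-- whiskering with `f` on the source side, `x : Γ ⊢ α(f x) : Id(g f x, h f x)` -/
  whiskerLeft_rep {X Y Z : S.CtxOb} (u : X ⟶ Y) {v w : Y ⟶ Z} (η : v ⟶ w) {f α} :
    (hom X Y u).Rep f → (cell v w η).Rep α →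
    (cell (u ≫ v) (u ≫ w) (Bicategory.whiskerLeft u η)).Rep fun i => (α i).subst f
  /-- whiskering with `h` on the target side, `x : Γ ⊢ h^•(α(x)) : Id(h f x, h g x)` -/
  whiskerRight_rep {X Y Z : S.CtxOb} {u v : X ⟶ Y} (η : u ⟶ v) (w : Y ⟶ Z) {Θ f g h α} :
    Z.Rep Θ → (hom X Y u).Rep f → (hom X Y v).Rep g → (hom Y Z w).Rep h →
    (cell u v η).Rep α →
    (cell (u ≫ w) (v ≫ w) (Bicategory.whiskerRight η w)).Rep (liftId Θ h f g α)

/-- The same for the 2-category of types.  Its 2-cells `(α, β) : (f, g) ⇒ (f', g')` are composed by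
regarding them as pairs of a 2-cell `α : f ⇒ f' : Γ → Δ` and a 2-cell
`(α, β) : f.g ⇒ f'.g' : Γ.A → Δ.B` of contexts, compatible with the dependent projections. -/
structure IsTypeTwoCategory [Bicategory.{u, u} S.TypOb] where
  hom (X Y : S.TypOb) : (X ⟶ Y) ≃ TypHom X Y
  cell {X Y : S.TypOb} (u v : X ⟶ Y) : (u ⟶ v) ≃ TypCell (hom X Y u) (hom X Y v)
  id_rep (X : S.TypOb) : (hom X X (𝟙 X)).Rep (.var, .var (Fin.last _))
  comp_rep {X Y Z : S.TypOb} (u : X ⟶ Y) (v : Y ⟶ Z) {F G} :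
    (hom X Y u).Rep F → (hom Y Z v).Rep G →
    (hom X Z (u ≫ v)).Rep (fun i => (G.1 i).subst F.1, G.2.subst (total F))
  idCell_rep {X Y : S.TypOb} (u : X ⟶ Y) {F} :
    (hom X Y u).Rep F → (cell u u (𝟙 u)).Rep (fun i => .refl (F.1 i), .refl F.2)
  vcomp_rep {X Y : S.TypOb} {u v w : X ⟶ Y} (η : u ⟶ v) (θ : v ⟶ w) {Δ B F G H a b} :
    Y.Rep Δ B → (hom X Y u).Rep F → (hom X Y v).Rep G → (hom X Y w).Rep H →
    (cell u v η).Rep a → (cell v w θ).Rep b →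
    (cell u w (η ≫ θ)).Rep (compId Δ F.1 G.1 H.1 a.1 b.1,
      lst (compId (Δ.snoc B) (total F) (total G) (total H) (total a) (total b)))
  whiskerLeft_rep {X Y Z : S.TypOb} (u : X ⟶ Y) {v w : Y ⟶ Z} (η : v ⟶ w) {F a} :
    (hom X Y u).Rep F → (cell v w η).Rep a →
    (cell (u ≫ v) (u ≫ w) (Bicategory.whiskerLeft u η)).Rep
      (fun i => (a.1 i).subst F.1, a.2.subst (total F))
  whiskerRight_rep {X Y Z : S.TypOb} {u v : X ⟶ Y} (η : u ⟶ v) (w : Y ⟶ Z) {Θ C F G H a} :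
    Z.Rep Θ C → (hom X Y u).Rep F → (hom X Y v).Rep G → (hom Y Z w).Rep H →
    (cell u v η).Rep a →
    (cell (u ≫ w) (v ≫ w) (Bicategory.whiskerRight η w)).Rep
      (liftId Θ H.1 F.1 G.1 a.1,
        lst (liftId (Θ.snoc C) (total H) (total F) (total G) (total a)))

variable {S}

/-- The 2-functor `P` from types to contexts sends `(Γ, A)` to `Γ`, `(f, g)` to `f` and `(α, β)`
to `α`. -/
structure IsProjection [Bicategory.{u, u} S.CtxOb] [Bicategory.{u, u} S.TypOb]
    (c : S.IsContextTwoCategory) (t : S.IsTypeTwoCategory)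
    (P : StrictPseudofunctor S.TypOb S.CtxOb) : Prop where
  obj (X : S.TypOb) : P.obj X = X.base
  map {X Y : S.TypOb} (u : X ⟶ Y) : HEq (c.hom _ _ (P.map u)) (t.hom X Y u).base
  map₂ {X Y : S.TypOb} {u v : X ⟶ Y} (η : u ⟶ v) :
    HEq (c.cell _ _ (P.map₂ η)) (t.cell u v η).base

end Calculus

/-! ## 2-fibrations -/

section Fibrations

universe w₁ w₂ v₁ v₂ u₁ u₂

/-- A split cleavage of a functor: a functorial choice of cartesian liftings. -/
structure SplitCleavage {E : Type u₁} [Category.{v₁} E] {B : Type u₂} [Category.{v₂} B]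
    (p : E ⥤ B) where
  dom {a : E} {R : B} (f : R ⟶ p.obj a) : E
  obj_dom {a : E} {R : B} (f : R ⟶ p.obj a) : p.obj (dom f) = R
  lift {a : E} {R : B} (f : R ⟶ p.obj a) : dom f ⟶ a
  cartesian {a : E} {R : B} (f : R ⟶ p.obj a) : p.IsStronglyCartesian f (lift f)
  dom_id (a : E) : dom (𝟙 (p.obj a)) = a
  lift_id (a : E) : lift (𝟙 (p.obj a)) = eqToHom (dom_id a)
  dom_comp {a : E} {R Q : B} (g : Q ⟶ R) (f : R ⟶ p.obj a) :
    dom (g ≫ f) = dom (g ≫ eqToHom (obj_dom f).symm)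
  lift_comp {a : E} {R Q : B} (g : Q ⟶ R) (f : R ⟶ p.obj a) :
    lift (g ≫ f) = eqToHom (dom_comp g f) ≫ lift (g ≫ eqToHom (obj_dom f).symm) ≫ lift f

variable {E : Type u₁} [Bicategory.{w₁, v₁} E] [Bicategory.Strict E]
  {B : Type u₂} [Bicategory.{w₂, v₂} B] [Bicategory.Strict B]

/-- The two-dimensional universal property of a 1-cell `f : y ⟶ z`: given `α : g ⇒ h : x → z` and
`γ : k ⇒ l : p(x) → p(y)` with `p(α) = p(f) γ`, there are unique `k'`, `l'` and `γ' : k' ⇒ l'` with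
`α = f γ'` and `p(γ') = γ`. -/
def HasTwoDimLifting (P : StrictPseudofunctor E B) {y z : E} (f : y ⟶ z) : Prop :=
  ∀ ⦃x : E⦄ ⦃g h : x ⟶ z⦄ (α : g ⟶ h) ⦃k l : P.obj x ⟶ P.obj y⦄ (γ : k ⟶ l)
    (hg : P.map g = k ≫ P.map f) (hh : P.map h = l ≫ P.map f),
    P.map₂ α = eqToHom hg ≫ Bicategory.whiskerRight γ (P.map f) ≫ eqToHom hh.symm →
    ∃! t : (Σ (k' : x ⟶ y) (l' : x ⟶ y), (k' ⟶ l')),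
      (∃ (hg' : g = t.1 ≫ f) (hh' : h = t.2.1 ≫ f),
        α = eqToHom hg' ≫ Bicategory.whiskerRight t.2.2 f ≫ eqToHom hh'.symm) ∧
      ∃ (hk : P.map t.1 = k) (hl : P.map t.2.1 = l),
        P.map₂ t.2.2 = eqToHom hk ≫ γ ≫ eqToHom hl.symm

/-- A globally split 2-fibration, in the sense of Hermida. -/
structure GloballySplitTwoFibration (P : StrictPseudofunctor E B) where
  /-- the underlying ordinary functor is a split fibration -/
  cleavage : SplitCleavage P.toFunctor
  /-- cartesian 1-cells have the two-dimensional universal property -/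
  twoDimLifting {y z : E} (f : y ⟶ z) :
    P.toFunctor.IsStronglyCartesian (P.map f) f → HasTwoDimLifting P f
  /-- the functors on hom-categories are fibrations -/
  homFibered (x y : E) : (P.mapFunctor x y).IsFibered
  /-- precomposition with a 1-cell preserves cartesian 2-cells -/
  precomp_cartesian {x y z : E} (f : x ⟶ y) {g h : y ⟶ z} (α : g ⟶ h) :
    (P.mapFunctor y z).IsStronglyCartesian (P.map₂ α) α →
    (P.mapFunctor x z).IsStronglyCartesian (P.map₂ (Bicategory.whiskerLeft f α))
      (Bicategory.whiskerLeft f α)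

end Fibrations

namespace Calculus

variable {S : Calculus σ}

/-- The chosen cartesian lifting of `f : Γ → Δ` at `(Δ, B)` is `(f, ρ_f) : (Γ, f^*B) → (Δ, B)`,
where `f^*B` is `x : Γ ⊢ B(f x) type` and `ρ_f` is `x : Γ, y : B(f x) ⊢ y : B(f x)`. -/
def IsCanonical [Bicategory.{u, u} S.CtxOb] [Bicategory.Strict S.CtxOb]
    [Bicategory.{u, u} S.TypOb] [Bicategory.Strict S.TypOb]
    {c : S.IsContextTwoCategory} {t : S.IsTypeTwoCategory}
    {P : StrictPseudofunctor S.TypOb S.CtxOb} (hP : IsProjection c t P)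
    (K : SplitCleavage P.toFunctor) : Prop :=
  ∀ ⦃X : S.CtxOb⦄ ⦃Y : S.TypOb⦄ (v : X ⟶ P.obj Y) ⦃Γ Δ B f⦄, X.Rep Γ → Y.Rep Δ B →
    (c.hom X Y.base (v ≫ eqToHom (hP.obj Y))).Rep f →
    ∃ (h : S.IsCtx Γ ∧ S.IsType Γ (B.subst f))
      (e : (⟨X.len, Quot.mk _ ⟨(Γ, B.subst f), h⟩⟩ : S.TypOb) = K.dom v),
      (t.hom _ Y (eqToHom e ≫ K.lift v)).Rep (f, .var (Fin.last _))

end Calculus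

end DTT

namespace DTT

variable {σ : Signature.{u}}

/-! ## The substitution calculus -/

namespace Expr

/-! Everything is reduced to path induction in one category. Raw contexts, with context morphisms
modulo judgemental equality, form a category `Syn`. Each context `X` has a path object `path X`, the
context `x, y : X, p : Id_X(x, y)`, with end points, reflexivity, inversion, composition of paths
and an action of morphisms on paths. A 2-cell `u ⇒ v : X → Y` is the same as a morphism `X ⟶ path Y`
with end points `u` and `v`.

Two facts carry the 2-categorical part. The first is `idSound`: identity contexts are contexts, and
elimination over them is well typed, respects equality and computes at reflexivity. It is proved by
induction on the context: elimination over `Λ, D` is elimination over `Λ` in a reordered context,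
whose generating family is an elimination over `D(x)`; the two fit because `r(x)^* z = z` holds
judgementally. The second is `elEq_of_elim`, the use of discreteness: if two elements `s, t` of an
identity context agree on the diagonal, then `r(s)` proves `s = t` there, elimination extends this
proof to the whole path context, and the discrete identity rule makes it a judgemental equality.
Hence (`path_ext`, `exists_composable`) a family of paths indexed by a path is determined by its end
points and its value at reflexivity. Functoriality, associativity, units, inverses and interchange
become checks at reflexivity, where both sides compute. These checks are made abstractly in a
`PathCategory`, where all 2-cells turn out to be invertible.

A type in context `(Γ, A)` is represented by its dependent projection `Γ.A → Γ`. Its 1-cells are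
commutative squares and its 2-cells are compatible pairs of 2-cells, so that the laws are inherited
from contexts. That these are the syntactic cells rests on `mkSnocPath_map`: the projection sends a
path `(p, q)` to `p`.

For the fibration, a square is called cartesian (`Square.IsCartesian`) if it and its image under
path objects are both pullbacks. The first pullback is the ordinary universal property, the second
is the two-dimensional one. The canonical square over `f` has both: vertical paths, lying over a
reflexivity, lift by mere conversion, since the canonical morphism acts on them as the identity
(`mkVertical_map_canon`); any path is a vertical path followed by a transport lift of its base
(`exists_lift`, `Square.isCartesian_of_vertical`). An arbitrary cartesian 1-cell differs from a
canonical lifting by an isomorphism and so inherits both pullbacks. The hom-functors are fibrations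
because transport lifts paths along dependent projections and the lifted 2-cell, being invertible,
is cartesian; invertibility also settles precomposition. The cleavage is split because raw
substitution is strictly unital and associative and objects are taken modulo judgemental equality.

What remains is bookkeeping between classes of raw cells and cells of chosen representatives. -/

theorem append_comp {α β : Type*} {n k : ℕ} (g : α → β) (f : Fin n → α) (h : Fin k → α) :
    (fun i => g (Fin.append f h i)) = Fin.append (fun i => g (f i)) fun i => g (h i) := by
  funext i
  refine Fin.addCases (fun i => ?_) (fun i => ?_) i <;> simp

theorem append_split {α : Type*} {n k : ℕ} (f : Fin (n + k) → α) :
    Fin.append (fun i => f (Fin.castAdd k i)) (fun i => f (Fin.natAdd n i)) = f := by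
  funext i
  refine Fin.addCases (fun i => ?_) (fun i => ?_) i <;> simp

@[simp] theorem liftRen_castAdd {n m : ℕ} (k : ℕ) (ρ : Fin n → Fin m) (i : Fin n) :
    liftRen k ρ (Fin.castAdd k i) = Fin.castAdd k (ρ i) := by simp [liftRen]

@[simp] theorem liftRen_natAdd {n m : ℕ} (k : ℕ) (ρ : Fin n → Fin m) (i : Fin k) :
    liftRen k ρ (Fin.natAdd n i) = Fin.natAdd m i := by simp [liftRen]

@[simp] theorem liftSub_castAdd {n m : ℕ} (k : ℕ) (s : Fin n → Tm σ m) (i : Fin n) :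
    liftSub k s (Fin.castAdd k i) = (s i).rename (Fin.castAdd k) := by simp [liftSub]

@[simp] theorem liftSub_natAdd {n m : ℕ} (k : ℕ) (s : Fin n → Tm σ m) (i : Fin k) :
    liftSub k s (Fin.natAdd n i) = .var (Fin.natAdd m i) := by simp [liftSub]

theorem liftRen_liftRen {n m l : ℕ} (k : ℕ) (ρ : Fin n → Fin m) (τ : Fin m → Fin l) :
    (fun i => liftRen k τ (liftRen k ρ i)) = liftRen k fun i => τ (ρ i) := by
  funext i
  refine Fin.addCases (fun i => ?_) (fun i => ?_) i <;> simp

theorem rename_rename {K : Kind} {n m l : ℕ} (t : Expr σ K n) (ρ : Fin n → Fin m)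
    (τ : Fin m → Fin l) : (t.rename ρ).rename τ = t.rename fun i => τ (ρ i) := by
  induction t generalizing m l with
  | var i => simp [rename]
  | op o args ih => simp [rename, ih, liftRen_liftRen]
  | id A a b ihA iha ihb => simp [rename, ihA, iha, ihb]
  | refl a ih => simp [rename, ih]
  | J m C d a b p e ihC ihd iha ihb ihp ihe =>
    simp [rename, ihC, ihd, iha, ihb, ihp, ihe, liftRen_liftRen]

theorem liftRen_var {n m : ℕ} (k : ℕ) (ρ : Fin n → Fin m) :
    (fun i => (.var (liftRen k ρ i) : Tm σ (m + k))) = liftSub k fun i => .var (ρ i) := by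
  funext i
  refine Fin.addCases (fun i => ?_) (fun i => ?_) i <;> simp [rename]

theorem rename_eq_subst {K : Kind} {n m : ℕ} (t : Expr σ K n) (ρ : Fin n → Fin m) :
    t.rename ρ = t.subst fun i => .var (ρ i) := by
  induction t generalizing m with
  | var i => simp [rename, subst]
  | op o args ih => simp [rename, subst, ih, liftRen_var]
  | id A a b ihA iha ihb => simp [rename, subst, ihA, iha, ihb]
  | refl a ih => simp [rename, subst, ih]
  | J m C d a b p e ihC ihd iha ihb ihp ihe =>
    simp [rename, subst, ihC, ihd, iha, ihb, ihp, ihe, liftRen_var]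

theorem liftSub_liftRen {n m l : ℕ} (k : ℕ) (ρ : Fin n → Fin m) (s : Fin m → Tm σ l) :
    (fun i => liftSub k s (liftRen k ρ i)) = liftSub k fun i => s (ρ i) := by
  funext i
  refine Fin.addCases (fun i => ?_) (fun i => ?_) i <;> simp

theorem rename_subst {K : Kind} {n m l : ℕ} (t : Expr σ K n) (ρ : Fin n → Fin m)
    (s : Fin m → Tm σ l) : (t.rename ρ).subst s = t.subst fun i => s (ρ i) := by
  induction t generalizing m l with
  | var i => simp [rename, subst]
  | op o args ih => simp [rename, subst, ih, liftSub_liftRen]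
  | id A a b ihA iha ihb => simp [rename, subst, ihA, iha, ihb]
  | refl a ih => simp [rename, subst, ih]
  | J m C d a b p e ihC ihd iha ihb ihp ihe =>
    simp [rename, subst, ihC, ihd, iha, ihb, ihp, ihe, liftSub_liftRen]

theorem liftSub_rename {n m l : ℕ} (k : ℕ) (s : Fin n → Tm σ m) (ρ : Fin m → Fin l) :
    (fun i => (liftSub k s i).rename (liftRen k ρ)) = liftSub k fun i => (s i).rename ρ := by
  funext i
  refine Fin.addCases (fun i => ?_) (fun i => ?_) i <;> simp [rename_rename, rename]

theorem subst_rename {K : Kind} {n m l : ℕ} (t : Expr σ K n) (s : Fin n → Tm σ m)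
    (ρ : Fin m → Fin l) : (t.subst s).rename ρ = t.subst fun i => (s i).rename ρ := by
  induction t generalizing m l with
  | var i => simp [subst]
  | op o args ih => simp [rename, subst, ih, liftSub_rename]
  | id A a b ihA iha ihb => simp [rename, subst, ihA, iha, ihb]
  | refl a ih => simp [rename, subst, ih]
  | J m C d a b p e ihC ihd iha ihb ihp ihe =>
    simp [rename, subst, ihC, ihd, iha, ihb, ihp, ihe, liftSub_rename]

theorem liftSub_liftSub {n m l : ℕ} (k : ℕ) (s : Fin n → Tm σ m) (s' : Fin m → Tm σ l) :
    (fun i => (liftSub k s i).subst (liftSub k s')) = liftSub k fun i => (s i).subst s' := by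
  funext i
  refine Fin.addCases (fun i => ?_) (fun i => ?_) i <;>
    simp [rename_subst, subst, subst_rename]

-- Pushing a substitution under binders weakens it by a renaming, so this law needs both mixed laws
-- first, and `subst_rename` in turn needs `rename_rename`. It yields strict associativity of
-- composition and, in the end, the splitness of the cleavage.
@[simp] theorem subst_subst {K : Kind} {n m l : ℕ} (t : Expr σ K n) (s : Fin n → Tm σ m)
    (s' : Fin m → Tm σ l) : (t.subst s).subst s' = t.subst fun i => (s i).subst s' := by
  induction t generalizing m l with
  | var i => simp [subst]
  | op o args ih => simp [subst, ih, liftSub_liftSub]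
  | id A a b ihA iha ihb => simp [subst, ihA, iha, ihb]
  | refl a ih => simp [subst, ih]
  | J m C d a b p e ihC ihd iha ihb ihp ihe =>
    simp [subst, ihC, ihd, iha, ihb, ihp, ihe, liftSub_liftSub]

@[simp] theorem liftSub_var {n : ℕ} (k : ℕ) :
    liftSub k (fun i => (.var i : Tm σ n)) = fun i => .var i := by
  funext i
  refine Fin.addCases (fun i => ?_) (fun i => ?_) i <;> simp [rename]

@[simp] theorem subst_var {K : Kind} {n : ℕ} (t : Expr σ K n) :
    t.subst (fun i => .var i) = t := by
  induction t with
  | var i => simp [subst]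
  | op o args ih => simp [subst, ih]
  | id A a b ihA iha ihb => simp [subst, ihA, iha, ihb]
  | refl a ih => simp [subst, ih]
  | J m C d a b p e ihC ihd iha ihb ihp ihe =>
    simp [subst, ihC, ihd, iha, ihb, ihp, ihe]

@[simp] theorem subst_var' {K : Kind} {n : ℕ} (t : Expr σ K n) : t.subst .var = t := subst_var t

@[simp] theorem var_subst {n m : ℕ} (i : Fin n) (s : Fin n → Tm σ m) :
    (var i : Tm σ n).subst s = s i := by simp [subst]

@[simp] theorem refl_subst {n m : ℕ} (a : Tm σ n) (s : Fin n → Tm σ m) :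
    (refl a).subst s = refl (a.subst s) := by simp [subst]

@[simp] theorem id_subst {n m : ℕ} (A : Ty σ n) (a b : Tm σ n) (s : Fin n → Tm σ m) :
    (id A a b).subst s = id (A.subst s) (a.subst s) (b.subst s) := by simp [subst]

/-- A substitution pushed under binders, in terms of substitutions only. -/
theorem liftSub_eq {n m : ℕ} (k : ℕ) (s : Fin n → Tm σ m) :
    liftSub k s = Fin.append (fun i => (s i).subst fun j => .var (Fin.castAdd k j))
      fun j => .var (Fin.natAdd m j) := by
  simp only [liftSub, rename_eq_subst]

end Expr

open DTT.Expr

/-! ### Vectors -/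

theorem ext_comp {α β : Type*} {k : ℕ} (g : α → β) (f : Fin k → α) (a : α) :
    (fun i => g (ext f a i)) = ext (fun i => g (f i)) (g a) := by
  funext i
  refine Fin.lastCases ?_ (fun i => ?_) i <;> simp [ext]

@[simp] theorem pre_ext {α : Type*} {k : ℕ} (f : Fin k → α) (a : α) : pre (ext f a) = f := by
  funext i; simp [ext]

@[simp] theorem lst_ext {α : Type*} {k : ℕ} (f : Fin k → α) (a : α) : lst (ext f a) = a := by
  simp [ext]

@[simp] theorem ext_castSucc {α : Type*} {k : ℕ} (f : Fin k → α) (a : α) (i : Fin k) :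
    ext f a i.castSucc = f i := by simp [ext]

@[simp] theorem ext_last {α : Type*} {k : ℕ} (f : Fin k → α) (a : α) :
    ext f a (Fin.last k) = a := by simp [ext]

@[simp] theorem ext_pre_lst {α : Type*} {k : ℕ} (f : Fin (k + 1) → α) : ext (pre f) (lst f) = f := by
  funext i
  refine Fin.lastCases ?_ (fun i => ?_) i <;> simp [ext]

/-- Depends on `n + (k + 1)` and `(n + k) + 1` being definitionally equal; the explicit length
arguments fix which reading is meant. -/
theorem append_ext {α : Type*} {n k : ℕ} (f : Fin n → α) (g : Fin k → α) (a : α) :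
    Fin.append (n := k + 1) f (ext g a) = ext (k := n + k) (Fin.append f g) a := by
  funext i
  refine Fin.addCases (m := n) (n := k + 1) (fun i => ?_) (fun i => ?_) i
  · rw [Fin.append_left]
    exact ((ext_castSucc (Fin.append f g) a (Fin.castAdd k i)).trans (Fin.append_left f g i)).symm
  · rw [Fin.append_right]
    refine Fin.lastCases ?_ (fun i => ?_) i
    · rw [ext_last]
      exact (ext_last (Fin.append f g) a).symm
    · rw [ext_castSucc]
      exact ((ext_castSucc (Fin.append f g) a (Fin.natAdd n i)).trans (Fin.append_right f g i)).symm

@[simp] theorem pre_append {α : Type*} {n k : ℕ} (f : Fin n → α) (g : Fin (k + 1) → α) :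
    pre (k := n + k) (Fin.append (n := k + 1) f g) = Fin.append f (pre g) := by
  rw [← ext_pre_lst g, append_ext, pre_ext, pre_ext]

@[simp] theorem lst_append {α : Type*} {n k : ℕ} (f : Fin n → α) (g : Fin (k + 1) → α) :
    lst (k := n + k) (Fin.append (n := k + 1) f g) = lst g := by
  rw [← ext_pre_lst g, append_ext, lst_ext, lst_ext]

section blocks

variable {α : Type*} {n k m : ℕ} (b : Fin n → α) (x y p : Fin k → α) (e : Fin m → α)

@[simp] theorem glue_vB (i : Fin n) : glue b x y p e (vB i) = b i := by simp [glue, vB]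
@[simp] theorem glue_vX (i : Fin k) : glue b x y p e (vX i) = x i := by simp [glue, vX]
@[simp] theorem glue_vY (i : Fin k) : glue b x y p e (vY i) = y i := by simp [glue, vY]
@[simp] theorem glue_vP (i : Fin k) : glue b x y p e (vP i) = p i := by simp [glue, vP]
@[simp] theorem glue_vE (i : Fin m) : glue b x y p e (vE i) = e i := by simp [glue, vE]

theorem glue_comp {β : Type*} (g : α → β) : (fun i => g (glue b x y p e i)) =
    glue (fun i => g (b i)) (fun i => g (x i)) (fun i => g (y i)) (fun i => g (p i))
      fun i => g (e i) := by
  simp only [glue, append_comp]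

end blocks

/-! ### Telescopes: substitution and concatenation -/

@[simp] theorem Tel.subst_subst {n m l k : ℕ} (Θ : Tel σ n k) (s : Fin n → Tm σ m)
    (s' : Fin m → Tm σ l) : (Θ.subst s).subst s' = Θ.subst fun i => (s i).subst s' := by
  induction Θ with
  | nil => simp [Tel.subst]
  | snoc Θ A ih => simp [Tel.subst, ih, liftSub_liftSub]

@[simp] theorem Tel.subst_var {n k : ℕ} (Θ : Tel σ n k) : Θ.subst (fun i => .var i) = Θ := by
  induction Θ with
  | nil => simp [Tel.subst]
  | snoc Θ A ih => simp [Tel.subst, ih]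

theorem liftSub_append {n m k : ℕ} (s : Fin n → Tm σ m) (p : Fin k → Tm σ m) :
    (fun i => (liftSub k s i).subst (Fin.append .var p)) = Fin.append s p := by
  funext i
  refine Fin.addCases (fun i => ?_) (fun i => ?_) i <;> simp [rename_subst]

/-- A closed context as a telescope over `n` variables. -/
def Ctx.tel : {k : ℕ} → Ctx σ k → (n : ℕ) → Tel σ n k
  | _, .nil, _ => .nil
  | _, .snoc Λ D, n => .snoc (Λ.tel n) (D.rename (Fin.natAdd n))

/-- The concatenation of telescopes. -/
def Tel.cat {n k : ℕ} (Θ : Tel σ n k) : {m : ℕ} → Tel σ (n + k) m → Tel σ n (k + m)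
  | _, .nil => Θ
  | m + 1, .snoc Ψ A => .snoc (Θ.cat Ψ) (A.rename (Fin.cast (Nat.add_assoc n k m)))

/-- A context of length `n`, regarded as one of an equal length. -/
def Ctx.cast {n m : ℕ} (h : n = m) (Γ : Ctx σ n) : Ctx σ m := h ▸ Γ

theorem Ctx.cast_snoc {n m : ℕ} (h : n = m) (Γ : Ctx σ n) (A : Ty σ n) :
    Ctx.cast (congrArg (· + 1) h) (Γ.snoc A) = (Γ.cast h).snoc (A.rename (Fin.cast h)) := by
  subst h
  simp [Ctx.cast, rename_eq_subst]

/-- Associativity of context extension holds only along `Nat.add_assoc`, which is not definitional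
for a variable length. The cast is the price of moving the telescope `y₁, y₂, q` into the
postcontext, as `elimTy` does. -/
theorem Ctx.append_cat {n k m : ℕ} (Γ : Ctx σ n) (Θ : Tel σ n k) (Ψ : Tel σ (n + k) m) :
    Γ.append (Θ.cat Ψ) = ((Γ.append Θ).append Ψ).cast (Nat.add_assoc n k m) := by
  induction Ψ with
  | nil => rfl
  | snoc Ψ A ih =>
    exact (congrArg (Ctx.snoc · _) ih).trans (Ctx.cast_snoc (Nat.add_assoc n k _) _ A).symm

theorem Tel.cat_subst {n n' k m : ℕ} (Θ : Tel σ n k) (Ψ : Tel σ (n + k) m) (s : Fin n → Tm σ n') :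
    (Θ.cat Ψ).subst s = (Θ.subst s).cat (Ψ.subst (liftSub k s)) := by
  induction Ψ with
  | nil => rfl
  | @snoc m Ψ A ih =>
    simp only [Tel.cat, Tel.subst, ih]
    congr 1
    rw [rename_subst, subst_rename]
    congr 1
    funext i
    refine Fin.addCases (fun i => ?_) (fun i => ?_) i
    · refine Fin.addCases (fun i => ?_) (fun i => ?_) i
      · have : Fin.cast (Nat.add_assoc n k m) (Fin.castAdd m (Fin.castAdd k i)) =
          Fin.castAdd (k + m) i := rfl
        simp only [this, liftSub_castAdd, rename_rename]
        rfl
      · have : Fin.cast (Nat.add_assoc n k m) (Fin.castAdd m (Fin.natAdd n i)) =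
          Fin.natAdd n (Fin.castAdd m i) := rfl
        simp only [this, liftSub_castAdd, liftSub_natAdd, rename]
        rfl
    · have : Fin.cast (Nat.add_assoc n k m) (Fin.natAdd (n + k) i) =
          Fin.natAdd n (Fin.natAdd k i) := Fin.ext (by simp [Nat.add_assoc])
      simp only [this, liftSub_natAdd, rename]
      congr 1
      exact Fin.ext (by simp [Nat.add_assoc])

/-! ### Consequences of the structural rules for morphisms and telescopes -/

namespace Calculus

/-- All the rules together. -/
structure Rules (S : Calculus σ) : Prop extends
  S.StructuralRules, S.IdentityRules, S.DiscreteIdentityRules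

namespace Rules

variable {S : Calculus σ}

/-- Morphisms can be tested variable by variable, so identities and composites follow from the
variable and substitution rules without induction on the context. -/
theorem isMor_iff_get {n m : ℕ} {Ξ : Ctx σ n} {Δ : Ctx σ m} {f : Fin m → Tm σ n} :
    S.IsMor Ξ Δ f ↔ ∀ i, S.IsTerm Ξ (f i) ((Δ.get i).subst f) := by
  induction Δ with
  | nil => simp [IsMor]
  | snoc Δ A ih =>
    simp only [IsMor, ih, Fin.forall_fin_succ', Ctx.get, ext_castSucc, ext_last, rename_subst]
    rfl

theorem isMor_append {n m k : ℕ} {Ξ : Ctx σ n} {Ω : Ctx σ m} {Θ : Tel σ m k} {f : Fin m → Tm σ n}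
    {p : Fin k → Tm σ n} :
    S.IsMor Ξ (Ω.append Θ) (Fin.append f p) ↔ S.IsMor Ξ Ω f ∧ S.IsEl Ξ (Θ.subst f) p := by
  induction Θ with
  | nil =>
    simp only [Ctx.append, Tel.subst, IsEl, and_true]
    have : Fin.append (n := 0) f p = f := funext fun i => Fin.append_left f p i
    rw [this]
  | snoc Θ A ih =>
    simp only [Ctx.append, Tel.subst, IsEl, IsMor, subst_subst, liftSub_append]
    rw [pre_append, lst_append, ih, and_assoc]

theorem morEq_append {n m k : ℕ} {Ξ : Ctx σ n} {Ω : Ctx σ m} {Θ : Tel σ m k} {f g : Fin m → Tm σ n}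
    {p q : Fin k → Tm σ n} :
    S.MorEq Ξ (Ω.append Θ) (Fin.append f p) (Fin.append g q) ↔
      S.MorEq Ξ Ω f g ∧ S.ElEq Ξ (Θ.subst f) p q := by
  induction Θ with
  | nil =>
    simp only [Ctx.append, Tel.subst, ElEq, and_true]
    have (f : Fin m → Tm σ n) (p : Fin 0 → Tm σ n) :
        Fin.append (n := 0) f p = f := funext fun i => Fin.append_left f p i
    rw [this, this]
  | snoc Θ A ih =>
    simp only [Ctx.append, Tel.subst, ElEq, MorEq, subst_subst, liftSub_append]
    rw [pre_append, lst_append, pre_append, lst_append, ih, and_assoc]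

theorem isEl_tel {n m k : ℕ} {Ξ : Ctx σ n} {Φ : Ctx σ k} {f : Fin m → Tm σ n}
    {p : Fin k → Tm σ n} : S.IsEl Ξ ((Φ.tel m).subst f) p ↔ S.IsMor Ξ Φ p := by
  induction Φ with
  | nil => simp [Ctx.tel, Tel.subst, IsEl, IsMor]
  | snoc Λ D ih =>
    simp only [Ctx.tel, Tel.subst, IsEl, IsMor, ih]
    simp [rename_subst]

theorem elEq_tel {n m k : ℕ} {Ξ : Ctx σ n} {Φ : Ctx σ k} {f : Fin m → Tm σ n}
    {p q : Fin k → Tm σ n} : S.ElEq Ξ ((Φ.tel m).subst f) p q ↔ S.MorEq Ξ Φ p q := by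
  induction Φ with
  | nil => simp [Ctx.tel, Tel.subst, ElEq, MorEq]
  | snoc Λ D ih =>
    simp only [Ctx.tel, Tel.subst, ElEq, MorEq, ih]
    simp [rename_subst]

theorem isCtx_of_append {n k : ℕ} {Ξ : Ctx σ n} {Θ : Tel σ n k} (hΞ : S.IsCtx (Ξ.append Θ)) : S.IsCtx Ξ := by
  induction Θ with
  | nil => exact hΞ
  | snoc Θ A ih => exact ih hΞ.1

theorem isMor_append_split {n m k : ℕ} {Ξ : Ctx σ n} {Ω : Ctx σ m} {Θ : Tel σ m k} {f : Fin (m + k) → Tm σ n} :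
    S.IsMor Ξ (Ω.append Θ) f ↔ S.IsMor Ξ Ω (fun i => f (Fin.castAdd k i)) ∧
      S.IsEl Ξ (Θ.subst fun i => f (Fin.castAdd k i)) fun i => f (Fin.natAdd m i) := by
  rw [← isMor_append, append_split]

variable (h : S.Rules)
include h

section

variable {n m l k : ℕ} {Ξ : Ctx σ n} {Ω : Ctx σ m} {Δ : Ctx σ l}

theorem isMor_var (hΞ : S.IsCtx Ξ) : S.IsMor Ξ Ξ .var :=
  isMor_iff_get.2 fun i => by simpa using h.var i hΞ

theorem isMor_comp (hΞ : S.IsCtx Ξ) {f g} (hf : S.IsMor Ξ Ω f) (hg : S.IsMor Ω Δ g) :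
    S.IsMor Ξ Δ fun i => (g i).subst f :=
  isMor_iff_get.2 fun i => by
    simpa using h.isTerm_subst hΞ hf (isMor_iff_get.1 hg i)

theorem morEq_refl {f} (hf : S.IsMor Ξ Ω f) : S.MorEq Ξ Ω f f := by
  induction Ω with
  | nil => trivial
  | snoc Ω A ih => exact ⟨ih hf.1, h.tmEq_refl hf.2⟩

theorem morEq_left {f g} (hf : S.MorEq Ξ Ω f g) : S.IsMor Ξ Ω f := by
  induction Ω with
  | nil => trivial
  | snoc Ω A ih => exact ⟨ih hf.1, h.tmEq_left hf.2⟩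

/-- Equality of vectors is typed at the left-hand vector, so typing the right-hand one costs a
conversion at each entry; this is where `Ω` must be a context. -/
theorem morEq_right (hΞ : S.IsCtx Ξ) (hΩ : S.IsCtx Ω) {f g} (hf : S.MorEq Ξ Ω f g) :
    S.IsMor Ξ Ω g := by
  induction Ω with
  | nil => trivial
  | snoc Ω A ih =>
    exact ⟨ih hΩ.1 hf.1, h.isTerm_conv (h.tmEq_right hf.2) (h.isType_substEq hΞ hf.1 hΩ.2)⟩

theorem morEq_symm (hΞ : S.IsCtx Ξ) (hΩ : S.IsCtx Ω) {f g} (hf : S.MorEq Ξ Ω f g) :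
    S.MorEq Ξ Ω g f := by
  induction Ω with
  | nil => trivial
  | snoc Ω A ih =>
    exact ⟨ih hΩ.1 hf.1, h.tmEq_conv (h.tmEq_symm hf.2) (h.isType_substEq hΞ hf.1 hΩ.2)⟩

theorem morEq_trans (hΞ : S.IsCtx Ξ) (hΩ : S.IsCtx Ω) {f g k} (hf : S.MorEq Ξ Ω f g)
    (hg : S.MorEq Ξ Ω g k) : S.MorEq Ξ Ω f k := by
  induction Ω with
  | nil => trivial
  | snoc Ω A ih =>
    exact ⟨ih hΩ.1 hf.1 hg.1, h.tmEq_trans hf.2 (h.tmEq_conv hg.2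
      (h.tyEq_symm (h.isType_substEq hΞ hf.1 hΩ.2)))⟩

theorem tmEq_congr (hΞ : S.IsCtx Ξ) {f g a b A} (hf : S.MorEq Ξ Ω f g) (ha : S.TmEq Ω a b A) :
    S.TmEq Ξ (a.subst f) (b.subst g) (A.subst f) :=
  h.tmEq_trans (h.tmEq_subst hΞ (h.morEq_left hf) ha) (h.isTerm_substEq hΞ hf (h.tmEq_right ha))

theorem tyEq_congr (hΞ : S.IsCtx Ξ) {f g A B} (hf : S.MorEq Ξ Ω f g) (ha : S.TyEq Ω A B) :
    S.TyEq Ξ (A.subst f) (B.subst g) :=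
  h.tyEq_trans (h.tyEq_subst hΞ (h.morEq_left hf) ha) (h.isType_substEq hΞ hf (h.tyEq_right ha))

theorem morEq_comp (hΞ : S.IsCtx Ξ) {f f' g g'} (hf : S.MorEq Ξ Ω f f') (hg : S.MorEq Ω Δ g g') :
    S.MorEq Ξ Δ (fun i => (g i).subst f) fun i => (g' i).subst f' := by
  induction Δ with
  | nil => trivial
  | snoc Δ A ih => exact ⟨ih hg.1, by simpa using h.tmEq_congr hΞ hf hg.2⟩

/-- Elements of a dependent context are sections of its projection. Through this and `elEq_iff`,
symmetry, transitivity and conversion for `ElEq` are borrowed from `MorEq`. -/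
theorem isEl_iff (hΞ : S.IsCtx Ξ) {Θ : Tel σ n k} {p} :
    S.IsEl Ξ Θ p ↔ S.IsMor Ξ (Ξ.append Θ) (Fin.append .var p) := by
  simp [isMor_append, h.isMor_var hΞ]

theorem elEq_iff (hΞ : S.IsCtx Ξ) {Θ : Tel σ n k} {p q} :
    S.ElEq Ξ Θ p q ↔ S.MorEq Ξ (Ξ.append Θ) (Fin.append .var p) (Fin.append .var q) := by
  simp [morEq_append, h.morEq_refl (h.isMor_var hΞ)]

theorem elEq_refl {Θ : Tel σ n k} {p} (hp : S.IsEl Ξ Θ p) : S.ElEq Ξ Θ p p := by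
  induction Θ with
  | nil => trivial
  | snoc Θ A ih => exact ⟨ih hp.1, h.tmEq_refl hp.2⟩

theorem elEq_right {Θ : Tel σ n k} {p q} (hΞ : S.IsCtx (Ξ.append Θ)) (hp : S.ElEq Ξ Θ p q) :
    S.IsEl Ξ Θ q :=
  (h.isEl_iff (isCtx_of_append hΞ)).2 (h.morEq_right (isCtx_of_append hΞ) hΞ
    ((h.elEq_iff (isCtx_of_append hΞ)).1 hp))

theorem elEq_symm {Θ : Tel σ n k} {p q} (hΞ : S.IsCtx (Ξ.append Θ)) (hp : S.ElEq Ξ Θ p q) :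
    S.ElEq Ξ Θ q p :=
  (h.elEq_iff (isCtx_of_append hΞ)).2 (h.morEq_symm (isCtx_of_append hΞ) hΞ
    ((h.elEq_iff (isCtx_of_append hΞ)).1 hp))

theorem elEq_trans {Θ : Tel σ n k} {p q r} (hΞ : S.IsCtx (Ξ.append Θ)) (hp : S.ElEq Ξ Θ p q)
    (hq : S.ElEq Ξ Θ q r) : S.ElEq Ξ Θ p r :=
  (h.elEq_iff (isCtx_of_append hΞ)).2 (h.morEq_trans (isCtx_of_append hΞ) hΞ
    ((h.elEq_iff (isCtx_of_append hΞ)).1 hp) ((h.elEq_iff (isCtx_of_append hΞ)).1 hq))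

theorem isEl_subst (hΞ : S.IsCtx Ξ) {Θ : Tel σ m k} {f p} (hf : S.IsMor Ξ Ω f)
    (hp : S.IsEl Ω Θ p) : S.IsEl Ξ (Θ.subst f) fun i => (p i).subst f := by
  induction Θ with
  | nil => trivial
  | snoc Θ A ih =>
    refine ⟨ih hp.1, ?_⟩
    simpa [liftSub_append, append_comp (fun t : Tm σ m => t.subst f)] using
      h.isTerm_subst hΞ hf hp.2

theorem elEq_subst (hΞ : S.IsCtx Ξ) {Θ : Tel σ m k} {f p q} (hf : S.IsMor Ξ Ω f)
    (hp : S.ElEq Ω Θ p q) :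
    S.ElEq Ξ (Θ.subst f) (fun i => (p i).subst f) fun i => (q i).subst f := by
  induction Θ with
  | nil => trivial
  | snoc Θ A ih =>
    refine ⟨ih hp.1, ?_⟩
    simpa [liftSub_append, append_comp (fun t : Tm σ m => t.subst f)] using
      h.tmEq_subst hΞ hf hp.2

theorem isMor_castAdd {Θ : Tel σ n k} (hΞ : S.IsCtx (Ξ.append Θ)) :
    S.IsMor (Ξ.append Θ) Ξ fun i => .var (Fin.castAdd k i) :=
  (isMor_append_split.1 (h.isMor_var hΞ)).1

theorem isEl_natAdd {Θ : Tel σ n k} (hΞ : S.IsCtx (Ξ.append Θ)) :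
    S.IsEl (Ξ.append Θ) (Θ.subst fun i => .var (Fin.castAdd k i)) fun i => .var (Fin.natAdd n i) :=
  (isMor_append_split.1 (h.isMor_var hΞ)).2

/-- Both claims go through one induction: the next type of `Θ` can be substituted only along the
lift already constructed. -/
theorem isMor_lift (hΞ : S.IsCtx Ξ) {Θ : Tel σ m k} (hΩ : S.IsCtx (Ω.append Θ)) {f}
    (hf : S.IsMor Ξ Ω f) :
    S.IsCtx (Ξ.append (Θ.subst f)) ∧ S.IsMor (Ξ.append (Θ.subst f)) (Ω.append Θ) (liftSub k f) := by
  induction Θ with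
  | nil =>
    refine ⟨hΞ, ?_⟩
    have : liftSub 0 f = f := funext fun i => by
      refine (liftSub_castAdd 0 f i).trans ?_
      rw [rename_eq_subst]
      exact subst_var (f i)
    rw [this]
    exact hf
  | snoc Θ A ih =>
    obtain ⟨h1, h2⟩ := ih hΩ.1
    have h3 : S.IsCtx (Ξ.append ((Θ.snoc A).subst f)) := ⟨h1, h.isType_subst h1 h2 hΩ.2⟩
    refine ⟨h3, ?_⟩
    rw [liftSub_eq, isMor_append]
    refine ⟨h.isMor_comp h3 (h.isMor_castAdd h3) hf, ?_⟩
    simpa using h.isEl_natAdd h3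

theorem isCtx_append_subst (hΞ : S.IsCtx Ξ) {Θ : Tel σ m k} (hΩ : S.IsCtx (Ω.append Θ)) {f}
    (hf : S.IsMor Ξ Ω f) : S.IsCtx (Ξ.append (Θ.subst f)) := (h.isMor_lift hΞ hΩ hf).1

end

/-! ### Equality of contexts -/

section

variable {n m k : ℕ}

theorem ctxEq_refl {Γ : Ctx σ n} (hΓ : S.IsCtx Γ) : S.CtxEq Γ Γ := by
  induction Γ with
  | nil => trivial
  | snoc Γ A ih => exact ⟨ih hΓ.1, h.tyEq_refl hΓ.2⟩

theorem isMor_conv {Ξ : Ctx σ n} (hΞ : S.IsCtx Ξ) {Δ Δ' : Ctx σ m} (e : S.CtxEq Δ Δ') {f}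
    (hf : S.IsMor Ξ Δ f) : S.IsMor Ξ Δ' f := by
  induction Δ with
  | nil => cases Δ'; trivial
  | snoc Δ A ih =>
    cases Δ' with
    | snoc Δ' A' =>
    exact ⟨ih e.1 hf.1, h.isTerm_conv hf.2 (h.tyEq_subst hΞ hf.1 e.2)⟩

theorem morEq_conv {Ξ : Ctx σ n} (hΞ : S.IsCtx Ξ) {Δ Δ' : Ctx σ m} (e : S.CtxEq Δ Δ') {f g}
    (hf : S.MorEq Ξ Δ f g) : S.MorEq Ξ Δ' f g := by
  induction Δ with
  | nil => cases Δ'; trivial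
  | snoc Δ A ih =>
    cases Δ' with
    | snoc Δ' A' =>
    exact ⟨ih e.1 hf.1, h.tmEq_conv hf.2 (h.tyEq_subst hΞ (h.morEq_left hf.1) e.2)⟩

/-- Equal contexts are connected by the identity vector; substitution along it is how judgements are
moved from one context to an equal one. -/
theorem isMor_var_of_ctxEq {Γ Γ' : Ctx σ n} (hΓ : S.IsCtx Γ) (e : S.CtxEq Γ Γ') :
    S.IsMor Γ Γ' .var := h.isMor_conv hΓ e (h.isMor_var hΓ)

theorem ctxEq_symm {Γ Γ' : Ctx σ n} (hΓ : S.IsCtx Γ) (hΓ' : S.IsCtx Γ') (e : S.CtxEq Γ Γ') :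
    S.CtxEq Γ' Γ := by
  induction Γ with
  | nil => cases Γ'; trivial
  | snoc Γ A ih =>
    cases Γ' with
    | snoc Γ' A' =>
    have e' := ih hΓ.1 hΓ'.1 e.1
    refine ⟨e', ?_⟩
    simpa using h.tyEq_subst hΓ'.1 (h.isMor_var_of_ctxEq hΓ'.1 e') (h.tyEq_symm e.2)

theorem ctxEq_trans {Γ Γ' Γ'' : Ctx σ n} (hΓ : S.IsCtx Γ) (hΓ' : S.IsCtx Γ')
    (e : S.CtxEq Γ Γ') (e' : S.CtxEq Γ' Γ'') : S.CtxEq Γ Γ'' := by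
  induction Γ with
  | nil => cases Γ'; cases Γ''; trivial
  | snoc Γ A ih =>
    cases Γ' with
    | snoc Γ' A' =>
    cases Γ'' with
    | snoc Γ'' A'' =>
    refine ⟨ih hΓ.1 hΓ'.1 e.1 e'.1, h.tyEq_trans e.2 ?_⟩
    simpa using h.tyEq_subst hΓ.1 (h.isMor_var_of_ctxEq hΓ.1 e.1) e'.2

variable {Γ Γ' : Ctx σ n}

theorem isType_ctxConv {A} (hΓ : S.IsCtx Γ) (hΓ' : S.IsCtx Γ') (e : S.CtxEq Γ Γ')
    (hA : S.IsType Γ A) : S.IsType Γ' A := by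
  simpa using h.isType_subst hΓ' (h.isMor_var_of_ctxEq hΓ' (h.ctxEq_symm hΓ hΓ' e)) hA

theorem tyEq_ctxConv {A B} (hΓ : S.IsCtx Γ) (hΓ' : S.IsCtx Γ') (e : S.CtxEq Γ Γ')
    (hA : S.TyEq Γ A B) : S.TyEq Γ' A B := by
  simpa using h.tyEq_subst hΓ' (h.isMor_var_of_ctxEq hΓ' (h.ctxEq_symm hΓ hΓ' e)) hA

theorem isTerm_ctxConv {a A} (hΓ : S.IsCtx Γ) (hΓ' : S.IsCtx Γ') (e : S.CtxEq Γ Γ')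
    (hA : S.IsTerm Γ a A) : S.IsTerm Γ' a A := by
  simpa using h.isTerm_subst hΓ' (h.isMor_var_of_ctxEq hΓ' (h.ctxEq_symm hΓ hΓ' e)) hA

theorem tmEq_ctxConv {a b A} (hΓ : S.IsCtx Γ) (hΓ' : S.IsCtx Γ') (e : S.CtxEq Γ Γ')
    (hA : S.TmEq Γ a b A) : S.TmEq Γ' a b A := by
  simpa using h.tmEq_subst hΓ' (h.isMor_var_of_ctxEq hΓ' (h.ctxEq_symm hΓ hΓ' e)) hA

theorem isMor_ctxConv {Δ : Ctx σ m} {f} (hΓ : S.IsCtx Γ) (hΓ' : S.IsCtx Γ') (e : S.CtxEq Γ Γ')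
    (hf : S.IsMor Γ Δ f) : S.IsMor Γ' Δ f := by
  simpa using h.isMor_comp hΓ' (h.isMor_var_of_ctxEq hΓ' (h.ctxEq_symm hΓ hΓ' e)) hf

theorem morEq_ctxConv {Δ : Ctx σ m} {f g} (hΓ : S.IsCtx Γ) (hΓ' : S.IsCtx Γ') (e : S.CtxEq Γ Γ')
    (hf : S.MorEq Γ Δ f g) : S.MorEq Γ' Δ f g := by
  simpa using h.morEq_comp hΓ' (h.morEq_refl
    (h.isMor_var_of_ctxEq hΓ' (h.ctxEq_symm hΓ hΓ' e))) hf

end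

end Rules

end Calculus

/-! ## Elimination over a single type -/

theorem append_var {n k : ℕ} :
    Fin.append (fun i => .var (Fin.castAdd k i)) (fun i => .var (Fin.natAdd n i)) =
      fun i => (.var i : Tm σ (n + k)) := append_split _

/-- The telescope `x : A, y : A, p : Id_A(x, y)`. -/
def Tel.idTel {n : ℕ} (A : Ty σ n) : Tel σ n 3 :=
  ((Tel.nil.snoc A).snoc (A.wk 1)).snoc
    (.id (A.wk 2) (.var (Fin.natAdd n (0 : Fin 2))) (.var (Fin.natAdd n (1 : Fin 2))))

theorem Ctx.append_idTel {n : ℕ} (Γ : Ctx σ n) (A : Ty σ n) :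
    Γ.append (Tel.idTel A) = Γ.idCtx A := rfl

theorem liftSub_zero {n m : ℕ} (s : Fin n → Tm σ m) : liftSub 0 s = s := funext fun i => by
  refine (liftSub_castAdd 0 s i).trans ?_
  rw [rename_eq_subst]
  exact Expr.subst_var (s i)

theorem Tel.idTel_subst {n m : ℕ} (A : Ty σ n) (s : Fin n → Tm σ m) :
    (Tel.idTel A).subst s = Tel.idTel (A.subst s) := by
  simp only [Tel.idTel, Tel.subst, id_subst, var_subst, liftSub_natAdd, liftSub_zero, wk,
    rename_subst, subst_rename, liftSub_castAdd]

theorem diag_natural {n m : ℕ} (s : Fin n → Tm σ m) :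
    (fun i => (liftSub 3 s i).subst (diag m)) = fun i => (diag n i).subst (liftSub 1 s) := by
  funext i
  refine Fin.addCases (fun i => ?_) (fun i => ?_) i
  · simp only [liftSub_castAdd, diag, Fin.append_left, rename_subst, var_subst]
    rw [rename_eq_subst]
  · have h : liftSub 1 s (Fin.last n) = .var (Fin.natAdd m 0) := liftSub_natAdd 1 s 0
    simp only [liftSub_natAdd, diag, Fin.append_right, var_subst]
    fin_cases i
    · simp [h]; rfl
    · simp [h]; rfl
    · simp [h]; rfl

@[simp] theorem diag_castAdd {n : ℕ} (i : Fin n) :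
    diag (σ := σ) n (Fin.castAdd 3 i) = .var (Fin.castAdd 1 i) := by simp [diag]

theorem append_liftSub {n m l k : ℕ} (s : Fin n → Tm σ m) (t : Fin m → Tm σ l)
    (p : Fin k → Tm σ l) :
    (fun i => (liftSub k s i).subst (Fin.append t p)) =
      Fin.append (fun i => (s i).subst t) p := by
  funext i
  refine Fin.addCases (fun i => ?_) (fun i => ?_) i <;> simp [rename_subst]

theorem elimOne_eq {n m : ℕ} (C : Ty σ (n + 3 + m)) (d : Tm σ (n + 1 + m)) :
    elimOne C d = .J m
      (C.subst (liftSub m (liftSub 3 fun i => .var (Fin.castAdd m (Fin.castAdd 3 i)))))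
      (d.subst (liftSub m (liftSub 1 fun i => .var (Fin.castAdd m (Fin.castAdd 3 i)))))
      (.var (Fin.castAdd m (Fin.natAdd n 0))) (.var (Fin.castAdd m (Fin.natAdd n 1)))
      (.var (Fin.castAdd m (Fin.natAdd n 2))) fun i => .var (Fin.natAdd (n + 3) i) := by
  simp only [elimOne, rename_eq_subst, liftRen_var]

theorem elimOne_subst_diag {n m : ℕ} (C : Ty σ (n + 3 + m)) (d : Tm σ (n + 1 + m)) :
    (elimOne C d).subst (liftSub m (diag n)) = .J m
      (C.subst (liftSub m (liftSub 3 fun i => .var (Fin.castAdd m (Fin.castAdd 1 i)))))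
      (d.subst (liftSub m (liftSub 1 fun i => .var (Fin.castAdd m (Fin.castAdd 1 i)))))
      (.var (Fin.castAdd m (Fin.last n))) (.var (Fin.castAdd m (Fin.last n)))
      (.refl (.var (Fin.castAdd m (Fin.last n)))) fun i => .var (Fin.natAdd (n + 1) i) := by
  rw [elimOne_eq, Expr.subst]
  simp only [subst_subst, liftSub_liftSub, var_subst, liftSub_castAdd, liftSub_natAdd, diag,
    Fin.append_left, Fin.append_right, rename]
  rfl

theorem vec3_eta {α : Type*} (v : Fin 3 → α) : ![v 0, v 1, v 2] = v := by
  funext i; fin_cases i <;> rfl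

namespace Calculus.Rules

variable {S : Calculus σ}

theorem isEl_idTel {n : ℕ} {Ξ : Ctx σ n} {A : Ty σ n} {x y p : Tm σ n} :
    S.IsEl Ξ (Tel.idTel A) ![x, y, p] ↔
      S.IsTerm Ξ x A ∧ S.IsTerm Ξ y A ∧ S.IsTerm Ξ p (.id A x y) := by
  have e0 : A.subst (Fin.append (n := 0) .var (pre (pre (pre ![x, y, p])))) = A := by
    have : (Fin.append (n := 0) .var (pre (pre (pre ![x, y, p]))) : Fin n → Tm σ n) = .var :=
      funext fun i => Fin.append_left _ (pre (pre (pre ![x, y, p]))) i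
    rw [this, subst_var']
  have e1 : (A.wk 1).subst (Fin.append .var (pre (pre ![x, y, p]))) = A := by
    simp [wk, rename_subst]
  have e2 : (Expr.id (A.wk 2) (.var (Fin.natAdd n 0)) (.var (Fin.natAdd n 1))).subst
      (Fin.append .var (pre ![x, y, p])) = .id A x y := by
    simp [wk, rename_subst]
    exact ⟨rfl, rfl⟩
  simp only [Tel.idTel, IsEl, e2, e1]
  rw [e0]
  simp only [true_and, and_assoc]
  rfl

variable (h : S.Rules)
include h

section

variable {n m : ℕ} {Γ : Ctx σ n} {A : Ty σ n} {Δ : Tel σ (n + 3) m} {C C' : Ty σ (n + 3 + m)}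
  {d d' : Tm σ (n + 1 + m)}

/-- The rule `elim_eq` is applied in `Γ, x, y, p, Δ` to the variables of that very context. Motive
and generating term are first weakened along `b`; instantiating the weakened motive at these
variables returns `C`. -/
theorem elimOne_congr (hC : S.TyEq ((Γ.idCtx A).append Δ) C C')
    (hd : S.TmEq ((Γ.snoc A).append (Δ.subst (diag n))) d d' (C.subst (liftSub m (diag n)))) :
    S.TmEq ((Γ.idCtx A).append Δ) (elimOne C d) (elimOne C' d') C := by
  have hΞ := h.isType_ctx (h.tyEq_left hC)
  have hΞ' := isCtx_of_append hΞ
  set b : Fin n → Tm σ (n + 3 + m) := fun i => .var (Fin.castAdd m (Fin.castAdd 3 i)) with hb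
  have hp := h.isMor_castAdd hΞ
  rw [← Ctx.append_idTel, isMor_append_split] at hp
  obtain ⟨hbm, hv⟩ := hp
  rw [Ctx.append_idTel] at hbm hv
  have L3 := h.isMor_lift (Θ := Tel.idTel A) hΞ hΞ' hbm
  have L3m := h.isMor_lift (Θ := Δ) L3.1 hΞ L3.2
  have L1 := h.isMor_lift (Θ := Tel.nil.snoc A) hΞ (isCtx_of_append
    (h.isType_ctx (h.isTerm_type (h.tmEq_left hd)))) hbm
  have L1m := h.isMor_lift (Θ := Δ.subst (diag n)) L1.1
    (h.isType_ctx (h.isTerm_type (h.tmEq_left hd))) L1.2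
  have h1 := h.tyEq_subst L3m.1 L3m.2 hC
  have h2 := h.tmEq_subst L1m.1 L1m.2 hd
  rw [← vec3_eta (fun i => _), Tel.idTel_subst, isEl_idTel] at hv
  rw [Tel.idTel_subst, Ctx.append_idTel] at h1
  have key : (fun i => (liftSub 3 b i).subst (Fin.append .var
      ![Expr.var (Fin.castAdd m (Fin.natAdd n 0)), .var (Fin.castAdd m (Fin.natAdd n 1)),
        .var (Fin.castAdd m (Fin.natAdd n 2))])) =
      fun i => (.var (Fin.castAdd m i) : Tm σ (n + 3 + m)) := by
    rw [append_liftSub, vec3_eta (fun i : Fin 3 => (.var (Fin.castAdd m (Fin.natAdd n i)) :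
      Tm σ (n + 3 + m)))]
    simp only [hb, var_subst]
    exact append_split fun i => (.var (Fin.castAdd m i) : Tm σ (n + 3 + m))
  have e : (C.subst (liftSub m (liftSub 3 b))).subst (Fin.append (Fin.append .var
      ![Expr.var (Fin.castAdd m (Fin.natAdd n 0)), .var (Fin.castAdd m (Fin.natAdd n 1)),
        .var (Fin.castAdd m (Fin.natAdd n 2))]) fun i => .var (Fin.natAdd (n + 3) i)) = C := by
    rw [subst_subst, append_liftSub, key, append_var, Expr.subst_var]
  rw [elimOne_eq, elimOne_eq]
  have := h.elim_eq (Δ := Δ.subst (liftSub 3 b)) h1 (d := d.subst (liftSub m (liftSub 1 b)))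
    (d' := d'.subst (liftSub m (liftSub 1 b)))
    (e := fun i => .var (Fin.natAdd (n + 3) i)) (e' := fun i => .var (Fin.natAdd (n + 3) i))
    (by
      simp only [Tel.subst_subst, subst_subst, liftSub_liftSub, diag_natural] at h2 ⊢
      have e1 : Tel.subst b (Tel.nil.snoc A) = Tel.nil.snoc (A.subst b) := by
        simp [Tel.subst, liftSub_zero]
      rw [e1] at h2
      exact h2) (h.tmEq_refl hv.1) (h.tmEq_refl hv.2.1) (h.tmEq_refl hv.2.2)
    (by
      rw [Tel.subst_subst, key]
      exact h.elEq_refl (h.isEl_natAdd hΞ))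
  rwa [e] at this

/-- The same device with the rule `comp`, in the context `Γ, x, Δ[x, x, r(x)]`. -/
theorem elimOne_comp (hC : S.IsType ((Γ.idCtx A).append Δ) C)
    (hd : S.IsTerm ((Γ.snoc A).append (Δ.subst (diag n))) d (C.subst (liftSub m (diag n)))) :
    S.TmEq ((Γ.snoc A).append (Δ.subst (diag n))) ((elimOne C d).subst (liftSub m (diag n))) d
      (C.subst (liftSub m (diag n))) := by
  have hΞ := h.isType_ctx (h.isTerm_type hd)
  have hΞ' := isCtx_of_append hΞ
  set b : Fin n → Tm σ (n + 1 + m) := fun i => .var (Fin.castAdd m (Fin.castAdd 1 i)) with hb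
  have hp := h.isMor_castAdd hΞ
  have hbm : S.IsMor ((Γ.snoc A).append (Δ.subst (diag n))) Γ b := hp.1
  have hx : S.IsTerm ((Γ.snoc A).append (Δ.subst (diag n))) (.var (Fin.castAdd m (Fin.last n)))
    (A.subst b) := hp.2
  have L3 := h.isMor_lift (Θ := Tel.idTel A) hΞ (isCtx_of_append (h.isType_ctx hC)) hbm
  have L3m := h.isMor_lift (Θ := Δ) L3.1 (h.isType_ctx hC) L3.2
  have L1 := h.isMor_lift (Θ := Tel.nil.snoc A) hΞ hΞ' hbm
  have L1m := h.isMor_lift (Θ := Δ.subst (diag n)) L1.1 hΞ L1.2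
  have h1 := h.isType_subst L3m.1 L3m.2 hC
  have h2 := h.isTerm_subst L1m.1 L1m.2 hd
  rw [Tel.idTel_subst, Ctx.append_idTel] at h1
  have key : (fun i => (liftSub 3 b i).subst (Fin.append .var
      ![Expr.var (Fin.castAdd m (Fin.last n)), .var (Fin.castAdd m (Fin.last n)),
        .refl (.var (Fin.castAdd m (Fin.last n)))])) =
      fun i => (diag n i).subst fun j => (.var (Fin.castAdd m j) : Tm σ (n + 1 + m)) := by
    rw [append_liftSub]
    funext i
    refine Fin.addCases (fun i => ?_) (fun i => ?_) i
    · simp [hb]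
    · simp only [diag, Fin.append_right]
      fin_cases i <;> simp
  have key1 : (fun i => (liftSub 1 b i).subst (Fin.append .var
      ![Expr.var (Fin.castAdd m (Fin.last n))])) =
      fun j => (.var (Fin.castAdd m j) : Tm σ (n + 1 + m)) := by
    rw [append_liftSub]
    funext i
    refine Fin.addCases (fun i => ?_) (fun i => ?_) i
    · simp [hb]
    · simp only [Fin.append_right]
      fin_cases i
      rfl
  have e : (C.subst (liftSub m (liftSub 3 b))).subst (Fin.append (Fin.append .var
      ![Expr.var (Fin.castAdd m (Fin.last n)), .var (Fin.castAdd m (Fin.last n)),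
        .refl (.var (Fin.castAdd m (Fin.last n)))]) fun i => .var (Fin.natAdd (n + 1) i)) =
      C.subst (liftSub m (diag n)) := by
    rw [subst_subst, append_liftSub, key, liftSub_eq]
  have e' : (d.subst (liftSub m (liftSub 1 b))).subst (Fin.append (Fin.append .var
      ![Expr.var (Fin.castAdd m (Fin.last n))]) fun i => .var (Fin.natAdd (n + 1) i)) = d := by
    rw [subst_subst, append_liftSub, key1, append_var, Expr.subst_var]
  rw [elimOne_subst_diag]
  have := h.comp (Δ := Δ.subst (liftSub 3 b)) h1 (d := d.subst (liftSub m (liftSub 1 b)))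
    (a := .var (Fin.castAdd m (Fin.last n))) (e := fun i => .var (Fin.natAdd (n + 1) i))
    (by
      simp only [Tel.subst_subst, subst_subst, liftSub_liftSub, diag_natural] at h2 ⊢
      have e1 : Tel.subst b (Tel.nil.snoc A) = Tel.nil.snoc (A.subst b) := by
        simp [Tel.subst, liftSub_zero]
      rw [e1] at h2
      exact h2) hx
    (by
      rw [Tel.subst_subst, key]
      simpa using h.isEl_natAdd hΞ)
  rwa [e, e'] at this

end

end Calculus.Rules

/-! ## The context of paths -/

section blocks

variable {n k m : ℕ}

/-- The blocks of variables of `Γ, x : Φ, y : Φ, p : Id_Φ(x, y)`. -/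
def uB (i : Fin n) : Fin (n + k + k + k) := Fin.castAdd k (Fin.castAdd k (Fin.castAdd k i))
def uX (i : Fin k) : Fin (n + k + k + k) := Fin.castAdd k (Fin.castAdd k (Fin.natAdd n i))
def uY (i : Fin k) : Fin (n + k + k + k) := Fin.castAdd k (Fin.natAdd (n + k) i)
def uP (i : Fin k) : Fin (n + k + k + k) := Fin.natAdd (n + k + k) i

/-- A vector over `n + k + k + k`, given blockwise. -/
def block {α : Type*} (b : Fin n → α) (x y p : Fin k → α) : Fin (n + k + k + k) → α :=
  Fin.append (Fin.append (Fin.append b x) y) p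

variable {α : Type*} (b : Fin n → α) (x y p : Fin k → α) (e : Fin m → α)

@[simp] theorem block_uB (i : Fin n) : block b x y p (uB i) = b i := by simp [block, uB]
@[simp] theorem block_uX (i : Fin k) : block b x y p (uX i) = x i := by simp [block, uX]
@[simp] theorem block_uY (i : Fin k) : block b x y p (uY i) = y i := by simp [block, uY]
@[simp] theorem block_uP (i : Fin k) : block b x y p (uP i) = p i := by simp [block, uP]

theorem glue_eq_append : glue b x y p e = Fin.append (block b x y p) e := rfl

theorem block_comp {β : Type*} (g : α → β) : (fun i => g (block b x y p i)) =
    block (fun i => g (b i)) (fun i => g (x i)) (fun i => g (y i)) fun i => g (p i) := by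
  simp only [block, append_comp]

theorem block_cases {P : Fin (n + k + k + k) → Prop} (hB : ∀ i, P (uB i)) (hX : ∀ i, P (uX i))
    (hY : ∀ i, P (uY i)) (hP : ∀ i, P (uP i)) (i) : P i :=
  Fin.addCases (fun i => Fin.addCases (fun i => Fin.addCases hB hX i) hY i) hP i

theorem block_split (f : Fin (n + k + k + k) → α) :
    block (fun i => f (uB i)) (fun i => f (uX i)) (fun i => f (uY i)) (fun i => f (uP i)) = f := by
  exact funext (block_cases (by simp) (by simp) (by simp) (by simp))

theorem glue_cases {P : Fin (n + k + k + k + m) → Prop} (hB : ∀ i, P (vB i)) (hX : ∀ i, P (vX i))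
    (hY : ∀ i, P (vY i)) (hP : ∀ i, P (vP i)) (hE : ∀ i, P (vE i)) (i) : P i :=
  Fin.addCases (block_cases hB hX hY hP) hE i

variable {l : ℕ} (s : Fin (n + k + k + k) → Tm σ l)

@[simp] theorem liftSub_vB (i : Fin n) :
    liftSub m s (vB i) = (s (uB i)).rename (Fin.castAdd m) := liftSub_castAdd m s _
@[simp] theorem liftSub_vX (i : Fin k) :
    liftSub m s (vX i) = (s (uX i)).rename (Fin.castAdd m) := liftSub_castAdd m s _
@[simp] theorem liftSub_vY (i : Fin k) :
    liftSub m s (vY i) = (s (uY i)).rename (Fin.castAdd m) := liftSub_castAdd m s _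
@[simp] theorem liftSub_vP (i : Fin k) :
    liftSub m s (vP i) = (s (uP i)).rename (Fin.castAdd m) := liftSub_castAdd m s _
@[simp] theorem liftSub_vE (i : Fin m) : liftSub m s (vE i) = .var (Fin.natAdd l i) :=
  liftSub_natAdd m s _

end blocks

theorem vec1_eta {α : Type*} (v : Fin 1 → α) : ![v 0] = v := by
  funext i; fin_cases i; rfl

theorem transport_subst {k n m : ℕ} (D : Ty σ k) (a b p : Fin k → Tm σ n) (z : Tm σ n)
    (s : Fin n → Tm σ m) : (transport D a b p z).subst s =
      transport D (fun i => (a i).subst s) (fun i => (b i).subst s) (fun i => (p i).subst s)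
        (z.subst s) := by
  rw [transport, transport, subst_subst, glue_comp (g := fun t : Tm σ n => t.subst s),
    ← vec1_eta fun i => (![z] i).subst s]
  congr 2
  funext i
  exact i.elim0

theorem wk_liftSub {K : Kind} {n m k : ℕ} (t : Expr σ K n) (s : Fin n → Tm σ m) :
    (t.wk k).subst (liftSub k s) = (t.subst s).wk k := by
  rw [wk, wk, rename_subst, subst_rename]
  simp

theorem wk_append {K : Kind} {n m k : ℕ} (t : Expr σ K n) (s : Fin n → Tm σ m)
    (p : Fin k → Tm σ m) : (t.wk k).subst (Fin.append s p) = t.subst s := by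
  rw [wk, rename_subst]
  simp

theorem idTel_subst {k n m : ℕ} (Φ : Ctx σ k) (a b : Fin k → Tm σ n) (s : Fin n → Tm σ m) :
    (idTel Φ a b).subst s = idTel Φ (fun i => (a i).subst s) fun i => (b i).subst s := by
  induction Φ generalizing n m with
  | nil => rfl
  | snoc Λ D ih =>
    simp only [idTel, Tel.subst, ih, id_subst, transport_subst, subst_subst, wk_liftSub,
      liftSub_natAdd, var_subst]

/-- The substitution `[x, x, r(x) / x, y, p]` for an identity context. -/
def diagTel (n k : ℕ) : Fin (n + k + k + k) → Tm σ (n + k) :=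
  block (fun i => .var (Fin.castAdd k i)) (fun i => .var (Fin.natAdd n i))
    (fun i => .var (Fin.natAdd n i)) fun i => .refl (.var (Fin.natAdd n i))

/-- The context `Γ, x : Φ, y : Φ, p : Id_Φ(x, y)`. -/
def Ctx.pathCtx {n k : ℕ} (Γ : Ctx σ n) (Φ : Ctx σ k) : Ctx σ (n + k + k + k) :=
  ((Γ.append (Φ.tel n)).append (Φ.tel (n + k))).append
    (idTel Φ (fun i => .var (Fin.castAdd k (Fin.natAdd n i))) fun i => .var (Fin.natAdd (n + k) i))

namespace Calculus

variable {S : Calculus σ}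

namespace Rules

theorem isMor_pathCtx {n k m : ℕ} {Ξ : Ctx σ m} {Γ : Ctx σ n} {Φ : Ctx σ k} {b : Fin n → Tm σ m}
    {x y p : Fin k → Tm σ m} : S.IsMor Ξ (Γ.pathCtx Φ) (block b x y p) ↔
      S.IsMor Ξ Γ b ∧ S.IsMor Ξ Φ x ∧ S.IsMor Ξ Φ y ∧ S.IsEl Ξ (idTel Φ x y) p := by
  simp only [Ctx.pathCtx, block, isMor_append, isEl_tel, idTel_subst, var_subst, Fin.append_left,
    Fin.append_right, and_assoc]

theorem morEq_pathCtx {n k m : ℕ} {Ξ : Ctx σ m} {Γ : Ctx σ n} {Φ : Ctx σ k} {b b' : Fin n → Tm σ m}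
    {x y p x' y' p' : Fin k → Tm σ m} :
    S.MorEq Ξ (Γ.pathCtx Φ) (block b x y p) (block b' x' y' p') ↔
      S.MorEq Ξ Γ b b' ∧ S.MorEq Ξ Φ x x' ∧ S.MorEq Ξ Φ y y' ∧ S.ElEq Ξ (idTel Φ x y) p p' := by
  simp only [Ctx.pathCtx, block, morEq_append, elEq_tel, idTel_subst, var_subst, Fin.append_left,
    Fin.append_right, and_assoc]

theorem isMor_pathCtx_split {n k m : ℕ} {Ξ : Ctx σ m} {Γ : Ctx σ n} {Φ : Ctx σ k}
    {f : Fin (n + k + k + k) → Tm σ m} : S.IsMor Ξ (Γ.pathCtx Φ) f ↔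
      S.IsMor Ξ Γ (fun i => f (uB i)) ∧ S.IsMor Ξ Φ (fun i => f (uX i)) ∧
      S.IsMor Ξ Φ (fun i => f (uY i)) ∧
      S.IsEl Ξ (idTel Φ (fun i => f (uX i)) fun i => f (uY i)) fun i => f (uP i) := by
  rw [← isMor_pathCtx, block_split]

theorem isEl_idTel_snoc {k n : ℕ} {Ξ : Ctx σ n} {Λ : Ctx σ k} {D : Ty σ k}
    {a b p : Fin (k + 1) → Tm σ n} : S.IsEl Ξ (DTT.idTel (Λ.snoc D) a b) p ↔
      S.IsEl Ξ (DTT.idTel Λ (pre a) (pre b)) (pre p) ∧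
      S.IsTerm Ξ (lst p) (.id (D.subst (pre a)) (lst a)
        (transport D (pre a) (pre b) (pre p) (lst b))) := by
  simp only [DTT.idTel, IsEl, id_subst, transport_subst, subst_subst, wk_append, subst_var',
    Fin.append_right, var_subst]

theorem elEq_idTel_snoc {k n : ℕ} {Ξ : Ctx σ n} {Λ : Ctx σ k} {D : Ty σ k}
    {a b p q : Fin (k + 1) → Tm σ n} : S.ElEq Ξ (DTT.idTel (Λ.snoc D) a b) p q ↔
      S.ElEq Ξ (DTT.idTel Λ (pre a) (pre b)) (pre p) (pre q) ∧
      S.TmEq Ξ (lst p) (lst q) (.id (D.subst (pre a)) (lst a)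
        (transport D (pre a) (pre b) (pre p) (lst b))) := by
  simp only [DTT.idTel, ElEq, id_subst, transport_subst, subst_subst, wk_append, subst_var',
    Fin.append_right, var_subst]

end Rules

/-- The identity context of `Φ` is a context, and elimination over it is sound. -/
structure IdSound (S : Calculus σ) {k : ℕ} (Φ : Ctx σ k) : Prop where
  elim_congr {n m : ℕ} {Γ : Ctx σ n} {Δ : Tel σ (n + k + k + k) m} {C C' d d'} :
    S.TyEq ((Γ.pathCtx Φ).append Δ) C C' →
    S.TmEq ((Γ.append (Φ.tel n)).append (Δ.subst (diagTel n k))) d d'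
      (C.subst (liftSub m (diagTel n k))) →
    S.TmEq ((Γ.pathCtx Φ).append Δ) (elimTy k C d) (elimTy k C' d') C
  elim_comp {n m : ℕ} {Γ : Ctx σ n} {Δ : Tel σ (n + k + k + k) m} {C d} :
    S.IsType ((Γ.pathCtx Φ).append Δ) C →
    S.IsTerm ((Γ.append (Φ.tel n)).append (Δ.subst (diagTel n k))) d
      (C.subst (liftSub m (diagTel n k))) →
    S.TmEq ((Γ.append (Φ.tel n)).append (Δ.subst (diagTel n k)))
      ((elimTy k C d).subst (liftSub m (diagTel n k))) d (C.subst (liftSub m (diagTel n k)))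
  idTel_congr {n : ℕ} {Ξ : Ctx σ n} {Φ' : Ctx σ k} {a a' b b'} : S.IsCtx Ξ → S.CtxEq Φ Φ' →
    S.MorEq Ξ Φ a a' → S.MorEq Ξ Φ b b' →
    S.IsCtx (Ξ.append (idTel Φ a b)) ∧
      S.CtxEq (Ξ.append (idTel Φ a b)) (Ξ.append (idTel Φ' a' b'))
  isEl_refl {n : ℕ} {Ξ : Ctx σ n} {a} : S.IsCtx Ξ → S.IsMor Ξ Φ a →
    S.IsEl Ξ (idTel Φ a a) fun i => .refl (a i)

namespace Rules

variable (h : S.Rules)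
include h

theorem isCtx_append_tel {n k : ℕ} {Γ : Ctx σ n} {Φ : Ctx σ k} (hΓ : S.IsCtx Γ) (hΦ : S.IsCtx Φ) :
    S.IsCtx (Γ.append (Φ.tel n)) ∧
      S.IsMor (Γ.append (Φ.tel n)) Φ fun i => .var (Fin.natAdd n i) := by
  have key : S.IsCtx (Γ.append (Φ.tel n)) := by
    induction Φ with
    | nil => exact hΓ
    | snoc Λ D ih =>
      have h1 := ih hΦ.1
      refine ⟨h1, ?_⟩
      rw [rename_eq_subst]
      refine h.isType_subst h1 ?_ hΦ.2
      exact isEl_tel.1 (h.isEl_natAdd h1)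
  exact ⟨key, isEl_tel.1 (h.isEl_natAdd key)⟩

section

variable {k : ℕ} {Λ : Ctx σ k} (I : S.IdSound Λ) (hΛ : S.IsCtx Λ)
include I

theorem isCtx_idTel {n : ℕ} {Ξ : Ctx σ n} {a b} (hΛ : S.IsCtx Λ) (hΞ : S.IsCtx Ξ)
    (ha : S.IsMor Ξ Λ a) (hb : S.IsMor Ξ Λ b) : S.IsCtx (Ξ.append (DTT.idTel Λ a b)) :=
  (I.idTel_congr hΞ (h.ctxEq_refl hΛ) (h.morEq_refl ha) (h.morEq_refl hb)).1

include hΛ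

theorem isCtx_pathCtx {n : ℕ} {Γ : Ctx σ n} (hΓ : S.IsCtx Γ) : S.IsCtx (Γ.pathCtx Λ) := by
  obtain ⟨h1, h2⟩ := h.isCtx_append_tel hΓ hΛ
  obtain ⟨h3, h4⟩ := h.isCtx_append_tel h1 hΛ
  exact h.isCtx_idTel I hΛ h3 (h.isMor_comp h3 (h.isMor_castAdd h3) h2) h4

theorem isMor_diagTel {n : ℕ} {Γ : Ctx σ n} (hΓ : S.IsCtx Γ) :
    S.IsMor (Γ.append (Λ.tel n)) (Γ.pathCtx Λ) (diagTel n k) := by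
  obtain ⟨h1, h2⟩ := h.isCtx_append_tel hΓ hΛ
  exact isMor_pathCtx.2 ⟨h.isMor_castAdd h1, h2, h2, I.isEl_refl h1 h2⟩

/-- The postcontext `z : D(y)` of the transport. -/
theorem isCtx_transport {D : Ty σ k} (hD : S.IsType Λ D) :
    S.IsCtx ((Ctx.nil.pathCtx Λ).append (Tel.nil.snoc (D.rename uY))) := by
  have h0 := h.isCtx_pathCtx I hΛ (Γ := .nil) trivial
  refine ⟨h0, ?_⟩
  rw [rename_eq_subst]
  exact h.isType_subst h0 (isMor_pathCtx_split.1 (h.isMor_var h0)).2.2.1 hD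

theorem isMor_transport {D : Ty σ k} (hD : S.IsType Λ D) :
    S.IsMor ((Ctx.nil.pathCtx Λ).append (Tel.nil.snoc (D.rename uY))) Λ fun i => .var (vX i) := by
  have h0 := h.isMor_castAdd (h.isCtx_transport I hΛ hD)
  exact (isMor_pathCtx_split.1 h0).2.1

theorem isTerm_transport_gen {D : Ty σ k} (hD : S.IsType Λ D) :
    S.IsTerm ((Ctx.nil.append (Λ.tel 0)).append ((Tel.nil.snoc (D.rename uY)).subst (diagTel 0 k)))
      (.var (Fin.last (0 + k))) ((D.rename vX).subst (liftSub 1 (diagTel 0 k))) := by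
  have h2 := h.isMor_diagTel I hΛ (Γ := .nil) trivial
  have h1 := h.isCtx_append_subst (h.isCtx_append_tel (Γ := .nil) trivial hΛ).1
    (h.isCtx_transport I hΛ hD) h2
  have h3 := (h.isMor_var h1).2
  convert h3 using 1
  · rfl
  rw [liftSub_zero, rename_subst, rename_subst, subst_subst]
  congr 1
  funext i
  rw [liftSub_vX]
  simp [diagTel, rename]
  rfl

/-- Transport is one elimination term over the generic path with postcontext `z : D(y)`,
instantiated at `(a, b, p, z)`. Congruence is thus congruence of elimination followed by
substitution along equal vectors. -/
theorem transport_congr {n : ℕ} {Ξ : Ctx σ n} {D D' : Ty σ k} {a a' b b' p p' z z'}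
    (hΞ : S.IsCtx Ξ) (hD : S.TyEq Λ D D') (ha : S.MorEq Ξ Λ a a') (hb : S.MorEq Ξ Λ b b')
    (hp : S.ElEq Ξ (DTT.idTel Λ a b) p p') (hz : S.TmEq Ξ z z' (D.subst b)) :
    S.TmEq Ξ (transport D a b p z) (transport D' a' b' p' z') (D.subst a) := by
  have hD' := h.tyEq_left hD
  have h1 := I.elim_congr (Γ := .nil) (Δ := Tel.nil.snoc (D.rename uY)) (C := D.rename vX)
    (C' := D'.rename vX) (by
      rw [rename_eq_subst _ vX, rename_eq_subst _ vX]
      exact h.tyEq_subst (h.isCtx_transport I hΛ hD') (h.isMor_transport I hΛ hD') hD)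
    (h.tmEq_refl (h.isTerm_transport_gen I hΛ hD'))
  have h2 : S.MorEq Ξ ((Ctx.nil.pathCtx Λ).append (Tel.nil.snoc (D.rename uY)))
      (glue Fin.elim0 a b p ![z]) (glue Fin.elim0 a' b' p' ![z']) := by
    rw [glue_eq_append, glue_eq_append, morEq_append, morEq_pathCtx]
    refine ⟨⟨trivial, ha, hb, hp⟩, trivial, ?_⟩
    convert hz using 1
    · rfl
    · rfl
    rw [liftSub_zero, subst_subst, rename_subst]
    congr 1
    funext i
    rw [block_uY]
    have : Fin.append (n := 0) (.var : Fin n → Tm σ n) (pre ![z]) = .var :=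
      funext fun i => Fin.append_left _ (pre ![z]) i
    rw [this, subst_var']
  have h3 := h.tmEq_congr hΞ h2 h1
  rwa [rename_subst, show (fun i => glue Fin.elim0 a b p ![z] (vX i)) = a from
    funext fun i => glue_vX _ _ _ _ _ i] at h3

/-- The computation rule for the generic transport, instantiated at `(a, z)`. Because of this
equality, identity contexts over a reflexivity reduce to identity types of `D`, which is what the
inductive step of elimination needs. -/
theorem transport_refl {n : ℕ} {Ξ : Ctx σ n} {D : Ty σ k} {a z} (hΞ : S.IsCtx Ξ)
    (hD : S.IsType Λ D) (ha : S.IsMor Ξ Λ a) (hz : S.IsTerm Ξ z (D.subst a)) :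
    S.TmEq Ξ (transport D a a (fun i => .refl (a i)) z) z (D.subst a) := by
  have h1 := I.elim_comp (Γ := .nil) (Δ := Tel.nil.snoc (D.rename uY)) (C := D.rename vX)
    (by
      rw [rename_eq_subst _ vX]
      exact h.isType_subst (h.isCtx_transport I hΛ hD) (h.isMor_transport I hΛ hD) hD)
    (h.isTerm_transport_gen I hΛ hD)
  have h2 : S.IsMor Ξ ((Ctx.nil.append (Λ.tel 0)).append
      ((Tel.nil.snoc (D.rename uY)).subst (diagTel 0 k)))
      (Fin.append (Fin.append Fin.elim0 a) ![z]) := by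
    rw [isMor_append, isMor_append, isEl_tel]
    refine ⟨⟨trivial, ha⟩, trivial, ?_⟩
    convert hz using 1
    · rfl
    rw [liftSub_zero, liftSub_zero, subst_subst, subst_subst, rename_subst]
    congr 1
    funext i
    have : Fin.append (n := 0) (.var : Fin n → Tm σ n) (pre ![z]) = .var :=
      funext fun i => Fin.append_left _ (pre ![z]) i
    simp only [this, subst_var', diagTel, block_uY, var_subst, Fin.append_right]
  have h3 := h.tmEq_subst hΞ h2 h1
  have e1 : (fun i => (liftSub 1 (diagTel (σ := σ) 0 k) i).subst
      (Fin.append (Fin.append Fin.elim0 a) ![z])) =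
      glue Fin.elim0 a a (fun i => .refl (a i)) ![z] := by
    rw [append_liftSub, glue_eq_append, diagTel,
      block_comp (g := fun t : Tm σ (0 + k) => t.subst (Fin.append Fin.elim0 a))]
    simp only [var_subst, refl_subst, Fin.append_left, Fin.append_right]
  rw [subst_subst, subst_subst, e1, rename_subst] at h3
  have e2 : (fun i => glue Fin.elim0 a a (fun i => .refl (a i)) ![z] (vX i)) = a :=
    funext fun i => glue_vX _ _ _ _ _ i
  have e3 : (Expr.var (Fin.last (0 + k))).subst (Fin.append (Fin.append Fin.elim0 a) ![z]) = z := by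
    rw [var_subst]
    exact Fin.append_right (Fin.append Fin.elim0 a) ![z] 0
  rw [e2, e3] at h3
  exact h3

theorem idTel_snoc_congr {n : ℕ} {D : Ty σ k} {Ξ : Ctx σ n}
    {Φ' : Ctx σ (k + 1)} {a a' b b'} (hΞ : S.IsCtx Ξ) (hΦ : S.CtxEq (Λ.snoc D) Φ')
    (ha : S.MorEq Ξ (Λ.snoc D) a a') (hb : S.MorEq Ξ (Λ.snoc D) b b') :
    S.IsCtx (Ξ.append (DTT.idTel (Λ.snoc D) a b)) ∧
      S.CtxEq (Ξ.append (DTT.idTel (Λ.snoc D) a b)) (Ξ.append (DTT.idTel Φ' a' b')) := by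
  cases Φ' with
  | snoc Λ' D' =>
  obtain ⟨h1, h2⟩ := I.idTel_congr hΞ hΦ.1 ha.1 hb.1
  have hw := h.morEq_refl (h.isMor_castAdd h1)
  have ha' := h.morEq_comp h1 hw ha
  have hb' := h.morEq_comp h1 hw hb
  have key := h.form_eq (h.tyEq_congr h1 ha'.1 hΦ.2) ha'.2 (h.transport_congr I hΛ h1 hΦ.2 ha'.1
    hb'.1 (p := fun i => .var (Fin.natAdd n i)) (p' := fun i => .var (Fin.natAdd n i)) (by
      have := h.elEq_refl (h.isEl_natAdd h1)
      rwa [DTT.idTel_subst] at this) hb'.2)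
  simp only [← rename_eq_subst] at key
  exact ⟨⟨h1, h.tyEq_left key⟩, h2, key⟩

/-- The last entry must have the type `Id(a', r(a)^* a')`, while `r` provides `Id(a', a')`; the two
types are equal by `transport_refl`. -/
theorem isEl_refl_snoc {n : ℕ} {D : Ty σ k} (hD : S.IsType Λ D) {Ξ : Ctx σ n} {a}
    (hΞ : S.IsCtx Ξ) (ha : S.IsMor Ξ (Λ.snoc D) a) :
    S.IsEl Ξ (DTT.idTel (Λ.snoc D) a a) fun i => .refl (a i) := by
  rw [isEl_idTel_snoc]
  refine ⟨I.isEl_refl hΞ ha.1, ?_⟩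
  refine h.isTerm_conv (h.intro ha.2) (h.form_eq (h.tyEq_refl (h.isTerm_type ha.2))
    (h.tmEq_refl ha.2) (h.tmEq_symm ?_))
  exact h.transport_refl I hΛ hΞ hD ha.1 ha.2

end

end Rules

end Calculus

/-! ## Elimination over identity contexts -/

/-- The telescope `z₁ : D(x), z₂ : D(y), q : Id(z₁, p^* z₂)` over `Γ, x : Λ, y : Λ, p`. -/
def overTel {k : ℕ} (D : Ty σ k) (n : ℕ) : Tel σ (n + k + k + k) 3 :=
  ((Tel.nil.snoc (D.rename uX)).snoc ((D.rename uY).wk 1)).snoc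
    (.id ((D.rename uX).wk 2) (.var (Fin.natAdd (n + k + k + k) (0 : Fin 2)))
      (transport D (fun i => .var (Fin.castAdd 2 (uX i))) (fun i => .var (Fin.castAdd 2 (uY i)))
        (fun i => .var (Fin.castAdd 2 (uP i))) (.var (Fin.natAdd (n + k + k + k) (1 : Fin 2)))))

/-- The vector `x, z₁, y, z₂, p, q` over `Γ, x : Λ, y : Λ, p, z₁, z₂, q`. -/
def toPair (n k : ℕ) :
    Fin (n + (k + 1) + (k + 1) + (k + 1)) → Tm σ (n + k + k + k + 3) :=
  block (fun i => .var (vB i)) (ext (fun i => .var (vX i)) (.var (vE 0)))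
    (ext (fun i => .var (vY i)) (.var (vE 1))) (ext (fun i => .var (vP i)) (.var (vE 2)))

/-- The vector `x, y, p, z₁, z₂, q` over `Γ, (x, z₁), (y, z₂), (p, q)`. -/
def ofPair (n k : ℕ) :
    Fin (n + k + k + k + 3) → Tm σ (n + (k + 1) + (k + 1) + (k + 1)) :=
  Fin.append (block (fun i => .var (uB i)) (fun i => .var (pre uX i)) (fun i => .var (pre uY i))
    fun i => .var (pre uP i)) ![.var (lst uX), .var (lst uY), .var (lst uP)]

/-- The vector `x, z₁, x, z₂, r(x), q` over `Γ, x, z₁, z₂, q`. -/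
def verticalPair (n k : ℕ) : Fin (n + (k + 1) + (k + 1) + (k + 1)) → Tm σ (n + k + 3) :=
  block (fun i => .var (Fin.castAdd 3 (Fin.castAdd k i)))
    (ext (fun i => .var (Fin.castAdd 3 (Fin.natAdd n i))) (.var (Fin.natAdd (n + k) 0)))
    (ext (fun i => .var (Fin.castAdd 3 (Fin.natAdd n i))) (.var (Fin.natAdd (n + k) 1)))
    (ext (fun i => .refl (.var (Fin.castAdd 3 (Fin.natAdd n i)))) (.var (Fin.natAdd (n + k) 2)))

theorem glue_subst {n k m l N : ℕ} (b : Fin n → Tm σ l) (x y p : Fin k → Tm σ l)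
    (e : Fin m → Tm σ l) (s : Fin l → Tm σ N) : (fun i => (glue b x y p e i).subst s) =
      glue (fun i => (b i).subst s) (fun i => (x i).subst s) (fun i => (y i).subst s)
        (fun i => (p i).subst s) fun i => (e i).subst s :=
  glue_comp b x y p e fun t : Tm σ l => t.subst s

theorem block_subst {n k l N : ℕ} (b : Fin n → Tm σ l) (x y p : Fin k → Tm σ l)
    (s : Fin l → Tm σ N) : (fun i => (block b x y p i).subst s) =
      block (fun i => (b i).subst s) (fun i => (x i).subst s) (fun i => (y i).subst s)
        fun i => (p i).subst s :=
  block_comp b x y p fun t : Tm σ l => t.subst s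

theorem ext_subst {k l N : ℕ} (x : Fin k → Tm σ l) (a : Tm σ l) (s : Fin l → Tm σ N) :
    (fun i => (ext x a i).subst s) = ext (fun i => (x i).subst s) (a.subst s) :=
  ext_comp (fun t : Tm σ l => t.subst s) x a

theorem append_subst {n k l N : ℕ} (x : Fin n → Tm σ l) (y : Fin k → Tm σ l) (s : Fin l → Tm σ N) :
    (fun i => (Fin.append x y i).subst s) =
      Fin.append (fun i => (x i).subst s) fun i => (y i).subst s :=
  append_comp (fun t : Tm σ l => t.subst s) x y

theorem vec3_subst {l N : ℕ} (x y z : Tm σ l) (s : Fin l → Tm σ N) :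
    (fun i => (![x, y, z] i).subst s) = ![x.subst s, y.subst s, z.subst s] := by
  funext i; fin_cases i <;> rfl

/-- Only this composite of the two reorderings matters: it returns motive and postcontext to
themselves after elimination over `Λ` in the reordered context. -/
theorem toPair_ofPair (n k : ℕ) :
    (fun i => (toPair (σ := σ) n k i).subst (ofPair n k)) = fun i => .var i := by
  simp only [toPair, block_subst, ext_subst, var_subst, ofPair]
  rw [← block_split fun i => (.var i : Tm σ (n + (k + 1) + (k + 1) + (k + 1)))]
  rw [← ext_pre_lst fun i => (.var (uX i) : Tm σ (n + (k + 1) + (k + 1) + (k + 1))),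
    ← ext_pre_lst fun i => (.var (uY i) : Tm σ (n + (k + 1) + (k + 1) + (k + 1))),
    ← ext_pre_lst fun i => (.var (uP i) : Tm σ (n + (k + 1) + (k + 1) + (k + 1)))]
  simp only [← glue_eq_append, glue_vB, glue_vX, glue_vY, glue_vP, glue_vE]
  rfl

theorem toPair_diagTel (n k : ℕ) :
    (fun i => (toPair (σ := σ) n k i).subst (liftSub 3 (diagTel n k))) = verticalPair n k := by
  simp only [toPair, block_subst, ext_subst, var_subst, liftSub_vB, liftSub_vX, liftSub_vY,
    liftSub_vP, liftSub_vE, diagTel, block_uB, block_uX, block_uY, block_uP, rename, verticalPair]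

/-- The diagonal of `Λ, D` is reached in two stages, over `Λ` and then over `D`; its computation
rule is accordingly a composite of two computation rules. -/
theorem verticalPair_diag (n k : ℕ) :
    (fun i => (verticalPair (σ := σ) n k i).subst (diag (n + k))) = diagTel n (k + 1) := by
  simp only [verticalPair, block_subst, ext_subst, var_subst, refl_subst, diag, Fin.append_left,
    Fin.append_right, diagTel]
  congr 1
  · funext i
    refine Fin.lastCases ?_ (fun i => ?_) i
    · simp
    · simp; rfl
  · funext i
    refine Fin.lastCases ?_ (fun i => ?_) i
    · simp
    · simp; rfl
  · funext i
    refine Fin.lastCases ?_ (fun i => ?_) i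
    · simp
    · simp; rfl

section cast

variable {n k m : ℕ}

theorem cast_vB (i : Fin n) : Fin.cast (Nat.add_assoc (n + k + k + k) 3 m) (Fin.castAdd m (vB i)) =
    vB i := rfl
theorem cast_vX (i : Fin k) : Fin.cast (Nat.add_assoc (n + k + k + k) 3 m) (Fin.castAdd m (vX i)) =
    vX i := rfl
theorem cast_vY (i : Fin k) : Fin.cast (Nat.add_assoc (n + k + k + k) 3 m) (Fin.castAdd m (vY i)) =
    vY i := rfl
theorem cast_vP (i : Fin k) : Fin.cast (Nat.add_assoc (n + k + k + k) 3 m) (Fin.castAdd m (vP i)) =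
    vP i := rfl
theorem cast_castAdd_vE (i : Fin 3) :
    Fin.cast (Nat.add_assoc (n + k + k + k) 3 m) (Fin.castAdd m (vE i)) = vE (Fin.castAdd m i) := rfl
theorem cast_natAdd (i : Fin m) :
    Fin.cast (Nat.add_assoc n 3 m) (Fin.natAdd (n + 3) i) = Fin.natAdd n (Fin.natAdd 3 i) :=
  Fin.ext (by simp [Nat.add_assoc])

end cast

/-- The motive of the elimination over `Λ`, in terms of `toPair`. -/
theorem rename_toPair {n k m : ℕ} (C : Ty σ (n + (k + 1) + (k + 1) + (k + 1) + m)) :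
    C.rename (glue vB
        (ext vX (vE (Fin.castAdd m 0))) (ext vY (vE (Fin.castAdd m 1)))
        (ext vP (vE (Fin.castAdd m 2))) fun i => vE (Fin.natAdd 3 i)) =
      (C.subst (liftSub m (toPair n k))).rename (Fin.cast (Nat.add_assoc _ 3 m)) := by
  rw [rename_eq_subst, subst_rename]
  congr 1
  refine funext (glue_cases (fun i => ?_) (fun i => ?_) (fun i => ?_) (fun i => ?_) fun i => ?_)
  · simp [toPair, rename, cast_vB]
  · refine Fin.lastCases ?_ (fun i => ?_) i <;>
      simp [toPair, rename, cast_castAdd_vE, cast_vX]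
  · refine Fin.lastCases ?_ (fun i => ?_) i <;>
      simp [toPair, rename, cast_castAdd_vE, cast_vY]
  · refine Fin.lastCases ?_ (fun i => ?_) i <;>
      simp [toPair, rename, cast_castAdd_vE, cast_vP]
  · simp [rename, cast_natAdd]
    rfl

/-- Elimination over `Λ, D`, in terms of elimination over `Λ`. -/
theorem elimTy_succ {n k m : ℕ} (C : Ty σ (n + (k + 1) + (k + 1) + (k + 1) + m))
    (d : Tm σ (n + (k + 1) + m)) :
    elimTy (k + 1) C d =
      ((elimTy k ((C.subst (liftSub m (toPair n k))).rename (Fin.cast (Nat.add_assoc _ 3 m)))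
        ((elimOne (n := n + k) (C.subst (liftSub m (verticalPair n k))) d).rename
          (Fin.cast (Nat.add_assoc (n + k) 3 m)))).rename
            (Fin.cast (Nat.add_assoc _ 3 m).symm)).subst (liftSub m (ofPair n k)) := by
  rw [rename_subst]
  simp only [elimTy]
  rw [rename_toPair, rename_eq_subst _ (glue _ _ _ _ _)]
  have e1 : (fun i => (.var (glue vB (pre vX) (pre vY) (pre vP) (Fin.append ![lst vX, lst vY, lst vP]
      vE) i) : Tm σ (n + (k + 1) + (k + 1) + (k + 1) + m))) =
      fun i => liftSub m (ofPair n k) (Fin.cast (Nat.add_assoc _ 3 m).symm i) := by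
    refine funext (glue_cases (fun i => ?_) (fun i => ?_) (fun i => ?_) (fun i => ?_) fun i => ?_)
    · have : liftSub m (ofPair (σ := σ) n k) (Fin.cast (Nat.add_assoc _ 3 m).symm (vB i)) =
        _ := liftSub_castAdd m _ (Fin.castAdd 3 (uB i))
      rw [this]
      simp [ofPair, rename]
      rfl
    · have : liftSub m (ofPair (σ := σ) n k) (Fin.cast (Nat.add_assoc _ 3 m).symm (vX i)) =
        _ := liftSub_castAdd m _ (Fin.castAdd 3 (uX i))
      rw [this]
      simp [ofPair, rename]
      rfl
    · have : liftSub m (ofPair (σ := σ) n k) (Fin.cast (Nat.add_assoc _ 3 m).symm (vY i)) =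
        _ := liftSub_castAdd m _ (Fin.castAdd 3 (uY i))
      rw [this]
      simp [ofPair, rename]
      rfl
    · have : liftSub m (ofPair (σ := σ) n k) (Fin.cast (Nat.add_assoc _ 3 m).symm (vP i)) =
        _ := liftSub_castAdd m _ (Fin.castAdd 3 (uP i))
      rw [this]
      simp [ofPair, rename]
      rfl
    · refine Fin.addCases (fun i => ?_) (fun i => ?_) i
      · have : liftSub m (ofPair (σ := σ) n k) (Fin.cast (Nat.add_assoc _ 3 m).symm
          (vE (Fin.castAdd m i))) = _ := liftSub_castAdd m _ (Fin.natAdd _ i)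
        rw [this]
        simp only [glue_vE, Fin.append_left, ofPair, Fin.append_right]
        fin_cases i <;> rfl
      · have e : Fin.cast (Nat.add_assoc (n + k + k + k) 3 m).symm (vE (Fin.natAdd 3 i)) =
            Fin.natAdd (n + k + k + k + 3) i := Fin.ext (by simp [vE, Nat.add_assoc])
        rw [e, liftSub_natAdd]
        simp
        rfl
  have e2 : (glue (fun i => .var (Fin.castAdd m (Fin.castAdd 3 (Fin.castAdd k i))))
      (ext (fun i => .var (Fin.castAdd m (Fin.castAdd 3 (Fin.natAdd n i))))
        (.var (Fin.castAdd m (Fin.natAdd (n + k) 0))))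
      (ext (fun i => .var (Fin.castAdd m (Fin.castAdd 3 (Fin.natAdd n i))))
        (.var (Fin.castAdd m (Fin.natAdd (n + k) 1))))
      (ext (fun i => .refl (.var (Fin.castAdd m (Fin.castAdd 3 (Fin.natAdd n i)))))
        (.var (Fin.castAdd m (Fin.natAdd (n + k) 2))))
      fun i => .var (Fin.natAdd (n + k + 3) i)) = liftSub (σ := σ) m (verticalPair n k) := by
    rw [liftSub_eq, verticalPair, glue_eq_append]
    simp only [block_subst, ext_subst, var_subst, refl_subst]
  rw [e1, e2]

theorem liftSub_cast {n n' k m : ℕ} (s : Fin n → Tm σ n') :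
    (fun i => liftSub (k + m) s (Fin.cast (Nat.add_assoc n k m) i)) =
      fun i => (liftSub m (liftSub k s) i).rename (Fin.cast (Nat.add_assoc n' k m)) := by
  funext i
  refine Fin.addCases (fun i => ?_) (fun i => ?_) i
  · refine Fin.addCases (fun i => ?_) (fun i => ?_) i
    · have : Fin.cast (Nat.add_assoc n k m) (Fin.castAdd m (Fin.castAdd k i)) =
        Fin.castAdd (k + m) i := rfl
      simp only [this, liftSub_castAdd, rename_rename]
      rfl
    · have : Fin.cast (Nat.add_assoc n k m) (Fin.castAdd m (Fin.natAdd n i)) =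
        Fin.natAdd n (Fin.castAdd m i) := rfl
      simp only [this, liftSub_castAdd, liftSub_natAdd, rename]
      rfl
  · have : Fin.cast (Nat.add_assoc n k m) (Fin.natAdd (n + k) i) =
        Fin.natAdd n (Fin.natAdd k i) := Fin.ext (by simp [Nat.add_assoc])
    simp only [this, liftSub_natAdd, rename]
    congr 1
    exact Fin.ext (by simp [Nat.add_assoc])

theorem ofPair_diagTel (n k : ℕ) :
    (fun i => (ofPair (σ := σ) n k i).subst (diagTel n (k + 1))) =
      fun i => (liftSub 3 (diagTel n k) i).subst (diag (n + k)) := by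
  have e1 : (fun i => (liftSub 3 (diagTel (σ := σ) n k) i).subst (diag (n + k))) = Fin.append
      (fun i => (diagTel n k i).subst fun j => .var (Fin.castAdd 1 j))
      ![.var (Fin.last (n + k)), .var (Fin.last (n + k)), .refl (.var (Fin.last (n + k)))] := by
    funext i
    refine Fin.addCases (fun i => ?_) (fun i => ?_) i
    · simp [rename_subst]
    · simp only [liftSub_natAdd, var_subst, diag, Fin.append_right]
  rw [e1]
  simp only [ofPair, append_subst, block_subst, vec3_subst, var_subst, diagTel, refl_subst,
    block_uB, pre, block_uX, block_uY, block_uP]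
  rfl

/-- On the diagonal of `Λ` a transport along `r(x)` survives in the raw syntax, so this is not yet
the context `idCtx` of `D`; `ctxEq_overTel_diag` gives the judgemental equality. -/
theorem append_overTel_diag {n k : ℕ} (Γ : Ctx σ n) (Λ : Ctx σ k) (D : Ty σ k) :
    (Γ.append (Λ.tel n)).append ((overTel D n).subst (diagTel n k)) =
      (((Γ.append (Λ.tel n)).snoc (D.rename (Fin.natAdd n))).snoc
        ((D.rename (Fin.natAdd n)).wk 1)).snoc
        (.id ((D.rename (Fin.natAdd n)).wk 2) (.var (Fin.natAdd (n + k) (0 : Fin 2)))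
          (transport D (fun i => .var (Fin.castAdd 2 (Fin.natAdd n i)))
            (fun i => .var (Fin.castAdd 2 (Fin.natAdd n i)))
            (fun i => .refl (.var (Fin.castAdd 2 (Fin.natAdd n i))))
            (.var (Fin.natAdd (n + k) (1 : Fin 2))))) := by
  have e1 : (D.rename uX).subst (diagTel n k) = D.rename (Fin.natAdd n) := by
    rw [rename_subst, rename_eq_subst]
    simp [diagTel]
  have e2 : (D.rename uY).subst (diagTel n k) = D.rename (Fin.natAdd n) := by
    rw [rename_subst, rename_eq_subst]
    simp [diagTel]
  simp only [overTel, Tel.subst, Ctx.append, id_subst, transport_subst, wk_liftSub, liftSub_zero,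
    e1, e2, var_subst, liftSub_castAdd, liftSub_natAdd]
  simp only [diagTel, block_uX, block_uY, block_uP, rename]

theorem rename_cast_cast {K : Kind} {n m : ℕ} (h : n = m) (t : Expr σ K n) :
    (t.rename (Fin.cast h)).rename (Fin.cast h.symm) = t := by
  rw [rename_rename, rename_eq_subst]
  exact subst_var t

theorem rename_cast_cast' {K : Kind} {n m : ℕ} (h : n = m) (t : Expr σ K m) :
    (t.rename (Fin.cast h.symm)).rename (Fin.cast h) = t := by
  rw [rename_rename, rename_eq_subst]
  exact subst_var t

namespace Calculus.Rules

variable {S : Calculus σ}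

theorem tyEq_cast {n m : ℕ} {Γ : Ctx σ n} {A B} (e : n = m) (hA : S.TyEq Γ A B) :
    S.TyEq (Γ.cast e) (A.rename (Fin.cast e)) (B.rename (Fin.cast e)) := by
  subst e
  simpa [Ctx.cast, rename_eq_subst] using hA

theorem tmEq_cast {n m : ℕ} {Γ : Ctx σ n} {a b A} (e : n = m) (hA : S.TmEq Γ a b A) :
    S.TmEq (Γ.cast e) (a.rename (Fin.cast e)) (b.rename (Fin.cast e)) (A.rename (Fin.cast e)) := by
  subst e
  simpa [Ctx.cast, rename_eq_subst] using hA

theorem tmEq_uncast {n m : ℕ} {Γ : Ctx σ n} {a b A} (e : n = m) (hA : S.TmEq (Γ.cast e) a b A) :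
    S.TmEq Γ (a.rename (Fin.cast e.symm)) (b.rename (Fin.cast e.symm))
      (A.rename (Fin.cast e.symm)) := by
  subst e
  simpa [Ctx.cast, rename_eq_subst] using hA

theorem isEl_overTel {n k N : ℕ} {Ξ : Ctx σ N} {D : Ty σ k} {b : Fin n → Tm σ N}
    {x y p : Fin k → Tm σ N} {z₁ z₂ q : Tm σ N} :
    S.IsEl Ξ ((overTel D n).subst (block b x y p)) ![z₁, z₂, q] ↔ S.IsTerm Ξ z₁ (D.subst x) ∧
      S.IsTerm Ξ z₂ (D.subst y) ∧
      S.IsTerm Ξ q (.id (D.subst x) z₁ (transport D x y p z₂)) := by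
  simp only [overTel, Tel.subst, IsEl, id_subst, transport_subst, subst_subst, var_subst,
    rename_subst, liftSub_castAdd, liftSub_natAdd, wk,
    block_uX, block_uY, block_uP, Fin.append_left, Fin.append_right, true_and, and_assoc,
    subst_var']
  refine and_congr (iff_of_eq ?_) (and_congr_right fun _ => Iff.rfl)
  congr 2
  funext i
  rw [liftSub_zero, block_uX]
  have : Fin.append (n := 0) (.var : Fin N → Tm σ N) (pre (pre (pre ![z₁, z₂, q]))) = .var :=
    funext fun i => Fin.append_left _ (pre (pre (pre ![z₁, z₂, q]))) i
  rw [this, subst_var']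

variable (h : S.Rules)
include h

theorem ctxEq_append {n m : ℕ} {Γ Γ' : Ctx σ n} {Θ : Tel σ n m} (e : S.CtxEq Γ Γ')
    (hΓ : S.IsCtx (Γ.append Θ)) : S.CtxEq (Γ.append Θ) (Γ'.append Θ) := by
  induction Θ with
  | nil => exact e
  | snoc Θ A ih => exact ⟨ih hΓ.1, h.tyEq_refl hΓ.2⟩

theorem isTerm_last {n : ℕ} {Γ : Ctx σ n} {A : Ty σ n} (hΓ : S.IsCtx (Γ.snoc A)) :
    S.IsTerm (Γ.snoc A) (.var (Fin.last n)) (A.wk 1) := by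
  rw [wk, rename_eq_subst]
  exact (h.isMor_var hΓ).2

theorem isMor_castSucc {n : ℕ} {Γ : Ctx σ n} {A : Ty σ n} (hΓ : S.IsCtx (Γ.snoc A)) :
    S.IsMor (Γ.snoc A) Γ fun i => .var (Fin.castAdd 1 i) := (h.isMor_var hΓ).1

theorem isMor_diag {n : ℕ} {Γ : Ctx σ n} {A : Ty σ n} (hΓ : S.IsCtx (Γ.snoc A)) :
    S.IsMor (Γ.snoc A) (Γ.idCtx A) (diag n) := by
  rw [← Ctx.append_idTel, diag, isMor_append, Tel.idTel_subst, isEl_idTel]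
  have h1 := h.isTerm_last hΓ
  rw [wk, rename_eq_subst] at h1
  exact ⟨h.isMor_castSucc hΓ, h1, h1, h.intro h1⟩

theorem isCtx_idCtx {n : ℕ} {Γ : Ctx σ n} {A : Ty σ n} (hA : S.IsType Γ A) :
    S.IsCtx (Γ.idCtx A) := by
  have h1 : S.IsCtx (Γ.snoc A) := ⟨h.isType_ctx hA, hA⟩
  have h2 : S.IsCtx ((Γ.snoc A).snoc (A.wk 1)) := ⟨h1, h.isTerm_type (h.isTerm_last h1)⟩
  refine ⟨h2, ?_⟩
  have h3 := h.isTerm_last h2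
  have h4 := h.isTerm_subst h2 (h.isMor_castSucc h2) (h.isTerm_last h1)
  simp only [wk, subst_subst, rename_eq_subst, var_subst] at h3 h4 ⊢
  exact h.form h4 h3

theorem isMor_ofPair {n k : ℕ} {Γ : Ctx σ n} {Λ : Ctx σ k} {D : Ty σ k}
    (hΓ : S.IsCtx (Γ.pathCtx (Λ.snoc D))) :
    S.IsMor (Γ.pathCtx (Λ.snoc D)) ((Γ.pathCtx Λ).append (overTel D n)) (ofPair n k) := by
  obtain ⟨hb, hx, hy, hp⟩ := isMor_pathCtx_split.1 (h.isMor_var hΓ)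
  rw [isEl_idTel_snoc] at hp
  rw [ofPair, isMor_append, isMor_pathCtx, isEl_overTel]
  exact ⟨⟨hb, hx.1, hy.1, hp.1⟩, hx.2, hy.2, hp.2⟩

section

variable {k : ℕ} {Λ : Ctx σ k} (I : S.IdSound Λ) (hΛ : S.IsCtx Λ) {D : Ty σ k} (hD : S.IsType Λ D)
  {n : ℕ} {Γ : Ctx σ n} (hΓ : S.IsCtx Γ)
include I hΛ hD hΓ

theorem isCtx_overTel : S.IsCtx ((Γ.pathCtx Λ).append (overTel D n)) := by
  have h0 := h.isCtx_pathCtx I hΛ hΓ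
  have h0' := isMor_pathCtx_split.1 (h.isMor_var h0)
  have h1 : S.IsCtx ((Γ.pathCtx Λ).snoc (D.rename uX)) :=
    ⟨h0, by rw [rename_eq_subst]; exact h.isType_subst h0 h0'.2.1 hD⟩
  have h1' := isMor_pathCtx_split.1 (h.isMor_castSucc h1)
  have h2 : S.IsCtx (((Γ.pathCtx Λ).snoc (D.rename uX)).snoc ((D.rename uY).wk 1)) :=
    ⟨h1, by
      rw [wk, rename_rename, rename_eq_subst D fun i => Fin.castAdd 1 (uY i)]
      exact h.isType_subst h1 h1'.2.2.1 hD⟩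
  have h2' := isMor_pathCtx_split.1 (h.isMor_comp h2 (h.isMor_castSucc h2) (h.isMor_castSucc h1))
  refine ⟨h2, ?_⟩
  have e1 : (D.rename (uX (n := n))).wk 2 = D.subst fun i => .var (Fin.castAdd 2 (uX i)) := by
    rw [wk, rename_rename, rename_eq_subst]
  rw [e1]
  have h3 := h.isTerm_subst h2 (h.isMor_castSucc h2) (h.isTerm_last h1)
  have h4 := h.isTerm_last h2
  have e3 : ((D.rename (uX (n := n))).wk 1).subst (fun i => .var (Fin.castAdd 1 i)) =
      D.subst fun i => .var (Fin.castAdd 2 (uX i)) := by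
    rw [wk, rename_subst, rename_subst]
    rfl
  have e4 : ((D.rename (uY (n := n))).wk 1).wk 1 = D.subst fun i => .var (Fin.castAdd 2 (uY i)) := by
    rw [wk, wk, rename_rename, rename_rename, rename_eq_subst]
    rfl
  rw [e3] at h3
  rw [e4] at h4
  refine h.form h3 (h.tmEq_left (h.transport_congr I hΛ h2 (h.tyEq_refl hD)
    (h.morEq_refl h2'.2.1) (h.morEq_refl h2'.2.2.1) (h.elEq_refl h2'.2.2.2) (h.tmEq_refl h4)))

theorem isMor_toPair : S.IsMor ((Γ.pathCtx Λ).append (overTel D n)) (Γ.pathCtx (Λ.snoc D))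
    (toPair n k) := by
  obtain ⟨h1, h2⟩ := isMor_append_split.1 (h.isMor_var (h.isCtx_overTel I hΛ hD hΓ))
  obtain ⟨hb, hx, hy, hp⟩ := isMor_pathCtx_split.1 h1
  rw [← block_split fun i => Expr.var (Fin.castAdd 3 i), ← vec3_eta fun i => Expr.var _,
    isEl_overTel] at h2
  rw [toPair, isMor_pathCtx, isEl_idTel_snoc]
  simp only [pre_ext, lst_ext]
  refine ⟨hb, ⟨?_, ?_⟩, ⟨?_, ?_⟩, hp, h2.2.2⟩
  · rw [pre_ext]; exact hx
  · rw [pre_ext, lst_ext]; exact h2.1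
  · rw [pre_ext]; exact hy
  · rw [pre_ext, lst_ext]; exact h2.2.1

theorem isCtx_overTel_diag :
    S.IsCtx ((Γ.append (Λ.tel n)).append ((overTel D n).subst (diagTel n k))) :=
  h.isCtx_append_subst (h.isCtx_append_tel hΓ hΛ).1 (h.isCtx_overTel I hΛ hD hΓ)
    (h.isMor_diagTel I hΛ hΓ)

/-- The two contexts differ in the last type only, and there by `r(x)^* z₂ = z₂`. -/
theorem ctxEq_overTel_diag :
    S.CtxEq ((Γ.append (Λ.tel n)).append ((overTel D n).subst (diagTel n k)))
      ((Γ.append (Λ.tel n)).idCtx (D.rename (Fin.natAdd n))) := by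
  have h0 := h.isCtx_overTel_diag I hΛ hD hΓ
  rw [append_overTel_diag] at h0 ⊢
  obtain ⟨h1, h2⟩ := h0
  have hx := h.isMor_comp h1 (h.isMor_comp h1 (h.isMor_castSucc h1) (h.isMor_castSucc h1.1))
    (h.isCtx_append_tel hΓ hΛ).2
  have h3 := h.isTerm_subst h1 (h.isMor_castSucc h1) (h.isTerm_last h1.1)
  have h4 := h.isTerm_last h1
  have e3 : ((D.rename (Fin.natAdd n)).wk 1).subst (fun i => .var (Fin.castAdd 1 i)) =
      D.subst fun i => .var (Fin.castAdd 2 (Fin.natAdd n i)) := by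
    rw [wk, rename_subst, rename_subst]
    rfl
  have e4 : ((D.rename (Fin.natAdd n)).wk 1).wk 1 =
      D.subst fun i => .var (Fin.castAdd 2 (Fin.natAdd n i)) := by
    rw [wk, wk, rename_rename, rename_rename, rename_eq_subst]
    rfl
  have e5 : (D.rename (Fin.natAdd n)).wk 2 =
      D.subst fun i => .var (Fin.castAdd 2 (Fin.natAdd n i)) := by
    rw [wk, rename_rename, rename_eq_subst]
  rw [e3] at h3
  rw [e4] at h4
  refine ⟨h.ctxEq_refl h1, ?_⟩
  rw [e5]
  exact h.form_eq (h.tyEq_refl (h.isTerm_type h3)) (h.tmEq_refl h3)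
    (h.transport_refl I hΛ h1 hD hx h4)

end

end Calculus.Rules

theorem append_cat_overTel {k n m : ℕ} (Γ : Ctx σ n) (Λ : Ctx σ k) (D : Ty σ k)
    (Δ : Tel σ (n + (k + 1) + (k + 1) + (k + 1)) m) :
    (Γ.append (Λ.tel n)).append (((overTel D n).cat (Δ.subst (toPair n k))).subst (diagTel n k)) =
      (((Γ.append (Λ.tel n)).append ((overTel D n).subst (diagTel n k))).append
        (Δ.subst (verticalPair n k))).cast (Nat.add_assoc _ 3 m) := by
  rw [Tel.cat_subst, Ctx.append_cat, Tel.subst_subst, toPair_diagTel]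

namespace Calculus.Rules

variable {S : Calculus σ} (h : S.Rules)
include h

section

variable {k : ℕ} {Λ : Ctx σ k} (I : S.IdSound Λ) (hΛ : S.IsCtx Λ) {D : Ty σ k} (hD : S.IsType Λ D)
  {n m : ℕ} {Γ : Ctx σ n} {Δ : Tel σ (n + (k + 1) + (k + 1) + (k + 1)) m}
include I hΛ hD

theorem isMor_verticalPair (hΓ : S.IsCtx Γ) :
    S.IsMor ((Γ.append (Λ.tel n)).idCtx (D.rename (Fin.natAdd n))) (Γ.pathCtx (Λ.snoc D))
      (verticalPair n k) := by
  have h0 := h.isCtx_overTel_diag I hΛ hD hΓ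
  have h1 := (h.isMor_lift (h.isCtx_append_tel hΓ hΛ).1 (h.isCtx_overTel I hΛ hD hΓ)
    (h.isMor_diagTel I hΛ hΓ)).2
  have h2 := h.isMor_comp h0 h1 (h.isMor_toPair I hΛ hD hΓ)
  rw [toPair_diagTel] at h2
  exact h.isMor_ctxConv h0 (h.isCtx_idCtx (h.isCtx_append_tel (Φ := Λ.snoc D) hΓ ⟨hΛ, hD⟩).1.2)
    (h.ctxEq_overTel_diag I hΛ hD hΓ) h2

/-- The generating family for elimination over `Λ`: elimination over `D(x)` takes place in a genuine
identity context and is then carried across `ctxEq_overTel_diag` to the context which elimination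
over `Λ` prescribes. -/
theorem elimOne_verticalPair {C C' : Ty σ (n + (k + 1) + (k + 1) + (k + 1) + m)}
    {d d' : Tm σ (n + (k + 1) + m)} (hΓ : S.IsCtx Γ)
    (hC : S.TyEq ((Γ.pathCtx (Λ.snoc D)).append Δ) C C')
    (hd : S.TmEq ((Γ.append ((Λ.snoc D).tel n)).append (Δ.subst (diagTel n (k + 1)))) d d'
      (C.subst (liftSub m (diagTel n (k + 1))))) :
    S.TmEq ((((Γ.append (Λ.tel n)).append ((overTel D n).subst (diagTel n k))).append
        (Δ.subst (verticalPair n k))))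
      (elimOne (n := n + k) (C.subst (liftSub m (verticalPair n k))) d)
      (elimOne (n := n + k) (C'.subst (liftSub m (verticalPair n k))) d')
      (C.subst (liftSub m (verticalPair n k))) := by
  have hK := h.isCtx_idCtx (h.isCtx_append_tel (Φ := Λ.snoc D) hΓ ⟨hΛ, hD⟩).1.2
  have hΔ := h.isType_ctx (h.tyEq_left hC)
  have hv := h.isMor_lift hK hΔ (h.isMor_verticalPair I hΛ hD hΓ)
  have h1 := h.elimOne_congr (Γ := Γ.append (Λ.tel n)) (h.tyEq_subst hv.1 hv.2 hC) (d := d) (d' := d') (by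
    rw [Tel.subst_subst, subst_subst, liftSub_liftSub, verticalPair_diag]
    exact hd)
  have h0 := h.isCtx_overTel_diag I hΛ hD hΓ
  have he := h.ctxEq_symm h0 hK (h.ctxEq_overTel_diag I hΛ hD hΓ)
  have he' := h.ctxEq_append he hv.1
  refine h.tmEq_ctxConv hv.1 ?_ he' h1
  have := h.isMor_var_of_ctxEq h0 (h.ctxEq_overTel_diag I hΛ hD hΓ)
  simpa using h.isCtx_append_subst h0 hv.1 this

/-- Conjugation by `toPair` and `ofPair` turns elimination over `Λ, D` into elimination over `Λ`
with the generating family of `elimOne_verticalPair`. The two clauses share this data and are proved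
together. For computation, the outer eliminator reduces on the diagonal of `Λ` to the inner one
(`h5`), which reduces on the diagonal of `D` to `d` (`h8`). -/
theorem elimTy_congr_snoc {C C' : Ty σ (n + (k + 1) + (k + 1) + (k + 1) + m)}
    {d d' : Tm σ (n + (k + 1) + m)} 
    (hC : S.TyEq ((Γ.pathCtx (Λ.snoc D)).append Δ) C C')
    (hd : S.TmEq ((Γ.append ((Λ.snoc D).tel n)).append (Δ.subst (diagTel n (k + 1)))) d d'
      (C.subst (liftSub m (diagTel n (k + 1))))) :
    S.TmEq ((Γ.pathCtx (Λ.snoc D)).append Δ) (elimTy (k + 1) C d) (elimTy (k + 1) C' d') C ∧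
    S.TmEq ((Γ.append ((Λ.snoc D).tel n)).append (Δ.subst (diagTel n (k + 1))))
      ((elimTy (k + 1) C d).subst (liftSub m (diagTel n (k + 1)))) d
      (C.subst (liftSub m (diagTel n (k + 1)))) := by
  have hΔ := h.isType_ctx (h.tyEq_left hC)
  have hG := isCtx_of_append hΔ
  have hΓ : S.IsCtx Γ := isCtx_of_append (isCtx_of_append (isCtx_of_append hG))
  have hT := h.isMor_lift (h.isCtx_overTel I hΛ hD hΓ) hΔ (h.isMor_toPair I hΛ hD hΓ)
  have h1 := tyEq_cast (Nat.add_assoc _ 3 m) (h.tyEq_subst hT.1 hT.2 hC)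
  rw [← Ctx.append_cat] at h1
  have h2 := h.elimOne_verticalPair I hΛ hD hΓ hC hd
  have h3 := tmEq_cast (Nat.add_assoc _ 3 m) h2
  rw [← append_cat_overTel] at h3
  have e1 : ((C.subst (liftSub m (toPair n k))).rename (Fin.cast (Nat.add_assoc _ 3 m))).subst
      (liftSub (3 + m) (diagTel n k)) = (C.subst (liftSub m (verticalPair n k))).rename
        (Fin.cast (Nat.add_assoc (n + k) 3 m)) := by
    rw [rename_subst, liftSub_cast, ← toPair_diagTel, ← liftSub_liftSub, ← subst_subst,
      ← subst_rename]
  rw [← e1] at h3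
  have hP := h.isMor_lift hG hT.1 (h.isMor_ofPair hG)
  have e2 : (Δ.subst (toPair n k)).subst (ofPair n k) = Δ := by
    rw [Tel.subst_subst, toPair_ofPair, Tel.subst_var]
  have e3 : (C.subst (liftSub m (toPair n k))).subst (liftSub m (ofPair n k)) = C := by
    rw [subst_subst, liftSub_liftSub, toPair_ofPair, liftSub_var, Expr.subst_var]
  rw [e2] at hP
  refine ⟨?_, ?_⟩
  · have h4 := I.elim_congr h1 h3
    rw [Ctx.append_cat] at h4
    have h5 := tmEq_uncast _ h4
    rw [rename_cast_cast] at h5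
    have h6 := h.tmEq_subst hP.1 hP.2 h5
    rw [e3] at h6
    rw [elimTy_succ, elimTy_succ]
    exact h6
  · have h4 := I.elim_comp (h.tyEq_left h1) (h.tmEq_left h3)
    rw [e1, append_cat_overTel] at h4
    have h5 := tmEq_uncast _ h4
    rw [rename_cast_cast, rename_cast_cast] at h5
    have hK := h.isCtx_idCtx (h.isCtx_append_tel (Φ := Λ.snoc D) hΓ ⟨hΛ, hD⟩).1.2
    have h0 := h.isCtx_overTel_diag I hΛ hD hΓ
    have hv := h.isMor_lift hK hΔ (h.isMor_verticalPair I hΛ hD hΓ)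
    have he := h.ctxEq_append (h.ctxEq_overTel_diag I hΛ hD hΓ)
      (h.isType_ctx (h.isTerm_type (h.tmEq_left h2)))
    have h6 := h.tmEq_ctxConv (h.isType_ctx (h.isTerm_type (h.tmEq_left h2))) hv.1 he h5
    have hg := (h.isCtx_append_tel (Φ := Λ.snoc D) hΓ ⟨hΛ, hD⟩).1
    have hdi := h.isMor_lift hg hv.1 (h.isMor_diag hg)
    have h7 := h.tmEq_subst hdi.1 hdi.2 h6
    rw [Tel.subst_subst, verticalPair_diag] at h7
    have e4 : (C.subst (liftSub m (verticalPair n k))).subst (liftSub m (diag (n + k))) =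
        C.subst (liftSub m (diagTel n (k + 1))) := by
      rw [subst_subst, liftSub_liftSub, verticalPair_diag]
    have h8 := h.elimOne_comp (Γ := Γ.append (Λ.tel n)) (A := D.rename (Fin.natAdd n))
      (h.isType_subst hv.1 hv.2 (h.tyEq_left hC)) (d := d) (by
        rw [Tel.subst_subst, verticalPair_diag, e4]
        exact h.tmEq_left hd)
    rw [Tel.subst_subst, verticalPair_diag] at h8
    rw [e4] at h7 h8
    refine h.tmEq_trans ?_ h8
    convert h7 using 1
    rw [elimTy_succ, subst_subst, liftSub_liftSub, ofPair_diagTel, ← liftSub_liftSub, ← subst_subst]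
    congr 1
    -- The particular eliminator is irrelevant from here on: only the interplay of the associativity
    -- cast with substitution remains, and it holds for any term.
    generalize elimTy k _ _ = E
    rw [← rename_cast_cast' (Nat.add_assoc (n + k + k + k) 3 m) E]
    generalize E.rename _ = E'
    rw [rename_cast_cast, rename_subst, liftSub_cast, ← subst_rename, rename_cast_cast]

end

/-- The four clauses have to be carried through one induction: elimination over `Λ` provides
transport, transport is needed for the identity context of `Λ, D` to be a context containing `r`,
and this in turn is needed for elimination over `Λ, D`. -/
theorem idSound {k : ℕ} {Φ : Ctx σ k} (hΦ : S.IsCtx Φ) : S.IdSound Φ := by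
  induction Φ with
  | nil =>
    -- For the empty context the diagonal is the identity and the eliminator is `d` itself.
    have e (n : ℕ) : diagTel (σ := σ) n 0 = fun i => .var i := by
      refine funext (block_cases (fun i => ?_) (fun i => i.elim0) (fun i => i.elim0)
        fun i => i.elim0)
      simp [diagTel]
      rfl
    refine ⟨fun {n m Γ Δ C C' d d'} hC hd => ?_, fun {n m Γ Δ C d} hC hd => ?_,
      fun {n Ξ Φ' a a' b b'} hΞ e _ _ => ?_, fun hΞ ha => trivial⟩
    · rw [e, liftSub_var, Tel.subst_var, Expr.subst_var] at hd
      exact hd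
    · simp only [e, liftSub_var, Tel.subst_var, Expr.subst_var] at hd ⊢
      exact h.tmEq_refl hd
    · cases Φ'
      exact ⟨hΞ, h.ctxEq_refl hΞ⟩
  | snoc Λ D ih =>
    have I := ih hΦ.1
    exact ⟨fun hC hd => (h.elimTy_congr_snoc I hΦ.1 hΦ.2 hC hd).1,
      fun hC hd => (h.elimTy_congr_snoc I hΦ.1 hΦ.2 (h.tyEq_refl hC) (h.tmEq_refl hd)).2,
      fun hΞ e ha hb => h.idTel_snoc_congr I hΦ.1 hΞ e ha hb,
      fun hΞ ha => h.isEl_refl_snoc I hΦ.1 hΦ.2 hΞ ha⟩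

end Calculus.Rules

/-! ### Instances and conversion of identity contexts -/

theorem diagTel_append {n k m N : ℕ} (b : Fin n → Tm σ N) (x : Fin k → Tm σ N)
    (e : Fin m → Tm σ N) :
    (fun i => (liftSub m (diagTel n k) i).subst (Fin.append (Fin.append b x) e)) =
      glue b x x (fun i => .refl (x i)) e := by
  rw [append_liftSub, diagTel, block_subst, glue_eq_append]
  simp only [var_subst, refl_subst, Fin.append_left, Fin.append_right]

namespace Calculus.Rules

variable {S : Calculus σ}

theorem isMor_glue {n k m N : ℕ} {Ξ : Ctx σ N} {Γ : Ctx σ n} {Φ : Ctx σ k}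
    {Δ : Tel σ (n + k + k + k) m} {b : Fin n → Tm σ N} {x y p : Fin k → Tm σ N}
    {e : Fin m → Tm σ N} : S.IsMor Ξ ((Γ.pathCtx Φ).append Δ) (glue b x y p e) ↔
      S.IsMor Ξ (Γ.pathCtx Φ) (block b x y p) ∧ S.IsEl Ξ (Δ.subst (block b x y p)) e := by
  rw [glue_eq_append, isMor_append]

variable (h : S.Rules)
include h

theorem isEl_congr {n m k : ℕ} {Ξ : Ctx σ n} {Ω : Ctx σ m} {Θ : Tel σ m k} {f g p}
    (hΞ : S.IsCtx Ξ) (hf : S.MorEq Ξ Ω f g) (hp : S.IsEl Ω Θ p) :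
    S.ElEq Ξ (Θ.subst f) (fun i => (p i).subst f) fun i => (p i).subst g := by
  induction Θ with
  | nil => trivial
  | snoc Θ A ih =>
    refine ⟨ih hp.1, ?_⟩
    have := h.isTerm_substEq hΞ hf hp.2
    rw [subst_subst, append_subst] at this
    rw [subst_subst, append_liftSub]
    simp only [var_subst, subst_var'] at this ⊢
    exact this

theorem ctxEq_idTel {n k : ℕ} {Ξ : Ctx σ n} {Φ Φ' : Ctx σ k} {a a' b b'} (hΞ : S.IsCtx Ξ)
    (hΦ : S.IsCtx Φ) (e : S.CtxEq Φ Φ') (ha : S.MorEq Ξ Φ a a') (hb : S.MorEq Ξ Φ b b') :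
    S.IsCtx (Ξ.append (DTT.idTel Φ a b)) ∧
      S.CtxEq (Ξ.append (DTT.idTel Φ a b)) (Ξ.append (DTT.idTel Φ' a' b')) :=
  (h.idSound hΦ).idTel_congr hΞ e ha hb

theorem isEl_idTel_conv {n k : ℕ} {Ξ : Ctx σ n} {Φ Φ' : Ctx σ k} {a a' b b' p} (hΞ : S.IsCtx Ξ)
    (hΦ : S.IsCtx Φ) (e : S.CtxEq Φ Φ') (ha : S.MorEq Ξ Φ a a') (hb : S.MorEq Ξ Φ b b')
    (hp : S.IsEl Ξ (DTT.idTel Φ a b) p) : S.IsEl Ξ (DTT.idTel Φ' a' b') p :=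
  (h.isEl_iff hΞ).2 (h.isMor_conv hΞ (h.ctxEq_idTel hΞ hΦ e ha hb).2 ((h.isEl_iff hΞ).1 hp))

theorem elEq_idTel_conv {n k : ℕ} {Ξ : Ctx σ n} {Φ Φ' : Ctx σ k} {a a' b b' p q} (hΞ : S.IsCtx Ξ)
    (hΦ : S.IsCtx Φ) (e : S.CtxEq Φ Φ') (ha : S.MorEq Ξ Φ a a') (hb : S.MorEq Ξ Φ b b')
    (hp : S.ElEq Ξ (DTT.idTel Φ a b) p q) : S.ElEq Ξ (DTT.idTel Φ' a' b') p q :=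
  (h.elEq_iff hΞ).2 (h.morEq_conv hΞ (h.ctxEq_idTel hΞ hΦ e ha hb).2 ((h.elEq_iff hΞ).1 hp))

/-! ### Elimination into telescopes -/

section

variable {n k m l : ℕ} {Γ : Ctx σ n} {Φ : Ctx σ k} {Δ : Tel σ (n + k + k + k) m}
  {Θ : Tel σ (n + k + k + k + m) l}

theorem isMor_liftSub_diagTel (hΦ : S.IsCtx Φ) (hG : S.IsCtx ((Γ.pathCtx Φ).append Δ)) :
    S.IsCtx ((Γ.append (Φ.tel n)).append (Δ.subst (diagTel n k))) ∧
    S.IsMor ((Γ.append (Φ.tel n)).append (Δ.subst (diagTel n k))) ((Γ.pathCtx Φ).append Δ)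
      (liftSub m (diagTel n k)) := by
  have hΓ : S.IsCtx Γ :=
    isCtx_of_append (isCtx_of_append (isCtx_of_append (isCtx_of_append hG)))
  exact h.isMor_lift (h.isCtx_append_tel hΓ hΦ).1 hG (h.isMor_diagTel (h.idSound hΦ) hΦ hΓ)

/-- Proceeds entry by entry. The type of the last entry mentions the eliminators already built, so
the given entry of `d` fits only after conversion along their computation rule; hence typing and
computation are proved simultaneously. -/
theorem elimTel_sound (hΦ : S.IsCtx Φ) (hΘ : S.IsCtx (((Γ.pathCtx Φ).append Δ).append Θ)) {d}
    (hd : S.IsEl ((Γ.append (Φ.tel n)).append (Δ.subst (diagTel n k)))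
      (Θ.subst (liftSub m (diagTel n k))) d) :
    S.IsEl ((Γ.pathCtx Φ).append Δ) Θ (elimTel k Θ d) ∧
    S.ElEq ((Γ.append (Φ.tel n)).append (Δ.subst (diagTel n k)))
      (Θ.subst (liftSub m (diagTel n k)))
      (fun i => (elimTel k Θ d i).subst (liftSub m (diagTel n k))) d := by
  have I := h.idSound hΦ
  have hG := isCtx_of_append hΘ
  obtain ⟨hG', hδ⟩ := h.isMor_liftSub_diagTel hΦ hG
  induction Θ with
  | nil => exact ⟨trivial, trivial⟩
  | @snoc l Θ D ih =>
    obtain ⟨h1, h2⟩ := ih hΘ.1 hd.1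
    have hC := h.isType_subst hG ((h.isEl_iff hG).1 h1) hΘ.2
    have hm : S.MorEq ((Γ.append (Φ.tel n)).append (Δ.subst (diagTel n k)))
        (((Γ.pathCtx Φ).append Δ).append Θ)
        (Fin.append (liftSub m (diagTel n k)) (pre d))
        (Fin.append (liftSub m (diagTel n k))
          fun i => (elimTel k Θ (pre d) i).subst (liftSub m (diagTel n k))) :=
      morEq_append.2 ⟨h.morEq_refl hδ, h.elEq_symm (h.isCtx_append_subst hG' hΘ.1 hδ) h2⟩
    have hD := h.isType_substEq hG' hm hΘ.2
    have e1 : (D.subst (Fin.append .var (elimTel k Θ (pre d)))).subst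
        (liftSub m (diagTel n k)) = D.subst (Fin.append (liftSub m (diagTel n k))
          fun i => (elimTel k Θ (pre d) i).subst (liftSub m (diagTel n k))) := by
      rw [subst_subst, append_subst]
      simp only [var_subst]
    have hd2 := hd.2
    rw [subst_subst, append_liftSub] at hd2
    simp only [subst_var'] at hd2
    have hd3 := h.isTerm_conv hd2 hD
    rw [← e1] at hd3
    have h3 := h.tmEq_left (I.elim_congr (h.tyEq_refl hC) (h.tmEq_refl hd3))
    have h4 := I.elim_comp hC hd3
    refine ⟨?_, ?_⟩
    · simp only [elimTel, IsEl, pre_ext, lst_ext]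
      exact ⟨h1, h3⟩
    · simp only [elimTel, ElEq, Tel.subst]
      rw [ext_subst]
      simp only [pre_ext, lst_ext]
      refine ⟨h2, ?_⟩
      rw [e1] at h4
      refine h.tmEq_conv (h.tmEq_conv h4 (h.tyEq_symm hD)) ?_
      rw [subst_subst, append_liftSub]
      simp only [subst_var']
      exact h.isType_substEq hG' (morEq_append.2 ⟨h.morEq_refl hδ,
        h.elEq_symm (h.isCtx_append_subst hG' hΘ.1 hδ) h2⟩) hΘ.2

theorem elimTel_refl (hΦ : S.IsCtx Φ) (hΘ : S.IsCtx (((Γ.pathCtx Φ).append Δ).append Θ)) {d}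
    (hd : S.IsEl ((Γ.append (Φ.tel n)).append (Δ.subst (diagTel n k)))
      (Θ.subst (liftSub m (diagTel n k))) d) {N : ℕ} {Ξ : Ctx σ N} (hΞ : S.IsCtx Ξ) {b x e}
    (hb : S.IsMor Ξ Γ b) (hx : S.IsMor Ξ Φ x)
    (he : S.IsEl Ξ (Δ.subst (block b x x fun i => .refl (x i))) e) :
    S.ElEq Ξ (Θ.subst (glue b x x (fun i => .refl (x i)) e))
      (fun i => (elimTel k Θ d i).subst (glue b x x (fun i => .refl (x i)) e))
      fun i => (d i).subst (Fin.append (Fin.append b x) e) := by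
  have e0 : (fun i => (diagTel (σ := σ) n k i).subst (Fin.append b x)) =
      block b x x fun i => .refl (x i) := by
    rw [diagTel, block_subst]
    simp only [var_subst, refl_subst, Fin.append_left, Fin.append_right]
  have h1 : S.IsMor Ξ ((Γ.append (Φ.tel n)).append (Δ.subst (diagTel n k)))
      (Fin.append (Fin.append b x) e) := by
    rw [isMor_append, isMor_append, isEl_tel, Tel.subst_subst, e0]
    exact ⟨⟨hb, hx⟩, he⟩
  have h2 := h.elEq_subst hΞ h1 (h.elimTel_sound hΦ hΘ hd).2
  simpa only [Tel.subst_subst, subst_subst, diagTel_append] using h2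

end

/-! ### Elements of identity contexts are determined on the diagonal -/

/-- If elimination along `δ` is possible, elements of an identity context are equal as soon as
they are equal after substitution of `δ`; this is a consequence of the discrete identity rule. -/
theorem elEq_of_elim {N N' l : ℕ} {G : Ctx σ N} {G' : Ctx σ N'} {δ : Fin N → Tm σ N'}
    (hG : S.IsCtx G)
    (elim : ∀ C d, S.IsType G C → S.IsTerm G' d (C.subst δ) → ∃ t, S.IsTerm G t C)
    {Ψ : Ctx σ l} (hΨ : S.IsCtx Ψ) {f g s t} (hf : S.IsMor G Ψ f) (hg : S.IsMor G Ψ g)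
    (hs : S.IsEl G (DTT.idTel Ψ f g) s) (ht : S.IsEl G (DTT.idTel Ψ f g) t)
    (hst : S.ElEq G' ((DTT.idTel Ψ f g).subst δ) (fun i => (s i).subst δ)
      fun i => (t i).subst δ) : S.ElEq G (DTT.idTel Ψ f g) s t := by
  induction Ψ with
  | nil => trivial
  | snoc Λ D ih =>
    rw [isEl_idTel_snoc] at hs ht
    rw [idTel_subst, elEq_idTel_snoc] at hst
    rw [elEq_idTel_snoc]
    have h1 := ih hΨ.1 hf.1 hg.1 hs.1 ht.1 (by rw [idTel_subst]; exact hst.1)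
    refine ⟨h1, ?_⟩
    -- The types of the last entries of `s` and `t` involve transport along their initial parts,
    -- which are equal by `h1`.
    have ht2 := h.isTerm_conv ht.2 (h.form_eq (h.tyEq_refl (h.isTerm_type hf.2))
      (h.tmEq_refl hf.2) (h.transport_congr (h.idSound hΨ.1) hΨ.1 hG (h.tyEq_refl hΨ.2)
        (h.morEq_refl hf.1) (h.morEq_refl hg.1)
        (h.elEq_symm (h.ctxEq_idTel hG hΨ.1 (h.ctxEq_refl hΨ.1) (h.morEq_refl hf.1)
          (h.morEq_refl hg.1)).1 h1) (h.tmEq_refl hg.2)))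
    -- On the diagonal the last entries agree, so `r` inhabits their identity type there;
    -- elimination extends this to all of `G`, and reflection then gives equality.
    obtain ⟨r, hr⟩ := elim _ (.refl ((lst s).subst δ)) (h.form hs.2 ht2) (by
      have h2 : S.TmEq G' ((lst s).subst δ) ((lst t).subst δ) _ := hst.2
      have h3 := h.isTerm_conv (h.intro (h.tmEq_left h2)) (h.form_eq (h.tyEq_refl
        (h.isTerm_type (h.tmEq_left h2))) (h.tmEq_refl (h.tmEq_left h2)) h2)
      simp only [id_subst, transport_subst, subst_subst]
      exact h3)
    exact h.reflection hs.2 ht2 hr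

/-- Elements of an identity context over `Γ, x : Φ, y : Φ, p : Id_Φ(x, y), Δ` are determined by
their values at `r(x)`. -/
theorem elEq_of_diagTel {n k m l : ℕ} {Γ : Ctx σ n} {Φ : Ctx σ k} {Δ : Tel σ (n + k + k + k) m}
    (hΦ : S.IsCtx Φ) (hG : S.IsCtx ((Γ.pathCtx Φ).append Δ)) {Ψ : Ctx σ l} (hΨ : S.IsCtx Ψ)
    {f g s t} (hf : S.IsMor ((Γ.pathCtx Φ).append Δ) Ψ f)
    (hg : S.IsMor ((Γ.pathCtx Φ).append Δ) Ψ g)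
    (hs : S.IsEl ((Γ.pathCtx Φ).append Δ) (DTT.idTel Ψ f g) s)
    (ht : S.IsEl ((Γ.pathCtx Φ).append Δ) (DTT.idTel Ψ f g) t)
    (hst : S.ElEq ((Γ.append (Φ.tel n)).append (Δ.subst (diagTel n k)))
      ((DTT.idTel Ψ f g).subst (liftSub m (diagTel n k)))
      (fun i => (s i).subst (liftSub m (diagTel n k)))
      fun i => (t i).subst (liftSub m (diagTel n k))) :
    S.ElEq ((Γ.pathCtx Φ).append Δ) (DTT.idTel Ψ f g) s t :=
  h.elEq_of_elim hG (fun _ _ hC hd =>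
    ⟨_, h.tmEq_left ((h.idSound hΦ).elim_congr (h.tyEq_refl hC) (h.tmEq_refl hd))⟩)
    hΨ hf hg hs ht hst

/-- Elements of an identity context over `Γ, x : A, y : A, p : Id_A(x, y)` are determined by
their values at `r(x)`. -/
theorem elEq_of_diag {n l : ℕ} {Γ : Ctx σ n} {A : Ty σ n} (hA : S.IsType Γ A)
    {Ψ : Ctx σ l} (hΨ : S.IsCtx Ψ) {f g s t} (hf : S.IsMor (Γ.idCtx A) Ψ f)
    (hg : S.IsMor (Γ.idCtx A) Ψ g)
    (hs : S.IsEl (Γ.idCtx A) (DTT.idTel Ψ f g) s) (ht : S.IsEl (Γ.idCtx A) (DTT.idTel Ψ f g) t)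
    (hst : S.ElEq (Γ.snoc A) ((DTT.idTel Ψ f g).subst (diag n))
      (fun i => (s i).subst (diag n)) fun i => (t i).subst (diag n)) :
    S.ElEq (Γ.idCtx A) (DTT.idTel Ψ f g) s t := by
  refine h.elEq_of_elim (h.isCtx_idCtx hA) (fun C d hC hd => ?_)
    hΨ hf hg hs ht hst
  refine ⟨_, h.tmEq_left (h.elimOne_congr (Δ := .nil) (m := 0) (h.tyEq_refl hC) (d := d) (d' := d)
    ?_)⟩
  rw [liftSub_zero]
  exact h.tmEq_refl hd

end Calculus.Rules

/-! ## The operations on elements of identity contexts -/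

/-- `p⁻¹ : Id_Φ(b, a)` for `p : Id_Φ(a, b)`, defined by elimination with `r(x)⁻¹ = r(x)`. -/
def symId {k n : ℕ} (Φ : Ctx σ k) (a b p : Fin k → Tm σ n) : Fin k → Tm σ n := fun i =>
  (elimTel k (n := 0) (m := 0) (idTel Φ (fun j => .var (vY j)) (fun j => .var (vX j)))
    (fun j => .refl (.var (Fin.natAdd 0 j))) i).subst (glue Fin.elim0 a b p Fin.elim0)

namespace Calculus.Rules

variable {S : Calculus σ} (h : S.Rules)
include h

theorem isCtx_pathCtx' {n k : ℕ} {Γ : Ctx σ n} {Φ : Ctx σ k} (hΓ : S.IsCtx Γ) (hΦ : S.IsCtx Φ) :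
    S.IsCtx (Γ.pathCtx Φ) := h.isCtx_pathCtx (h.idSound hΦ) hΦ hΓ

theorem isEl_refl {n k : ℕ} {Ξ : Ctx σ n} {Φ : Ctx σ k} (hΞ : S.IsCtx Ξ) (hΦ : S.IsCtx Φ) {a}
    (ha : S.IsMor Ξ Φ a) : S.IsEl Ξ (DTT.idTel Φ a a) fun i => .refl (a i) :=
  (h.idSound hΦ).isEl_refl hΞ ha

section

variable {k n : ℕ} {Φ : Ctx σ k} {Ξ : Ctx σ n}

omit h in
theorem isMor_glue_nil {a b p : Fin k → Tm σ n} {z : Fin 0 → Tm σ n} :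
    S.IsMor Ξ ((Ctx.nil.pathCtx Φ).append .nil) (glue Fin.elim0 a b p z) ↔
      S.IsMor Ξ Φ a ∧ S.IsMor Ξ Φ b ∧ S.IsEl Ξ (DTT.idTel Φ a b) p := by
  rw [isMor_glue, isMor_pathCtx]
  exact ⟨fun h => ⟨h.1.2.1, h.1.2.2.1, h.1.2.2.2⟩, fun h => ⟨⟨trivial, h⟩, trivial⟩⟩

/-- Elimination of `Φ` into identity contexts, without parameters. -/
theorem elimTel_path (hΞ : S.IsCtx Ξ) (hΦ : S.IsCtx Φ) {m : ℕ} {Ψ : Ctx σ m} (hΨ : S.IsCtx Ψ)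
    {f g : Fin m → Tm σ (0 + k + k + k + 0)} {d : Fin m → Tm σ (0 + k)}
    (hf : S.IsMor ((Ctx.nil.pathCtx Φ).append .nil) Ψ f)
    (hg : S.IsMor ((Ctx.nil.pathCtx Φ).append .nil) Ψ g)
    (hd : S.IsEl (Ctx.nil.append (Φ.tel 0))
      (DTT.idTel Ψ (fun i => (f i).subst (diagTel 0 k)) fun i => (g i).subst (diagTel 0 k)) d)
    {a b p : Fin k → Tm σ n} (ha : S.IsMor Ξ Φ a) (hb : S.IsMor Ξ Φ b) :
    (S.IsEl Ξ (DTT.idTel Φ a b) p →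
      S.IsEl Ξ (DTT.idTel Ψ (fun i => (f i).subst (glue Fin.elim0 a b p Fin.elim0))
        fun i => (g i).subst (glue Fin.elim0 a b p Fin.elim0))
        fun i => (elimTel k (DTT.idTel Ψ f g) d i).subst (glue Fin.elim0 a b p Fin.elim0)) ∧
    S.ElEq Ξ (DTT.idTel Ψ
        (fun i => (f i).subst (glue Fin.elim0 a a (fun i => .refl (a i)) Fin.elim0))
        fun i => (g i).subst (glue Fin.elim0 a a (fun i => .refl (a i)) Fin.elim0))
      (fun i => (elimTel k (DTT.idTel Ψ f g) d i).subst
        (glue Fin.elim0 a a (fun i => .refl (a i)) Fin.elim0))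
      fun i => (d i).subst (Fin.append Fin.elim0 a) := by
  have h0 : S.IsCtx ((Ctx.nil.pathCtx Φ).append .nil) := h.isCtx_pathCtx' (Γ := .nil) trivial hΦ
  have hΘ := (h.ctxEq_idTel h0 hΨ (h.ctxEq_refl hΨ) (h.morEq_refl hf) (h.morEq_refl hg)).1
  have hd' : S.IsEl ((Ctx.nil.append (Φ.tel 0)).append (Tel.nil.subst (diagTel 0 k)))
      ((DTT.idTel Ψ f g).subst (liftSub 0 (diagTel 0 k))) d := by
    rw [liftSub_zero, idTel_subst]
    exact hd
  constructor
  · intro hp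
    have h1 := h.isEl_subst hΞ ((isMor_glue_nil (z := Fin.elim0)).2 ⟨ha, hb, hp⟩) (h.elimTel_sound hΦ hΘ hd').1
    rwa [idTel_subst] at h1
  · have h1 := h.elimTel_refl hΦ hΘ hd' hΞ (b := Fin.elim0) (e := Fin.elim0) trivial ha trivial
    have e1 : Fin.append (n := 0) (Fin.append Fin.elim0 a) Fin.elim0 = Fin.append Fin.elim0 a :=
      funext fun i => Fin.append_left (Fin.append Fin.elim0 a) Fin.elim0 i
    rw [idTel_subst, e1] at h1
    exact h1

theorem isMor_natAdd_tel (hΦ : S.IsCtx Φ) :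
    S.IsCtx (Ctx.nil.append (Φ.tel 0)) ∧
      S.IsMor (Ctx.nil.append (Φ.tel 0)) Φ fun i => .var (Fin.natAdd 0 i) :=
  h.isCtx_append_tel trivial hΦ

theorem liftId_spec {m : ℕ} {Ψ : Ctx σ m} (hΞ : S.IsCtx Ξ) (hΦ : S.IsCtx Φ) (hΨ : S.IsCtx Ψ)
    {f : Fin m → Tm σ k} (hf : S.IsMor Φ Ψ f) {a b p : Fin k → Tm σ n} (ha : S.IsMor Ξ Φ a)
    (hb : S.IsMor Ξ Φ b) :
    (S.IsEl Ξ (DTT.idTel Φ a b) p →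
      S.IsEl Ξ (DTT.idTel Ψ (fun i => (f i).subst a) fun i => (f i).subst b)
        (liftId Ψ f a b p)) ∧
    S.ElEq Ξ (DTT.idTel Ψ (fun i => (f i).subst a) fun i => (f i).subst a)
      (liftId Ψ f a a fun i => .refl (a i)) fun i => .refl ((f i).subst a) := by
  have h0 : S.IsCtx ((Ctx.nil.pathCtx Φ).append .nil) := h.isCtx_pathCtx' (Γ := .nil) trivial hΦ
  have hv := isMor_pathCtx_split.1 (h.isMor_var h0)
  have h1 := h.elimTel_path hΞ hΦ hΨ (f := fun j => (f j).rename vX)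
    (g := fun j => (f j).rename vY) (d := fun j => .refl ((f j).rename (Fin.natAdd 0)))
    (by simp only [rename_eq_subst]; exact h.isMor_comp h0 hv.2.1 hf)
    (by simp only [rename_eq_subst]; exact h.isMor_comp h0 hv.2.2.1 hf)
    (by
      have e1 : (fun i => ((f i).rename (vX (n := 0) (k := k) (m := 0))).subst (diagTel 0 k)) =
          fun i => (f i).rename (Fin.natAdd 0) := by
        funext i
        rw [rename_subst, rename_eq_subst]
        congr 1
        exact funext fun i => block_uX _ _ _ _ i
      have e2 : (fun i => ((f i).rename (vY (n := 0) (k := k) (m := 0))).subst (diagTel 0 k)) =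
          fun i => (f i).rename (Fin.natAdd 0) := by
        funext i
        rw [rename_subst, rename_eq_subst]
        congr 1
        exact funext fun i => block_uY _ _ _ _ i
      rw [e1, e2]
      refine h.isEl_refl (h.isMor_natAdd_tel hΦ).1 hΨ ?_
      simp only [rename_eq_subst]
      exact h.isMor_comp (h.isMor_natAdd_tel hΦ).1 (h.isMor_natAdd_tel hΦ).2 hf) ha hb (p := p)
  simp only [rename_subst, glue_vX, glue_vY, refl_subst, Fin.append_right] at h1
  exact h1

theorem symId_spec (hΞ : S.IsCtx Ξ) (hΦ : S.IsCtx Φ) {a b p : Fin k → Tm σ n}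
    (ha : S.IsMor Ξ Φ a) (hb : S.IsMor Ξ Φ b) :
    (S.IsEl Ξ (DTT.idTel Φ a b) p → S.IsEl Ξ (DTT.idTel Φ b a) (symId Φ a b p)) ∧
    S.ElEq Ξ (DTT.idTel Φ a a) (symId Φ a a fun i => .refl (a i)) fun i => .refl (a i) := by
  have h0 : S.IsCtx ((Ctx.nil.pathCtx Φ).append .nil) := h.isCtx_pathCtx' (Γ := .nil) trivial hΦ
  have hv := isMor_pathCtx_split.1 (h.isMor_var h0)
  have h1 := h.elimTel_path hΞ hΦ hΦ (f := fun j => .var (vY j))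
    (g := fun j => .var (vX j)) (d := fun j => .refl (.var (Fin.natAdd 0 j)))
    hv.2.2.1 hv.2.1
    (by
      have e1 : (fun i => (Expr.var (σ := σ) (vY (n := 0) (k := k) (m := 0) i)).subst (diagTel 0 k)) =
          fun i => .var (Fin.natAdd 0 i) :=
        funext fun i => (var_subst _ _).trans (block_uY _ _ _ _ i)
      have e2 : (fun i => (Expr.var (σ := σ) (vX (n := 0) (k := k) (m := 0) i)).subst (diagTel 0 k)) =
          fun i => .var (Fin.natAdd 0 i) :=
        funext fun i => (var_subst _ _).trans (block_uX _ _ _ _ i)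
      rw [e1, e2]
      exact h.isEl_refl (h.isMor_natAdd_tel hΦ).1 hΦ (h.isMor_natAdd_tel hΦ).2) ha hb (p := p)
  simp only [var_subst, glue_vX, glue_vY, refl_subst, Fin.append_right] at h1
  exact h1

/-- The context `x : Φ, y : Φ, z : Φ, q : Id(y, z), p : Id(x, y)`. -/
theorem isCtx_compId (hΦ : S.IsCtx Φ) : S.IsCtx ((Φ.pathCtx Φ).append
    (DTT.idTel Φ (fun j => .var (uB j)) fun j => .var (uX j))) := by
  have h0 := h.isCtx_pathCtx' hΦ hΦ
  have hv := isMor_pathCtx_split.1 (h.isMor_var h0)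
  exact (h.ctxEq_idTel h0 hΦ (h.ctxEq_refl hΦ) (h.morEq_refl hv.1) (h.morEq_refl hv.2.1)).1

/-- The variables of `x : Φ, y : Φ, z : Φ, q : Id(y, z), p : Id(x, y)`. -/
theorem isMor_compId_var (hΦ : S.IsCtx Φ) {G} (hG : G = (Φ.pathCtx Φ).append
    (DTT.idTel Φ (fun j => .var (uB j)) fun j => .var (uX j))) :
    S.IsMor G Φ (fun j => .var (vB j)) ∧ S.IsMor G Φ (fun j => .var (vX j)) ∧
      S.IsMor G Φ (fun j => .var (vY j)) ∧
      S.IsEl G (DTT.idTel Φ (fun j => .var (vX j)) fun j => .var (vY j)) (fun j => .var (vP j)) ∧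
      S.IsEl G (DTT.idTel Φ (fun j => .var (vB j)) fun j => .var (vX j)) fun j => .var (vE j) := by
  subst hG
  have h1 := isMor_append_split.1 (h.isMor_var (h.isCtx_compId hΦ))
  have hv := isMor_pathCtx_split.1 h1.1
  have hw := h1.2
  rw [idTel_subst] at hw
  exact ⟨hv.1, hv.2.1, hv.2.2.1, hv.2.2.2, hw⟩

theorem compId_spec (hΞ : S.IsCtx Ξ) (hΦ : S.IsCtx Φ) {x y z p q : Fin k → Tm σ n}
    (hx : S.IsMor Ξ Φ x) (hy : S.IsMor Ξ Φ y) (hz : S.IsMor Ξ Φ z)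
    (hp : S.IsEl Ξ (DTT.idTel Φ x y) p) :
    (S.IsEl Ξ (DTT.idTel Φ y z) q → S.IsEl Ξ (DTT.idTel Φ x z) (compId Φ x y z p q)) ∧
    S.ElEq Ξ (DTT.idTel Φ x y) (compId Φ x y y p fun i => .refl (y i)) p := by
  have h1 := h.isCtx_compId hΦ
  have hv := h.isMor_compId_var hΦ rfl
  have hΘ := (h.ctxEq_idTel h1 hΦ (h.ctxEq_refl hΦ) (h.morEq_refl hv.1)
    (h.morEq_refl hv.2.2.1)).1
  have hd : S.IsEl ((Φ.append (Φ.tel k)).append ((DTT.idTel Φ (fun j => .var (uB j))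
      fun j => .var (uX j)).subst (diagTel k k)))
      ((DTT.idTel Φ (fun j => .var (vB j)) (fun j => .var (vY j))).subst
        (liftSub k (diagTel k k))) fun j => .var (Fin.natAdd (k + k) j) := by
    have h2 := h.isEl_natAdd (h.isMor_liftSub_diagTel hΦ h1).1
    have e : (DTT.idTel Φ (fun j => .var (vB j)) (fun j => .var (vY j))).subst
        (liftSub k (diagTel (σ := σ) k k)) = ((DTT.idTel Φ (fun j => .var (uB j))
      fun j => .var (uX j)).subst (diagTel k k)).subst fun i => .var (Fin.castAdd k i) := by
      simp only [idTel_subst, var_subst, diagTel, block_uB, block_uX, liftSub_vB, liftSub_vY,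
        block_uY, rename]
    rw [e]
    exact h2
  constructor
  · intro hq
    have hm : S.IsMor Ξ ((Φ.pathCtx Φ).append
        (DTT.idTel Φ (fun j => .var (uB j)) fun j => .var (uX j))) (glue x y z q p) := by
      rw [isMor_glue, isMor_pathCtx, idTel_subst]
      simp only [var_subst, block_uB, block_uX]
      exact ⟨⟨hx, hy, hz, hq⟩, hp⟩
    have h2 := h.isEl_subst hΞ hm (h.elimTel_sound hΦ hΘ hd).1
    simp only [idTel_subst, var_subst, glue_vB, glue_vY] at h2
    exact h2
  · have h2 := h.elimTel_refl hΦ hΘ hd hΞ hx hy (e := p) (by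
      rw [idTel_subst]
      simpa only [var_subst, block_uB, block_uX] using hp)
    simp only [idTel_subst, var_subst, glue_vB, glue_vY, Fin.append_right] at h2
    exact h2

/-- The composite of the generic pair of paths is well typed, and every composite is an instance of
it; congruence is substitution along equal vectors. -/
theorem compId_congr (hΞ : S.IsCtx Ξ) (hΦ : S.IsCtx Φ)
    {x y z p q x' y' z' p' q' : Fin k → Tm σ n}
    (hx : S.MorEq Ξ Φ x x') (hy : S.MorEq Ξ Φ y y') (hz : S.MorEq Ξ Φ z z')
    (hp : S.ElEq Ξ (DTT.idTel Φ x y) p p') (hq : S.ElEq Ξ (DTT.idTel Φ y z) q q') :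
    S.ElEq Ξ (DTT.idTel Φ x z) (compId Φ x y z p q) (compId Φ x' y' z' p' q') := by
  have h1 := h.isCtx_compId hΦ
  have hv := h.isMor_compId_var hΦ rfl
  have h2 := (h.compId_spec h1 hΦ hv.1 hv.2.1 hv.2.2.1 hv.2.2.2.2).1 hv.2.2.2.1
  have hm : S.MorEq Ξ ((Φ.pathCtx Φ).append
      (DTT.idTel Φ (fun j => .var (uB j)) fun j => .var (uX j))) (glue x y z q p)
      (glue x' y' z' q' p') := by
    rw [glue_eq_append, glue_eq_append, morEq_append, morEq_pathCtx, idTel_subst]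
    simp only [var_subst, block_uB, block_uX]
    exact ⟨⟨hx, hy, hz, hq⟩, hp⟩
  have h3 := h.isEl_congr hΞ hm h2
  have e (x y z p q : Fin k → Tm σ n) : (fun i => (compId (σ := σ) (n := k + k + k + k + k) Φ
      (fun i => .var (vB i)) (fun i => .var (vX i)) (fun i => .var (vY i))
      (fun i => .var (vE i)) (fun i => .var (vP i)) i).subst (glue x y z q p)) =
      compId Φ x y z p q := by
    funext i
    rw [compId, subst_subst, glue_subst]
    simp only [var_subst, glue_vB, glue_vX, glue_vY, glue_vP, glue_vE]
    rfl
  have e1 := e x y z p q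
  have e2 := e x' y' z' p' q'
  rw [idTel_subst, e1, e2] at h3
  simpa only [var_subst, glue_vB, glue_vY] using h3

end

end Calculus.Rules

/-! ## The category of raw contexts, with its path objects -/

namespace Calculus

variable {S : Calculus σ}

/-- Raw contexts of a calculus with the given rules. -/
structure Syn (h : S.Rules) where of ::
  len : ℕ
  ctx : Ctx σ len
  wf : S.IsCtx ctx

namespace Syn

variable {h : S.Rules}

/-- Equality of context morphisms. -/
def homSetoid (X Y : Syn h) : Setoid { f // S.IsMor X.ctx Y.ctx f } where
  r f g := S.MorEq X.ctx Y.ctx f.1 g.1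
  iseqv := ⟨fun f => h.morEq_refl f.2, h.morEq_symm X.wf Y.wf, h.morEq_trans X.wf Y.wf⟩

instance : Category (Syn h) where
  Hom X Y := Quotient (homSetoid X Y)
  id X := Quotient.mk _ ⟨.var, h.isMor_var X.wf⟩
  comp {X Y Z} := Quotient.map₂ (fun f g => ⟨_, h.isMor_comp X.wf f.2 g.2⟩)
    fun _ _ hf _ _ hg => h.morEq_comp X.wf hf hg
  id_comp {X Y} := by
    rintro ⟨f⟩
    exact Quotient.sound (by
      simp only [subst_var']
      exact h.morEq_refl f.2)
  comp_id {X Y} := by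
    rintro ⟨f⟩
    exact Quotient.sound (by
      simp only [var_subst]
      exact h.morEq_refl f.2)
  assoc {X Y Z W} := by
    rintro ⟨f⟩ ⟨g⟩ ⟨k⟩
    refine Quotient.sound ?_
    have := h.isMor_comp X.wf (h.isMor_comp X.wf f.2 g.2) k.2
    simp only [subst_subst] at this ⊢
    exact h.morEq_refl this

variable {W X Y Z : Syn h}

/-- The class of a raw morphism. -/
def mk (f : Fin Y.len → Tm σ X.len) (hf : S.IsMor X.ctx Y.ctx f) : X ⟶ Y := Quotient.mk _ ⟨f, hf⟩

theorem exists_mk (u : X ⟶ Y) : ∃ f hf, u = mk f hf := by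
  obtain ⟨f⟩ := u
  exact ⟨f.1, f.2, rfl⟩

theorem mk_eq_mk {f g : Fin Y.len → Tm σ X.len} {hf hg} :
    (mk f hf : X ⟶ Y) = mk g hg ↔ S.MorEq X.ctx Y.ctx f g := Quotient.eq (r := homSetoid X Y)

theorem mk_congr {f g : Fin Y.len → Tm σ X.len} {hf : S.IsMor X.ctx Y.ctx f} (e : f = g) :
    (mk f hf : X ⟶ Y) = mk g (e ▸ hf) := by subst e; rfl

theorem mk_comp {f : Fin Y.len → Tm σ X.len} {g : Fin Z.len → Tm σ Y.len} {hf hg} :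
    (mk f hf : X ⟶ Y) ≫ (mk g hg : Y ⟶ Z) =
      mk (fun i => (g i).subst f) (h.isMor_comp X.wf hf hg) := rfl

/-- The context `x, y : X, p : Id_X(x, y)`. -/
abbrev path (X : Syn h) : Syn h :=
  ⟨0 + X.len + X.len + X.len, Ctx.nil.pathCtx X.ctx, h.isCtx_pathCtx' trivial X.wf⟩

variable {a b p a' b' p' : Fin Y.len → Tm σ X.len}

theorem isMor_path : S.IsMor X.ctx (path Y).ctx (block Fin.elim0 a b p) ↔
    S.IsMor X.ctx Y.ctx a ∧ S.IsMor X.ctx Y.ctx b ∧ S.IsEl X.ctx (DTT.idTel Y.ctx a b) p :=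
  Rules.isMor_pathCtx.trans ⟨fun h => h.2, fun h => ⟨trivial, h⟩⟩

/-- The morphism into a path object with the given components. -/
def mkPath (a b p : Fin Y.len → Tm σ X.len) (ha : S.IsMor X.ctx Y.ctx a)
    (hb : S.IsMor X.ctx Y.ctx b) (hp : S.IsEl X.ctx (DTT.idTel Y.ctx a b) p) : X ⟶ path Y :=
  mk (block Fin.elim0 a b p) (isMor_path.2 ⟨ha, hb, hp⟩)

theorem exists_mkPath (u : X ⟶ path Y) : ∃ a b p ha hb hp, u = mkPath a b p ha hb hp := by
  obtain ⟨f, hf, rfl⟩ := exists_mk u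
  have e : f = block Fin.elim0 (fun i => f (uX i)) (fun i => f (uY i)) fun i => f (uP i) := by
    refine (block_split (n := 0) (k := Y.len) f).symm.trans ?_
    exact congrArg (fun g => block g _ _ _) (funext fun i => i.elim0)
  rw [e] at hf
  have := isMor_path.1 hf
  exact ⟨_, _, _, this.1, this.2.1, this.2.2, mk_congr e⟩

theorem mkPath_eq_mkPath {ha hb hp ha' hb' hp'} :
    (mkPath a b p ha hb hp : X ⟶ path Y) = mkPath a' b' p' ha' hb' hp' ↔
      S.MorEq X.ctx Y.ctx a a' ∧ S.MorEq X.ctx Y.ctx b b' ∧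
        S.ElEq X.ctx (DTT.idTel Y.ctx a b) p p' :=
  mk_eq_mk.trans (Rules.morEq_pathCtx.trans ⟨fun h => h.2, fun h => ⟨trivial, h⟩⟩)

theorem mkPath_congr {ha : S.IsMor X.ctx Y.ctx a} {hb : S.IsMor X.ctx Y.ctx b} {hp}
    (e₁ : a = a') (e₂ : b = b') (e₃ : p = p') :
    (mkPath a b p ha hb hp : X ⟶ path Y) =
      mkPath a' b' p' (e₁ ▸ ha) (e₂ ▸ hb) (e₁ ▸ e₂ ▸ e₃ ▸ hp) := by
  subst e₁ e₂ e₃; rfl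

def src (X : Syn h) : path X ⟶ X :=
  mk (fun i => .var (uX i)) (Rules.isMor_pathCtx_split.1 (h.isMor_var (path X).wf)).2.1

def tgt (X : Syn h) : path X ⟶ X :=
  mk (fun i => .var (uY i)) (Rules.isMor_pathCtx_split.1 (h.isMor_var (path X).wf)).2.2.1

def rf (X : Syn h) : X ⟶ path X :=
  mkPath .var .var (fun i => .refl (.var i)) (h.isMor_var X.wf) (h.isMor_var X.wf)
    (h.isEl_refl X.wf X.wf (h.isMor_var X.wf))

@[simp] theorem mkPath_src {ha hb hp} : (mkPath a b p ha hb hp : X ⟶ path Y) ≫ src Y = mk a ha :=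
  mk_congr (funext fun _ => (var_subst _ _).trans (block_uX ..))

@[simp] theorem mkPath_tgt {ha hb hp} : (mkPath a b p ha hb hp : X ⟶ path Y) ≫ tgt Y = mk b hb :=
  mk_congr (funext fun _ => (var_subst _ _).trans (block_uY ..))

theorem isEl_comp {f : Fin X.len → Tm σ W.len} (hf : S.IsMor W.ctx X.ctx f)
    (hp : S.IsEl X.ctx (DTT.idTel Y.ctx a b) p) :
    S.IsEl W.ctx (DTT.idTel Y.ctx (fun i => (a i).subst f) fun i => (b i).subst f)
      fun i => (p i).subst f := by
  rw [← idTel_subst]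
  exact h.isEl_subst W.wf hf hp

theorem mk_comp_mkPath {f : Fin X.len → Tm σ W.len} {hf ha hb hp} :
    (mk f hf : W ⟶ X) ≫ (mkPath a b p ha hb hp : X ⟶ path Y) =
      mkPath (fun i => (a i).subst f) (fun i => (b i).subst f) (fun i => (p i).subst f)
        (h.isMor_comp W.wf hf ha) (h.isMor_comp W.wf hf hb) (isEl_comp hf hp) := by
  refine mk_congr ((block_subst ..).trans ?_)
  exact congrArg (fun g => block g _ _ _) (funext fun i => i.elim0)

theorem mk_rf {ha} : (mk a ha : X ⟶ Y) ≫ rf Y =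
    mkPath a a (fun i => .refl (a i)) ha ha (h.isEl_refl X.wf Y.wf ha) := by
  rw [rf, mk_comp_mkPath]
  rfl

@[simp] theorem rf_src (X : Syn h) : rf X ≫ src X = 𝟙 X := mkPath_src
@[simp] theorem rf_tgt (X : Syn h) : rf X ≫ tgt X = 𝟙 X := mkPath_tgt

/-! ### Path induction -/

/-- The context `G, x, y : X, p : Id_X(x, y), Δ`. -/
abbrev pathTel (G X : Syn h) {m : ℕ} (Δ : Tel σ (G.len + X.len + X.len + X.len) m)
    (hΔ : S.IsCtx ((G.ctx.pathCtx X.ctx).append Δ)) : Syn h := ⟨_, _, hΔ⟩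

/-- The context `G, x : X, Δ[x, x, r(x)]`. -/
abbrev diagCtx (G X : Syn h) {m : ℕ} (Δ : Tel σ (G.len + X.len + X.len + X.len) m)
    (hΔ : S.IsCtx ((G.ctx.pathCtx X.ctx).append Δ)) : Syn h :=
  ⟨_, _, (h.isMor_liftSub_diagTel X.wf hΔ).1⟩

def diagMor (G X : Syn h) {m : ℕ} (Δ : Tel σ (G.len + X.len + X.len + X.len) m) (hΔ) :
    diagCtx G X Δ hΔ ⟶ pathTel G X Δ hΔ :=
  mk (liftSub m (diagTel G.len X.len)) (h.isMor_liftSub_diagTel X.wf hΔ).2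

/-- The uniqueness principle is kept as a hypothesis `H` because three diagonals occur: the one with
parameters and postcontext, reflexivity of a path object, and the diagonal of the identity type of a
single type. -/
theorem eq_of_diag {V V' : Syn h} (d : V' ⟶ V) {δ} (hδ) (hd : d = mk δ hδ)
    (H : ∀ {f g : Fin Y.len → Tm σ V.len} {s t}, S.IsMor V.ctx Y.ctx f → S.IsMor V.ctx Y.ctx g →
      S.IsEl V.ctx (DTT.idTel Y.ctx f g) s → S.IsEl V.ctx (DTT.idTel Y.ctx f g) t →
      S.ElEq V'.ctx ((DTT.idTel Y.ctx f g).subst δ) (fun i => (s i).subst δ)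
        (fun i => (t i).subst δ) → S.ElEq V.ctx (DTT.idTel Y.ctx f g) s t)
    {s t : V ⟶ path Y} (h₁ : s ≫ src Y = t ≫ src Y) (h₂ : s ≫ tgt Y = t ≫ tgt Y)
    (h₃ : d ≫ s = d ≫ t) : s = t := by
  subst hd
  obtain ⟨a, b, p, ha, hb, hp, rfl⟩ := exists_mkPath s
  obtain ⟨a', b', p', ha', hb', hp', rfl⟩ := exists_mkPath t
  rw [mkPath_src, mkPath_src, mk_eq_mk] at h₁
  rw [mkPath_tgt, mkPath_tgt, mk_eq_mk] at h₂
  rw [mk_comp_mkPath, mk_comp_mkPath, mkPath_eq_mkPath] at h₃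
  refine mkPath_eq_mkPath.2 ⟨h₁, h₂, H ha hb hp ?_ ?_⟩
  · exact h.isEl_idTel_conv V.wf Y.wf (h.ctxEq_refl Y.wf) (h.morEq_symm V.wf Y.wf h₁)
      (h.morEq_symm V.wf Y.wf h₂) hp'
  · rw [idTel_subst]
    exact h₃.2.2

theorem eq_of_diagMor {G X : Syn h} {m : ℕ} {Δ : Tel σ (G.len + X.len + X.len + X.len) m} {hΔ}
    {s t : pathTel G X Δ hΔ ⟶ path Y} (h₁ : s ≫ src Y = t ≫ src Y) (h₂ : s ≫ tgt Y = t ≫ tgt Y)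
    (h₃ : diagMor G X Δ hΔ ≫ s = diagMor G X Δ hΔ ≫ t) : s = t :=
  eq_of_diag _ _ rfl (h.elEq_of_diagTel X.wf hΔ Y.wf) h₁ h₂ h₃

/-- Elements of an identity context over `x, y : X, p : Id_X(x, y)` are determined by their values
at `r(x)`. -/
theorem path_ext {s t : path X ⟶ path Y} (h₁ : s ≫ src Y = t ≫ src Y)
    (h₂ : s ≫ tgt Y = t ≫ tgt Y) (h₃ : rf X ≫ s = rf X ≫ t) : s = t := by
  -- Elimination without parameters puts the diagonal over a context of length `0 + X.len` instead
  -- of over `X` itself; the morphism in `hV` mediates between the two.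
  have hV := h.isMor_natAdd_tel X.wf
  refine eq_of_diag (V' := ⟨_, _, hV.1⟩) (mk (fun i => .var (Fin.natAdd 0 i)) hV.2 ≫ rf X)
    (h.isMor_diagTel (Γ := .nil) (h.idSound X.wf) X.wf trivial) ?_ (fun hf hg hs ht hst => ?_)
    h₁ h₂ ?_
  · refine mk_rf.trans (mk_congr ?_)
    exact congrArg (fun f => block f _ _ _) (funext fun i => i.elim0)
  · refine h.elEq_of_diagTel (Γ := .nil) (Δ := .nil) X.wf (path X).wf Y.wf hf hg hs ht ?_
    rw [liftSub_zero]
    exact hst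
  · rw [Category.assoc, h₃, Category.assoc]

/-- A context of pairs of composable paths, over the graph of `f`, with the induction principle for
the second path. -/
theorem exists_composable {G X : Syn h} (f : G ⟶ X) :
    ∃ (D : Syn h) (b : D ⟶ G) (p q : D ⟶ path X), p ≫ src X = b ≫ f ∧ p ≫ tgt X = q ≫ src X ∧
      (∀ {V : Syn h} (b' : V ⟶ G) (p' q' : V ⟶ path X), p' ≫ src X = b' ≫ f →
        p' ≫ tgt X = q' ≫ src X → ∃ e : V ⟶ D, e ≫ b = b' ∧ e ≫ p = p' ∧ e ≫ q = q') ∧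
      ∀ {Y : Syn h} {s t : D ⟶ path Y}, s ≫ src Y = t ≫ src Y → s ≫ tgt Y = t ≫ tgt Y →
        (∀ {V : Syn h} (e : V ⟶ D), e ≫ q = e ≫ q ≫ src X ≫ rf X → e ≫ s = e ≫ t) → s = t := by
  obtain ⟨f, hf, rfl⟩ := exists_mk f
  have h0 := h.isCtx_pathCtx' G.wf X.wf
  have hu := Rules.isMor_pathCtx_split.1 (h.isMor_var h0)
  have hfu := h.isMor_comp h0 hu.1 hf
  have hΔ : S.IsCtx ((G.ctx.pathCtx X.ctx).append
      (DTT.idTel X.ctx (fun j => (f j).subst fun i => .var (uB i)) fun j => .var (uX j))) :=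
    (h.ctxEq_idTel h0 X.wf (h.ctxEq_refl X.wf) (h.morEq_refl hfu) (h.morEq_refl hu.2.1)).1
  have hv' := Rules.isMor_append_split.1 (h.isMor_var hΔ)
  have hv := Rules.isMor_pathCtx_split.1 hv'.1
  have hE := hv'.2
  rw [idTel_subst] at hE
  simp only [subst_subst, var_subst] at hE
  -- The second path is the one eliminated, so the first path comes last, as its postcontext.
  let D := pathTel G X _ hΔ
  let b : D ⟶ G := mk (fun i => .var (vB i)) hv.1
  let q : D ⟶ path X := mkPath (fun i => .var (vX i)) (fun i => .var (vY i))
    (fun i => .var (vP i)) hv.2.1 hv.2.2.1 hv.2.2.2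
  let p : D ⟶ path X := mkPath (fun i => (f i).subst fun i => .var (vB i))
    (fun i => .var (vX i)) (fun i => .var (vE i)) (h.isMor_comp hΔ hv.1 hf) hv.2.1 hE
  refine ⟨D, b, p, q, mkPath_src, mkPath_tgt.trans mkPath_src.symm, ?_, fun h₁ h₂ h₃ => ?_⟩
  · intro V b' p' q' h₁ h₂
    obtain ⟨b', hb', rfl⟩ := exists_mk b'
    obtain ⟨x, y, p', hx, hy, hp, rfl⟩ := exists_mkPath p'
    obtain ⟨y', z, q', hy', hz, hq, rfl⟩ := exists_mkPath q'
    rw [mkPath_src, mk_comp, mk_eq_mk] at h₁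
    rw [mkPath_tgt, mkPath_src, mk_eq_mk] at h₂
    have he : S.IsMor V.ctx D.ctx (glue b' y' z q' p') := by
      refine Rules.isMor_glue.2 ⟨Rules.isMor_pathCtx.2 ⟨hb', hy', hz, hq⟩, ?_⟩
      rw [idTel_subst]
      simp only [subst_subst, var_subst, block_uB, block_uX]
      exact h.isEl_idTel_conv V.wf X.wf (h.ctxEq_refl X.wf) h₁ h₂ hp
    refine ⟨mk _ he, mk_congr (funext fun i => (var_subst _ _).trans (glue_vB ..)), ?_, ?_⟩
    · refine mk_comp_mkPath.trans (mkPath_eq_mkPath.2 ?_)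
      simp only [subst_subst, var_subst, glue_vB, glue_vX, glue_vE]
      exact ⟨h.morEq_symm V.wf X.wf h₁, h.morEq_symm V.wf X.wf h₂, h.elEq_refl
        (h.isEl_idTel_conv V.wf X.wf (h.ctxEq_refl X.wf) h₁ h₂ hp)⟩
    · refine mk_comp_mkPath.trans (mkPath_eq_mkPath.2 ?_)
      simp only [var_subst, glue_vX, glue_vY, glue_vP]
      exact ⟨h.morEq_refl hy', h.morEq_refl hz, h.elEq_refl hq⟩
  -- The hypothesis quantifies over all morphisms which make the second path a reflexivity, so that
  -- its statement need not name the diagonal context; only the diagonal itself is needed.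
  · refine eq_of_diagMor h₁ h₂ (h₃ _ ?_)
    have e := (Category.assoc q (src X) (rf X)).symm.trans
      ((congrArg (· ≫ rf X) mkPath_src).trans mk_rf)
    refine Eq.trans ?_ (congrArg (diagMor G X _ hΔ ≫ ·) e).symm
    refine mk_comp_mkPath.trans ((mkPath_congr rfl (funext fun i => ?_) (funext fun i => ?_)).trans
      mk_comp_mkPath.symm)
    · simp only [var_subst, liftSub_vX, liftSub_vY, diagTel, block_uX, block_uY]
    · simp only [var_subst, refl_subst, liftSub_vX, liftSub_vP, diagTel, block_uX, block_uP,
        rename]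

end Syn

end Calculus

namespace Calculus.Syn

variable {S : Calculus σ} {h : S.Rules} {W X Y Z : Syn h}

/-! ### The action of morphisms on paths -/

theorem liftId_subst {k m n l : ℕ} (Δ : Ctx σ m) (f : Fin m → Tm σ k) (a b p : Fin k → Tm σ n)
    (s : Fin n → Tm σ l) : (fun i => (liftId Δ f a b p i).subst s) =
      liftId Δ f (fun i => (a i).subst s) (fun i => (b i).subst s) fun i => (p i).subst s := by
  funext i
  rw [liftId, subst_subst, glue_subst]
  refine congrArg (Expr.subst _) ?_
  congr 1 <;> exact funext fun i => i.elim0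

theorem compId_subst {k n l : ℕ} (Φ : Ctx σ k) (x y z p q : Fin k → Tm σ n)
    (s : Fin n → Tm σ l) : (fun i => (compId Φ x y z p q i).subst s) =
      compId Φ (fun i => (x i).subst s) (fun i => (y i).subst s) (fun i => (z i).subst s)
        (fun i => (p i).subst s) fun i => (q i).subst s := by
  funext i
  rw [compId, subst_subst, glue_subst]
  rfl

theorem symId_subst {k n l : ℕ} (Φ : Ctx σ k) (a b p : Fin k → Tm σ n)
    (s : Fin n → Tm σ l) : (fun i => (symId Φ a b p i).subst s) =
      symId Φ (fun i => (a i).subst s) (fun i => (b i).subst s) fun i => (p i).subst s := by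
  funext i
  rw [symId, subst_subst, glue_subst]
  refine congrArg (Expr.subst _) ?_
  congr 1 <;> exact funext fun i => i.elim0

/-- The variables of `x, y : X, p : Id_X(x, y)`. -/
theorem isMor_path_var (X : Syn h) : S.IsMor (path X).ctx X.ctx (fun i => .var (uX i)) ∧
    S.IsMor (path X).ctx X.ctx (fun i => .var (uY i)) ∧
    S.IsEl (path X).ctx (DTT.idTel X.ctx (fun i => .var (uX i)) fun i => .var (uY i))
      fun i => .var (uP i) :=
  (Rules.isMor_pathCtx_split.1 (h.isMor_var (path X).wf)).2

def mapRaw (f : Fin Y.len → Tm σ X.len) (hf : S.IsMor X.ctx Y.ctx f) : path X ⟶ path Y :=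
  mkPath _ _ _ (h.isMor_comp (path X).wf (isMor_path_var X).1 hf)
    (h.isMor_comp (path X).wf (isMor_path_var X).2.1 hf)
    ((h.liftId_spec (path X).wf X.wf Y.wf hf (isMor_path_var X).1 (isMor_path_var X).2.1).1
      (isMor_path_var X).2.2)

theorem mkPath_mapRaw {f : Fin Y.len → Tm σ X.len} {hf} {a b p : Fin X.len → Tm σ W.len}
    {ha hb hp} : (mkPath a b p ha hb hp : W ⟶ path X) ≫ mapRaw f hf =
      mkPath _ _ _ (h.isMor_comp W.wf ha hf) (h.isMor_comp W.wf hb hf)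
        ((h.liftId_spec W.wf X.wf Y.wf hf ha hb).1 hp) := by
  refine mk_comp_mkPath.trans (mkPath_congr ?_ ?_ ?_)
  · funext i
    simp only [subst_subst, var_subst, block_uX]
  · funext i
    simp only [subst_subst, var_subst, block_uY]
  · rw [liftId_subst]
    simp only [var_subst, block_uX, block_uY, block_uP]

/-- Both actions are compared at reflexivity by `path_ext`, where they compute to `r(f x)` and `r(g
x)`. This makes the action on paths independent of the raw representative, and so licenses the
choice in `map`. -/
theorem mapRaw_congr {f g : Fin Y.len → Tm σ X.len} {hf hg}
    (e : (mk f hf : X ⟶ Y) = mk g hg) : mapRaw f hf = mapRaw g hg := by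
  have e' := mk_eq_mk.1 e
  refine path_ext ?_ ?_ ?_
  · refine mkPath_src.trans (Eq.trans ?_ mkPath_src.symm)
    exact congrArg (src X ≫ ·) e
  · refine mkPath_tgt.trans (Eq.trans ?_ mkPath_tgt.symm)
    exact congrArg (tgt X ≫ ·) e
  · refine mkPath_mapRaw.trans (Eq.trans (mkPath_eq_mkPath.2 ?_) mkPath_mapRaw.symm)
    have hv := h.isMor_var X.wf
    have h1 := (h.liftId_spec X.wf X.wf Y.wf hf (p := fun i => .refl (.var i)) hv hv).2
    have h2 := (h.liftId_spec X.wf X.wf Y.wf hg (p := fun i => .refl (.var i)) hv hv).2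
    have h3 := h.isEl_refl X.wf Y.wf hf
    simp only [subst_var'] at h1 h2 ⊢
    have h4 : S.ElEq X.ctx (DTT.idTel Y.ctx f f) (fun i => .refl (f i)) fun i => .refl (g i) :=
      (mkPath_eq_mkPath.1 ((mk_rf (X := X) (Y := Y) (ha := hf)).symm.trans
        ((congrArg (· ≫ rf Y) e).trans mk_rf))).2.2
    have hc := (h.ctxEq_idTel X.wf Y.wf (h.ctxEq_refl Y.wf) (h.morEq_refl hf)
      (h.morEq_refl hf)).1
    refine ⟨e', e', h.elEq_trans hc h1 (h.elEq_trans hc h4 (h.elEq_symm hc ?_))⟩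
    exact h.elEq_idTel_conv X.wf Y.wf (h.ctxEq_refl Y.wf) (h.morEq_symm X.wf Y.wf e')
      (h.morEq_symm X.wf Y.wf e') h2

noncomputable def map (u : X ⟶ Y) : path X ⟶ path Y :=
  mapRaw (exists_mk u).choose (exists_mk u).choose_spec.choose

theorem map_mk {f : Fin Y.len → Tm σ X.len} {hf} : map (mk f hf : X ⟶ Y) = mapRaw f hf :=
  mapRaw_congr (exists_mk (mk f hf : X ⟶ Y)).choose_spec.choose_spec.symm

theorem mkPath_map {f : Fin Y.len → Tm σ X.len} {hf} {a b p : Fin X.len → Tm σ W.len}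
    {ha hb hp} : (mkPath a b p ha hb hp : W ⟶ path X) ≫ map (mk f hf) =
      mkPath _ _ _ (h.isMor_comp W.wf ha hf) (h.isMor_comp W.wf hb hf)
        ((h.liftId_spec W.wf X.wf Y.wf hf ha hb).1 hp) := by
  rw [map_mk, mkPath_mapRaw]

theorem map_src (u : X ⟶ Y) : map u ≫ src Y = src X ≫ u := by
  obtain ⟨f, hf, rfl⟩ := exists_mk u
  rw [map_mk]
  exact mkPath_src

theorem map_tgt (u : X ⟶ Y) : map u ≫ tgt Y = tgt X ≫ u := by
  obtain ⟨f, hf, rfl⟩ := exists_mk u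
  rw [map_mk]
  exact mkPath_tgt

theorem rf_map (u : X ⟶ Y) : rf X ≫ map u = u ≫ rf Y := by
  obtain ⟨f, hf, rfl⟩ := exists_mk u
  have hv := h.isMor_var X.wf
  refine mkPath_map.trans (Eq.trans (mkPath_eq_mkPath.2 ?_) mk_rf.symm)
  have h1 := (h.liftId_spec X.wf X.wf Y.wf hf (p := fun i => .refl (.var i)) hv hv).2
  simp only [subst_var'] at h1 ⊢
  exact ⟨h.morEq_refl hf, h.morEq_refl hf, h1⟩

/-! ### Inverses -/

def inv (X : Syn h) : path X ⟶ path X :=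
  mkPath _ _ _ (isMor_path_var X).2.1 (isMor_path_var X).1
    ((h.symId_spec (path X).wf X.wf (isMor_path_var X).1 (isMor_path_var X).2.1).1
      (isMor_path_var X).2.2)

theorem inv_src (X : Syn h) : inv X ≫ src X = tgt X := mkPath_src

theorem inv_tgt (X : Syn h) : inv X ≫ tgt X = src X := mkPath_tgt

theorem rf_inv (X : Syn h) : rf X ≫ inv X = rf X := by
  have hv := h.isMor_var X.wf
  refine mk_comp_mkPath.trans (mkPath_eq_mkPath.2 ?_)
  rw [symId_subst]
  simp only [var_subst, block_uX, block_uY, block_uP]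
  exact ⟨h.morEq_refl hv, h.morEq_refl hv,
    (h.symId_spec X.wf X.wf (p := fun i => .refl (.var i)) hv hv).2⟩

/-! ### Composition of paths -/

theorem exists_mkPath₂ (p q : W ⟶ path X) (e : p ≫ tgt X = q ≫ src X) :
    ∃ a b c p' q' ha hb hc hp hq, p = mkPath a b p' ha hb hp ∧ q = mkPath b c q' hb hc hq := by
  obtain ⟨a, b, p', ha, hb, hp, rfl⟩ := exists_mkPath p
  obtain ⟨b', c, q', hb', hc, hq, rfl⟩ := exists_mkPath q
  rw [mkPath_tgt, mkPath_src, mk_eq_mk] at e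
  have e' := h.morEq_symm W.wf X.wf e
  have hq' := h.isEl_idTel_conv W.wf X.wf (h.ctxEq_refl X.wf) e' (h.morEq_refl hc) hq
  exact ⟨a, b, c, p', q', ha, hb, hc, hp, hq', rfl,
    mkPath_eq_mkPath.2 ⟨e', h.morEq_refl hc, h.elEq_refl hq⟩⟩

/-- Composable paths share their middle point only judgementally. `exists_mkPath₂` makes it
literally the same vector, and `compId_congr` shows that the composite does not depend on the
representatives chosen. -/
theorem exists_cmp (p q : W ⟶ path X) (e : p ≫ tgt X = q ≫ src X) :
    ∃ r : W ⟶ path X, ∀ {a b c p' q'} (ha hb hc hp hq), p = mkPath a b p' ha hb hp →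
      q = mkPath b c q' hb hc hq → r = mkPath a c (compId X.ctx a b c p' q') ha hc
        ((h.compId_spec W.wf X.wf ha hb hc hp).1 hq) := by
  obtain ⟨a, b, c, p', q', ha, hb, hc, hp, hq, rfl, rfl⟩ := exists_mkPath₂ p q e
  refine ⟨mkPath a c (compId X.ctx a b c p' q') ha hc
    ((h.compId_spec W.wf X.wf ha hb hc hp).1 hq), ?_⟩
  intro a' b' c' p'' q'' ha' hb' hc' hp' hq' e₁ e₂
  rw [mkPath_eq_mkPath] at e₁ e₂ ⊢
  exact ⟨e₁.1, e₂.2.1, h.compId_congr W.wf X.wf e₁.1 e₁.2.1 e₂.2.1 e₁.2.2 e₂.2.2⟩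

noncomputable def cmp (p q : W ⟶ path X) (e : p ≫ tgt X = q ≫ src X) : W ⟶ path X := (exists_cmp p q e).choose

theorem cmp_mkPath {a b c p q : Fin X.len → Tm σ W.len} {ha hb hc hp hq e} :
    cmp (mkPath a b p ha hb hp : W ⟶ path X) (mkPath b c q hb hc hq) e =
      mkPath a c (compId X.ctx a b c p q) ha hc ((h.compId_spec W.wf X.wf ha hb hc hp).1 hq) :=
  (exists_cmp _ _ e).choose_spec _ _ _ _ _ rfl rfl

variable (p q : W ⟶ path X) (e : p ≫ tgt X = q ≫ src X)

theorem cmp_src : cmp p q e ≫ src X = p ≫ src X := by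
  obtain ⟨a, b, c, p', q', ha, hb, hc, hp, hq, rfl, rfl⟩ := exists_mkPath₂ p q e
  rw [cmp_mkPath, mkPath_src, mkPath_src]

theorem cmp_tgt : cmp p q e ≫ tgt X = q ≫ tgt X := by
  obtain ⟨a, b, c, p', q', ha, hb, hc, hp, hq, rfl, rfl⟩ := exists_mkPath₂ p q e
  rw [cmp_mkPath, mkPath_tgt, mkPath_tgt]

theorem comp_cmp {V : Syn h} (g : V ⟶ W) :
    g ≫ cmp p q e = cmp (g ≫ p) (g ≫ q) (by rw [Category.assoc, e, Category.assoc]) := by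
  obtain ⟨a, b, c, p', q', ha, hb, hc, hp, hq, rfl, rfl⟩ := exists_mkPath₂ p q e
  obtain ⟨g, hg, rfl⟩ := exists_mk g
  simp only [cmp_mkPath, mk_comp_mkPath]
  exact mkPath_congr rfl rfl (compId_subst ..)

theorem cmp_rf (e) : cmp p (p ≫ tgt X ≫ rf X) e = p := by
  obtain ⟨a, b, p, ha, hb, hp, rfl⟩ := exists_mkPath p
  have e' : (mkPath a b p ha hb hp : W ⟶ path X) ≫ tgt X ≫ rf X =
    mkPath b b (fun i => .refl (b i)) hb hb (h.isEl_refl W.wf X.wf hb) := by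
    rw [← Category.assoc, mkPath_tgt, mk_rf]
  simp only [e', cmp_mkPath]
  exact mkPath_eq_mkPath.2 ⟨h.morEq_refl ha, h.morEq_refl hb,
    (h.compId_spec W.wf X.wf ha hb hb (q := p) hp).2⟩

end Calculus.Syn

/-! ## Categories with path objects -/

section

universe v₁ u₁

/-- A category with path objects, which satisfy path induction for elements of path objects. -/
class PathCategory (C : Type u₁) [Category.{v₁} C] where
  path : C → C
  src (X : C) : path X ⟶ X
  tgt (X : C) : path X ⟶ X
  rf (X : C) : X ⟶ path X
  rf_src (X : C) : rf X ≫ src X = 𝟙 X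
  rf_tgt (X : C) : rf X ≫ tgt X = 𝟙 X
  map {X Y : C} (u : X ⟶ Y) : path X ⟶ path Y
  map_src {X Y : C} (u : X ⟶ Y) : map u ≫ src Y = src X ≫ u
  map_tgt {X Y : C} (u : X ⟶ Y) : map u ≫ tgt Y = tgt X ≫ u
  rf_map {X Y : C} (u : X ⟶ Y) : rf X ≫ map u = u ≫ rf Y
  cmp {W X : C} (p q : W ⟶ path X) (e : p ≫ tgt X = q ≫ src X) : W ⟶ path X
  cmp_src {W X : C} (p q : W ⟶ path X) (e) : cmp p q e ≫ src X = p ≫ src X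
  cmp_tgt {W X : C} (p q : W ⟶ path X) (e) : cmp p q e ≫ tgt X = q ≫ tgt X
  comp_cmp' {W X : C} (p q : W ⟶ path X) (e) {V : C} (g : V ⟶ W) :
    g ≫ cmp p q e = cmp (g ≫ p) (g ≫ q) (by rw [Category.assoc, e, Category.assoc])
  cmp_rf' {W X : C} (p : W ⟶ path X) (e) : cmp p (p ≫ tgt X ≫ rf X) e = p
  inv (X : C) : path X ⟶ path X
  inv_src (X : C) : inv X ≫ src X = tgt X
  inv_tgt (X : C) : inv X ≫ tgt X = src X
  rf_inv (X : C) : rf X ≫ inv X = rf X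
  path_ext {X Y : C} {s t : path X ⟶ path Y} : s ≫ src Y = t ≫ src Y → s ≫ tgt Y = t ≫ tgt Y →
    rf X ≫ s = rf X ≫ t → s = t
  exists_composable {G X : C} (f : G ⟶ X) :
    ∃ (D : C) (b : D ⟶ G) (p q : D ⟶ path X), p ≫ src X = b ≫ f ∧ p ≫ tgt X = q ≫ src X ∧
      (∀ {V : C} (b' : V ⟶ G) (p' q' : V ⟶ path X), p' ≫ src X = b' ≫ f →
        p' ≫ tgt X = q' ≫ src X → ∃ e : V ⟶ D, e ≫ b = b' ∧ e ≫ p = p' ∧ e ≫ q = q') ∧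
      ∀ {Y : C} {s t : D ⟶ path Y}, s ≫ src Y = t ≫ src Y → s ≫ tgt Y = t ≫ tgt Y →
        (∀ {V : C} (e : V ⟶ D), e ≫ q = e ≫ q ≫ src X ≫ rf X → e ≫ s = e ≫ t) → s = t

end

noncomputable instance {S : Calculus σ} {h : S.Rules} : PathCategory (Calculus.Syn h) where
  path := Calculus.Syn.path
  src := Calculus.Syn.src
  tgt := Calculus.Syn.tgt
  rf := Calculus.Syn.rf
  rf_src := Calculus.Syn.rf_src
  rf_tgt := Calculus.Syn.rf_tgt
  map := Calculus.Syn.map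
  map_src := Calculus.Syn.map_src
  map_tgt := Calculus.Syn.map_tgt
  rf_map := Calculus.Syn.rf_map
  cmp := Calculus.Syn.cmp
  cmp_src := Calculus.Syn.cmp_src
  cmp_tgt := Calculus.Syn.cmp_tgt
  comp_cmp' := Calculus.Syn.comp_cmp
  cmp_rf' := Calculus.Syn.cmp_rf
  inv := Calculus.Syn.inv
  inv_src := Calculus.Syn.inv_src
  inv_tgt := Calculus.Syn.inv_tgt
  rf_inv := Calculus.Syn.rf_inv
  path_ext := Calculus.Syn.path_ext
  exists_composable := Calculus.Syn.exists_composable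

namespace PathCategory

universe v₁ u₁

variable {C : Type u₁} [Category.{v₁} C] [PathCategory C] {V W X Y Z : C}

attribute [simp] rf_src rf_tgt map_src map_tgt rf_map cmp_src cmp_tgt inv_src inv_tgt rf_inv

@[simp] theorem rf_src_assoc (k : X ⟶ W) : rf X ≫ src X ≫ k = k := by
  rw [← Category.assoc, rf_src, Category.id_comp]

@[simp] theorem rf_tgt_assoc (k : X ⟶ W) : rf X ≫ tgt X ≫ k = k := by
  rw [← Category.assoc, rf_tgt, Category.id_comp]

@[simp] theorem map_src_assoc (u : X ⟶ Y) (k : Y ⟶ W) : map u ≫ src Y ≫ k = src X ≫ u ≫ k := by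
  rw [← Category.assoc, map_src, Category.assoc]

@[simp] theorem map_tgt_assoc (u : X ⟶ Y) (k : Y ⟶ W) : map u ≫ tgt Y ≫ k = tgt X ≫ u ≫ k := by
  rw [← Category.assoc, map_tgt, Category.assoc]

@[simp] theorem rf_map_assoc (u : X ⟶ Y) (k : path Y ⟶ W) :
    rf X ≫ map u ≫ k = u ≫ rf Y ≫ k := by
  rw [← Category.assoc, rf_map, Category.assoc]

@[simp] theorem inv_src_assoc (k : X ⟶ W) : inv X ≫ src X ≫ k = tgt X ≫ k := by
  rw [← Category.assoc, inv_src]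

@[simp] theorem inv_tgt_assoc (k : X ⟶ W) : inv X ≫ tgt X ≫ k = src X ≫ k := by
  rw [← Category.assoc, inv_tgt]

@[simp] theorem rf_inv_assoc (k : path X ⟶ W) : rf X ≫ inv X ≫ k = rf X ≫ k := by
  rw [← Category.assoc, rf_inv]

@[simp] theorem comp_cmp (p q : W ⟶ path X) (e) (g : V ⟶ W) :
    g ≫ cmp p q e = cmp (g ≫ p) (g ≫ q) (by rw [Category.assoc, e, Category.assoc]) :=
  comp_cmp' p q e g

@[simp] theorem comp_cmp_assoc (p q : W ⟶ path X) (e) (g : V ⟶ W) (k : path X ⟶ Y) :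
    g ≫ cmp p q e ≫ k =
      cmp (g ≫ p) (g ≫ q) (by rw [Category.assoc, e, Category.assoc]) ≫ k := by
  rw [← Category.assoc, comp_cmp]

@[simp] theorem cmp_src_assoc (p q : W ⟶ path X) (e) (k : X ⟶ Y) :
    cmp p q e ≫ src X ≫ k = p ≫ src X ≫ k := by
  rw [← Category.assoc, cmp_src, Category.assoc]

@[simp] theorem cmp_tgt_assoc (p q : W ⟶ path X) (e) (k : X ⟶ Y) :
    cmp p q e ≫ tgt X ≫ k = q ≫ tgt X ≫ k := by
  rw [← Category.assoc, cmp_tgt, Category.assoc]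

theorem map_composable {p q : W ⟶ path X} (e : p ≫ tgt X = q ≫ src X) (f : X ⟶ Y) :
    (p ≫ map f) ≫ tgt Y = (q ≫ map f) ≫ src Y := by
  rw [Category.assoc, map_tgt, ← Category.assoc, e, Category.assoc, Category.assoc, map_src]

theorem cmp_congr {p p' q q' : W ⟶ path X} {e} (hp : p = p') (hq : q = q') :
    cmp p q e = cmp p' q' (by rw [← hp, ← hq, e]) := by
  subst hp hq; rfl

@[simp] theorem cmp_rf (p : W ⟶ path X) (u : W ⟶ X) (e) : cmp p (u ≫ rf X) e = p := by
  have : u = p ≫ tgt X := by simpa using e.symm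
  subst this
  exact (cmp_congr rfl (Category.assoc ..)).trans (cmp_rf' p (by simp))

/-- A morphism between path objects is known from its two end points and its value at reflexivity.
Here and in the unit, inverse and interchange laws, those three checks are the whole proof. -/
theorem map_id : map (𝟙 X) = 𝟙 (path X) := path_ext (by simp) (by simp) (by simp)

theorem map_comp (u : X ⟶ Y) (v : Y ⟶ Z) : map (u ≫ v) = map u ≫ map v :=
  path_ext (by simp) (by simp) (by simp)

-- Composition is defined so that only the other unit law, `cmp_rf`, is a computation rule. This one
-- is reduced to the generic path `𝟙 (path X)`; at reflexivity it is an instance of `cmp_rf`.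
@[simp] theorem rf_cmp (p : W ⟶ path X) (u : W ⟶ X) (e) : cmp (u ≫ rf X) p e = p := by
  have : u = p ≫ src X := by simpa using e
  subst this
  have h : cmp (src X ≫ rf X) (𝟙 (path X)) (by simp) = 𝟙 (path X) := by
    refine path_ext (by simp) (by simp) ?_
    simp only [comp_cmp, Category.comp_id]
    refine (cmp_congr (p' := rf X) (q' := 𝟙 X ≫ rf X) (by simp) (by simp)).trans (cmp_rf _ _ _)
  have := congrArg (p ≫ ·) h
  simpa using this

theorem cmp_inv (p : W ⟶ path X) (e) : cmp p (p ≫ inv X) e = p ≫ src X ≫ rf X := by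
  have h : cmp (𝟙 (path X)) (inv X) (by simp) = src X ≫ rf X := by
    refine path_ext (by simp) (by simp) ?_
    rw [comp_cmp]
    refine (cmp_congr (p' := rf X) (q' := 𝟙 X ≫ rf X) (by simp) (by simp)).trans ?_
    rw [cmp_rf]; simp
  have := congrArg (p ≫ ·) h
  simpa using this

theorem inv_cmp (p : W ⟶ path X) (e) : cmp (p ≫ inv X) p e = p ≫ tgt X ≫ rf X := by
  have h : cmp (inv X) (𝟙 (path X)) (by simp) = tgt X ≫ rf X := by
    refine path_ext (by simp) (by simp) ?_
    rw [comp_cmp]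
    refine (cmp_congr (p' := rf X) (q' := 𝟙 X ≫ rf X) (by simp) (by simp)).trans ?_
    rw [cmp_rf]; simp
  have := congrArg (p ≫ ·) h
  simpa using this

/-- Path induction for the second of two composable paths. -/
theorem eq_of_composable {G : C} (f : G ⟶ X)
    (F F' : ∀ {V : C} (b : V ⟶ G) (p q : V ⟶ path X), p ≫ src X = b ≫ f →
      p ≫ tgt X = q ≫ src X → (V ⟶ path Y))
    (nat : ∀ {V V' : C} (g : V' ⟶ V) (b p q e₁ e₂), g ≫ F (V := V) b p q e₁ e₂ =
      F (g ≫ b) (g ≫ p) (g ≫ q) (by rw [Category.assoc, e₁, Category.assoc])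
        (by rw [Category.assoc, e₂, Category.assoc]))
    (nat' : ∀ {V V' : C} (g : V' ⟶ V) (b p q e₁ e₂), g ≫ F' (V := V) b p q e₁ e₂ =
      F' (g ≫ b) (g ≫ p) (g ≫ q) (by rw [Category.assoc, e₁, Category.assoc])
        (by rw [Category.assoc, e₂, Category.assoc]))
    (hsrc : ∀ {V : C} (b p q e₁ e₂), F (V := V) b p q e₁ e₂ ≫ src Y = F' b p q e₁ e₂ ≫ src Y)
    (htgt : ∀ {V : C} (b p q e₁ e₂), F (V := V) b p q e₁ e₂ ≫ tgt Y = F' b p q e₁ e₂ ≫ tgt Y)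
    (hrf : ∀ {V : C} (b p) (y : V ⟶ X) (e₁ e₂), F (V := V) b p (y ≫ rf X) e₁ e₂ =
      F' b p (y ≫ rf X) e₁ e₂)
    (b : V ⟶ G) (p q : V ⟶ path X) (e₁ e₂) : F b p q e₁ e₂ = F' b p q e₁ e₂ := by
  -- Naturality of `F` and `F'` reduces the claim to the universal pair of composable paths over
  -- `D`.
  obtain ⟨D, b₀, p₀, q₀, h₁, h₂, hu, hx⟩ := exists_composable f
  obtain ⟨e, rfl, rfl, rfl⟩ := hu b p q e₁ e₂
  rw [← nat e b₀ p₀ q₀ h₁ h₂, ← nat' e b₀ p₀ q₀ h₁ h₂,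
    hx (hsrc b₀ p₀ q₀ h₁ h₂) (htgt b₀ p₀ q₀ h₁ h₂) fun g hg => ?_]
  rw [nat, nat']
  -- The composability proofs depend on the second path, so it is generalised to a variable before
  -- being replaced by a reflexivity.
  have key : ∀ (q' : _ ⟶ path X) (y : _ ⟶ X), q' = y ≫ rf X → ∀ h₁ h₂,
      F (g ≫ b₀) (g ≫ p₀) q' h₁ h₂ = F' (g ≫ b₀) (g ≫ p₀) q' h₁ h₂ := by
    rintro _ y rfl h₁ h₂
    exact hrf _ _ _ _ _
  exact key _ (g ≫ q₀ ≫ src X) (by simpa using hg) _ _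

/-- Induction on the last path, with the first as the parameter `b`; when `r` is a reflexivity both
sides are `cmp p q`. -/
theorem cmp_assoc (p q r : W ⟶ path X) (e e' e₁ e₂) :
    cmp (cmp p q e) r e' = cmp p (cmp q r e₁) e₂ :=
  eq_of_composable (tgt X) (fun b p q e₁ e₂ => cmp (cmp b p e₁.symm) q (by simpa using e₂))
    (fun b p q e₁ e₂ => cmp b (cmp p q e₂) (by simpa using e₁.symm))
    (by intros; simp) (by intros; simp) (by intros; simp) (by intros; simp)
    (by intros; simp) p q r e.symm e₁

/-- Induction on `q` with trivial parameter `𝟙 X`; when `q` is a reflexivity, so is its image, and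
both sides are `p ≫ map f`. -/
theorem cmp_map (p q : W ⟶ path X) (e) (f : X ⟶ Y) : cmp p q e ≫ map f =
    cmp (p ≫ map f) (q ≫ map f) (map_composable e f) :=
  eq_of_composable (𝟙 X) (fun _ p q _ e₂ => cmp p q e₂ ≫ map f)
    (fun _ p q _ e₂ => cmp (p ≫ map f) (q ≫ map f) (map_composable e₂ f))
    (by intros; simp) (by intros; simp) (by intros; simp) (by intros; simp)
    (fun b p y _ e₂ => by
      rw [cmp_rf]
      exact ((cmp_congr rfl (q' := (y ≫ f) ≫ rf Y) (by simp)).trans (cmp_rf _ _ _)).symm)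
    (p ≫ src X) p q (by simp) e

/-- Interchange is naturality of `β` along a path `p`. It suffices to take the generic path, and at
reflexivity both composites are `β`. -/
theorem exchange (p : W ⟶ path X) (β : X ⟶ path Y) (e e') :
    cmp (p ≫ map (β ≫ src Y)) (p ≫ tgt X ≫ β) e =
      cmp (p ≫ src X ≫ β) (p ≫ map (β ≫ tgt Y)) e' := by
  have h : cmp (map (β ≫ src Y)) (tgt X ≫ β) (by simp) =
      cmp (src X ≫ β) (map (β ≫ tgt Y)) (by simp) := by
    refine path_ext (by simp) (by simp) ?_
    rw [comp_cmp, comp_cmp]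
    refine (cmp_congr (p' := (β ≫ src Y) ≫ rf Y) (q' := β) (by simp) (by simp)).trans ?_
    refine Eq.trans ?_
      (cmp_congr (p' := rf X ≫ src X ≫ β) (q' := (β ≫ tgt Y) ≫ rf Y) rfl (by simp)).symm
    rw [rf_cmp, cmp_rf]; simp
  have := congrArg (p ≫ ·) h
  simpa using this

end PathCategory

namespace PathCategory

universe v₁ u₁ w₁

variable {C : Type u₁} [Category.{v₁} C] [PathCategory C]

/-! ### 2-cells in a category with path objects -/

/-- A 2-cell `u ⇒ v`: a morphism into the path object with source `u` and target `v`. -/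
@[ext]
structure Cell {X Y : C} (u v : X ⟶ Y) where
  val : X ⟶ path Y
  val_src : val ≫ src Y = u
  val_tgt : val ≫ tgt Y = v

namespace Cell

attribute [simp] val_src val_tgt

variable {X Y Z : C} {u v w : X ⟶ Y}

@[simp] theorem val_src_assoc (η : Cell u v) (k : Y ⟶ Z) : η.val ≫ src Y ≫ k = u ≫ k := by
  rw [← Category.assoc, val_src]

@[simp] theorem val_tgt_assoc (η : Cell u v) (k : Y ⟶ Z) : η.val ≫ tgt Y ≫ k = v ≫ k := by
  rw [← Category.assoc, val_tgt]

/-- The identity 2-cell, between equal morphisms. -/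
@[simps]
def ofEq (e : u = v) : Cell u v where
  val := u ≫ rf Y
  val_src := by simp
  val_tgt := by simp [e]

@[simps]
def comp (η : Cell u v) (θ : Cell v w) : Cell u w where
  val := cmp η.val θ.val (by simp)
  val_src := by simp
  val_tgt := by simp

@[simps]
def inv (η : Cell u v) : Cell v u where
  val := η.val ≫ PathCategory.inv Y
  val_src := by simp
  val_tgt := by simp

@[simps]
def whiskerLeft (u : X ⟶ Y) {v w : Y ⟶ Z} (η : Cell v w) : Cell (u ≫ v) (u ≫ w) where
  val := u ≫ η.val
  val_src := by simp
  val_tgt := by simp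

@[simps]
def whiskerRight (η : Cell u v) (w : Y ⟶ Z) : Cell (u ≫ w) (v ≫ w) where
  val := η.val ≫ map w
  val_src := by simp
  val_tgt := by simp

theorem ofEq_comp (e : u = v) (θ : Cell v w) : ((ofEq e).comp θ).val = θ.val := rf_cmp _ _ _

theorem comp_ofEq (η : Cell u v) (e : v = w) : (η.comp (ofEq e)).val = η.val := cmp_rf _ _ _

theorem inv_comp (η : Cell u v) : η.inv.comp η = ofEq rfl := by
  ext
  refine (inv_cmp _ _).trans ?_
  simp

theorem comp_inv (η : Cell u v) : η.comp η.inv = ofEq rfl := by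
  ext
  refine (cmp_inv _ _).trans ?_
  simp

theorem comp_assoc {x : X ⟶ Y} (η : Cell u v) (θ : Cell v w) (ζ : Cell w x) :
    (η.comp θ).comp ζ = η.comp (θ.comp ζ) := Cell.ext (cmp_assoc _ _ _ _ _ _ _)

theorem comp_whiskerRight (η : Cell u v) (θ : Cell v w) (x : Y ⟶ Z) :
    (η.comp θ).whiskerRight x = (η.whiskerRight x).comp (θ.whiskerRight x) :=
  Cell.ext (cmp_map _ _ _ _)

theorem whisker_exchange (η : Cell u v) {w x : Y ⟶ Z} (θ : Cell w x) :
    (whiskerLeft u θ).comp (η.whiskerRight x) = (η.whiskerRight w).comp (whiskerLeft v θ) := by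
  obtain ⟨p, rfl, rfl⟩ := η
  obtain ⟨q, rfl, rfl⟩ := θ
  ext
  simpa using (exchange p q (by simp) (by simp)).symm

theorem ofEq_trans (e : u = v) (e' : v = w) : (ofEq e).comp (ofEq e') = ofEq (e.trans e') := by
  subst e e'
  exact Cell.ext (ofEq_comp _ _)

end Cell

/-- The category of 2-cells. -/
@[reducible]
def homCategory (X Y : C) : Category.{v₁} (X ⟶ Y) where
  Hom u v := Cell u v
  id _ := .ofEq rfl
  comp η θ := η.comp θ
  id_comp _ := Cell.ext (Cell.ofEq_comp _ _)
  comp_id _ := Cell.ext (Cell.comp_ofEq _ _)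
  assoc _ _ _ := Cell.comp_assoc _ _ _

section

variable {V W X Y Z : C}

-- Unit laws for reflexivities standing behind right-associated composites, the form in which they
-- arise from coherence cells; with these the coherence axioms of `bicategory` fall to `simp`.
@[simp] theorem cmp_rf₂ (p : W ⟶ path X) (u : W ⟶ Y) (v : Y ⟶ X) (e) :
    cmp p (u ≫ v ≫ rf X) e = p := by
  simpa using cmp_rf p (u ≫ v) (by simpa using e)

@[simp] theorem rf₂_cmp (p : W ⟶ path X) (u : W ⟶ Y) (v : Y ⟶ X) (e) :
    cmp (u ≫ v ≫ rf X) p e = p := by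
  simpa using rf_cmp p (u ≫ v) (by simpa using e)

@[simp] theorem cmp_rf₃ (p : W ⟶ path X) (u : W ⟶ Y) (v : Y ⟶ Z) (w : Z ⟶ X) (e) :
    cmp p (u ≫ v ≫ w ≫ rf X) e = p := by
  simpa using cmp_rf₂ p (u ≫ v) w (by simpa using e)

@[simp] theorem rf₃_cmp (p : W ⟶ path X) (u : W ⟶ Y) (v : Y ⟶ Z) (w : Z ⟶ X) (e) :
    cmp (u ≫ v ≫ w ≫ rf X) p e = p := by
  simpa using rf₂_cmp p (u ≫ v) w (by simpa using e)

@[simp] theorem cmp_rf₄ (p : W ⟶ path X) (u : W ⟶ Y) (v : Y ⟶ Z) (w : Z ⟶ V) (x : V ⟶ X) (e) :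
    cmp p (u ≫ v ≫ w ≫ x ≫ rf X) e = p := by
  simpa using cmp_rf₃ p (u ≫ v) w x (by simpa using e)

end

/-- The invertible 2-cell given by an equality. -/
@[reducible]
def Cell.isoOfEq {X Y : C} {u v : X ⟶ Y} (e : u = v) : @Iso _ (homCategory X Y) u v :=
  @Iso.mk _ (homCategory X Y) u v (.ofEq e) (.ofEq e.symm) (Cell.ofEq_trans _ _)
    (Cell.ofEq_trans _ _)

theorem Cell.isoOfEq_eq {X Y : C} {u v : X ⟶ Y} (e : u = v) :
    Cell.isoOfEq e = @eqToIso _ (homCategory X Y) u v e := by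
  subst e; rfl

variable {I : Type w₁} (out : I → C)

/-- The 2-category of objects of a category with path objects. -/
@[reducible]
def bicategory : Bicategory.{v₁, v₁} I where
  Hom i j := out i ⟶ out j
  id i := 𝟙 (out i)
  comp u v := u ≫ v
  homCategory i j := homCategory (out i) (out j)
  whiskerLeft u _ _ η := η.whiskerLeft u
  whiskerRight η w := η.whiskerRight w
  associator u v w := Cell.isoOfEq (Category.assoc u v w)
  leftUnitor u := Cell.isoOfEq (Category.id_comp u)
  rightUnitor u := Cell.isoOfEq (Category.comp_id u)
  whiskerLeft_id _ _ := Cell.ext (by simp [CategoryStruct.id])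
  whiskerLeft_comp _ _ _ _ _ _ := Cell.ext (by simp [CategoryStruct.comp])
  id_whiskerLeft _ := Cell.ext (by simp [CategoryStruct.comp])
  comp_whiskerLeft _ _ _ _ _ := Cell.ext (by simp [CategoryStruct.comp])
  id_whiskerRight _ _ := Cell.ext (by simp [CategoryStruct.id])
  comp_whiskerRight _ _ _ := Cell.comp_whiskerRight _ _ _
  whiskerRight_id _ := Cell.ext (by simp [CategoryStruct.comp, map_id])
  whiskerRight_comp _ _ _ := Cell.ext (by simp [CategoryStruct.comp, map_comp])
  whisker_assoc _ _ _ _ _ := Cell.ext (by simp [CategoryStruct.comp])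
  whisker_exchange _ _ := Cell.whisker_exchange _ _
  pentagon _ _ _ _ := Cell.ext (by simp [CategoryStruct.comp])
  triangle _ _ := Cell.ext (by simp [CategoryStruct.comp])

theorem bicategory_strict : @Bicategory.Strict I (bicategory out) :=
  @Bicategory.Strict.mk I (bicategory out) (fun u => Category.id_comp u)
    (fun u => Category.comp_id u) (fun u v w => Category.assoc u v w)
    (fun _ => Cell.isoOfEq_eq _) (fun _ => Cell.isoOfEq_eq _) fun _ _ _ => Cell.isoOfEq_eq _

/-! ### 2-cells between squares -/

section

variable {E B E' B' E'' B'' : C}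

/-- A commutative square. -/
@[ext]
structure Square (π : E ⟶ B) (π' : E' ⟶ B') where
  base : B ⟶ B'
  tot : E ⟶ E'
  comm : tot ≫ π' = π ≫ base

variable {π : E ⟶ B} {π' : E' ⟶ B'} {π'' : E'' ⟶ B''}

@[simps]
def Square.id (π : E ⟶ B) : Square π π := ⟨𝟙 B, 𝟙 E, by simp⟩

@[simps]
def Square.comp (u : Square π π') (v : Square π' π'') : Square π π'' where
  base := u.base ≫ v.base
  tot := u.tot ≫ v.tot
  comm := by rw [Category.assoc, v.comm, ← Category.assoc, u.comm, Category.assoc]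

/-- A 2-cell of squares: compatible 2-cells between the sides. -/
@[ext]
structure SquareCell (u v : Square π π') where
  base : Cell u.base v.base
  tot : Cell u.tot v.tot
  comm : tot.val ≫ map π' = π ≫ base.val

namespace SquareCell

variable {u v w : Square π π'}

@[simps]
def ofEq (e : u = v) : SquareCell u v where
  base := .ofEq (congrArg Square.base e)
  tot := .ofEq (congrArg Square.tot e)
  comm := by
    simp only [Cell.ofEq_val, Category.assoc, rf_map]
    rw [← Category.assoc, u.comm, Category.assoc]

@[simps]
def comp (η : SquareCell u v) (θ : SquareCell v w) : SquareCell u w where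
  base := η.base.comp θ.base
  tot := η.tot.comp θ.tot
  comm := by
    simp only [Cell.comp_val, cmp_map, comp_cmp, η.comm, θ.comm]

theorem inv_map {X Y : C} (f : X ⟶ Y) : PathCategory.inv X ≫ map f = map f ≫ PathCategory.inv Y :=
  path_ext (by simp) (by simp) (by simp)

@[simps]
def inv (η : SquareCell u v) : SquareCell v u where
  base := η.base.inv
  tot := η.tot.inv
  comm := by
    simp only [Cell.inv_val, Category.assoc, inv_map]
    rw [← Category.assoc, η.comm, Category.assoc]

@[simps]
def whiskerLeft (u : Square π π') {v w : Square π' π''} (η : SquareCell v w) :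
    SquareCell (u.comp v) (u.comp w) where
  base := η.base.whiskerLeft u.base
  tot := η.tot.whiskerLeft u.tot
  comm := by
    simp only [Cell.whiskerLeft_val, Category.assoc, η.comm]
    rw [← Category.assoc, u.comm, Category.assoc]

@[simps]
def whiskerRight (η : SquareCell u v) (w : Square π' π'') :
    SquareCell (u.comp w) (v.comp w) where
  base := η.base.whiskerRight w.base
  tot := η.tot.whiskerRight w.tot
  comm := by
    simp only [Cell.whiskerRight_val, Category.assoc, ← map_comp, w.comm]
    rw [map_comp, ← Category.assoc, η.comm, Category.assoc]

theorem ext_val {η θ : SquareCell u v} (hb : η.base.val = θ.base.val)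
    (ht : η.tot.val = θ.tot.val) : η = θ :=
  SquareCell.ext (Cell.ext hb) (Cell.ext ht)

theorem inv_comp (η : SquareCell u v) : η.inv.comp η = ofEq rfl :=
  SquareCell.ext (Cell.inv_comp _) (Cell.inv_comp _)

theorem comp_inv (η : SquareCell u v) : η.comp η.inv = ofEq rfl :=
  SquareCell.ext (Cell.comp_inv _) (Cell.comp_inv _)

theorem ofEq_trans (e : u = v) (e' : v = w) : (ofEq e).comp (ofEq e') = ofEq (e.trans e') :=
  SquareCell.ext (Cell.ofEq_trans (congrArg Square.base e) (congrArg Square.base e'))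
    (Cell.ofEq_trans (congrArg Square.tot e) (congrArg Square.tot e'))

end SquareCell

variable (π π')

/-- The category of 2-cells of squares. -/
@[reducible]
def squareCategory : Category.{v₁} (Square π π') where
  Hom u v := SquareCell u v
  id _ := .ofEq rfl
  comp η θ := η.comp θ
  id_comp _ := SquareCell.ext_val (Cell.ofEq_comp rfl _) (Cell.ofEq_comp rfl _)
  comp_id _ := SquareCell.ext_val (Cell.comp_ofEq _ rfl) (Cell.comp_ofEq _ rfl)
  assoc _ _ _ := SquareCell.ext (Cell.comp_assoc _ _ _) (Cell.comp_assoc _ _ _)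

variable {π π'}

/-- The invertible 2-cell given by an equality. -/
@[reducible]
def SquareCell.isoOfEq {u v : Square π π'} (e : u = v) : @Iso _ (squareCategory π π') u v :=
  @Iso.mk _ (squareCategory π π') u v (.ofEq e) (.ofEq e.symm) (SquareCell.ofEq_trans _ _)
    (SquareCell.ofEq_trans _ _)

theorem SquareCell.isoOfEq_eq {u v : Square π π'} (e : u = v) :
    SquareCell.isoOfEq e = @eqToIso _ (squareCategory π π') u v e := by
  subst e; rfl

end

omit [PathCategory C] in
theorem Square.id_comp {E B E' B' : C} {π : E ⟶ B} {π' : E' ⟶ B'} (u : Square π π') :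
    (Square.id π).comp u = u := Square.ext (Category.id_comp _) (Category.id_comp _)

omit [PathCategory C] in
theorem Square.comp_id {E B E' B' : C} {π : E ⟶ B} {π' : E' ⟶ B'} (u : Square π π') :
    u.comp (Square.id π') = u := Square.ext (Category.comp_id _) (Category.comp_id _)

omit [PathCategory C] in
theorem Square.assoc {E B E' B' E'' B'' E₃ B₃ : C} {π : E ⟶ B} {π' : E' ⟶ B'} {π'' : E'' ⟶ B''}
    {π₃ : E₃ ⟶ B₃} (u : Square π π') (v : Square π' π'') (w : Square π'' π₃) :
    (u.comp v).comp w = u.comp (v.comp w) :=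
  Square.ext (Category.assoc _ _ _) (Category.assoc _ _ _)

variable {T : Type w₁} {tot base : T → C} (π : ∀ i, tot i ⟶ base i)

/-- The 2-category of a family of morphisms and the squares between them. -/
@[reducible]
def squareBicategory : Bicategory.{v₁, v₁} T where
  Hom i j := Square (π i) (π j)
  id i := .id (π i)
  comp u v := u.comp v
  homCategory i j := squareCategory (π i) (π j)
  whiskerLeft u _ _ η := η.whiskerLeft u
  whiskerRight η w := η.whiskerRight w
  associator u v w := SquareCell.isoOfEq (Square.assoc u v w)
  leftUnitor u := SquareCell.isoOfEq (Square.id_comp u)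
  rightUnitor u := SquareCell.isoOfEq (Square.comp_id u)
  whiskerLeft_id {i j k} u v := SquareCell.ext
    (@Bicategory.whiskerLeft_id T (bicategory base) i j k u.base v.base)
    (@Bicategory.whiskerLeft_id T (bicategory tot) i j k u.tot v.tot)
  whiskerLeft_comp {i j k} u _ _ _ η θ := SquareCell.ext
    (@Bicategory.whiskerLeft_comp T (bicategory base) i j k u.base _ _ _ η.base θ.base)
    (@Bicategory.whiskerLeft_comp T (bicategory tot) i j k u.tot _ _ _ η.tot θ.tot)
  id_whiskerLeft {i j} _ _ η := SquareCell.ext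
    (@Bicategory.id_whiskerLeft T (bicategory base) i j _ _ η.base)
    (@Bicategory.id_whiskerLeft T (bicategory tot) i j _ _ η.tot)
  comp_whiskerLeft {i j k l} u v _ _ η := SquareCell.ext
    (@Bicategory.comp_whiskerLeft T (bicategory base) i j k l u.base v.base _ _ η.base)
    (@Bicategory.comp_whiskerLeft T (bicategory tot) i j k l u.tot v.tot _ _ η.tot)
  id_whiskerRight {i j k} u v := SquareCell.ext
    (@Bicategory.id_whiskerRight T (bicategory base) i j k u.base v.base)
    (@Bicategory.id_whiskerRight T (bicategory tot) i j k u.tot v.tot)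
  comp_whiskerRight {i j k _ _ _} η θ u := SquareCell.ext
    (@Bicategory.comp_whiskerRight T (bicategory base) i j k _ _ _ η.base θ.base u.base)
    (@Bicategory.comp_whiskerRight T (bicategory tot) i j k _ _ _ η.tot θ.tot u.tot)
  whiskerRight_id {i j} _ _ η := SquareCell.ext
    (@Bicategory.whiskerRight_id T (bicategory base) i j _ _ η.base)
    (@Bicategory.whiskerRight_id T (bicategory tot) i j _ _ η.tot)
  whiskerRight_comp {i j k l _ _} η u v := SquareCell.ext
    (@Bicategory.whiskerRight_comp T (bicategory base) i j k l _ _ η.base u.base v.base)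
    (@Bicategory.whiskerRight_comp T (bicategory tot) i j k l _ _ η.tot u.tot v.tot)
  whisker_assoc {i j k l} u _ _ η v := SquareCell.ext
    (@Bicategory.whisker_assoc T (bicategory base) i j k l u.base _ _ η.base v.base)
    (@Bicategory.whisker_assoc T (bicategory tot) i j k l u.tot _ _ η.tot v.tot)
  whisker_exchange {i j k _ _ _ _} η θ := SquareCell.ext
    (@Bicategory.whisker_exchange T (bicategory base) i j k _ _ _ _ η.base θ.base)
    (@Bicategory.whisker_exchange T (bicategory tot) i j k _ _ _ _ η.tot θ.tot)
  pentagon {i j k l m} u v w x := SquareCell.ext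
    (@Bicategory.pentagon T (bicategory base) i j k l m u.base v.base w.base x.base)
    (@Bicategory.pentagon T (bicategory tot) i j k l m u.tot v.tot w.tot x.tot)
  triangle {i j k} u v := SquareCell.ext
    (@Bicategory.triangle T (bicategory base) i j k u.base v.base)
    (@Bicategory.triangle T (bicategory tot) i j k u.tot v.tot)

theorem squareBicategory_strict : @Bicategory.Strict T (squareBicategory π) :=
  @Bicategory.Strict.mk T (squareBicategory π) (fun u => Square.id_comp u)
    (fun u => Square.comp_id u) (fun u v w => Square.assoc u v w)
    (fun _ => SquareCell.isoOfEq_eq _) (fun _ => SquareCell.isoOfEq_eq _)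
    fun _ _ _ => SquareCell.isoOfEq_eq _

end PathCategory

open DTT.Expr

variable {σ : Signature.{u}}

/-! ## Dependent projections and their path lifting -/

namespace Calculus.Syn

variable {S : Calculus σ} {h : S.Rules} {W X Y : Syn h}

/-- The context `X, A`. -/
abbrev snoc (X : Syn h) (A : Ty σ X.len) (hA : S.IsType X.ctx A) : Syn h :=
  ⟨X.len + 1, X.ctx.snoc A, X.wf, hA⟩

theorem isMor_snoc {n k : ℕ} {Ξ : Ctx σ n} {Γ : Ctx σ k} {A : Ty σ k} {a : Fin k → Tm σ n} {z} :
    S.IsMor Ξ (Γ.snoc A) (ext a z) ↔ S.IsMor Ξ Γ a ∧ S.IsTerm Ξ z (A.subst a) := by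
  rw [IsMor, pre_ext, lst_ext]

theorem morEq_snoc {n k : ℕ} {Ξ : Ctx σ n} {Γ : Ctx σ k} {A : Ty σ k} {a b : Fin k → Tm σ n}
    {z w} : S.MorEq Ξ (Γ.snoc A) (ext a z) (ext b w) ↔
      S.MorEq Ξ Γ a b ∧ S.TmEq Ξ z w (A.subst a) := by
  rw [MorEq, pre_ext, lst_ext, pre_ext, lst_ext]

theorem isEl_idTel_ext {n k : ℕ} {Ξ : Ctx σ n} {Γ : Ctx σ k} {A : Ty σ k} {a b p : Fin k → Tm σ n}
    {s t r} : S.IsEl Ξ (DTT.idTel (Γ.snoc A) (ext a s) (ext b t)) (ext p r) ↔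
      S.IsEl Ξ (DTT.idTel Γ a b) p ∧ S.IsTerm Ξ r (.id (A.subst a) s (transport A a b p t)) := by
  rw [Rules.isEl_idTel_snoc]
  simp only [pre_ext, lst_ext]

theorem elEq_idTel_ext {n k : ℕ} {Ξ : Ctx σ n} {Γ : Ctx σ k} {A : Ty σ k}
    {a b p q : Fin k → Tm σ n} {s t r r'} :
    S.ElEq Ξ (DTT.idTel (Γ.snoc A) (ext a s) (ext b t)) (ext p r) (ext q r') ↔
      S.ElEq Ξ (DTT.idTel Γ a b) p q ∧
        S.TmEq Ξ r r' (.id (A.subst a) s (transport A a b p t)) := by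
  rw [Rules.elEq_idTel_snoc]
  simp only [pre_ext, lst_ext]

variable {A : Ty σ X.len} {hA : S.IsType X.ctx A}

/-- The dependent projection `X, A → X`. -/
def disp (X : Syn h) (A : Ty σ X.len) (hA : S.IsType X.ctx A) : snoc X A hA ⟶ X :=
  mk (fun i => .var (Fin.castAdd 1 i)) (h.isMor_castSucc (snoc X A hA).wf)

def mkSnoc (a : Fin X.len → Tm σ W.len) (z : Tm σ W.len) (ha : S.IsMor W.ctx X.ctx a)
    (hz : S.IsTerm W.ctx z (A.subst a)) : W ⟶ snoc X A hA :=
  mk (ext a z) (isMor_snoc.2 ⟨ha, hz⟩)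

variable {a b p a' b' p' : Fin X.len → Tm σ W.len} {s t r s' t' r' : Tm σ W.len}

theorem exists_mkSnoc (u : W ⟶ snoc X A hA) : ∃ a z ha hz, u = mkSnoc a z ha hz := by
  obtain ⟨f, hf, rfl⟩ := exists_mk u
  exact ⟨pre f, lst f, hf.1, hf.2, mk_congr (ext_pre_lst f).symm⟩

theorem mkSnoc_disp {ha hs} : (mkSnoc a s ha hs : W ⟶ snoc X A hA) ≫ disp X A hA = mk a ha :=
  mk_congr (funext fun i => (var_subst _ _).trans (ext_castSucc a s i))

theorem mkSnoc_eq_mkSnoc {ha hs ha' hs'} :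
    (mkSnoc a s ha hs : W ⟶ snoc X A hA) = mkSnoc a' s' ha' hs' ↔
      S.MorEq W.ctx X.ctx a a' ∧ S.TmEq W.ctx s s' (A.subst a) := mk_eq_mk.trans morEq_snoc

theorem isTerm_comp {V : Syn h} {f : Fin W.len → Tm σ V.len} (hf : S.IsMor V.ctx W.ctx f)
    (hs : S.IsTerm W.ctx s (A.subst a)) :
    S.IsTerm V.ctx (s.subst f) (A.subst fun i => (a i).subst f) := by
  rw [← subst_subst]
  exact h.isTerm_subst V.wf hf hs

theorem mk_mkSnoc {V : Syn h} {f : Fin W.len → Tm σ V.len} {hf ha hs} :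
    (mk f hf : V ⟶ W) ≫ (mkSnoc a s ha hs : W ⟶ snoc X A hA) =
      mkSnoc (fun i => (a i).subst f) (s.subst f) (h.isMor_comp V.wf hf ha) (isTerm_comp hf hs) :=
  mk_congr (ext_subst a s f)

/-- The morphism into the path object of `X, A` with the given components. -/
def mkSnocPath (ha : S.IsMor W.ctx X.ctx a) (hb : S.IsMor W.ctx X.ctx b)
    (hp : S.IsEl W.ctx (DTT.idTel X.ctx a b) p) (hs : S.IsTerm W.ctx s (A.subst a))
    (ht : S.IsTerm W.ctx t (A.subst b))
    (hr : S.IsTerm W.ctx r (.id (A.subst a) s (transport A a b p t))) :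
    W ⟶ path (snoc X A hA) :=
  mkPath (ext a s) (ext b t) (ext p r) (isMor_snoc.2 ⟨ha, hs⟩) (isMor_snoc.2 ⟨hb, ht⟩)
    (isEl_idTel_ext.2 ⟨hp, hr⟩)

theorem exists_mkSnocPath (u : W ⟶ path (snoc X A hA)) :
    ∃ a b p s t r ha hb hp hs ht hr, u = mkSnocPath (a := a) (b := b) (p := p) (s := s) (t := t)
      (r := r) ha hb hp hs ht hr := by
  obtain ⟨a, b, p, ha, hb, hp, rfl⟩ := exists_mkPath u
  have hp' := Rules.isEl_idTel_snoc.1 hp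
  exact ⟨pre a, pre b, pre p, lst a, lst b, lst p, ha.1, hb.1, hp'.1, ha.2, hb.2, hp'.2,
    mkPath_congr (ext_pre_lst a).symm (ext_pre_lst b).symm (ext_pre_lst p).symm⟩

theorem mkSnocPath_tgt {ha hb hp hs ht hr} :
    (mkSnocPath (a := a) (b := b) (p := p) (s := s) (t := t) (r := r) ha hb hp hs ht hr :
      W ⟶ path (snoc X A hA)) ≫ tgt _ = mkSnoc b t hb ht := mkPath_tgt

theorem mkSnocPath_eq {ha hb hp hs ht hr ha' hb' hp' hs' ht' hr'} :
    (mkSnocPath (a := a) (b := b) (p := p) (s := s) (t := t) (r := r) ha hb hp hs ht hr :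
      W ⟶ path (snoc X A hA)) = mkSnocPath (a := a') (b := b') (p := p') (s := s') (t := t')
        (r := r') ha' hb' hp' hs' ht' hr' ↔
      (S.MorEq W.ctx X.ctx a a' ∧ S.TmEq W.ctx s s' (A.subst a)) ∧
      (S.MorEq W.ctx X.ctx b b' ∧ S.TmEq W.ctx t t' (A.subst b)) ∧
      S.ElEq W.ctx (DTT.idTel X.ctx a b) p p' ∧
        S.TmEq W.ctx r r' (.id (A.subst a) s (transport A a b p t)) :=
  mkPath_eq_mkPath.trans (by rw [morEq_snoc, morEq_snoc, elEq_idTel_ext])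

/-- The action of the dependent projection on paths. -/
theorem mkSnocPath_map {ha hb hp hs ht hr} :
    (mkSnocPath (a := a) (b := b) (p := p) (s := s) (t := t) (r := r) ha hb hp hs ht hr :
      W ⟶ path (snoc X A hA)) ≫ map (disp X A hA) = mkPath a b p ha hb hp := by
  have hv := isMor_path_var (snoc X A hA)
  have hp0 := Rules.isEl_idTel_snoc.1 hv.2.2
  have e : map (disp X A hA) = mkPath (pre fun i => .var (uX i)) (pre fun i => .var (uY i))
      (pre fun i => .var (uP i)) hv.1.1 hv.2.1.1 hp0.1 := by
    -- The action of the projection is itself defined by elimination, so it is identified on the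
    -- generic path, by comparison at reflexivity with dropping the last entry of each block.
    refine path_ext ?_ ?_ ?_
    · rw [map_src, mkPath_src]
      rfl
    · rw [map_tgt, mkPath_tgt]
      rfl
    · rw [rf_map]
      refine mk_rf.trans (Eq.trans ?_ mk_comp_mkPath.symm)
      refine mkPath_congr (funext fun i => ?_) (funext fun i => ?_) (funext fun i => ?_)
      · exact ((var_subst _ _).trans (block_uX ..)).symm
      · exact ((var_subst _ _).trans (block_uY ..)).symm
      · change _ = (Expr.var (uP (Fin.castSucc i))).subst (block (n := 0) Fin.elim0 Expr.var
          Expr.var fun i => .refl (.var i))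
        rw [var_subst, block_uP]
        rfl
  rw [e]
  refine mk_comp_mkPath.trans
    (mkPath_congr (funext fun i => ?_) (funext fun i => ?_) (funext fun i => ?_))
  · exact ((var_subst _ _).trans (block_uX ..)).trans (ext_castSucc a s i)
  · exact ((var_subst _ _).trans (block_uY ..)).trans (ext_castSucc b t i)
  · exact ((var_subst _ _).trans (block_uP ..)).trans (ext_castSucc p r i)

/-- Paths lift along dependent projections, by transport. -/
theorem exists_lift (c : W ⟶ path X) (z : W ⟶ snoc X A hA) (e : z ≫ disp X A hA = c ≫ tgt X) :
    ∃ c' : W ⟶ path (snoc X A hA), c' ≫ map (disp X A hA) = c ∧ c' ≫ tgt _ = z := by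
  obtain ⟨a, b, p, ha, hb, hp, rfl⟩ := exists_mkPath c
  obtain ⟨b', t, hb', ht, rfl⟩ := exists_mkSnoc z
  rw [mkSnoc_disp, mkPath_tgt, mk_eq_mk] at e
  have ht' := h.isTerm_conv ht (h.isType_substEq W.wf e hA)
  have hs := h.tmEq_left (h.transport_congr (h.idSound X.wf) X.wf W.wf (h.tyEq_refl hA)
    (h.morEq_refl ha) (h.morEq_refl hb) (h.elEq_refl hp) (h.tmEq_refl ht'))
  -- The lift runs from `p^* t` to `t`; its second component is reflexivity at `p^* t`.
  refine ⟨mkSnocPath ha hb hp hs ht' (h.intro hs), mkSnocPath_map, ?_⟩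
  rw [mkSnocPath_tgt, mkSnoc_eq_mkSnoc]
  exact ⟨h.morEq_symm W.wf X.wf e, h.tmEq_refl ht'⟩

/-! ### Vertical paths -/

/-- By `transport_refl`; so a path over the reflexivity at `a` amounts to an element of the ordinary
identity type of `A(a)`. -/
theorem isTerm_vertical {a : Fin X.len → Tm σ W.len} (hA : S.IsType X.ctx A)
    (ha : S.IsMor W.ctx X.ctx a) (hs : S.IsTerm W.ctx s (A.subst a))
    (ht : S.IsTerm W.ctx t (A.subst a)) :
    S.TyEq W.ctx (.id (A.subst a) s t)
      (.id (A.subst a) s (transport A a a (fun i => .refl (a i)) t)) :=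
  h.form_eq (h.tyEq_refl (h.isType_subst W.wf ha hA)) (h.tmEq_refl hs)
    (h.tmEq_symm (h.transport_refl (h.idSound X.wf) X.wf W.wf hA ha ht))

/-- The path `(r(a), r)` from `(a, s)` to `(a, t)`, for `r : Id_{A(a)}(s, t)`. -/
def mkVertical (ha : S.IsMor W.ctx X.ctx a) (hs : S.IsTerm W.ctx s (A.subst a))
    (ht : S.IsTerm W.ctx t (A.subst a)) (hr : S.IsTerm W.ctx r (.id (A.subst a) s t)) :
    W ⟶ path (snoc X A hA) :=
  mkSnocPath ha ha (h.isEl_refl W.wf X.wf ha) hs ht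
    (h.isTerm_conv hr (isTerm_vertical hA ha hs ht))

theorem mkVertical_map {ha hs ht hr} :
    (mkVertical (a := a) (s := s) (t := t) (r := r) ha hs ht hr :
      W ⟶ path (snoc X A hA)) ≫ map (disp X A hA) = mk a ha ≫ rf X :=
  mkSnocPath_map.trans mk_rf.symm

/-- The base of `c` is a reflexivity only judgementally; converting all components along this
equality puts `r(a)` itself in its place. -/
theorem exists_mkVertical (c : W ⟶ path (snoc X A hA)) (ha : S.IsMor W.ctx X.ctx a)
    (e : c ≫ map (disp X A hA) = mk a ha ≫ rf X) :
    ∃ s t r hs ht hr, c = mkVertical (a := a) (s := s) (t := t) (r := r) ha hs ht hr := by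
  obtain ⟨a', b, p, s, t, r, ha', hb, hp, hs, ht, hr, rfl⟩ := exists_mkSnocPath c
  rw [mkSnocPath_map, mk_rf, mkPath_eq_mkPath] at e
  have e1 := h.isType_substEq W.wf e.1 hA
  have hs' := h.isTerm_conv hs e1
  have ht' := h.isTerm_conv ht (h.isType_substEq W.wf e.2.1 hA)
  have hr' := h.isTerm_conv hr (h.form_eq e1 (h.tmEq_refl hs)
    (h.transport_congr (h.idSound X.wf) X.wf W.wf (h.tyEq_refl hA) e.1 e.2.1 e.2.2
      (h.tmEq_refl ht)))
  have hr'' := h.isTerm_conv hr' (h.tyEq_symm (isTerm_vertical hA ha hs' ht'))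
  exact ⟨s, t, r, hs', ht', hr'', mkSnocPath_eq.2 ⟨⟨e.1, h.tmEq_refl hs⟩, ⟨e.2.1,
    h.tmEq_refl ht⟩, e.2.2, h.tmEq_refl hr⟩⟩

theorem mkVertical_eq {ha hs ht hr ha' hs' ht' hr'} :
    (mkVertical (a := a) (s := s) (t := t) (r := r) ha hs ht hr : W ⟶ path (snoc X A hA)) =
      mkVertical (a := a') (s := s') (t := t') (r := r') ha' hs' ht' hr' ↔
      S.MorEq W.ctx X.ctx a a' ∧ S.TmEq W.ctx s s' (A.subst a) ∧ S.TmEq W.ctx t t' (A.subst a) ∧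
        S.TmEq W.ctx r r' (.id (A.subst a) s t) := by
  refine mkSnocPath_eq.trans ⟨fun e => ⟨e.1.1, e.1.2, e.2.1.2,
    h.tmEq_conv e.2.2.2 (h.tyEq_symm (isTerm_vertical hA ha hs ht))⟩, fun e => ⟨⟨e.1, e.2.1⟩,
      ⟨e.1, e.2.2.1⟩, ?_, h.tmEq_conv e.2.2.2 (isTerm_vertical hA ha hs ht)⟩⟩
  have := (mk_eq_mk (hf := ha) (hg := ha')).2 e.1
  have e' := congrArg (· ≫ rf X) this
  simp only [mk_rf] at e'
  exact (mkPath_eq_mkPath.1 e').2.2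

variable {B : Ty σ Y.len} {hB : S.IsType Y.ctx B} {f : Fin Y.len → Tm σ X.len}

/-- The canonical morphism `X, A → Y, B` for `f : X → Y` and `A = B(f)`. -/
def canon (hf : S.IsMor X.ctx Y.ctx f) (e : S.TyEq X.ctx A (B.subst f)) :
    snoc X A hA ⟶ snoc Y B hB :=
  mkSnoc (fun i => (f i).wk 1) (.var (Fin.last _))
    (by
      simp only [wk, rename_eq_subst]
      exact h.isMor_comp (snoc X A hA).wf (h.isMor_castSucc (snoc X A hA).wf) hf)
    (by
      have h1 := h.isTerm_last (snoc X A hA).wf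
      have h2 := h.tyEq_subst (snoc X A hA).wf (h.isMor_castSucc (snoc X A hA).wf) e
      rw [subst_subst] at h2
      simp only [wk, rename_eq_subst] at h1 ⊢
      exact h.isTerm_conv h1 h2)

theorem canon_disp (hf : S.IsMor X.ctx Y.ctx f) (e : S.TyEq X.ctx A (B.subst f)) :
    (canon hf e : snoc X A hA ⟶ snoc Y B hB) ≫ disp Y B hB = disp X A hA ≫ mk f hf := by
  refine mkSnoc_disp.trans (mk_congr ?_)
  simp only [wk, rename_eq_subst]

theorem tyEq_comp (e : S.TyEq X.ctx A (B.subst f)) (ha : S.IsMor W.ctx X.ctx a) :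
    S.TyEq W.ctx (A.subst a) (B.subst fun i => (f i).subst a) := by
  have := h.tyEq_subst W.wf ha e
  rwa [subst_subst] at this

theorem wk_ext {K : Kind} {n k : ℕ} (t : Expr σ K k) (a : Fin k → Tm σ n) (z : Tm σ n) :
    (t.wk 1).subst (ext a z) = t.subst a := by
  rw [wk, rename_subst]
  exact congrArg t.subst (funext fun i => ext_castSucc a z i)

theorem mkSnoc_canon (hf : S.IsMor X.ctx Y.ctx f) (e : S.TyEq X.ctx A (B.subst f)) {ha hs} :
    (mkSnoc a s ha hs : W ⟶ snoc X A hA) ≫ (canon hf e : _ ⟶ snoc Y B hB) =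
      mkSnoc (fun i => (f i).subst a) s (h.isMor_comp W.wf ha hf)
        (h.isTerm_conv hs (tyEq_comp e ha)) := by
  refine mk_mkSnoc.trans (mk_congr ?_)
  congr 1
  · funext i
    exact wk_ext _ a s
  · exact (var_subst _ _).trans (ext_last a s)

/-- `X, x : A, y : A, p : Id_A(x, y)` -/
abbrev idObj (X : Syn h) (A : Ty σ X.len) (hA : S.IsType X.ctx A) : Syn h :=
  ⟨_, X.ctx.idCtx A, h.isCtx_idCtx hA⟩

theorem isMor_idObj (ha : S.IsMor W.ctx X.ctx a) (hs : S.IsTerm W.ctx s (A.subst a))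
    (ht : S.IsTerm W.ctx t (A.subst a)) (hr : S.IsTerm W.ctx r (.id (A.subst a) s t)) :
    S.IsMor W.ctx (idObj X A hA).ctx (Fin.append a ![s, t, r]) := by
  change S.IsMor W.ctx (X.ctx.idCtx A) _
  rw [← Ctx.append_idTel, Rules.isMor_append, Tel.idTel_subst, Rules.isEl_idTel]
  exact ⟨ha, hs, ht, hr⟩

theorem isMor_idObj_var (X : Syn h) (A : Ty σ X.len) (hA : S.IsType X.ctx A) :
    S.IsMor (idObj X A hA).ctx X.ctx (fun i => .var (Fin.castAdd 3 i)) ∧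
    S.IsTerm (idObj X A hA).ctx (.var (Fin.natAdd _ 0))
      (A.subst fun i => .var (Fin.castAdd 3 i)) ∧
    S.IsTerm (idObj X A hA).ctx (.var (Fin.natAdd _ 1))
      (A.subst fun i => .var (Fin.castAdd 3 i)) ∧
    S.IsTerm (idObj X A hA).ctx (.var (Fin.natAdd _ 2))
      (.id (A.subst fun i => .var (Fin.castAdd 3 i)) (.var (Fin.natAdd _ 0))
        (.var (Fin.natAdd _ 1))) := by
  have h1 := h.isMor_var (idObj X A hA).wf
  change S.IsMor (X.ctx.idCtx A) (X.ctx.idCtx A) _ at h1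
  nth_rw 2 [← Ctx.append_idTel] at h1
  have h2 := Rules.isMor_append_split.1 h1
  rw [Tel.idTel_subst, ← vec3_eta (fun i => Expr.var (Fin.natAdd X.len i)),
    Rules.isEl_idTel] at h2
  exact h2

theorem mk_mkVertical {V : Syn h} {f : Fin W.len → Tm σ V.len} {hf ha hs ht hr} :
    (mk f hf : V ⟶ W) ≫ (mkVertical (a := a) (s := s) (t := t) (r := r) ha hs ht hr :
      W ⟶ path (snoc X A hA)) = mkVertical (a := fun i => (a i).subst f) (s := s.subst f)
        (t := t.subst f) (r := r.subst f) (h.isMor_comp V.wf hf ha) (isTerm_comp hf hs)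
        (isTerm_comp hf ht) (by
          rw [← subst_subst, ← id_subst]
          exact h.isTerm_subst V.wf hf hr) := by
  unfold mkVertical mkSnocPath
  rw [mk_comp_mkPath]
  exact mkPath_congr (ext_subst a s f) (ext_subst a t f) (ext_subst _ r f)

theorem mkVertical_congr {ha hs ht hr} (e₁ : a = a') (e₂ : s = s') (e₃ : t = t') (e₄ : r = r') :
    (mkVertical (a := a) (s := s) (t := t) (r := r) ha hs ht hr : W ⟶ path (snoc X A hA)) =
      mkVertical (a := a') (s := s') (t := t') (r := r') (e₁ ▸ ha) (e₁ ▸ e₂ ▸ hs)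
        (e₁ ▸ e₃ ▸ ht) (e₁ ▸ e₂ ▸ e₃ ▸ e₄ ▸ hr) := by
  subst e₁ e₂ e₃ e₄; rfl

theorem mkVertical_src {ha hs ht hr} :
    (mkVertical (a := a) (s := s) (t := t) (r := r) ha hs ht hr : W ⟶ path (snoc X A hA)) ≫
      src _ = mkSnoc a s ha hs := by
  unfold mkVertical mkSnocPath
  exact mkPath_src

theorem mkVertical_tgt {ha hs ht hr} :
    (mkVertical (a := a) (s := s) (t := t) (r := r) ha hs ht hr : W ⟶ path (snoc X A hA)) ≫
      tgt _ = mkSnoc a t ha ht := by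
  unfold mkVertical mkSnocPath
  exact mkPath_tgt

theorem isTerm_canon (e : S.TyEq X.ctx A (B.subst f)) (ha : S.IsMor W.ctx X.ctx a)
    (hs : S.IsTerm W.ctx s (A.subst a)) (ht : S.IsTerm W.ctx t (A.subst a))
    (hr : S.IsTerm W.ctx r (.id (A.subst a) s t)) :
    S.IsTerm W.ctx r (.id (B.subst fun i => (f i).subst a) s t) :=
  h.isTerm_conv hr (h.form_eq (tyEq_comp e ha) (h.tmEq_refl hs) (h.tmEq_refl ht))

/-- The canonical morphism acts on vertical paths as the identity. -/
theorem mkVertical_map_canon (hf : S.IsMor X.ctx Y.ctx f) (e : S.TyEq X.ctx A (B.subst f))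
    {ha hs ht hr} : (mkVertical (a := a) (s := s) (t := t) (r := r) ha hs ht hr :
      W ⟶ path (snoc X A hA)) ≫ map (canon hf e : _ ⟶ snoc Y B hB) =
    mkVertical (h.isMor_comp W.wf ha hf) (h.isTerm_conv hs (tyEq_comp e ha))
      (h.isTerm_conv ht (tyEq_comp e ha)) (isTerm_canon e ha hs ht hr) := by
  have hv := isMor_idObj_var X A hA
  have hd := h.isMor_diag (snoc X A hA).wf
  -- First the generic vertical path, over `X, x : A, y : A, p : Id_A(x, y)`. Here the base point is
  -- a parameter, so elimination over the single type `A` suffices. Every vertical path is a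
  -- substitution instance of this one.
  have key : (mkVertical hv.1 hv.2.1 hv.2.2.1 hv.2.2.2 : idObj X A hA ⟶ path (snoc X A hA)) ≫
      map (canon hf e : _ ⟶ snoc Y B hB) =
      mkVertical (h.isMor_comp (idObj X A hA).wf hv.1 hf) (h.isTerm_conv hv.2.1 (tyEq_comp e hv.1))
        (h.isTerm_conv hv.2.2.1 (tyEq_comp e hv.1))
        (isTerm_canon e hv.1 hv.2.1 hv.2.2.1 hv.2.2.2) := by
    refine eq_of_diag (V' := snoc X A hA) _ hd rfl
      (h.elEq_of_diag hA (snoc Y B hB).wf) ?_ ?_ ?_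
    · rw [Category.assoc, map_src, ← Category.assoc, mkVertical_src, mkVertical_src, mkSnoc_canon]
    · rw [Category.assoc, map_tgt, ← Category.assoc, mkVertical_tgt, mkVertical_tgt, mkSnoc_canon]
    -- On the diagonal the generic vertical path is `rf`, whose image under `map` is known.
    · have e1 : (mk (diag X.len) hd : snoc X A hA ⟶ idObj X A hA) ≫
          (mkVertical hv.1 hv.2.1 hv.2.2.1 hv.2.2.2 : idObj X A hA ⟶ path (snoc X A hA)) =
          rf _ := by
        rw [mk_mkVertical]
        have e2 (z : Tm σ (X.len + 1)) (hz : z = .var (Fin.last _)) :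
            ext (fun i => (Expr.var (σ := σ) (Fin.castAdd 3 i)).subst (diag X.len)) z = .var := by
          subst hz
          simp only [var_subst, diag_castAdd]
          exact ext_pre_lst (Expr.var (n := X.len + 1))
        unfold mkVertical mkSnocPath rf
        refine mkPath_congr (e2 _ ?_) (e2 _ ?_) ?_
        · exact (var_subst _ _).trans (Fin.append_right _ _ (0 : Fin 3))
        · exact (var_subst _ _).trans (Fin.append_right _ _ (1 : Fin 3))
        · rw [show (Expr.var (σ := σ) (Fin.natAdd X.len 2)).subst (diag X.len) =
            .refl (.var (Fin.last _)) from (var_subst _ _).trans (Fin.append_right _ _ (2 : Fin 3)),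
            ← ext_comp Expr.refl, e2 _ rfl]
      rw [← Category.assoc, e1, rf_map, mk_mkVertical]
      refine mk_rf.trans ?_
      have e2 : (fun i => ((f i).subst fun i => .var (Fin.castAdd 3 i)).subst (diag X.len)) =
          fun i => (f i).wk 1 := by
        funext i
        rw [subst_subst, wk, rename_eq_subst]
        simp only [var_subst, diag_castAdd]
      have e3 (z : Tm σ (X.len + 1)) (hz : z = .var (Fin.last _)) :
          ext (fun i => (f i).wk 1) (.var (Fin.last _)) = ext (fun i =>
            ((f i).subst fun i => .var (Fin.castAdd 3 i)).subst (diag X.len)) z := by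
        rw [e2, hz]
      unfold mkVertical mkSnocPath
      refine mkPath_congr (e3 _ ?_) (e3 _ ?_) ?_
      · exact (var_subst _ _).trans (Fin.append_right _ _ (0 : Fin 3))
      · exact (var_subst _ _).trans (Fin.append_right _ _ (1 : Fin 3))
      · rw [show (Expr.var (σ := σ) (Fin.natAdd X.len 2)).subst (diag X.len) =
          .refl (.var (Fin.last _)) from (var_subst _ _).trans (Fin.append_right _ _ (2 : Fin 3)),
          ← ext_comp Expr.refl, ← e3 _ rfl]
  have hm := isMor_idObj (hA := hA) ha hs ht hr
  have h1 := congrArg (mk _ hm ≫ ·) key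
  simp only [← Category.assoc] at h1
  rw [mk_mkVertical, mk_mkVertical] at h1
  have ea : (fun i => (Expr.var (Fin.castAdd 3 i)).subst (Fin.append a ![s, t, r])) = a :=
    funext fun i => (var_subst _ _).trans (Fin.append_left _ _ i)
  have es : (Expr.var (Fin.natAdd X.len 0)).subst (Fin.append a ![s, t, r]) = s :=
    (var_subst _ _).trans (Fin.append_right _ _ (0 : Fin 3))
  have et : (Expr.var (Fin.natAdd X.len 1)).subst (Fin.append a ![s, t, r]) = t :=
    (var_subst _ _).trans (Fin.append_right _ _ (1 : Fin 3))
  have er : (Expr.var (Fin.natAdd X.len 2)).subst (Fin.append a ![s, t, r]) = r :=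
    (var_subst _ _).trans (Fin.append_right _ _ (2 : Fin 3))
  refine (congrArg (· ≫ map _) (mkVertical_congr ea.symm es.symm et.symm er.symm)).trans
    (h1.trans (mkVertical_congr (funext fun i => ?_) es et er))
  rw [subst_subst, ea]

end Calculus.Syn

namespace PathCategory

universe v₁ u₁

variable {C : Type u₁} [Category.{v₁} C] [PathCategory C]

/-! ### Cartesian squares -/

@[simp] theorem inv_map_assoc {X Y W : C} (f : X ⟶ Y) (k : path Y ⟶ W) :
    PathCategory.inv X ≫ map f ≫ k = map f ≫ PathCategory.inv Y ≫ k := by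
  rw [← Category.assoc, SquareCell.inv_map, Category.assoc]

theorem cmp_inv_cancel {W X : C} (p q : W ⟶ path X) (e : p ≫ tgt X = q ≫ tgt X) :
    cmp (cmp p (q ≫ inv X) (by simpa using e)) q (by simp) = p := by
  rw [cmp_assoc _ _ _ _ _ (by simp) (by simp [e])]
  exact (cmp_congr rfl ((inv_cmp _ _).trans (Category.assoc ..).symm)).trans (cmp_rf _ _ (by simp [e]))

/-- Paths with given end points over the base lift to the total object. -/
def HasPathLifting {E B : C} (π : E ⟶ B) : Prop :=
  ∀ {W : C} (c : W ⟶ path B) (z : W ⟶ E), z ≫ π = c ≫ tgt B →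
    ∃ c' : W ⟶ path E, c' ≫ map π = c ∧ c' ≫ tgt E = z

variable {E B E' B' E'' B'' : C} {π : E ⟶ B} {π' : E' ⟶ B'} {π'' : E'' ⟶ B''}

/-- A square is cartesian if it and the induced square of path objects are pullbacks. -/
structure Square.IsCartesian (q : Square π π') : Prop where
  lift {W : C} (w : W ⟶ B) (e : W ⟶ E') : e ≫ π' = w ≫ q.base →
    ∃! e' : W ⟶ E, e' ≫ π = w ∧ e' ≫ q.tot = e
  liftPath {W : C} (c : W ⟶ path B) (A : W ⟶ path E') : A ≫ map π' = c ≫ map q.base →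
    ∃! A' : W ⟶ path E, A' ≫ map π = c ∧ A' ≫ map q.tot = A

theorem Square.map_comm (q : Square π π') : map q.tot ≫ map π' = map π ≫ map q.base := by
  rw [← map_comp, q.comm, map_comp]

/-- A pullback square is cartesian if vertical paths lift uniquely. -/
theorem Square.isCartesian_of_vertical (q : Square π π') (hπ : HasPathLifting π)
    (hlift : ∀ {W : C} (w : W ⟶ B) (e : W ⟶ E'), e ≫ π' = w ≫ q.base →
      ∃! e' : W ⟶ E, e' ≫ π = w ∧ e' ≫ q.tot = e)
    (hv : ∀ {W : C} (w : W ⟶ B) (d : W ⟶ path E'), d ≫ map π' = w ≫ q.base ≫ rf B' →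
      ∃! d' : W ⟶ path E, d' ≫ map π = w ≫ rf B ∧ d' ≫ map q.tot = d) : q.IsCartesian := by
  refine ⟨hlift, fun {W} c A hA => ?_⟩
  have huniq {e₁ e₂ : W ⟶ E} (h₁ : e₁ ≫ π = e₂ ≫ π) (h₂ : e₁ ≫ q.tot = e₂ ≫ q.tot) :
      e₁ = e₂ := by
    refine (hlift (e₂ ≫ π) (e₂ ≫ q.tot) ?_).unique ⟨h₁, h₂⟩ ⟨rfl, rfl⟩
    rw [Category.assoc, q.comm, Category.assoc]
  have htgt : (A ≫ tgt E') ≫ π' = (c ≫ tgt B) ≫ q.base := by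
    rw [Category.assoc, ← map_tgt, ← Category.assoc, hA, Category.assoc, map_tgt, Category.assoc]
  -- The end point `L` of the required path is forced. Let `g` be any lift of `c` ending at `L`.
  -- Then `A` followed by the inverse of the image of `g` lies over a reflexivity, hence lifts to a
  -- unique vertical path `d`, and `d` followed by `g` is the path sought.
  obtain ⟨L, ⟨hL, hL'⟩, -⟩ := hlift _ _ htgt
  obtain ⟨g, hg, hg'⟩ := hπ c L hL
  have hgq : (g ≫ map q.tot) ≫ tgt E' = A ≫ tgt E' := by
    rw [Category.assoc, map_tgt, ← Category.assoc, hg', hL']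
  have hgπ : (g ≫ map q.tot) ≫ map π' = c ≫ map q.base := by
    rw [Category.assoc, q.map_comm, ← Category.assoc, hg]
  have hd : cmp A ((g ≫ map q.tot) ≫ inv E') (by simpa using hgq.symm) ≫ map π' =
      (c ≫ src B) ≫ q.base ≫ rf B' := by
    rw [cmp_map]
    refine (cmp_congr hA (q' := (c ≫ map q.base) ≫ inv B') ?_).trans ?_
    · rw [Category.assoc, SquareCell.inv_map, ← Category.assoc, hgπ]
    · rw [cmp_inv]; simp
  obtain ⟨d, ⟨hd₁, hd₂⟩, hdu⟩ := hv _ _ hd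
  have hdg : d ≫ tgt E = g ≫ src E := by
    refine huniq ?_ ?_
    · rw [Category.assoc, ← map_tgt, ← Category.assoc, hd₁, Category.assoc g, ← map_src,
        ← Category.assoc g, hg]
      simp
    · rw [Category.assoc, ← map_tgt, ← Category.assoc, hd₂]
      simp
  refine ⟨cmp d g hdg, ⟨?_, ?_⟩, fun A' hA' => ?_⟩
  · rw [cmp_map]
    exact (cmp_congr hd₁ hg).trans (rf_cmp _ _ (by simp))
  · rw [cmp_map]
    exact (cmp_congr hd₂ rfl).trans (cmp_inv_cancel A (g ≫ map q.tot) hgq.symm)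
  -- A competitor has the same end point as `g`; composed with the inverse of `g` it becomes a
  -- vertical path with the defining property of `d`.
  · have hA'g : A' ≫ tgt E = g ≫ tgt E := by
      refine huniq ?_ ?_
      · rw [Category.assoc, ← map_tgt, ← Category.assoc, hA'.1, hg', hL]
      · rw [Category.assoc, ← map_tgt, ← Category.assoc, hA'.2, hg', hL']
    have : cmp A' (g ≫ inv E) (by simpa using hA'g) = d := by
      refine hdu _ ⟨?_, ?_⟩
      · rw [cmp_map]
        refine (cmp_congr hA'.1 (q' := c ≫ inv B) ?_).trans ?_
        · rw [Category.assoc, SquareCell.inv_map, ← Category.assoc, hg]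
        · rw [cmp_inv]; simp
      · rw [cmp_map]
        refine cmp_congr hA'.2 ?_
        rw [Category.assoc, SquareCell.inv_map, ← Category.assoc]
    rw [← cmp_inv_cancel A' g hA'g]
    exact cmp_congr this rfl

/-- Cartesian squares are closed under composition with isomorphisms. -/
theorem Square.IsCartesian.iso_comp {q : Square π' π''} (hq : q.IsCartesian) (φ : Square π π')
    (ψ : Square π' π) (h₁ : φ.comp ψ = .id π) (h₂ : ψ.comp φ = .id π') :
    (φ.comp q).IsCartesian := by
  have hb₁ : φ.base ≫ ψ.base = 𝟙 B := congrArg Square.base h₁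
  have ht₁ : φ.tot ≫ ψ.tot = 𝟙 E := congrArg Square.tot h₁
  have ht₂ : ψ.tot ≫ φ.tot = 𝟙 E' := congrArg Square.tot h₂
  constructor
  · intro W w e he
    obtain ⟨e', ⟨he₁, he₂⟩, hu⟩ := hq.lift (w ≫ φ.base) e (by simpa using he)
    refine ⟨e' ≫ ψ.tot, ⟨?_, ?_⟩, fun e'' h'' => ?_⟩
    · rw [Category.assoc, ψ.comm, ← Category.assoc, he₁, Category.assoc, hb₁, Category.comp_id]
    · simp only [Square.comp_tot, Category.assoc]
      rw [← Category.assoc ψ.tot, ht₂, Category.id_comp, he₂]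
    · have := hu (e'' ≫ φ.tot) ⟨by rw [Category.assoc, φ.comm, ← Category.assoc, h''.1],
        by simpa using h''.2⟩
      rw [← this, Category.assoc, ht₁, Category.comp_id]
  · intro W c A hA
    obtain ⟨A', ⟨hA₁, hA₂⟩, hu⟩ := hq.liftPath (c ≫ map φ.base) A
      (by simpa [map_comp] using hA)
    refine ⟨A' ≫ map ψ.tot, ⟨?_, ?_⟩, fun A'' h'' => ?_⟩
    · rw [Category.assoc, ψ.map_comm, ← Category.assoc, hA₁, Category.assoc, ← map_comp, hb₁,
        map_id, Category.comp_id]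
    · simp only [Square.comp_tot, Category.assoc, ← map_comp]
      rw [← Category.assoc ψ.tot, ht₂, Category.id_comp, hA₂]
    · have := hu (A'' ≫ map φ.tot) ⟨by rw [Category.assoc, φ.map_comm, ← Category.assoc, h''.1],
        by simpa [map_comp] using h''.2⟩
      rw [← this, Category.assoc, ← map_comp, ht₁, map_id, Category.comp_id]

end PathCategory

open DTT.Expr

variable {σ : Signature.{u}}

namespace Calculus.Syn

variable {S : Calculus σ} {h : S.Rules} {W X Y : Syn h} {A : Ty σ X.len} {hA : S.IsType X.ctx A}
  {B : Ty σ Y.len} {hB : S.IsType Y.ctx B} {f : Fin Y.len → Tm σ X.len}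

theorem hasPathLifting_disp : PathCategory.HasPathLifting (disp X A hA) :=
  fun c z e => exists_lift c z e

/-- The square of the canonical morphism `X, B(f) → Y, B`. -/
def canonSquare (hf : S.IsMor X.ctx Y.ctx f) (e : S.TyEq X.ctx A (B.subst f)) :
    PathCategory.Square (disp X A hA) (disp Y B hB) where
  base := mk f hf
  tot := canon hf e
  comm := canon_disp hf e

/-- Given `A = B(f)`, terms of `A(w)` and of `B(f(w))` are the same, and by `mkVertical_map_canon`
so are vertical paths in them. Both lifting properties are therefore conversions, and path lifting
extends the second to all paths. -/
theorem isCartesian_canonSquare (hf : S.IsMor X.ctx Y.ctx f) (e : S.TyEq X.ctx A (B.subst f)) :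
    (canonSquare hf e : PathCategory.Square (disp X A hA) (disp Y B hB)).IsCartesian := by
  refine PathCategory.Square.isCartesian_of_vertical _ hasPathLifting_disp ?_ ?_
  · intro W w z hz
    obtain ⟨w, hw, rfl⟩ := exists_mk w
    obtain ⟨b, z, hb, hz', rfl⟩ := exists_mkSnoc z
    rw [mkSnoc_disp] at hz
    have hbw := mk_eq_mk.1 hz
    have hs := h.isTerm_conv (h.isTerm_conv hz' (h.isType_substEq W.wf hbw hB))
      (h.tyEq_symm (tyEq_comp e hw))
    refine ⟨mkSnoc w z hw hs, ⟨mkSnoc_disp, ?_⟩, ?_⟩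
    · refine (mkSnoc_canon hf e).trans (mkSnoc_eq_mkSnoc.2 ?_)
      exact ⟨h.morEq_symm W.wf Y.wf hbw, h.tmEq_refl
        (h.isTerm_conv hz' (h.isType_substEq W.wf hbw hB))⟩
    · rintro z' ⟨h₁, h₂⟩
      obtain ⟨w', z', hw', hz'', rfl⟩ := exists_mkSnoc z'
      rw [mkSnoc_disp, mk_eq_mk] at h₁
      have h₃ := mkSnoc_eq_mkSnoc.1 ((mkSnoc_canon hf e).symm.trans h₂)
      exact mkSnoc_eq_mkSnoc.2 ⟨h₁, h.tmEq_conv h₃.2 (h.tyEq_symm (tyEq_comp e hw'))⟩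
  · intro W w d hd
    obtain ⟨w, hw, rfl⟩ := exists_mk w
    have hd' : d ≫ map (disp Y B hB) = mk _ (h.isMor_comp W.wf hw hf) ≫ rf Y :=
      hd.trans (Category.assoc _ _ _).symm
    obtain ⟨s, t, r, hs, ht, hr, rfl⟩ := exists_mkVertical d _ hd'
    have e' := h.tyEq_symm (tyEq_comp e hw)
    have hs' := h.isTerm_conv hs e'
    have ht' := h.isTerm_conv ht e'
    have hr' := h.isTerm_conv hr (h.form_eq e' (h.tmEq_refl hs) (h.tmEq_refl ht))
    refine ⟨mkVertical hw hs' ht' hr', ⟨mkVertical_map, mkVertical_map_canon hf e⟩, ?_⟩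
    rintro d' ⟨h₁, h₂⟩
    obtain ⟨s', t', r', hs', ht', hr', rfl⟩ := exists_mkVertical d' hw h₁
    have h₃ := mkVertical_eq.1 ((mkVertical_map_canon hf e).symm.trans h₂)
    exact mkVertical_eq.2 ⟨h.morEq_refl hw, h.tmEq_conv h₃.2.1 (h.tyEq_symm (tyEq_comp e hw)),
      h.tmEq_conv h₃.2.2.1 (h.tyEq_symm (tyEq_comp e hw)), h.tmEq_conv h₃.2.2.2
        (h.tyEq_symm (h.form_eq (tyEq_comp e hw) (h.tmEq_refl hs') (h.tmEq_refl ht')))⟩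

end Calculus.Syn

namespace Calculus

variable {S : Calculus σ}

/-! ## Representatives of contexts and types -/

namespace Rules

variable (h : S.Rules)
include h

/-- Equality in `Quot` a priori yields only the generated equivalence relation; as the relation is
already an equivalence, representatives of one class are judgementally equal. -/
theorem ctxEq_equivalence (n : ℕ) :
    Equivalence fun Γ Δ : { Γ : Ctx σ n // S.IsCtx Γ } => S.CtxEq Γ.1 Δ.1 :=
  ⟨fun Γ => h.ctxEq_refl Γ.2, fun {Γ Δ} e => h.ctxEq_symm Γ.2 Δ.2 e,
    fun {Γ Δ _} e e' => h.ctxEq_trans Γ.2 Δ.2 e e'⟩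

theorem typEq_equivalence (n : ℕ) :
    Equivalence fun X Y : { X : Ctx σ n × Ty σ n // S.IsCtx X.1 ∧ S.IsType X.1 X.2 } =>
      S.CtxEq X.1.1 Y.1.1 ∧ S.TyEq X.1.1 X.1.2 Y.1.2 :=
  ⟨fun X => h.ctxEq_refl (Γ := X.1.1.snoc X.1.2) X.2,
    fun {X Y} e => h.ctxEq_symm (Γ := X.1.1.snoc X.1.2) (Γ' := Y.1.1.snoc Y.1.2) X.2 Y.2 e,
    fun {X Y Z} e e' => h.ctxEq_trans (Γ := X.1.1.snoc X.1.2) (Γ' := Y.1.1.snoc Y.1.2)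
      (Γ'' := Z.1.1.snoc Z.1.2) X.2 Y.2 e e'⟩

variable {n m : ℕ} {Γ Γ' : Ctx σ n} {Δ Δ' : Ctx σ m} {A : Ty σ n} {B : Ty σ m}

theorem isEl_ctxConv {k : ℕ} {Θ : Tel σ n k} {p} (hΓ : S.IsCtx Γ) (hΓ' : S.IsCtx Γ')
    (e : S.CtxEq Γ Γ') (hp : S.IsEl Γ Θ p) : S.IsEl Γ' Θ p := by
  induction Θ with
  | nil => trivial
  | snoc Θ A ih => exact ⟨ih hp.1, h.isTerm_ctxConv hΓ hΓ' e hp.2⟩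

theorem elEq_ctxConv {k : ℕ} {Θ : Tel σ n k} {p q} (hΓ : S.IsCtx Γ) (hΓ' : S.IsCtx Γ')
    (e : S.CtxEq Γ Γ') (hp : S.ElEq Γ Θ p q) : S.ElEq Γ' Θ p q := by
  induction Θ with
  | nil => trivial
  | snoc Θ A ih => exact ⟨ih hp.1, h.tmEq_ctxConv hΓ hΓ' e hp.2⟩

theorem isMor_conv₂ {f} (hΓ : S.IsCtx Γ) (hΓ' : S.IsCtx Γ') (e : S.CtxEq Γ Γ') (e' : S.CtxEq Δ Δ')
    (hf : S.IsMor Γ Δ f) : S.IsMor Γ' Δ' f :=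
  h.isMor_conv hΓ' e' (h.isMor_ctxConv hΓ hΓ' e hf)

theorem morEq_conv₂ {f g} (hΓ : S.IsCtx Γ) (hΓ' : S.IsCtx Γ') (e : S.CtxEq Γ Γ')
    (e' : S.CtxEq Δ Δ') (hf : S.MorEq Γ Δ f g) : S.MorEq Γ' Δ' f g :=
  h.morEq_conv hΓ' e' (h.morEq_ctxConv hΓ hΓ' e hf)

theorem isEl_conv₂ {a a' b b' p} (hΓ : S.IsCtx Γ) (hΓ' : S.IsCtx Γ') (hΔ : S.IsCtx Δ)
    (hΔ' : S.IsCtx Δ') (e : S.CtxEq Γ Γ') (e' : S.CtxEq Δ Δ') (ha : S.MorEq Γ' Δ' a a')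
    (hb : S.MorEq Γ' Δ' b b') (hp : S.IsEl Γ (DTT.idTel Δ a b) p) :
    S.IsEl Γ' (DTT.idTel Δ' a' b') p :=
  have e'' := h.ctxEq_symm hΔ hΔ' e'
  h.isEl_idTel_conv hΓ' hΔ e' (h.morEq_conv hΓ' e'' ha) (h.morEq_conv hΓ' e'' hb)
    (h.isEl_ctxConv hΓ hΓ' e hp)

theorem elEq_conv₂ {a a' b b' p q} (hΓ : S.IsCtx Γ) (hΓ' : S.IsCtx Γ') (hΔ : S.IsCtx Δ)
    (hΔ' : S.IsCtx Δ') (e : S.CtxEq Γ Γ') (e' : S.CtxEq Δ Δ') (ha : S.MorEq Γ' Δ' a a')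
    (hb : S.MorEq Γ' Δ' b b') (hp : S.ElEq Γ (DTT.idTel Δ a b) p q) :
    S.ElEq Γ' (DTT.idTel Δ' a' b') p q :=
  have e'' := h.ctxEq_symm hΔ hΔ' e'
  h.elEq_idTel_conv hΓ' hΔ e' (h.morEq_conv hΓ' e'' ha) (h.morEq_conv hΓ' e'' hb)
    (h.elEq_ctxConv hΓ hΓ' e hp)

theorem isMor_wk {f : Fin m → Tm σ n} (hΓ : S.IsCtx (Γ.snoc A)) (hf : S.IsMor Γ Δ f) :
    S.IsMor (Γ.snoc A) Δ fun i => (f i).wk 1 := by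
  simp only [wk, rename_eq_subst]
  exact h.isMor_comp hΓ (h.isMor_castSucc hΓ) hf

theorem morEq_wk {f g : Fin m → Tm σ n} (hΓ : S.IsCtx (Γ.snoc A)) (hf : S.MorEq Γ Δ f g) :
    S.MorEq (Γ.snoc A) Δ (fun i => (f i).wk 1) fun i => (g i).wk 1 := by
  simp only [wk, rename_eq_subst]
  exact h.morEq_comp hΓ (h.morEq_refl (h.isMor_castSucc hΓ)) hf

theorem isEl_wk {f g p : Fin m → Tm σ n} (hΓ : S.IsCtx (Γ.snoc A))
    (hp : S.IsEl Γ (DTT.idTel Δ f g) p) :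
    S.IsEl (Γ.snoc A) (DTT.idTel Δ (fun i => (f i).wk 1) fun i => (g i).wk 1)
      fun i => (p i).wk 1 := by
  simp only [wk, rename_eq_subst]
  rw [← idTel_subst]
  exact h.isEl_subst hΓ (h.isMor_castSucc hΓ) hp

theorem elEq_wk {f g p q : Fin m → Tm σ n} (hΓ : S.IsCtx (Γ.snoc A))
    (hp : S.ElEq Γ (DTT.idTel Δ f g) p q) :
    S.ElEq (Γ.snoc A) (DTT.idTel Δ (fun i => (f i).wk 1) fun i => (g i).wk 1)
      (fun i => (p i).wk 1) fun i => (q i).wk 1 := by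
  simp only [wk, rename_eq_subst]
  rw [← idTel_subst]
  exact h.elEq_subst hΓ (h.isMor_castSucc hΓ) hp

theorem isMor_total {F : RawPair σ n m} (hΓ : S.IsCtx (Γ.snoc A)) (hF : S.IsMor Γ Δ F.1) :
    S.IsMor (Γ.snoc A) (Δ.snoc B) (total F) ↔ S.IsTerm (Γ.snoc A) F.2 (tyAt B F.1) :=
  Syn.isMor_snoc.trans ⟨And.right, fun H => ⟨h.isMor_wk hΓ hF, H⟩⟩

theorem morEq_total {F G : RawPair σ n m} (hΓ : S.IsCtx (Γ.snoc A)) (hF : S.MorEq Γ Δ F.1 G.1) :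
    S.MorEq (Γ.snoc A) (Δ.snoc B) (total F) (total G) ↔
      S.TmEq (Γ.snoc A) F.2 G.2 (tyAt B F.1) :=
  Syn.morEq_snoc.trans ⟨And.right, fun H => ⟨h.morEq_wk hΓ hF, H⟩⟩

/-- Once the base component is typed, typing `β` amounts to typing `(α, β)` as a 2-cell `Γ.A → Δ.B`
of contexts. This is how raw 2-cells of types become 2-cells of squares. -/
theorem isEl_total {F G a : RawPair σ n m} (hΓ : S.IsCtx (Γ.snoc A))
    (ha : S.IsEl Γ (DTT.idTel Δ F.1 G.1) a.1) :
    S.IsEl (Γ.snoc A) (DTT.idTel (Δ.snoc B) (total F) (total G)) (total a) ↔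
      S.IsTerm (Γ.snoc A) a.2 (cellTy B F G a.1) :=
  Syn.isEl_idTel_ext.trans ⟨And.right, fun H => ⟨h.isEl_wk hΓ ha, H⟩⟩

theorem elEq_total {F G a b : RawPair σ n m} (hΓ : S.IsCtx (Γ.snoc A))
    (ha : S.ElEq Γ (DTT.idTel Δ F.1 G.1) a.1 b.1) :
    S.ElEq (Γ.snoc A) (DTT.idTel (Δ.snoc B) (total F) (total G)) (total a) (total b) ↔
      S.TmEq (Γ.snoc A) a.2 b.2 (cellTy B F G a.1) :=
  Syn.elEq_idTel_ext.trans ⟨And.right, fun H => ⟨h.elEq_wk hΓ ha, H⟩⟩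

end Rules

namespace CtxOb

theorem exists_rep (X : S.CtxOb) : ∃ Γ, X.Rep Γ := by
  obtain ⟨n, ⟨Γ⟩⟩ := X
  exact ⟨Γ.1, Γ.2, rfl⟩

theorem Rep.wf {X : S.CtxOb} {Γ} (hΓ : X.Rep Γ) : S.IsCtx Γ := hΓ.1

theorem Rep.ctxEq {X : S.CtxOb} {Γ Γ'} (hΓ : X.Rep Γ) (h : S.Rules) (hΓ' : X.Rep Γ') :
    S.CtxEq Γ Γ' := by
  obtain ⟨w, e⟩ := hΓ
  obtain ⟨w', e'⟩ := hΓ'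
  exact (h.ctxEq_equivalence _).eqvGen_iff.1 (Quot.eqvGen_exact (e.symm.trans e'))

/-- A representative of a context. -/
noncomputable def rep (X : S.CtxOb) : Ctx σ X.len := X.exists_rep.choose

theorem rep_spec (X : S.CtxOb) : X.Rep X.rep := X.exists_rep.choose_spec

/-- A raw context in the given class. -/
noncomputable abbrev out (h : S.Rules) (X : S.CtxOb) : Syn h := ⟨X.len, X.rep, X.rep_spec.wf⟩

end CtxOb

namespace TypOb

theorem Rep.wf {X : S.TypOb} {Γ A} (hΓ : X.Rep Γ A) : S.IsCtx (Γ.snoc A) := hΓ.1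

theorem Rep.ctxEq {X : S.TypOb} {Γ Γ' A A'} (hΓ : X.Rep Γ A) (h : S.Rules)
    (hΓ' : X.Rep Γ' A') : S.CtxEq (Γ.snoc A) (Γ'.snoc A') := by
  obtain ⟨w, e⟩ := hΓ
  obtain ⟨w', e'⟩ := hΓ'
  exact (h.typEq_equivalence _).eqvGen_iff.1 (Quot.eqvGen_exact (e.symm.trans e'))

theorem Rep.of_ctxEq {X : S.TypOb} {Γ Γ' A A'} (hΓ : X.Rep Γ A) (w : S.IsCtx (Γ'.snoc A'))
    (e : S.CtxEq (Γ.snoc A) (Γ'.snoc A')) : X.Rep Γ' A' := ⟨w, hΓ.2.trans (Quot.sound e)⟩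

theorem exists_rep (X : S.TypOb) : ∃ Γ A, X.Rep Γ A := by
  obtain ⟨n, ⟨Γ⟩⟩ := X
  exact ⟨Γ.1.1, Γ.1.2, Γ.2, rfl⟩

/-- Allows a type to be represented over the chosen representative of its own context, so that the
base of a square of projections is literally a morphism of chosen contexts. -/
theorem exists_rep_over (h : S.Rules) (X : S.TypOb) {Γ} (hΓ : X.base.Rep Γ) : ∃ A, X.Rep Γ A := by
  obtain ⟨Γ', A, hX⟩ := X.exists_rep
  have e := hX.base.ctxEq h hΓ
  have hA := h.isType_ctxConv hX.wf.1 hΓ.wf e hX.wf.2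
  exact ⟨A, hX.of_ctxEq ⟨hΓ.wf, hA⟩ ⟨e, h.tyEq_refl hX.wf.2⟩⟩

/-- A representative of a type in context, over the chosen representative of the context. -/
noncomputable def ty (h : S.Rules) (X : S.TypOb) : Ty σ X.len :=
  (X.exists_rep_over h X.base.rep_spec).choose

theorem ty_spec (h : S.Rules) (X : S.TypOb) : X.Rep X.base.rep (X.ty h) :=
  (X.exists_rep_over h X.base.rep_spec).choose_spec

/-- The context of a type in context. -/
noncomputable abbrev out (h : S.Rules) (X : S.TypOb) : Syn h := X.base.out h

/-- The comprehension of a type in context. -/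
noncomputable abbrev tot (h : S.Rules) (X : S.TypOb) : Syn h :=
  Syn.snoc (X.out h) (X.ty h) (X.ty_spec h).wf.2

/-- The dependent projection of a type in context. -/
noncomputable abbrev proj (h : S.Rules) (X : S.TypOb) : X.tot h ⟶ X.out h :=
  Syn.disp (X.out h) (X.ty h) (X.ty_spec h).wf.2

end TypOb

end Calculus

namespace Calculus

variable {S : Calculus σ}

namespace Syn

variable {h : S.Rules} {W X Y Z : Syn h}

open PathCategory (Cell Square SquareCell)

/-! ### Cells with given raw components -/

theorem exists_mkPath_of_src_tgt {f g : Fin Y.len → Tm σ X.len} {hf hg} (w : X ⟶ path Y)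
    (e₁ : w ≫ src Y = mk f hf) (e₂ : w ≫ tgt Y = mk g hg) : ∃ p hp, w = mkPath f g p hf hg hp := by
  obtain ⟨a, b, p, ha, hb, hp, rfl⟩ := exists_mkPath w
  rw [mkPath_src, mk_eq_mk] at e₁
  rw [mkPath_tgt, mk_eq_mk] at e₂
  exact ⟨p, h.isEl_idTel_conv X.wf Y.wf (h.ctxEq_refl Y.wf) e₁ e₂ hp,
    mkPath_eq_mkPath.2 ⟨e₁, e₂, h.elEq_refl hp⟩⟩

/-- The 2-cell with the given raw components. -/
def cell {u v : X ⟶ Y} {f g p : Fin Y.len → Tm σ X.len} {hf hg} (hu : u = mk f hf)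
    (hv : v = mk g hg) (hp : S.IsEl X.ctx (DTT.idTel Y.ctx f g) p) : Cell u v :=
  ⟨mkPath f g p hf hg hp, mkPath_src.trans hu.symm, mkPath_tgt.trans hv.symm⟩

theorem cell_eq_cell {u v : X ⟶ Y} {f g f' g' p q : Fin Y.len → Tm σ X.len} {h₁ h₂ h₃ h₄}
    {hu : u = mk f h₁} {hv : v = mk g h₂} {hu' : u = mk f' h₃} {hv' : v = mk g' h₄} {hp hq} :
    cell (p := p) hu hv hp = cell (p := q) hu' hv' hq ↔
      S.ElEq X.ctx (DTT.idTel Y.ctx f g) p q := by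
  rw [Cell.ext_iff]
  exact (mkPath_eq_mkPath (ha := h₁) (hb := h₂) (hp := hp) (ha' := h₃) (hb' := h₄)
    (hp' := hq)).trans ⟨fun e => e.2.2, fun e =>
    ⟨mk_eq_mk.1 (hu.symm.trans hu'), mk_eq_mk.1 (hv.symm.trans hv'), e⟩⟩

/-- Raw components of a morphism. -/
noncomputable def raw (u : X ⟶ Y) : Fin Y.len → Tm σ X.len := (exists_mk u).choose

theorem isMor_raw (u : X ⟶ Y) : S.IsMor X.ctx Y.ctx (raw u) := (exists_mk u).choose_spec.choose

theorem eq_mk_raw (u : X ⟶ Y) : u = mk (raw u) (isMor_raw u) :=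
  (exists_mk u).choose_spec.choose_spec

/-! ### Change of representative of a context -/

/-- The raw terms `compId` and `liftId` mention the representing context. A change of representative
is the identity vector; it acts as the identity on the generic path, by comparison at reflexivity,
so the operations do not depend on the representative. -/
theorem map_mk_var {Δ : Ctx σ Y.len} (hΔ : S.IsCtx Δ) (e : S.CtxEq Δ Y.ctx) :
    ∃ hf ha hb hp, PathCategory.map (mk .var hf : (⟨_, Δ, hΔ⟩ : Syn h) ⟶ Y) =
      mkPath (fun i => .var (uX i)) (fun i => .var (uY i)) (fun i => .var (uP i)) ha hb hp := by
  let Y' : Syn h := ⟨_, Δ, hΔ⟩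
  have hv := Rules.isMor_pathCtx_split.1 (h.isMor_var (path Y').wf)
  have hf : S.IsMor Y'.ctx Y.ctx .var := h.isMor_conv hΔ e (h.isMor_var hΔ)
  refine ⟨hf, h.isMor_conv (path Y').wf e hv.2.1, h.isMor_conv (path Y').wf e hv.2.2.1,
    h.isEl_idTel_conv (path Y').wf hΔ e (h.morEq_refl hv.2.1) (h.morEq_refl hv.2.2.1) hv.2.2.2, ?_⟩
  refine PathCategory.path_ext ?_ ?_ ?_
  · exact (PathCategory.map_src _).trans (Eq.trans rfl mkPath_src.symm)
  · exact (PathCategory.map_tgt _).trans (Eq.trans rfl mkPath_tgt.symm)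
  · refine (PathCategory.rf_map _).trans (mk_rf.trans ?_)
    refine Eq.trans ?_ mk_comp_mkPath.symm
    refine mkPath_congr ?_ ?_ ?_ <;> funext i <;> rw [var_subst]
    · exact (block_uX ..).symm
    · exact (block_uY ..).symm
    · exact (block_uP Fin.elim0 Expr.var Expr.var (fun i => .refl (.var i)) i).symm

theorem mkPath_map_mk_var {Δ : Ctx σ Y.len} (hΔ : S.IsCtx Δ) (e : S.CtxEq Δ Y.ctx)
    {a b p : Fin Y.len → Tm σ X.len} {ha hb hp} :
    ∃ hf ha' hb' hp', (mkPath a b p ha hb hp : X ⟶ path (⟨_, Δ, hΔ⟩ : Syn h)) ≫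
      PathCategory.map (mk .var hf : (⟨_, Δ, hΔ⟩ : Syn h) ⟶ Y) = mkPath a b p ha' hb' hp' := by
  obtain ⟨hf, h₁, h₂, h₃, E⟩ := map_mk_var hΔ e
  refine ⟨hf, h.isMor_conv X.wf e ha, h.isMor_conv X.wf e hb, h.isEl_idTel_conv X.wf hΔ e
    (h.morEq_refl ha) (h.morEq_refl hb) hp, ?_⟩
  rw [E]
  refine mk_comp_mkPath.trans (mkPath_congr ?_ ?_ ?_) <;> funext i <;> refine (var_subst ..).trans ?_
  · exact block_uX ..
  · exact block_uY ..
  · exact block_uP ..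

/-- Compatibility of composition with the action of a morphism (`cmp_map`), applied to the change of
representative. -/
theorem cmp_mkPath_of_ctxEq {Δ : Ctx σ Y.len} (hΔ : S.IsCtx Δ) (e : S.CtxEq Δ Y.ctx)
    {a b c p q : Fin Y.len → Tm σ X.len} {ha hb hp hb' hc hq} (E) :
    ∃ hr, PathCategory.cmp (mkPath a b p ha hb hp : X ⟶ path Y) (mkPath b c q hb' hc hq) E =
      mkPath a c (compId Δ a b c p q) ha hc hr := by
  let Y' : Syn h := ⟨_, Δ, hΔ⟩
  have e' := h.ctxEq_symm hΔ Y.wf e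
  have hp' := h.isEl_idTel_conv X.wf Y.wf e' (h.morEq_refl ha) (h.morEq_refl hb) hp
  have hq' := h.isEl_idTel_conv X.wf Y.wf e' (h.morEq_refl hb) (h.morEq_refl hc) hq
  obtain ⟨hf, _, _, _, E₁⟩ := mkPath_map_mk_var hΔ e (ha := h.isMor_conv X.wf e' ha)
    (hb := h.isMor_conv X.wf e' hb) (hp := hp')
  obtain ⟨_, _, _, _, E₂⟩ := mkPath_map_mk_var hΔ e (ha := h.isMor_conv X.wf e' hb)
    (hb := h.isMor_conv X.wf e' hc) (hp := hq')
  have hr := (h.compId_spec X.wf hΔ (h.isMor_conv X.wf e' ha) (h.isMor_conv X.wf e' hb)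
    (h.isMor_conv X.wf e' hc) hp').1 hq'
  obtain ⟨_, _, _, hr', E₃⟩ := mkPath_map_mk_var hΔ e (ha := h.isMor_conv X.wf e' ha)
    (hb := h.isMor_conv X.wf e' hc) (hp := hr)
  refine ⟨hr', (PathCategory.cmp_congr E₁.symm E₂.symm).trans
    ((PathCategory.cmp_map (X := Y') _ _ (mkPath_tgt.trans mkPath_src.symm) _).symm.trans ?_)⟩
  exact (congrArg (· ≫ _) (cmp_mkPath (X := Y'))).trans E₃

/-- The morphism `k` is factored through the other representative of its target. -/
theorem mkPath_map_of_ctxEq {Θ : Ctx σ Z.len} (hΘ : S.IsCtx Θ) (e : S.CtxEq Θ Z.ctx)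
    {a b p : Fin Y.len → Tm σ X.len} {k : Fin Z.len → Tm σ Y.len} {ha hb hp hk} :
    ∃ hr, (mkPath a b p ha hb hp : X ⟶ path Y) ≫ PathCategory.map (mk k hk : Y ⟶ Z) =
      mkPath _ _ (liftId Θ k a b p) (h.isMor_comp X.wf ha hk) (h.isMor_comp X.wf hb hk) hr := by
  let Z' : Syn h := ⟨_, Θ, hΘ⟩
  have hk' := h.isMor_conv Y.wf (h.ctxEq_symm hΘ Z.wf e) hk
  have hr := (h.liftId_spec X.wf Y.wf hΘ hk' ha hb).1 hp
  obtain ⟨hf, _, _, hr', E⟩ := mkPath_map_mk_var hΘ e (ha := h.isMor_comp X.wf ha hk')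
    (hb := h.isMor_comp X.wf hb hk') (hp := hr)
  have hc : (mk k hk : Y ⟶ Z) = (mk k hk' : Y ⟶ Z') ≫ (mk .var hf : Z' ⟶ Z) :=
    mk_congr (funext fun _ => (var_subst _ _).symm)
  refine ⟨hr', ?_⟩
  rw [hc, PathCategory.map_comp, ← Category.assoc]
  exact (congrArg (· ≫ _) (mkPath_map (Y := Z'))).trans E

variable {A : Ty σ X.len} {hA : S.IsType X.ctx A} {B : Ty σ Y.len} {hB : S.IsType Y.ctx B}

/-- The square with the given raw components. -/
def pair (F : RawPair σ X.len Y.len) (hF : S.IsMor X.ctx Y.ctx F.1)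
    (hF' : S.IsMor (X.ctx.snoc A) (Y.ctx.snoc B) (total F)) :
    Square (disp X A hA) (disp Y B hB) where
  base := mk F.1 hF
  tot := mk (total F) hF'
  comm := (mkSnoc_disp (ha := (isMor_snoc.1 hF').1) (hs := (isMor_snoc.1 hF').2)).trans
    (mk_congr (funext fun _ => rename_eq_subst _ _))

theorem pair_eq_pair {F G : RawPair σ X.len Y.len} {hF hF' hG hG'} :
    (pair F hF hF' : Square (disp X A hA) (disp Y B hB)) = pair G hG hG' ↔
      S.MorEq X.ctx Y.ctx F.1 G.1 ∧
        S.MorEq (X.ctx.snoc A) (Y.ctx.snoc B) (total F) (total G) := by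
  rw [Square.ext_iff]
  exact and_congr mk_eq_mk (mk_eq_mk (X := snoc X A hA) (Y := snoc Y B hB))

/-- Commutativity of the square says that the initial part of the total vector equals the weakening
of `f`; it may therefore be replaced by that weakening. -/
theorem exists_pair (u : Square (disp X A hA) (disp Y B hB)) : ∃ F hF hF', u = pair F hF hF' := by
  obtain ⟨b, t, e⟩ := u
  obtain ⟨f, hf, rfl⟩ := exists_mk b
  obtain ⟨a, z, ha, hz, rfl⟩ := exists_mkSnoc t
  rw [mkSnoc_disp] at e
  have e' : S.MorEq (X.ctx.snoc A) Y.ctx a fun i => (f i).wk 1 := by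
    simp only [wk, rename_eq_subst]
    exact mk_eq_mk.1 e
  have H : S.MorEq (X.ctx.snoc A) (Y.ctx.snoc B) (ext a z) (total (f, z)) :=
    morEq_snoc.2 ⟨e', h.tmEq_refl hz⟩
  exact ⟨(f, z), hf, h.morEq_right (snoc X A hA).wf (snoc Y B hB).wf H,
    Square.ext rfl (mk_eq_mk.2 H)⟩

/-- Raw components of a square. -/
noncomputable def rawPair (u : Square (disp X A hA) (disp Y B hB)) : RawPair σ X.len Y.len :=
  (exists_pair u).choose

theorem isMor_rawPair (u : Square (disp X A hA) (disp Y B hB)) :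
    S.IsMor X.ctx Y.ctx (rawPair u).1 := (exists_pair u).choose_spec.choose

theorem isMor_total_rawPair (u : Square (disp X A hA) (disp Y B hB)) :
    S.IsMor (X.ctx.snoc A) (Y.ctx.snoc B) (total (rawPair u)) :=
  (exists_pair u).choose_spec.choose_spec.choose

theorem eq_pair_rawPair (u : Square (disp X A hA) (disp Y B hB)) :
    u = pair (rawPair u) (isMor_rawPair u) (isMor_total_rawPair u) :=
  (exists_pair u).choose_spec.choose_spec.choose_spec

/-- The 2-cell of squares with the given raw components. -/
def pairCell {u v : Square (disp X A hA) (disp Y B hB)} {F G a : RawPair σ X.len Y.len}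
    {hF hF' hG hG'} (hu : u = pair F hF hF') (hv : v = pair G hG hG')
    (ha : S.IsEl X.ctx (DTT.idTel Y.ctx F.1 G.1) a.1)
    (ha' : S.IsEl (X.ctx.snoc A) (DTT.idTel (Y.ctx.snoc B) (total F) (total G)) (total a)) :
    SquareCell u v where
  base := cell (congrArg Square.base hu) (congrArg Square.base hv) ha
  tot := cell (X := snoc X A hA) (Y := snoc Y B hB) (congrArg Square.tot hu)
    (congrArg Square.tot hv) ha'
  comm := by
    refine (mkSnocPath_map (ha := (isMor_snoc.1 hF').1) (hb := (isMor_snoc.1 hG').1)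
      (hp := (isEl_idTel_ext.1 ha').1) (hs := (isMor_snoc.1 hF').2) (ht := (isMor_snoc.1 hG').2)
      (hr := (isEl_idTel_ext.1 ha').2)).trans ((mkPath_congr ?_ ?_ ?_).trans
        (mk_comp_mkPath (ha := hF) (hb := hG) (hp := ha)).symm)
      <;> exact funext fun _ => rename_eq_subst _ _

/-- Compatibility with the projections, computed by `mkSnocPath_map`, forces all entries of `P` but
the last to equal the weakening of `p`, so only the last one carries new information. -/
theorem eq_pairCell {u v : Square (disp X A hA) (disp Y B hB)} {F G : RawPair σ X.len Y.len}
    {hF hF' hG hG'} (hu : u = pair F hF hF') (hv : v = pair G hG hG') (η : SquareCell u v)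
    {p P hp hP} (ep : η.base.val = mkPath F.1 G.1 p hF hG hp)
    (eP : η.tot.val = mkPath (total F) (total G) P hF' hG' hP) :
    ∃ ha ha', η = pairCell (a := (p, lst P)) hu hv ha ha' := by
  obtain ⟨P, r, rfl⟩ : ∃ Q r, P = ext Q r := ⟨pre P, lst P, (Fin.snoc_init_self P).symm⟩
  rw [show lst (ext P r) = r from Fin.snoc_last ..]
  have c := η.comm
  rw [ep, eP] at c
  have c' := (mkSnocPath_map (ha := (isMor_snoc.1 hF').1) (hb := (isMor_snoc.1 hG').1)
      (hp := (isEl_idTel_ext.1 hP).1) (hs := (isMor_snoc.1 hF').2) (ht := (isMor_snoc.1 hG').2)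
      (hr := (isEl_idTel_ext.1 hP).2)).symm.trans
    (c.trans (mk_comp_mkPath (ha := hF) (hb := hG) (hp := hp)))
  have H : S.ElEq (X.ctx.snoc A) (DTT.idTel (Y.ctx.snoc B) (total F) (total G)) (ext P r)
      (total (p, r)) := by
    refine elEq_idTel_ext.2 ⟨?_, h.tmEq_refl (isEl_idTel_ext.1 hP).2⟩
    have := (mkPath_eq_mkPath.1 c').2.2
    simpa only [wk, rename_eq_subst] using this
  have H₁ := h.elEq_right (h.ctxEq_idTel (snoc X A hA).wf (snoc Y B hB).wf
    (h.ctxEq_refl (snoc Y B hB).wf) (h.morEq_refl hF') (h.morEq_refl hG')).1 H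
  have H₂ := mkPath_eq_mkPath (ha := hF') (hb := hG') (hp := hP) (ha' := hF') (hb' := hG')
    (hp' := H₁)
    |>.2 ⟨h.morEq_refl hF', h.morEq_refl hG', H⟩
  exact ⟨hp, H₁, SquareCell.ext_val ep (eP.trans H₂)⟩

theorem exists_pairCell {u v : Square (disp X A hA) (disp Y B hB)} {F G : RawPair σ X.len Y.len}
    {hF hF' hG hG'} (hu : u = pair F hF hF') (hv : v = pair G hG hG') (η : SquareCell u v) :
    ∃ a ha ha', η = pairCell (a := a) hu hv ha ha' := by
  obtain ⟨p, hp, ep⟩ := exists_mkPath_of_src_tgt (hf := hF) (hg := hG) η.base.val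
    (η.base.val_src.trans (congrArg Square.base hu)) (η.base.val_tgt.trans (congrArg Square.base hv))
  obtain ⟨P, hP, eP⟩ := exists_mkPath_of_src_tgt (hf := hF') (hg := hG') η.tot.val
    (η.tot.val_src.trans (congrArg Square.tot hu)) (η.tot.val_tgt.trans (congrArg Square.tot hv))
  exact ⟨_, eq_pairCell hu hv η ep eP⟩

theorem pairCell_eq_pairCell {u v : Square (disp X A hA) (disp Y B hB)}
    {F G F' G' a b : RawPair σ X.len Y.len} {h₁ h₂ h₃ h₄ h₅ h₆ h₇ h₈} {hu : u = pair F h₁ h₂}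
    {hv : v = pair G h₃ h₄} {hu' : u = pair F' h₅ h₆} {hv' : v = pair G' h₇ h₈} {ha ha' hb hb'} :
    pairCell (a := a) hu hv ha ha' = pairCell (a := b) hu' hv' hb hb' ↔
      S.ElEq X.ctx (DTT.idTel Y.ctx F.1 G.1) a.1 b.1 ∧
      S.ElEq (X.ctx.snoc A) (DTT.idTel (Y.ctx.snoc B) (total F) (total G)) (total a) (total b) := by
  have eu := pair_eq_pair.1 (hu.symm.trans hu')
  have ev := pair_eq_pair.1 (hv.symm.trans hv')
  have e₁ := mkPath_eq_mkPath (ha := h₁) (hb := h₃) (hp := ha) (ha' := h₅) (hb' := h₇) (hp' := hb)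
  have e₂ := mkPath_eq_mkPath (X := snoc X A hA) (Y := snoc Y B hB) (ha := h₂) (hb := h₄)
    (hp := ha') (ha' := h₆) (hb' := h₈) (hp' := hb')
  refine ⟨fun e => ?_, fun e => ?_⟩
  · exact ⟨(e₁.1 (congrArg (fun η : SquareCell u v => η.base.val) e)).2.2,
      (e₂.1 (congrArg (fun η : SquareCell u v => η.tot.val) e)).2.2⟩
  · exact SquareCell.ext_val (e₁.2 ⟨eu.1, ev.1, e.1⟩) (e₂.2 ⟨eu.2, ev.2, e.2⟩)

end Syn

end Calculus

namespace Calculus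

variable {S : Calculus σ} (h : S.Rules)

open PathCategory (Cell Square SquareCell)
open Syn

/-! ## Cells of contexts and types as classes of raw cells -/

section Ctx

variable {X Y : S.CtxOb}

include h in
theorem CtxOb.isMor_rep {f} (H : ∃ Γ Δ, X.Rep Γ ∧ Y.Rep Δ ∧ S.IsMor Γ Δ f) :
    S.IsMor X.rep Y.rep f := by
  obtain ⟨Γ, Δ, hΓ, hΔ, hf⟩ := H
  exact h.isMor_conv₂ hΓ.wf X.rep_spec.wf (hΓ.ctxEq h X.rep_spec) (hΔ.ctxEq h Y.rep_spec) hf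

include h in
theorem CtxOb.morEq_rep {f g} (H : ∃ Γ Δ, X.Rep Γ ∧ Y.Rep Δ ∧ S.MorEq Γ Δ f g) :
    S.MorEq X.rep Y.rep f g := by
  obtain ⟨Γ, Δ, hΓ, hΔ, hf⟩ := H
  exact h.morEq_conv₂ hΓ.wf X.rep_spec.wf (hΓ.ctxEq h X.rep_spec) (hΔ.ctxEq h Y.rep_spec) hf

/-- Morphisms between chosen representatives are morphisms of contexts. -/
noncomputable def CtxHom.equiv (X Y : S.CtxOb) : (X.out h ⟶ Y.out h) ≃ CtxHom X Y where
  toFun := Quotient.lift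
    (fun f => Quot.mk _ ⟨f.1, X.rep, Y.rep, X.rep_spec, Y.rep_spec, f.2⟩)
    fun _ _ e => Quot.sound ⟨X.rep, Y.rep, X.rep_spec, Y.rep_spec, e⟩
  invFun := Quot.lift (fun f => Syn.mk f.1 (CtxOb.isMor_rep h f.2))
    fun _ _ e => mk_eq_mk.2 (CtxOb.morEq_rep h e)
  left_inv := by rintro ⟨f⟩; rfl
  right_inv := by rintro ⟨f⟩; rfl

theorem CtxHom.rep_equiv {u : X.out h ⟶ Y.out h} {f} :
    (CtxHom.equiv h X Y u).Rep f ↔ ∃ hf, u = Syn.mk f hf := by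
  constructor
  · rintro ⟨H, e⟩
    exact ⟨CtxOb.isMor_rep h H, (Equiv.eq_symm_apply _).2 e⟩
  · rintro ⟨hf, rfl⟩
    exact ⟨⟨X.rep, Y.rep, X.rep_spec, Y.rep_spec, hf⟩, rfl⟩

variable {u v : X.out h ⟶ Y.out h}

theorem CtxOb.isEl_rep {α} (H : ∃ Γ Δ f g, X.Rep Γ ∧ Y.Rep Δ ∧ (CtxHom.equiv h X Y u).Rep f ∧
    (CtxHom.equiv h X Y v).Rep g ∧ S.IsEl Γ (DTT.idTel Δ f g) α) :
    S.IsEl X.rep (DTT.idTel Y.rep (raw u) (raw v)) α := by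
  obtain ⟨Γ, Δ, f, g, hΓ, hΔ, hu, hv, hα⟩ := H
  obtain ⟨hf, eu⟩ := (CtxHom.rep_equiv h).1 hu
  obtain ⟨hg, ev⟩ := (CtxHom.rep_equiv h).1 hv
  exact h.isEl_conv₂ hΓ.wf X.rep_spec.wf hΔ.wf Y.rep_spec.wf (hΓ.ctxEq h X.rep_spec)
    (hΔ.ctxEq h Y.rep_spec) (mk_eq_mk.1 (eu.symm.trans (eq_mk_raw u)))
    (mk_eq_mk.1 (ev.symm.trans (eq_mk_raw v))) hα

theorem CtxOb.elEq_rep {α β} (H : ∃ Γ Δ f g, X.Rep Γ ∧ Y.Rep Δ ∧ (CtxHom.equiv h X Y u).Rep f ∧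
    (CtxHom.equiv h X Y v).Rep g ∧ S.ElEq Γ (DTT.idTel Δ f g) α β) :
    S.ElEq X.rep (DTT.idTel Y.rep (raw u) (raw v)) α β := by
  obtain ⟨Γ, Δ, f, g, hΓ, hΔ, hu, hv, hα⟩ := H
  obtain ⟨hf, eu⟩ := (CtxHom.rep_equiv h).1 hu
  obtain ⟨hg, ev⟩ := (CtxHom.rep_equiv h).1 hv
  exact h.elEq_conv₂ hΓ.wf X.rep_spec.wf hΔ.wf Y.rep_spec.wf (hΓ.ctxEq h X.rep_spec)
    (hΔ.ctxEq h Y.rep_spec) (mk_eq_mk.1 (eu.symm.trans (eq_mk_raw u)))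
    (mk_eq_mk.1 (ev.symm.trans (eq_mk_raw v))) hα

/-- The 2-cell between morphisms of chosen representatives given by a class of raw 2-cells. -/
noncomputable def CtxCell.toCell (u v : X.out h ⟶ Y.out h) :
    CtxCell (CtxHom.equiv h X Y u) (CtxHom.equiv h X Y v) → Cell u v :=
  Quot.lift (fun α => cell (eq_mk_raw u) (eq_mk_raw v) (CtxOb.isEl_rep h α.2))
    fun _ _ e => cell_eq_cell.2 (CtxOb.elEq_rep h e)

theorem CtxHom.rep_raw (u : X.out h ⟶ Y.out h) : (CtxHom.equiv h X Y u).Rep (raw u) :=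
  (CtxHom.rep_equiv h).2 ⟨_, eq_mk_raw u⟩

theorem CtxCell.toCell_bijective : Function.Bijective (CtxCell.toCell h u v) := by
  constructor
  · rintro ⟨α⟩ ⟨β⟩ e
    exact Quot.sound ⟨X.rep, Y.rep, _, _, X.rep_spec, Y.rep_spec, CtxHom.rep_raw h u,
      CtxHom.rep_raw h v, (cell_eq_cell (hu := eq_mk_raw u) (hv := eq_mk_raw v)
        (hu' := eq_mk_raw u) (hv' := eq_mk_raw v) (hp := CtxOb.isEl_rep h α.2)
        (hq := CtxOb.isEl_rep h β.2)).1 e⟩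
  · intro η
    obtain ⟨p, hp, e⟩ := exists_mkPath_of_src_tgt (hf := isMor_raw u) (hg := isMor_raw v) η.val
      (η.val_src.trans (eq_mk_raw u)) (η.val_tgt.trans (eq_mk_raw v))
    exact ⟨Quot.mk _ ⟨p, X.rep, Y.rep, _, _, X.rep_spec, Y.rep_spec, CtxHom.rep_raw h u,
      CtxHom.rep_raw h v, hp⟩, Cell.ext e.symm⟩

noncomputable def CtxCell.equiv (u v : X.out h ⟶ Y.out h) :
    Cell u v ≃ CtxCell (CtxHom.equiv h X Y u) (CtxHom.equiv h X Y v) :=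
  (Equiv.ofBijective _ (CtxCell.toCell_bijective h)).symm

theorem CtxCell.rep_equiv {η : Cell u v} {α} : (CtxCell.equiv h u v η).Rep α ↔
    ∃ f g hf hg hα, ∃ (hu : u = Syn.mk f hf) (hv : v = Syn.mk g hg), η = cell (p := α) hu hv hα := by
  constructor
  · rintro ⟨H, e⟩
    exact ⟨_, _, _, _, CtxOb.isEl_rep h H, eq_mk_raw u, eq_mk_raw v,
      (Equiv.symm_apply_eq _).1 e⟩
  · rintro ⟨f, g, hf, hg, hα, hu, hv, rfl⟩
    refine ⟨⟨X.rep, Y.rep, f, g, X.rep_spec, Y.rep_spec, (CtxHom.rep_equiv h).2 ⟨hf, hu⟩,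
      (CtxHom.rep_equiv h).2 ⟨hg, hv⟩, hα⟩, (Equiv.symm_apply_eq _).2 ?_⟩
    exact (cell_eq_cell (hu' := eq_mk_raw u) (hv' := eq_mk_raw v)).2 (h.elEq_refl hα)

end Ctx

section Typ

variable {X Y : S.TypOb}

theorem TypOb.isMor_rep {F : RawPair σ X.len Y.len} (H : ∃ Γ A Δ B, X.Rep Γ A ∧ Y.Rep Δ B ∧
      S.IsMor Γ Δ F.1 ∧ S.IsTerm (Γ.snoc A) F.2 (tyAt B F.1)) :
    S.IsMor X.base.rep Y.base.rep F.1 ∧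
      S.IsMor (X.base.rep.snoc (X.ty h)) (Y.base.rep.snoc (Y.ty h)) (total F) := by
  obtain ⟨Γ, A, Δ, B, hΓ, hΔ, hf, hg⟩ := H
  have e := hΓ.ctxEq h (X.ty_spec h)
  have e' := hΔ.ctxEq h (Y.ty_spec h)
  exact ⟨h.isMor_conv₂ hΓ.wf.1 (X.ty_spec h).wf.1 e.1 e'.1 hf,
    h.isMor_conv₂ hΓ.wf (X.ty_spec h).wf e e' ((h.isMor_total hΓ.wf hf).2 hg)⟩

theorem TypOb.morEq_rep {F G : RawPair σ X.len Y.len} (H : ∃ Γ A Δ B, X.Rep Γ A ∧ Y.Rep Δ B ∧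
      S.MorEq Γ Δ F.1 G.1 ∧ S.TmEq (Γ.snoc A) F.2 G.2 (tyAt B F.1)) :
    S.MorEq X.base.rep Y.base.rep F.1 G.1 ∧
      S.MorEq (X.base.rep.snoc (X.ty h)) (Y.base.rep.snoc (Y.ty h)) (total F) (total G) := by
  obtain ⟨Γ, A, Δ, B, hΓ, hΔ, hf, hg⟩ := H
  have e := hΓ.ctxEq h (X.ty_spec h)
  have e' := hΔ.ctxEq h (Y.ty_spec h)
  exact ⟨h.morEq_conv₂ hΓ.wf.1 (X.ty_spec h).wf.1 e.1 e'.1 hf,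
    h.morEq_conv₂ hΓ.wf (X.ty_spec h).wf e e' ((h.morEq_total hΓ.wf hf).2 hg)⟩

/-- The square of chosen representatives given by a class of raw morphisms of types. -/
noncomputable def TypHom.toSquare (X Y : S.TypOb) : TypHom X Y → Square (X.proj h) (Y.proj h) :=
  Quot.lift (fun F => pair (X := X.out h) (Y := Y.out h) F.1 (TypOb.isMor_rep h F.2).1
      (TypOb.isMor_rep h F.2).2)
    fun _ _ e => pair_eq_pair.2 (TypOb.morEq_rep h e)

theorem TypOb.exists_rep_pair {F : RawPair σ X.len Y.len} (hF : S.IsMor X.base.rep Y.base.rep F.1)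
    (hF' : S.IsMor (X.base.rep.snoc (X.ty h)) (Y.base.rep.snoc (Y.ty h)) (total F)) :
    ∃ Γ A Δ B, X.Rep Γ A ∧ Y.Rep Δ B ∧ S.IsMor Γ Δ F.1 ∧
      S.IsTerm (Γ.snoc A) F.2 (tyAt B F.1) :=
  ⟨_, _, _, _, X.ty_spec h, Y.ty_spec h, hF, (h.isMor_total (X.ty_spec h).wf hF).1 hF'⟩

theorem TypHom.toSquare_bijective : Function.Bijective (TypHom.toSquare h X Y) := by
  constructor
  · rintro ⟨F⟩ ⟨G⟩ e
    have e := (pair_eq_pair (X := X.out h) (Y := Y.out h) (hF := (TypOb.isMor_rep h F.2).1)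
      (hF' := (TypOb.isMor_rep h F.2).2) (hG := (TypOb.isMor_rep h G.2).1)
      (hG' := (TypOb.isMor_rep h G.2).2)).1 e
    exact Quot.sound ⟨_, _, _, _, X.ty_spec h, Y.ty_spec h, e.1,
      (h.morEq_total (X.ty_spec h).wf e.1).1 e.2⟩
  · intro u
    obtain ⟨F, hF, hF', rfl⟩ := exists_pair u
    exact ⟨Quot.mk _ ⟨F, TypOb.exists_rep_pair h hF hF'⟩, rfl⟩

/-- Squares of chosen representatives are morphisms of types. -/
noncomputable def TypHom.equiv (X Y : S.TypOb) : Square (X.proj h) (Y.proj h) ≃ TypHom X Y :=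
  (Equiv.ofBijective _ (TypHom.toSquare_bijective h)).symm

theorem TypHom.rep_equiv {u : Square (X.proj h) (Y.proj h)} {F} :
    (TypHom.equiv h X Y u).Rep F ↔
      ∃ hF hF', u = pair (X := X.out h) (Y := Y.out h) F hF hF' := by
  constructor
  · rintro ⟨H, e⟩
    exact ⟨(TypOb.isMor_rep h H).1, (TypOb.isMor_rep h H).2, (Equiv.symm_apply_eq _).1 e⟩
  · rintro ⟨hF, hF', rfl⟩
    exact ⟨TypOb.exists_rep_pair h hF hF', (Equiv.symm_apply_eq _).2 rfl⟩

theorem TypHom.base_equiv (u : Square (X.proj h) (Y.proj h)) :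
    (TypHom.equiv h X Y u).base = CtxHom.equiv h X.base Y.base u.base := by
  obtain ⟨F, hF, hF', rfl⟩ := exists_pair u
  obtain ⟨H, e⟩ := (TypHom.rep_equiv h).2 ⟨hF, hF', rfl⟩
  rw [e]
  rfl

variable {u v : Square (X.proj h) (Y.proj h)}

theorem TypHom.rep_rawPair (u : Square (X.proj h) (Y.proj h)) :
    (TypHom.equiv h X Y u).Rep (rawPair u) :=
  (TypHom.rep_equiv h).2 ⟨_, _, eq_pair_rawPair u⟩

theorem TypOb.isEl_rep {a : RawPair σ X.len Y.len} (H : ∃ Γ A Δ B F F', X.Rep Γ A ∧ Y.Rep Δ B ∧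
    (TypHom.equiv h X Y u).Rep F ∧ (TypHom.equiv h X Y v).Rep F' ∧
      S.IsEl Γ (DTT.idTel Δ F.1 F'.1) a.1 ∧ S.IsTerm (Γ.snoc A) a.2 (cellTy B F F' a.1)) :
    S.IsEl X.base.rep (DTT.idTel Y.base.rep (rawPair u).1 (rawPair v).1) a.1 ∧
      S.IsEl (X.base.rep.snoc (X.ty h)) (DTT.idTel (Y.base.rep.snoc (Y.ty h))
        (total (rawPair u)) (total (rawPair v))) (total a) := by
  obtain ⟨Γ, A, Δ, B, F, G, hΓ, hΔ, hu, hv, hα, hβ⟩ := H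
  obtain ⟨hf, hf', eu⟩ := (TypHom.rep_equiv h).1 hu
  obtain ⟨hg, hg', ev⟩ := (TypHom.rep_equiv h).1 hv
  have e := hΓ.ctxEq h (X.ty_spec h)
  have e' := hΔ.ctxEq h (Y.ty_spec h)
  have e₁ := pair_eq_pair.1 (eu.symm.trans (eq_pair_rawPair u))
  have e₂ := pair_eq_pair.1 (ev.symm.trans (eq_pair_rawPair v))
  exact ⟨h.isEl_conv₂ hΓ.wf.1 (X.ty_spec h).wf.1 hΔ.wf.1 (Y.ty_spec h).wf.1 e.1 e'.1 e₁.1 e₂.1 hα,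
    h.isEl_conv₂ hΓ.wf (X.ty_spec h).wf hΔ.wf (Y.ty_spec h).wf e e' e₁.2 e₂.2
      ((h.isEl_total hΓ.wf hα).2 hβ)⟩

theorem TypOb.elEq_rep {a b : RawPair σ X.len Y.len} (H : ∃ Γ A Δ B F F', X.Rep Γ A ∧
    Y.Rep Δ B ∧ (TypHom.equiv h X Y u).Rep F ∧ (TypHom.equiv h X Y v).Rep F' ∧
      S.ElEq Γ (DTT.idTel Δ F.1 F'.1) a.1 b.1 ∧
      S.TmEq (Γ.snoc A) a.2 b.2 (cellTy B F F' a.1)) :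
    S.ElEq X.base.rep (DTT.idTel Y.base.rep (rawPair u).1 (rawPair v).1) a.1 b.1 ∧
      S.ElEq (X.base.rep.snoc (X.ty h)) (DTT.idTel (Y.base.rep.snoc (Y.ty h))
        (total (rawPair u)) (total (rawPair v))) (total a) (total b) := by
  obtain ⟨Γ, A, Δ, B, F, G, hΓ, hΔ, hu, hv, hα, hβ⟩ := H
  obtain ⟨hf, hf', eu⟩ := (TypHom.rep_equiv h).1 hu
  obtain ⟨hg, hg', ev⟩ := (TypHom.rep_equiv h).1 hv
  have e := hΓ.ctxEq h (X.ty_spec h)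
  have e' := hΔ.ctxEq h (Y.ty_spec h)
  have e₁ := pair_eq_pair.1 (eu.symm.trans (eq_pair_rawPair u))
  have e₂ := pair_eq_pair.1 (ev.symm.trans (eq_pair_rawPair v))
  exact ⟨h.elEq_conv₂ hΓ.wf.1 (X.ty_spec h).wf.1 hΔ.wf.1 (Y.ty_spec h).wf.1 e.1 e'.1 e₁.1 e₂.1 hα,
    h.elEq_conv₂ hΓ.wf (X.ty_spec h).wf hΔ.wf (Y.ty_spec h).wf e e' e₁.2 e₂.2
      ((h.elEq_total hΓ.wf hα).2 hβ)⟩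

/-- The 2-cell of squares of chosen representatives given by a class of raw 2-cells of types. -/
noncomputable def TypCell.toSquareCell (u v : Square (X.proj h) (Y.proj h)) :
    TypCell (TypHom.equiv h X Y u) (TypHom.equiv h X Y v) → SquareCell u v :=
  Quot.lift (fun a => pairCell (eq_pair_rawPair u) (eq_pair_rawPair v) (TypOb.isEl_rep h a.2).1
      (TypOb.isEl_rep h a.2).2)
    fun _ _ e => pairCell_eq_pairCell.2 (TypOb.elEq_rep h e)

theorem TypOb.exists_rep_pairCell {F G a : RawPair σ X.len Y.len}
    (hu : (TypHom.equiv h X Y u).Rep F) (hv : (TypHom.equiv h X Y v).Rep G)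
    (ha : S.IsEl X.base.rep (DTT.idTel Y.base.rep F.1 G.1) a.1)
    (ha' : S.IsEl (X.base.rep.snoc (X.ty h)) (DTT.idTel (Y.base.rep.snoc (Y.ty h))
        (total F) (total G)) (total a)) :
    ∃ Γ A Δ B F F', X.Rep Γ A ∧ Y.Rep Δ B ∧ (TypHom.equiv h X Y u).Rep F ∧
      (TypHom.equiv h X Y v).Rep F' ∧ S.IsEl Γ (DTT.idTel Δ F.1 F'.1) a.1 ∧
        S.IsTerm (Γ.snoc A) a.2 (cellTy B F F' a.1) :=
  ⟨_, _, _, _, F, G, X.ty_spec h, Y.ty_spec h, hu, hv, ha,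
    (h.isEl_total (X.ty_spec h).wf ha).1 ha'⟩

theorem TypCell.toSquareCell_bijective :
    Function.Bijective (TypCell.toSquareCell h u v) := by
  constructor
  · rintro ⟨a⟩ ⟨b⟩ e
    have e := (pairCell_eq_pairCell (hu := eq_pair_rawPair u) (hv := eq_pair_rawPair v)
      (hu' := eq_pair_rawPair u) (hv' := eq_pair_rawPair v) (ha := (TypOb.isEl_rep h a.2).1)
      (ha' := (TypOb.isEl_rep h a.2).2) (hb := (TypOb.isEl_rep h b.2).1)
      (hb' := (TypOb.isEl_rep h b.2).2)).1 e
    exact Quot.sound ⟨_, _, _, _, _, _, X.ty_spec h, Y.ty_spec h, TypHom.rep_rawPair h u,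
      TypHom.rep_rawPair h v, e.1, (h.elEq_total (X.ty_spec h).wf e.1).1 e.2⟩
  · intro η
    obtain ⟨a, ha, ha', rfl⟩ := exists_pairCell (eq_pair_rawPair u) (eq_pair_rawPair v) η
    exact ⟨Quot.mk _ ⟨a, TypOb.exists_rep_pairCell h (TypHom.rep_rawPair h u)
      (TypHom.rep_rawPair h v) ha ha'⟩, rfl⟩

noncomputable def TypCell.equiv (u v : Square (X.proj h) (Y.proj h)) :
    SquareCell u v ≃ TypCell (TypHom.equiv h X Y u) (TypHom.equiv h X Y v) :=
  (Equiv.ofBijective _ (TypCell.toSquareCell_bijective h)).symm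

theorem TypCell.rep_equiv {η : SquareCell u v} {a} : (TypCell.equiv h u v η).Rep a ↔
    ∃ F G hF hF' hG hG' ha ha', ∃ (hu : u = pair (X := X.out h) (Y := Y.out h) F hF hF')
      (hv : v = pair (X := X.out h) (Y := Y.out h) G hG hG'), 
        η = pairCell (a := a) hu hv ha ha' := by
  constructor
  · rintro ⟨H, e⟩
    exact ⟨_, _, _, _, _, _, (TypOb.isEl_rep h H).1, (TypOb.isEl_rep h H).2, eq_pair_rawPair u,
      eq_pair_rawPair v, (Equiv.symm_apply_eq _).1 e⟩
  · rintro ⟨F, G, hF, hF', hG, hG', ha, ha', hu, hv, rfl⟩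
    refine ⟨TypOb.exists_rep_pairCell h ((TypHom.rep_equiv h).2 ⟨hF, hF', hu⟩)
      ((TypHom.rep_equiv h).2 ⟨hG, hG', hv⟩) ha ha', (Equiv.symm_apply_eq _).2 ?_⟩
    exact (pairCell_eq_pairCell (hu' := eq_pair_rawPair u) (hv' := eq_pair_rawPair v)).2
      ⟨h.elEq_refl ha, h.elEq_refl ha'⟩

theorem TypCell.base_equiv (η : SquareCell u v) :
    HEq (TypCell.equiv h u v η).base (CtxCell.equiv h u.base v.base η.base) := by
  obtain ⟨a, ha, ha', e⟩ := exists_pairCell (eq_pair_rawPair u) (eq_pair_rawPair v) η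
  obtain ⟨H, e₁⟩ := (TypCell.rep_equiv h).2 ⟨_, _, _, _, _, _, ha, ha', _, _, e⟩
  obtain ⟨H', e₂⟩ := (CtxCell.rep_equiv h (η := η.base)).2 ⟨_, _, _, _, ha,
    congrArg Square.base (eq_pair_rawPair u), congrArg Square.base (eq_pair_rawPair v),
    congrArg SquareCell.base e⟩
  rw [e₁, e₂]
  show HEq (Quot.mk _ _) (Quot.mk _ _)
  -- The two classes have the same raw vector but live over boundaries which agree only by
  -- `TypHom.base_equiv`; once the boundaries are variables this is reflexivity.
  have E : ∀ {p q p' q' : CtxHom X.base Y.base} (_ : p = p') (_ : q = q') (a) (H H'),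
      HEq (Quot.mk _ ⟨a, H⟩ : CtxCell p q) (Quot.mk _ ⟨a, H'⟩ : CtxCell p' q') := by
    rintro _ _ _ _ rfl rfl _ _ _
    rfl
  exact E (TypHom.base_equiv h u) (TypHom.base_equiv h v) _ _ _

end Typ

end Calculus

namespace Calculus

variable {S : Calculus σ}

open PathCategory (Cell Square SquareCell)
open Syn

/-! ## The 2-categories of contexts and of types -/

section Ctx

/-- Representatives of a 2-cell and of its two boundary 1-cells are given independently; conversion
shows that the raw 2-cell is also typed over the given boundary vectors. -/
theorem CtxCell.exists_eq_cell (h : S.Rules) {X Y : S.CtxOb} {u v : X.out h ⟶ Y.out h}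
    {η : Cell u v} {α f g} (hη : (CtxCell.equiv h u v η).Rep α)
    (hu : (CtxHom.equiv h X Y u).Rep f) (hv : (CtxHom.equiv h X Y v).Rep g) :
    ∃ hf hg hα, ∃ (hu : u = Syn.mk f hf) (hv : v = Syn.mk g hg), η = cell (p := α) hu hv hα := by
  obtain ⟨f', g', hf', hg', hα, hu', hv', rfl⟩ := (CtxCell.rep_equiv h).1 hη
  obtain ⟨hf, rfl⟩ := (CtxHom.rep_equiv h).1 hu
  obtain ⟨hg, rfl⟩ := (CtxHom.rep_equiv h).1 hv
  have hα' := h.isEl_idTel_conv X.rep_spec.wf Y.rep_spec.wf (h.ctxEq_refl Y.rep_spec.wf)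
    (mk_eq_mk.1 hu'.symm) (mk_eq_mk.1 hv'.symm) hα
  exact ⟨hf, hg, hα', rfl, rfl, (cell_eq_cell (hp := hα) (hq := hα')).2 (h.elEq_refl hα)⟩

theorem CtxCell.rep_of_val (h : S.Rules) {X Y : S.CtxOb} {u v : X.out h ⟶ Y.out h}
    {η : Cell u v} {α f g hf hg hα} (e : η.val = mkPath f g α hf hg hα) :
    (CtxCell.equiv h u v η).Rep α :=
  (CtxCell.rep_equiv h).2 ⟨f, g, hf, hg, hα,
    η.val_src.symm.trans ((congrArg (· ≫ src _) e).trans mkPath_src),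
    η.val_tgt.symm.trans ((congrArg (· ≫ tgt _) e).trans mkPath_tgt), Cell.ext e⟩

variable [H : Fact S.Rules]

/-- The rules enter as a `Fact`, so that the 2-category structures can be found by instance search.
-/
noncomputable instance : Bicategory.{u, u} S.CtxOb := PathCategory.bicategory (CtxOb.out H.out)

instance : Bicategory.Strict S.CtxOb := PathCategory.bicategory_strict (CtxOb.out H.out)

variable (S) in
/-- The 2-category of contexts. -/
noncomputable def contextTwoCategory : S.IsContextTwoCategory where
  hom X Y := CtxHom.equiv H.out X Y
  cell u v := CtxCell.equiv H.out u v
  id_rep _ := (CtxHom.rep_equiv _).2 ⟨_, rfl⟩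
  comp_rep u v _ _ hu hv := by
    obtain ⟨hf, rfl⟩ := (CtxHom.rep_equiv _).1 hu
    obtain ⟨hg, rfl⟩ := (CtxHom.rep_equiv _).1 hv
    exact (CtxHom.rep_equiv _).2 ⟨_, mk_comp⟩
  idCell_rep u _ hu := by
    obtain ⟨hf, rfl⟩ := (CtxHom.rep_equiv _).1 hu
    exact CtxCell.rep_of_val _ mk_rf
  vcomp_rep {X Y u v w} η θ Δ f g k α β hΔ hu hv hw hη hθ := by
    obtain ⟨hf, hg, hα, rfl, rfl, rfl⟩ := CtxCell.exists_eq_cell _ hη hu hv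
    obtain ⟨_, hk, hβ, _, rfl, rfl⟩ := CtxCell.exists_eq_cell _ hθ hv hw
    obtain ⟨_, e⟩ := cmp_mkPath_of_ctxEq (Y := Y.out _) hΔ.wf (hΔ.ctxEq H.out Y.rep_spec)
      (ha := hf) (hb := hg) (hp := hα) (hb' := hg) (hc := hk) (hq := hβ)
      (mkPath_tgt.trans mkPath_src.symm)
    exact CtxCell.rep_of_val _ e
  whiskerLeft_rep {X Y Z} u {v w} η f α hu hη := by
    obtain ⟨hf, rfl⟩ := (CtxHom.rep_equiv _).1 hu
    obtain ⟨_, _, hg, hk, hα, rfl, rfl, rfl⟩ := (CtxCell.rep_equiv _).1 hη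
    exact CtxCell.rep_of_val _ (mk_comp_mkPath (hf := hf) (ha := hg) (hb := hk) (hp := hα))
  whiskerRight_rep {X Y Z u v} η w Θ f g k α hΘ hu hv hw hη := by
    obtain ⟨hf, hg, hα, rfl, rfl, rfl⟩ := CtxCell.exists_eq_cell _ hη hu hv
    obtain ⟨hk, rfl⟩ := (CtxHom.rep_equiv _).1 hw
    obtain ⟨_, e⟩ := mkPath_map_of_ctxEq (Z := Z.out _) hΘ.wf (hΘ.ctxEq H.out Z.rep_spec)
      (ha := hf) (hb := hg) (hp := hα) (hk := hk)
    exact CtxCell.rep_of_val _ e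

end Ctx

section Typ

theorem TypCell.exists_eq_pairCell (h : S.Rules) {X Y : S.TypOb}
    {u v : Square (X.proj h) (Y.proj h)} {η : SquareCell u v} {a F G}
    (hη : (TypCell.equiv h u v η).Rep a) (hu : (TypHom.equiv h X Y u).Rep F)
    (hv : (TypHom.equiv h X Y v).Rep G) :
    ∃ hF hF' hG hG' ha ha', ∃ (hu : u = pair (X := X.out h) (Y := Y.out h) F hF hF')
      (hv : v = pair (X := X.out h) (Y := Y.out h) G hG hG'),
        η = pairCell (a := a) hu hv ha ha' := by
  obtain ⟨F', G', h₁, h₂, h₃, h₄, ha, ha', hu', hv', rfl⟩ := (TypCell.rep_equiv h).1 hη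
  obtain ⟨hF, hF', rfl⟩ := (TypHom.rep_equiv h).1 hu
  obtain ⟨hG, hG', rfl⟩ := (TypHom.rep_equiv h).1 hv
  have eu := pair_eq_pair.1 hu'.symm
  have ev := pair_eq_pair.1 hv'.symm
  have wX := (X.ty_spec h).wf
  have wY := (Y.ty_spec h).wf
  have hb := h.isEl_idTel_conv wX.1 wY.1 (h.ctxEq_refl wY.1) eu.1 ev.1 ha
  have hb' := h.isEl_idTel_conv wX wY (h.ctxEq_refl wY) eu.2 ev.2 ha'
  exact ⟨hF, hF', hG, hG', hb, hb', rfl, rfl, (pairCell_eq_pairCell (ha := ha) (ha' := ha')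
    (hb := hb) (hb' := hb')).2 ⟨h.elEq_refl ha, h.elEq_refl ha'⟩⟩

theorem TypCell.rep_of_val (h : S.Rules) {X Y : S.TypOb} {u v : Square (X.proj h) (Y.proj h)}
    {η : SquareCell u v} {F G : RawPair σ X.len Y.len} {p P r hF hF' hG hG' hp hP}
    (hu : u = pair (X := X.out h) (Y := Y.out h) F hF hF')
    (hv : v = pair (X := X.out h) (Y := Y.out h) G hG hG')
    (e : η.base.val = mkPath F.1 G.1 p hF hG hp)
    (e' : η.tot.val = mkPath (X := X.tot h) (Y := Y.tot h) (total F) (total G) P hF' hG' hP)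
    (hr : lst P = r) : (TypCell.equiv h u v η).Rep (p, r) := by
  subst hr
  obtain ⟨ha, ha', e⟩ := eq_pairCell hu hv η e e'
  exact (TypCell.rep_equiv h).2 ⟨_, _, _, _, _, _, ha, ha', hu, hv, e⟩

theorem total_comp {n m k : ℕ} (F : RawPair σ n m) (G : RawPair σ m k) :
    (fun i => (total G i).subst (total F)) =
      total (fun i => (G.1 i).subst F.1, G.2.subst (total F)) := by
  refine (ext_subst _ _ _).trans ?_
  congr 1
  funext i
  simp only [wk, rename_eq_subst, subst_subst]
  refine congrArg _ (funext fun j => ?_)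
  exact (var_subst _ _).trans ((ext_castSucc _ _ j).trans (rename_eq_subst _ _))

theorem pair_comp {h : S.Rules} {X Y Z : S.TypOb} {F : RawPair σ X.len Y.len}
    {G : RawPair σ Y.len Z.len} {hF hF' hG hG'} : ∃ hK hK',
    (pair (X := X.out h) (Y := Y.out h) F hF hF' : Square (X.proj h) (Y.proj h)).comp
      (pair (X := Y.out h) (Y := Z.out h) G hG hG' : Square (Y.proj h) (Z.proj h)) =
      pair (X := X.out h) (Y := Z.out h)
        (fun i => (G.1 i).subst F.1, G.2.subst (total F)) hK hK' := by
  have hK' := h.isMor_comp (X.ty_spec h).wf hF' hG'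
  exact ⟨h.isMor_comp X.base.rep_spec.wf hF hG, (total_comp F G) ▸ hK', Square.ext rfl (mk_congr (total_comp F G))⟩

variable [H : Fact S.Rules]

noncomputable instance : Bicategory.{u, u} S.TypOb :=
  PathCategory.squareBicategory (TypOb.proj H.out)

instance : Bicategory.Strict S.TypOb := PathCategory.squareBicategory_strict (TypOb.proj H.out)

variable (S) in
/-- The 2-category of types. -/
noncomputable def typeTwoCategory : S.IsTypeTwoCategory where
  hom X Y := TypHom.equiv H.out X Y
  cell u v := TypCell.equiv H.out u v
  id_rep X := by
    have e : (Expr.var : Fin (X.len + 1) → Tm σ (X.len + 1)) =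
        total (Expr.var, .var (Fin.last _)) :=
      funext (Fin.lastCases (by simp) fun i => by
        simp only [Fin.snoc_castSucc, wk, Expr.rename]; rfl)
    have hv := H.out.isMor_var (X.ty_spec H.out).wf
    exact (TypHom.rep_equiv _).2 ⟨H.out.isMor_var X.base.rep_spec.wf, e ▸ hv,
      Square.ext rfl (mk_congr e)⟩
  comp_rep u v _ _ hu hv := by
    obtain ⟨hF, hF', rfl⟩ := (TypHom.rep_equiv _).1 hu
    obtain ⟨hG, hG', rfl⟩ := (TypHom.rep_equiv _).1 hv
    exact (TypHom.rep_equiv _).2 pair_comp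
  idCell_rep {X Y} u F hu := by
    obtain ⟨hF, hF', rfl⟩ := (TypHom.rep_equiv _).1 hu
    exact TypCell.rep_of_val H.out rfl rfl (mk_rf (ha := hF))
      (mk_rf (X := X.tot H.out) (Y := Y.tot H.out) (ha := hF'))
      (congrArg Expr.refl (Fin.snoc_last ..))
  vcomp_rep {X Y u v w} η θ Δ B F G K a b hΔ hu hv hw hη hθ := by
    obtain ⟨hF, hF', hG, hG', ha, ha', rfl, rfl, rfl⟩ := TypCell.exists_eq_pairCell _ hη hu hv
    obtain ⟨_, _, hK, hK', hb, hb', _, rfl, rfl⟩ := TypCell.exists_eq_pairCell _ hθ hv hw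
    have e := hΔ.ctxEq H.out (Y.ty_spec H.out)
    obtain ⟨_, e₁⟩ := cmp_mkPath_of_ctxEq (Y := Y.out H.out) hΔ.wf.1 e.1
      (ha := hF) (hb := hG) (hp := ha) (hb' := hG) (hc := hK) (hq := hb)
      (mkPath_tgt.trans mkPath_src.symm)
    obtain ⟨_, e₂⟩ := cmp_mkPath_of_ctxEq (Y := Y.tot H.out) (X := X.tot H.out) hΔ.wf e
      (ha := hF') (hb := hG') (hp := ha') (hb' := hG') (hc := hK') (hq := hb')
      (mkPath_tgt.trans mkPath_src.symm)
    exact TypCell.rep_of_val _ rfl rfl e₁ e₂ rfl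
  whiskerLeft_rep {X Y Z} u {v w} η F a hu hη := by
    obtain ⟨hF, hF', rfl⟩ := (TypHom.rep_equiv _).1 hu
    obtain ⟨G, K, hG, hG', hK, hK', ha, ha', rfl, rfl, rfl⟩ := (TypCell.rep_equiv _).1 hη
    obtain ⟨_, _, e₁⟩ := pair_comp (h := H.out) (X := X) (hF := hF) (hF' := hF') (hG := hG)
      (hG' := hG')
    obtain ⟨_, _, e₂⟩ := pair_comp (h := H.out) (X := X) (hF := hF) (hF' := hF') (hG := hK)
      (hG' := hK')
    exact TypCell.rep_of_val H.out (η := SquareCell.whiskerLeft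
        (pair (X := X.out H.out) (Y := Y.out H.out) F hF hF')
        (pairCell (hF := hG) (hG := hK) rfl rfl ha ha')) e₁ e₂
      (mk_comp_mkPath (hf := hF) (ha := hG) (hb := hK) (hp := ha))
      ((mk_comp_mkPath (W := X.tot H.out) (X := Y.tot H.out) (Y := Z.tot H.out) (hf := hF')
        (ha := hG') (hb := hK') (hp := ha')).trans
        (mkPath_congr (total_comp F G) (total_comp F K) rfl))
      (congrArg (Expr.subst · _) (Fin.snoc_last ..))
  whiskerRight_rep {X Y Z u v} η w Θ C F G K a hΘ hu hv hw hη := by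
    obtain ⟨hF, hF', hG, hG', ha, ha', rfl, rfl, rfl⟩ := TypCell.exists_eq_pairCell _ hη hu hv
    obtain ⟨hK, hK', rfl⟩ := (TypHom.rep_equiv _).1 hw
    obtain ⟨_, _, e₁⟩ := pair_comp (h := H.out) (X := X) (hF := hF) (hF' := hF') (hG := hK)
      (hG' := hK')
    obtain ⟨_, _, e₂⟩ := pair_comp (h := H.out) (X := X) (hF := hG) (hF' := hG') (hG := hK)
      (hG' := hK')
    have e := hΘ.ctxEq H.out (Z.ty_spec H.out)
    obtain ⟨_, e₃⟩ := mkPath_map_of_ctxEq (X := X.out H.out) (Y := Y.out H.out)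
      (Z := Z.out H.out) hΘ.wf.1 e.1 (ha := hF) (hb := hG) (hp := ha) (hk := hK)
    obtain ⟨_, e₄⟩ := mkPath_map_of_ctxEq (X := X.tot H.out) (Y := Y.tot H.out)
      (Z := Z.tot H.out) hΘ.wf e (ha := hF') (hb := hG') (hp := ha') (hk := hK')
    exact TypCell.rep_of_val H.out (η := SquareCell.whiskerRight
        (pairCell (hF := hF) (hG := hG) rfl rfl ha ha')
        (pair (X := Y.out H.out) (Y := Z.out H.out) K hK hK')) e₁ e₂ e₃
      (e₄.trans (mkPath_congr (total_comp F K) (total_comp G K) rfl)) rfl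

end Typ

end Calculus

namespace PathCategory

universe v₁ u₁

variable {C : Type u₁} [Category.{v₁} C] [PathCategory C]
  {E B E' B' E'' B'' : C} {π : E ⟶ B} {π' : E' ⟶ B'} {π'' : E'' ⟶ B''}

/-! ### Lifting of 2-cells of squares -/

/-- The 2-cell of squares with given components. -/
@[simps]
def SquareCell.ofPath {k l : B ⟶ B'} (γ : Cell k l) (A : E ⟶ path E')
    (h : A ≫ map π' = π ≫ γ.val) :
    SquareCell (π := π) (π' := π')
      ⟨k, A ≫ src E', by rw [Category.assoc, ← map_src, ← Category.assoc, h]; simp⟩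
      ⟨l, A ≫ tgt E', by rw [Category.assoc, ← map_tgt, ← Category.assoc, h]; simp⟩ where
  base := γ
  tot := ⟨A, rfl, rfl⟩
  comm := h

/-- The path `π ≫ f.val` is lifted so as to end at `a.tot`; the source of the lift is the total part
of the new 1-cell. -/
theorem HasPathLifting.exists_squareCell (hπ : HasPathLifting π') (a : Square π π') {r : B ⟶ B'}
    (f : Cell r a.base) : ∃ t h, ∃ φ : SquareCell ⟨r, t, h⟩ a, φ.base = f := by
  obtain ⟨c, hc, hz⟩ := hπ (π ≫ f.val) a.tot (by simp [a.comm])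
  exact ⟨c ≫ src E', by rw [Category.assoc, ← map_src, ← Category.assoc, hc]; simp,
    ⟨f, ⟨c, rfl, hz⟩, hc⟩, rfl⟩

/-- The pullback property of path objects, applied to the path `π ≫ γ.val`: the lifted path is the
total part of `γ'`, and its end points determine `k'` and `l'`. -/
theorem Square.IsCartesian.existsUnique_cell {f : Square π' π''} (hf : f.IsCartesian)
    {g h : Square π π''} (α : SquareCell g h) {k l : B ⟶ B'} (γ : Cell k l)
    (hα : α.base.val = γ.val ≫ map f.base) :
    ∃! t : Σ (k' : Square π π') (l' : Square π π'), SquareCell k' l',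
      t.1.base = k ∧ t.2.1.base = l ∧ t.2.2.base.val = γ.val ∧
        t.2.2.tot.val ≫ map f.tot = α.tot.val := by
  obtain ⟨A, ⟨h₁, h₂⟩, h₃⟩ := hf.liftPath (π ≫ γ.val) α.tot.val (by
    rw [Category.assoc, ← hα, α.comm])
  refine ⟨⟨_, _, .ofPath γ A h₁⟩, ⟨rfl, rfl, rfl, h₂⟩, ?_⟩
  rintro ⟨k', l', γ'⟩ ⟨hk, hl, eb, e⟩
  have et : γ'.tot.val = A := h₃ _ ⟨γ'.comm.trans (congrArg (π ≫ ·) eb), e⟩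
  obtain rfl : k' = ⟨k, A ≫ src E', by rw [Category.assoc, ← map_src, ← Category.assoc, h₁]; simp⟩ :=
    Square.ext hk (γ'.tot.val_src.symm.trans (congrArg (· ≫ _) et))
  obtain rfl : l' = ⟨l, A ≫ tgt E', by rw [Category.assoc, ← map_tgt, ← Category.assoc, h₁]; simp⟩ :=
    Square.ext hl (γ'.tot.val_tgt.symm.trans (congrArg (· ≫ _) et))
  obtain rfl : γ' = .ofPath γ A h₁ := SquareCell.ext_val eb et
  rfl

theorem SquareCell.src_eq {f : Square π' π''} {g h : Square π π''} (α : SquareCell g h)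
    {k l : Square π π'} (γ : SquareCell k l) (hg : g.base = k.base ≫ f.base)
    (e : γ.tot.val ≫ map f.tot = α.tot.val) : g = k.comp f := by
  refine Square.ext hg (α.tot.val_src.symm.trans ?_)
  rw [← e, Category.assoc, map_src, Cell.val_src_assoc]
  rfl

theorem SquareCell.tgt_eq {f : Square π' π''} {g h : Square π π''} (α : SquareCell g h)
    {k l : Square π π'} (γ : SquareCell k l) (hh : h.base = l.base ≫ f.base)
    (e : γ.tot.val ≫ map f.tot = α.tot.val) : h = l.comp f := by
  refine Square.ext hh (α.tot.val_tgt.symm.trans ?_)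
  rw [← e, Category.assoc, map_tgt, Cell.val_tgt_assoc]
  rfl

theorem Square.IsCartesian.existsUnique_lift {q : Square π' π''} (hq : q.IsCartesian)
    (φ : Square π π'') (g : B ⟶ B') (e : φ.base = g ≫ q.base) :
    ∃! χ : Square π π', χ.base = g ∧ χ.comp q = φ := by
  obtain ⟨t, ⟨h₁, h₂⟩, h₃⟩ := hq.lift (π ≫ g) φ.tot (by rw [Category.assoc, ← e, φ.comm])
  refine ⟨⟨g, t, h₁⟩, ⟨rfl, Square.ext e.symm h₂⟩, fun χ h => Square.ext h.1 (h₃ _ ⟨?_, ?_⟩)⟩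
  · rw [χ.comm, h.1]
  · rw [← h.2]
    rfl

end PathCategory

open DTT.Expr

variable {σ : Signature.{u}}

namespace Calculus

variable {S : Calculus σ} [H : Fact S.Rules]

open PathCategory (Cell Square SquareCell)
open Syn

/-! ## The projection from types to contexts -/

/-- Strict equations between 2-cells are stated with `eqToHom`; these vanish on the underlying
morphisms into path objects, where the equations are actually proved. -/
theorem CtxOb.val_eqToHom {X Y : S.CtxOb} {u u' v v' : X ⟶ Y} (e : u' = u) (η : u ⟶ v)
    (e' : v = v') : Cell.val (eqToHom e ≫ η ≫ eqToHom e') = Cell.val η := by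
  subst e e'
  rw [eqToHom_refl, eqToHom_refl, Category.id_comp, Category.comp_id]

variable (S) in
/-- The 2-functor from types to contexts. -/
noncomputable def projection : StrictPseudofunctor S.TypOb S.CtxOb :=
  StrictPseudofunctor.mk''
    { obj := TypOb.base
      map := Square.base
      map₂ := SquareCell.base
      map₂_whisker_left := fun _ _ _ _ => Cell.ext (CtxOb.val_eqToHom rfl _ rfl).symm
      map₂_whisker_right := fun _ _ => Cell.ext (CtxOb.val_eqToHom rfl _ rfl).symm }

theorem isProjection : IsProjection (contextTwoCategory S) (typeTwoCategory S) (projection S) where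
  obj _ := rfl
  map u := heq_of_eq (TypHom.base_equiv H.out u).symm
  map₂ η := (TypCell.base_equiv H.out η).symm

theorem TypOb.tot_val_eqToHom {X Y : S.TypOb} {u u' v v' : X ⟶ Y} (e : u' = u) (η : u ⟶ v)
    (e' : v = v') :
    (SquareCell.tot (eqToHom e ≫ η ≫ eqToHom e')).val = (SquareCell.tot η).val := by
  subst e e'
  rw [eqToHom_refl, eqToHom_refl, Category.id_comp, Category.comp_id]

theorem TypOb.base_val_eqToHom {X Y : S.TypOb} {u u' v v' : X ⟶ Y} (e : u' = u) (η : u ⟶ v)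
    (e' : v = v') :
    (SquareCell.base (eqToHom e ≫ η ≫ eqToHom e')).val = (SquareCell.base η).val := by
  subst e e'
  rw [eqToHom_refl, eqToHom_refl, Category.id_comp, Category.comp_id]

theorem TypOb.eq_whiskerRight {x y z : S.TypOb} {g h : x ⟶ z} {k l : x ⟶ y} {α : g ⟶ h}
    {γ : k ⟶ l} {f : y ⟶ z} (hg : g = k ≫ f) (hh : h = l ≫ f)
    (eb : (SquareCell.base α).val = (SquareCell.base γ).val ≫ PathCategory.map (Square.base f))
    (et : (SquareCell.tot α).val = (SquareCell.tot γ).val ≫ PathCategory.map (Square.tot f)) :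
    α = eqToHom hg ≫ Bicategory.whiskerRight γ f ≫ eqToHom hh.symm :=
  SquareCell.ext_val (eb.trans (TypOb.base_val_eqToHom hg (Bicategory.whiskerRight γ f) _).symm)
    (et.trans (TypOb.tot_val_eqToHom hg (Bicategory.whiskerRight γ f) _).symm)

/-- Paths can be reversed, so every 2-cell is invertible, and hence every 2-cell is cartesian over
its image. -/
instance {X Y : S.TypOb} {u v : X ⟶ Y} (η : u ⟶ v) : IsIso η :=
  ⟨SquareCell.inv η, SquareCell.comp_inv η, SquareCell.inv_comp η⟩

/-- A lift of a 2-cell exists by path lifting along the projection of `y`, and it is strongly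
cartesian because it is invertible. -/
theorem homFibered (x y : S.TypOb) : ((projection S).mapFunctor x y).IsFibered := by
  refine Functor.IsFibered.of_exists_isStronglyCartesian fun a R f => ?_
  obtain ⟨t, h, φ, e⟩ := PathCategory.HasPathLifting.exists_squareCell
    (hasPathLifting_disp (hA := (y.ty_spec H.out).wf.2)) a f
  let k : x ⟶ y := ⟨R, t, h⟩
  let φ' : k ⟶ a := φ
  have : ((projection S).mapFunctor x y).IsHomLift f φ' := by
    rw [← show ((projection S).mapFunctor x y).map φ' = f from e]
    exact .map φ'
  exact ⟨k, φ', inferInstance⟩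

theorem isStronglyCartesian_of_isCartesian {y z : S.TypOb} {q : y ⟶ z}
    (hq : Square.IsCartesian q) :
    (projection S).toFunctor.IsStronglyCartesian ((projection S).map q) q where
  toIsHomLift := .map q
  universal_property' {x} g φ hφ := by
    obtain ⟨χ, ⟨h₁, h₂⟩, h₃⟩ := hq.existsUnique_lift φ g
      (@IsHomLift.eq_of_isHomLift _ _ _ _ (projection S).toFunctor _ _ _ φ hφ).symm
    let ψ : x ⟶ y := χ
    refine ⟨χ, ⟨?_, h₂⟩, fun χ' h => h₃ χ' ⟨?_, h.2⟩⟩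
    · rw [← show (projection S).toFunctor.map ψ = g from h₁]
      exact .map ψ
    · exact (@IsHomLift.eq_of_isHomLift _ _ _ _ (projection S).toFunctor _ _ g χ' h.1).symm

theorem hasTwoDimLifting_of_isCartesian {y z : S.TypOb} {f : y ⟶ z}
    (hf : Square.IsCartesian f) : HasTwoDimLifting (projection S) f := by
  intro x g h α k l γ hg hh hα
  have eα : (SquareCell.base α).val = Cell.val γ ≫ PathCategory.map (Square.base f) :=
    (congrArg Cell.val hα).trans (CtxOb.val_eqToHom hg _ hh.symm)
  obtain ⟨⟨k', l', γ'⟩, ⟨h₁, h₂, h₃, h₄⟩, h₅⟩ := hf.existsUnique_cell α γ eα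
  have hg' : g = Square.comp k' f :=
    SquareCell.src_eq α γ' (hg.trans (congrArg (· ≫ _) h₁.symm)) h₄
  have hh' : h = Square.comp l' f :=
    SquareCell.tgt_eq α γ' (hh.trans (congrArg (· ≫ _) h₂.symm)) h₄
  refine ⟨⟨k', l', γ'⟩, ⟨⟨hg', hh', TypOb.eq_whiskerRight (k := k') (l := l') (γ := γ') hg' hh'
    (eα.trans (congrArg (· ≫ _) h₃.symm)) h₄.symm⟩, h₁, h₂, ?_⟩, ?_⟩
  · exact Cell.ext (h₃.trans (CtxOb.val_eqToHom _ _ _).symm)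
  · rintro ⟨k', l', γ'⟩ ⟨⟨hg', hh', e₁⟩, hk, hl, e₂⟩
    exact h₅ ⟨k', l', γ'⟩ ⟨hk, hl, (congrArg Cell.val e₂).trans (CtxOb.val_eqToHom hk _ hl.symm),
      ((congrArg (fun η => (SquareCell.tot η).val) e₁).trans
        (TypOb.tot_val_eqToHom _ _ _)).symm⟩

end Calculus

namespace Calculus

variable {S : Calculus σ}

open PathCategory (Cell Square SquareCell)
open Syn

/-! ## The canonical cleavage -/

theorem Syn.canonSquare_eq_pair {h : S.Rules} {X Y : Syn h} {A : Ty σ X.len}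
    {hA : S.IsType X.ctx A} {B : Ty σ Y.len} {hB : S.IsType Y.ctx B} {f : Fin Y.len → Tm σ X.len}
    (hf : S.IsMor X.ctx Y.ctx f) (e : S.TyEq X.ctx A (B.subst f)) : ∃ hF',
    (canonSquare hf e : Square (disp X A hA) (disp Y B hB)) =
      pair (f, .var (Fin.last _)) hf hF' := by
  have h1 := h.isTerm_last (snoc X A hA).wf
  have h2 := h.tyEq_subst (snoc X A hA).wf (h.isMor_castSucc (snoc X A hA).wf) e
  simp only [wk, rename_eq_subst] at h1
  have h3 := h.isTerm_conv h1 h2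
  rw [subst_subst] at h3
  refine ⟨(h.isMor_total (snoc X A hA).wf hf).2 ?_, rfl⟩
  simpa only [tyAt, wk, rename_eq_subst] using h3

theorem CtxOb.Rep.eq {X : S.CtxOb} {Γ} (hΓ : X.Rep Γ) :
    (⟨X.len, Quot.mk _ ⟨Γ, hΓ.1⟩⟩ : S.CtxOb) = X := congrArg (CtxOb.mk X.len) hΓ.2.symm

theorem TypOb.Rep.eq {X : S.TypOb} {Γ A} (hΓ : X.Rep Γ A) :
    (⟨X.len, Quot.mk _ ⟨(Γ, A), hΓ.1⟩⟩ : S.TypOb) = X := congrArg (TypOb.mk X.len) hΓ.2.symm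

section

variable (h : S.Rules)

/-- Together with `TypHom.rep_unique` this reduces the strict equations of the cleavage to
exhibiting a common raw representative. -/
theorem CtxHom.rep_unique {X Y : S.CtxOb} {u v : X.out h ⟶ Y.out h} {f}
    (hu : (CtxHom.equiv h X Y u).Rep f) (hv : (CtxHom.equiv h X Y v).Rep f) : u = v := by
  obtain ⟨_, rfl⟩ := (CtxHom.rep_equiv h).1 hu
  obtain ⟨_, rfl⟩ := (CtxHom.rep_equiv h).1 hv
  rfl

theorem TypHom.rep_unique {X Y : S.TypOb} {u v : Square (X.proj h) (Y.proj h)} {F}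
    (hu : (TypHom.equiv h X Y u).Rep F) (hv : (TypHom.equiv h X Y v).Rep F) : u = v := by
  obtain ⟨_, _, rfl⟩ := (TypHom.rep_equiv h).1 hu
  obtain ⟨_, _, rfl⟩ := (TypHom.rep_equiv h).1 hv
  rfl

variable {X : S.CtxOb} {Y : S.TypOb} (v : X.out h ⟶ Y.base.out h)

theorem isCtx_pullback {Γ Δ B f} (hΓ : X.Rep Γ) (hΔ : Y.Rep Δ B)
    (hv : (CtxHom.equiv h X Y.base v).Rep f) : S.IsCtx (Γ.snoc (B.subst f)) := by
  obtain ⟨hf, _⟩ := (CtxHom.rep_equiv h).1 hv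
  have hf' := h.isMor_conv₂ X.rep_spec.wf hΓ.wf (X.rep_spec.ctxEq h hΓ)
    (Y.base.rep_spec.ctxEq h hΔ.base) hf
  exact ⟨hΓ.wf, h.isType_subst hΓ.wf hf' hΔ.wf.2⟩

/-- The pullback of a type in context along a morphism of contexts. -/
noncomputable def TypOb.pullback : S.TypOb where
  len := X.len
  cls := Quot.mk _ ⟨(X.rep, (Y.ty h).subst (raw v)),
    isCtx_pullback h v X.rep_spec (Y.ty_spec h) (CtxHom.rep_raw h v)⟩

theorem TypOb.base_pullback : (TypOb.pullback h v).base = X := X.rep_spec.eq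

theorem TypOb.rep_pullback {Γ Δ B f} (hΓ : X.Rep Γ) (hΔ : Y.Rep Δ B)
    (hv : (CtxHom.equiv h X Y.base v).Rep f) : (TypOb.pullback h v).Rep Γ (B.subst f) := by
  obtain ⟨hf, e⟩ := (CtxHom.rep_equiv h).1 hv
  have e' := (Y.ty_spec h).ctxEq h hΔ
  have e₁ : S.TyEq X.rep ((Y.ty h).subst (raw v)) (B.subst f) :=
    h.tyEq_congr X.rep_spec.wf (mk_eq_mk.1 ((eq_mk_raw v).symm.trans e)) e'.2
  exact Rep.of_ctxEq ⟨isCtx_pullback h v X.rep_spec (Y.ty_spec h) (CtxHom.rep_raw h v), rfl⟩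
    (isCtx_pullback h v hΓ hΔ hv) ⟨X.rep_spec.ctxEq h hΓ, e₁⟩

/-- The representative chosen for the class of the pullback need not be the pair it was built from.
It is only judgementally equal to it, which is why `canon` takes an equation `A = B(f)` as a
hypothesis. -/
theorem TypOb.ctxEq_pullback : S.CtxEq (X.rep.snoc ((Y.ty h).subst (raw v)))
    ((TypOb.pullback h v).base.rep.snoc ((TypOb.pullback h v).ty h)) :=
  (TypOb.rep_pullback h v X.rep_spec (Y.ty_spec h) (CtxHom.rep_raw h v)).ctxEq h
    ((TypOb.pullback h v).ty_spec h)

theorem TypOb.isMor_pullback : S.IsMor (TypOb.pullback h v).base.rep Y.base.rep (raw v) :=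
  h.isMor_ctxConv X.rep_spec.wf (TypOb.pullback h v).base.rep_spec.wf
    (TypOb.ctxEq_pullback h v).1 (isMor_raw v)

theorem TypOb.tyEq_pullback : S.TyEq (TypOb.pullback h v).base.rep ((TypOb.pullback h v).ty h)
    ((Y.ty h).subst (raw v)) :=
  h.tyEq_symm (h.tyEq_ctxConv X.rep_spec.wf (TypOb.pullback h v).base.rep_spec.wf
    (TypOb.ctxEq_pullback h v).1 (TypOb.ctxEq_pullback h v).2)

/-- The canonical lifting of a morphism of contexts. -/
noncomputable def TypOb.lift : Square ((TypOb.pullback h v).proj h) (Y.proj h) :=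
  canonSquare (TypOb.isMor_pullback h v) (TypOb.tyEq_pullback h v)

theorem TypOb.isCartesian_lift : (TypOb.lift h v).IsCartesian := isCartesian_canonSquare _ _

theorem TypOb.rep_lift {f} (hv : (CtxHom.equiv h X Y.base v).Rep f) :
    (TypHom.equiv h _ Y (TypOb.lift h v)).Rep (f, .var (Fin.last _)) := by
  obtain ⟨hf, e⟩ := (CtxHom.rep_equiv h).1 hv
  have wP := ((TypOb.pullback h v).ty_spec h).wf
  have e₁ := h.morEq_ctxConv X.rep_spec.wf wP.1 (TypOb.ctxEq_pullback h v).1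
    (mk_eq_mk.1 ((eq_mk_raw v).symm.trans e))
  obtain ⟨hF', eF⟩ := canonSquare_eq_pair (X := (TypOb.pullback h v).base.out h)
    (Y := Y.base.out h) (hA := wP.2) (hB := (Y.ty_spec h).wf.2) (TypOb.isMor_pullback h v) (TypOb.tyEq_pullback h v)
  have hz := (h.isMor_total wP (TypOb.isMor_pullback h v)).1 hF'
  have e₂ : S.MorEq ((TypOb.pullback h v).base.rep.snoc ((TypOb.pullback h v).ty h))
      (Y.base.rep.snoc (Y.ty h)) (total (raw v, .var (Fin.last _)))
      (total (f, .var (Fin.last _))) :=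
    (h.morEq_total (F := (raw v, .var (Fin.last _))) (G := (f, .var (Fin.last _))) wP e₁).2
      (h.tmEq_refl hz)
  exact (TypHom.rep_equiv h).2 ⟨h.morEq_right wP.1 Y.base.rep_spec.wf e₁,
    h.morEq_right wP (Y.ty_spec h).wf e₂, eF.trans (pair_eq_pair.2 ⟨e₁, e₂⟩)⟩

end

/-! ### Strict equations of the cleavage and the 2-fibration -/

variable [H : Fact S.Rules]

/-- Transport between equal objects of one common length does not change raw vectors; fixing the
length makes the same `f` meaningful on both sides. -/
theorem CtxHom.rep_eqToHom_comp {n c c'} {Y : S.CtxOb} (e : (⟨n, c⟩ : S.CtxOb) = ⟨n, c'⟩)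
    (u : (⟨n, c'⟩ : S.CtxOb) ⟶ Y) {f : Fin Y.len → Tm σ n} :
    ((contextTwoCategory S).hom _ _ (eqToHom e ≫ u)).Rep f ↔ ((contextTwoCategory S).hom _ _ u).Rep f := by
  obtain rfl : c = c' := eq_of_heq (CtxOb.mk.inj e).2
  rw [eqToHom_refl, Category.id_comp]

theorem CtxHom.rep_comp_eqToHom {n c c'} {X : S.CtxOb} (e : (⟨n, c⟩ : S.CtxOb) = ⟨n, c'⟩)
    (u : X ⟶ (⟨n, c⟩ : S.CtxOb)) {f : Fin n → Tm σ X.len} :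
    ((contextTwoCategory S).hom _ _ (u ≫ eqToHom e)).Rep f ↔ ((contextTwoCategory S).hom _ _ u).Rep f := by
  obtain rfl : c = c' := eq_of_heq (CtxOb.mk.inj e).2
  rw [eqToHom_refl, Category.comp_id]

theorem TypHom.rep_eqToHom_comp {n c c'} {Y : S.TypOb} (e : (⟨n, c⟩ : S.TypOb) = ⟨n, c'⟩)
    (u : (⟨n, c'⟩ : S.TypOb) ⟶ Y) {F : RawPair σ n Y.len} :
    ((typeTwoCategory S).hom _ _ (eqToHom e ≫ u)).Rep F ↔ ((typeTwoCategory S).hom _ _ u).Rep F := by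
  obtain rfl : c = c' := eq_of_heq (TypOb.mk.inj e).2
  rw [eqToHom_refl, Category.id_comp]

theorem projection_map_lift {a : S.TypOb} {R : S.CtxOb} (f : R ⟶ a.base) :
    (TypOb.lift H.out f).base = eqToHom (TypOb.base_pullback H.out f) ≫ f := by
  refine CtxHom.rep_unique H.out (f := raw f) ?_ ?_
  · rw [← TypHom.base_equiv]
    exact (TypOb.rep_lift H.out f (CtxHom.rep_raw H.out f)).base
  · exact (CtxHom.rep_eqToHom_comp (TypOb.base_pullback H.out f) f).2 (CtxHom.rep_raw H.out f)

theorem isStronglyCartesian_lift {a : S.TypOb} {R : S.CtxOb} (f : R ⟶ a.base) :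
    (projection S).toFunctor.IsStronglyCartesian (a := TypOb.pullback H.out f) f
      (TypOb.lift H.out f) := by
  -- The domain lies over `R` only up to a propositional equality; with `d` a variable, `R` can be
  -- eliminated in favour of its base.
  have key : ∀ {d : S.TypOb} {φ : d ⟶ a} (e : d.base = R),
      (projection S).toFunctor.IsStronglyCartesian ((projection S).map φ) φ →
      (projection S).map φ = eqToHom e ≫ f →
      (projection S).toFunctor.IsStronglyCartesian f φ := by
    intro d φ e h₁ h₂
    subst e
    have h₃ := h₂.trans (Category.id_comp f)
    rwa [h₃] at h₁
  exact key (φ := TypOb.lift H.out f) (TypOb.base_pullback H.out f)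
    (isStronglyCartesian_of_isCartesian (TypOb.isCartesian_lift H.out f)) (projection_map_lift f)

theorem rep_id (X : S.CtxOb) : (CtxHom.equiv H.out X X (𝟙 X)).Rep .var :=
  (contextTwoCategory S).id_rep X

/-- Raw substitution by the variables is the identity, so both types in context have a common
representative. Likewise `pullback_comp` comes from `subst_subst`. -/
theorem TypOb.pullback_id (a : S.TypOb) : TypOb.pullback H.out (𝟙 a.base) = a := by
  have h₁ := TypOb.rep_pullback H.out (𝟙 a.base) a.base.rep_spec (a.ty_spec H.out)
    (rep_id a.base)
  have h₂ := (congrArg (Rep (TypOb.pullback H.out (𝟙 a.base)) a.base.rep)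
    (subst_var' (a.ty H.out))).mp h₁
  exact congrArg (TypOb.mk a.len) (h₂.2.trans (a.ty_spec H.out).2.symm)

/-- A morphism into the source of `f`, as a morphism into the context of the pullback along `f`. -/
noncomputable def TypOb.toPullback {a : S.TypOb} {R Q : S.CtxOb} (g : Q ⟶ R) (f : R ⟶ a.base) :
    Q ⟶ (TypOb.pullback H.out f).base :=
  CategoryStruct.comp (obj := S.CtxOb) g (eqToHom (TypOb.base_pullback H.out f).symm)

theorem TypOb.pullback_comp {a : S.TypOb} {R Q : S.CtxOb} (g : Q ⟶ R) (f : R ⟶ a.base) :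
    TypOb.pullback H.out (CategoryStruct.comp (obj := S.CtxOb) g f) =
      TypOb.pullback H.out (TypOb.toPullback g f) := by
  have hf := CtxHom.rep_raw H.out f
  have hg := CtxHom.rep_raw H.out g
  have h₁ := TypOb.rep_pullback H.out (CategoryStruct.comp (obj := S.CtxOb) g f) Q.rep_spec (a.ty_spec H.out)
    ((contextTwoCategory S).comp_rep g f hg hf)
  have h₂ := TypOb.rep_pullback H.out (TypOb.toPullback g f) Q.rep_spec
    (TypOb.rep_pullback H.out f R.rep_spec (a.ty_spec H.out) hf)
    ((CtxHom.rep_comp_eqToHom (TypOb.base_pullback H.out f).symm g).2 hg)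
  have h₃ := (congrArg (Rep (TypOb.pullback H.out (TypOb.toPullback g f)) Q.rep)
    (subst_subst (a.ty H.out) (raw f) (raw g))).mp h₂
  exact congrArg (TypOb.mk Q.len) (h₁.2.trans h₃.2.symm)

variable (S) in
/-- The canonical split cleavage of the projection from types to contexts. -/
noncomputable def cleavage : SplitCleavage (projection S).toFunctor where
  dom f := TypOb.pullback H.out f
  obj_dom f := TypOb.base_pullback H.out f
  lift f := TypOb.lift H.out f
  cartesian f := isStronglyCartesian_lift f
  dom_id a := TypOb.pullback_id a
  lift_id a := by
    refine TypHom.rep_unique H.out (TypOb.rep_lift H.out _ (rep_id a.base)) ?_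
    have e : eqToHom (TypOb.pullback_id a) ≫ 𝟙 a = eqToHom (TypOb.pullback_id a) :=
      Category.comp_id _
    have := (TypHom.rep_eqToHom_comp (TypOb.pullback_id a) (𝟙 a)).2 ((typeTwoCategory S).id_rep a)
    exact (congrArg (fun u => ((typeTwoCategory S).hom _ _ u).Rep _) e).mp this
  dom_comp g f := TypOb.pullback_comp g f
  lift_comp {a R Q} g f := by
    have hf := CtxHom.rep_raw H.out f
    have hg := CtxHom.rep_raw H.out g
    refine TypHom.rep_unique H.out (TypOb.rep_lift H.out _
      ((contextTwoCategory S).comp_rep g f hg hf)) ?_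
    refine (TypHom.rep_eqToHom_comp (TypOb.pullback_comp g f) _).2 ?_
    have h₁ := (typeTwoCategory S).comp_rep _ _ (TypOb.rep_lift H.out
      (TypOb.toPullback g f)
      ((CtxHom.rep_comp_eqToHom (TypOb.base_pullback H.out f).symm g).2 hg))
      (TypOb.rep_lift H.out f hf)
    have h₂ : (Expr.var (Fin.last R.len)).subst (total (raw g, .var (Fin.last Q.len))) =
        (.var (Fin.last Q.len) : Tm σ _) := by
      simp [total, Expr.subst]
    exact (congrArg (fun t => TypHom.Rep _ (_, t)) h₂).mp h₁

theorem isCanonical_cleavage : IsCanonical (isProjection (S := S)) (cleavage S) := by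
  intro X Y v Γ Δ B f hΓ hΔ hv
  have hv' : (CtxHom.equiv H.out X Y.base v).Rep f := by
    have e : v ≫ eqToHom ((isProjection (S := S)).obj Y) = v := Category.comp_id _
    rwa [e] at hv
  have e := TypOb.rep_pullback H.out v hΓ hΔ hv'
  exact ⟨e.1, e.eq, (TypHom.rep_eqToHom_comp e.eq _).2 (TypOb.rep_lift H.out v hv')⟩

/-- Cartesian liftings of one base morphism are isomorphic, so `f` is the canonical lifting preceded
by an isomorphism, and the pullback property of path objects passes across it by
`Square.IsCartesian.iso_comp`. -/
theorem isCartesian_of_isStronglyCartesian {y z : S.TypOb} (f : y ⟶ z)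
    (hf : (projection S).toFunctor.IsStronglyCartesian ((projection S).map f) f) :
    Square.IsCartesian f := by
  let q : TypOb.pullback H.out ((projection S).map f) ⟶ z :=
    TypOb.lift H.out ((projection S).map f)
  have hq : (projection S).toFunctor.IsStronglyCartesian ((projection S).map f) q :=
    isStronglyCartesian_lift ((projection S).map f)
  let φ := Functor.IsCartesian.domainUniqueUpToIso (projection S).toFunctor
    ((projection S).map f) q f
  have e : φ.hom ≫ q = f := Functor.IsCartesian.fac (projection S).toFunctor
    ((projection S).map f) q f
  rw [← e]
  exact (TypOb.isCartesian_lift H.out _).iso_comp φ.hom φ.inv φ.hom_inv_id φ.inv_hom_id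

variable (S) in
/-- The projection from types to contexts is a globally split 2-fibration. -/
noncomputable def globallySplit : GloballySplitTwoFibration (projection S) where
  cleavage := cleavage S
  twoDimLifting f hf := hasTwoDimLifting_of_isCartesian (isCartesian_of_isStronglyCartesian f hf)
  homFibered := homFibered
  precomp_cartesian {x y z} f g h α _ := by
    have : ((projection S).mapFunctor x z).IsHomLift
        ((projection S).map₂ (Bicategory.whiskerLeft f α)) (Bicategory.whiskerLeft f α) :=
      .map (p := (projection S).mapFunctor x z) (Bicategory.whiskerLeft f α)
    -- The whiskered 2-cell is invertible, and an invertible lift is strongly cartesian.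
    infer_instance

end Calculus

end DTT

theorem mainTheorem1 {σ : DTT.Signature.{u}} (S : DTT.Calculus σ)
    (hStruct : S.StructuralRules) (hId : S.IdentityRules) (hDisc : S.DiscreteIdentityRules) :
    ∃ (_ : Bicategory.{u, u} S.CtxOb) (_ : Bicategory.Strict S.CtxOb)
      (_ : Bicategory.{u, u} S.TypOb) (_ : Bicategory.Strict S.TypOb)
      (c : S.IsContextTwoCategory) (t : S.IsTypeTwoCategory)
      (P : StrictPseudofunctor S.TypOb S.CtxOb) (hP : DTT.Calculus.IsProjection c t P)
      (F : DTT.GloballySplitTwoFibration P), DTT.Calculus.IsCanonical hP F.cleavage := by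
  have : Fact S.Rules := ⟨⟨hStruct, hId, hDisc⟩⟩
  exact ⟨inferInstance, inferInstance, inferInstance, inferInstance,
    DTT.Calculus.contextTwoCategory S, DTT.Calculus.typeTwoCategory S, DTT.Calculus.projection S,
    DTT.Calculus.isProjection, DTT.Calculus.globallySplit S, DTT.Calculus.isCanonical_cleavage⟩
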